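/- Let $d\ge 1$, $k\ge 1$, $\lambda>0$. Write $|\cdot|$ for Lebesgue measure on $\mathbb{R}^d$, $B_r(x)$ for the closed Euclidean ball, $y+A$ and $tA$ for translates and dilates. Call $A\subset\mathbb{R}^d$ Riemann measurable if it is bounded and $|\partial A|=0$; let $\mathcal{R}(\mathbb{R}^d)$ be the class of such sets and, for $B_0\in\mathcal{R}(\mathbb{R}^d)$, let $\mathcal{R}(B_0)$ be the class of Riemann measurable subsets of $B_0$. A point process set function is a real-valued functional $h(\mathcal{X},A)$, defined for finite $\mathcal{X}\subset\mathbb{R}^d$ and $A\in\mathcal{R}(\mathbb{R}^d)$, such that for every $m$ and every $A\in\mathcal{R}(\mathbb{R}^d)$ the function $(x_1,\dots,x_m)\mapsto h(\{x_1,\dots,x_m\},A)$ is Lebesgue measurable, and Borel measurable if $A$ is a Borel set, and such that $h(y+\mathcal{X},y+A)=h(\mathcal{X},A)$ for all $y\in\mathbb{R}^d$. Its add one cost is $\delta(A,\mathcal{X})=h(\mathcal{X}\cup\{\mathbf{0}\},A)-h(\mathcal{X},A)$. Let $\mathcal{P}_\lambda$ be a homogeneous Poisson point process of intensity $\lambda$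 on $\mathbb{R}^d$. The functional $h$ is strongly stabilizing at intensity $\lambda$ with stabilizing limit $\delta_\infty$ if $\delta_\infty$ is a real random variable and there is a real random variable $S$ such that almost surely, for all $A\in\mathcal{R}(\mathbb{R}^d)$ and all finite $\mathcal{A}\subset\mathbb{R}^d\setminus B_S(\mathbf{0})$, the quantity $\delta(A,(\mathcal{P}_\lambda\cap B_S(\mathbf{0}))\cup\mathcal{A})$ equals $\delta_\infty$ if $B_S(\mathbf{0})\subseteq A$, and equals $0$ if $A\cap B_S(\mathbf{0})=\emptyset$. Let $B_0\in\mathcal{R}(\mathbb{R}^d)$ with $|B_0|>0$. For $t\ge1$ and $m\in\mathbb{N}$ let $\mathcal{U}_{m,t}$ be the set of $m$ independent random vectors, each uniformly distributed on $tB_0$. Let $h^1,\dots,h^k$ be point process set functions such that each $h=h^j$ is strongly stabilizing at intensity $\lambda$, with stabilizing limit $\delta^j_\infty$, and satisfies the moments condition $$\sup_{t\ge1,\ A\in\mathcal{R}(B_0),\ x\in -tB_0}\ \ \sup_{m\in\mathbb{N}\cap[\lambda t^d|B_0|/2,\ 3\lambda t^d|B_0|/2]}\mathbb{E}\big[\delta(x+tA,\,x+\mathcal{U}_{m,t})^4\big]<\infty$$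 and the bound $|h(\mathcal{X},A)|\le\beta(\operatorname{diam}\mathcal{X}+\operatorname{card}\mathcal{X})^{\beta}$ for all finite $\mathcal{X}\subset\mathbb{R}^d$ and $A\in\mathcal{R}(\mathbb{R}^d)$, for some constant $\beta$. Let $\mathcal{F}$ be the $\sigma$-field generated by the restriction of $\mathcal{P}_\lambda$ to $\{x\in\mathbb{R}^d:x_1<0\}$, let $A_1,\dots,A_k\in\mathcal{R}(B_0)$, and set $$\sigma_{ij}=\mathbb{E}\big[\mathbb{E}(\delta^i_\infty\mid\mathcal{F})\,\mathbb{E}(\delta^j_\infty\mid\mathcal{F})\big],\qquad \tau_{ij}=\frac{\sigma_{ij}|A_i\cap A_j|}{|B_0|}-\frac{|A_i|\,|A_j|}{|B_0|^2}\,\mathbb{E}[\delta^i_\infty]\,\mathbb{E}[\delta^j_\infty].$$ Let $(t_n)_{n\ge1}$ be a $[1,\infty)$-valued sequence with $\lambda t_n^d|B_0|-n=O(n^{1/2})$ as $n\to\infty$. Then the variables $\delta^i_\infty$ and $h^i(\mathcal{U}_{n,t_n},t_nA_i)$ are square integrable; for all $i,j\in\{1,\dots,k\}$, $$\lim_{n\to\infty}n^{-1}\operatorname{Cov}\big(h^i(\mathcal{U}_{n,t_n},t_nA_i),\,h^j(\mathcal{U}_{n,t_n},t_nA_j)\big)=\tau_{ij};$$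 the matrix $(\tau_{ij})$ is nonnegative definite; and, as $n\to\infty$, $$n^{-1/2}\big(h^i(\mathcal{U}_{n,t_n},t_nA_i)-\mathbb{E}\,h^i(\mathcal{U}_{n,t_n},t_nA_i)\big)_{i=1}^k\ \xrightarrow{\ \mathcal{D}\ }\ \mathcal{N}\big(\mathbf{0},(\tau_{ij})_{i,j=1}^k\big).$$ -/

import Mathlib

open MeasureTheory ProbabilityTheory Filter Topology
open scoped Pointwise ENNReal

namespace StabCLT

/-- `ℝ^d` with the Euclidean norm and Lebesgue measure. -/
abbrev Space (d : ℕ) : Type := EuclideanSpace ℝ (Fin d)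

/-- Riemann measurable sets: bounded, with Lebesgue-null boundary (not necessarily Borel). -/
def RiemannMeasurable {d : ℕ} (A : Set (Space d)) : Prop :=
  Bornology.IsBounded A ∧ volume (frontier A) = 0

/-- The translated set `y + A`. -/
def translate {d : ℕ} (y : Space d) (A : Set (Space d)) : Set (Space d) :=
  (fun x => y + x) '' A

/-- Point process set functions `h(𝒳, A)`. Only the values at finite `𝒳` and Riemann measurable `A`
matter. A Riemann measurable set need not be Borel; Borel measurability of `h(·, A)` is asked
for Borel `A`, and Lebesgue measurability for every Riemann measurable `A`. -/
structure IsPointProcessSetFunction {d : ℕ} (h : Set (Space d) → Set (Space d) → ℝ) : Prop where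
  measurable : ∀ (m : ℕ) (A : Set (Space d)), RiemannMeasurable A → MeasurableSet A →
    Measurable (fun x : Fin m → Space d => h (Set.range x) A)
  aemeasurable : ∀ (m : ℕ) (A : Set (Space d)), RiemannMeasurable A →
    AEMeasurable (fun x : Fin m → Space d => h (Set.range x) A) volume
  translation_invariant : ∀ (A : Set (Space d)), RiemannMeasurable A → ∀ (y : Space d)
    (X : Set (Space d)), X.Finite → h (translate y X) (translate y A) = h X A

/-- The add one cost `δ(A, 𝒳) = h(𝒳 ∪ {0}, A) - h(𝒳, A)`. -/
def addOneCost {d : ℕ} (h : Set (Space d) → Set (Space d) → ℝ) (A X : Set (Space d)) : ℝ :=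
  h (X ∪ {0}) A - h X A

/-- `P` is a homogeneous Poisson point process on `ℝ^d` of intensity `lam`, viewed as a random
locally finite subset of `ℝ^d`. -/
structure IsPoissonProcess {d : ℕ} {Ω : Type*} [MeasurableSpace Ω] (P : Ω → Set (Space d))
    (lam : ℝ) (μ : Measure Ω) : Prop where
  locallyFinite : ∀ ω, ∀ B : Set (Space d), Bornology.IsBounded B → (P ω ∩ B).Finite
  measurable_count : ∀ B : Set (Space d), MeasurableSet B → Bornology.IsBounded B →
    Measurable (fun ω => (P ω ∩ B).ncard)
  count_law : ∀ B : Set (Space d), MeasurableSet B → Bornology.IsBounded B →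
    μ.map (fun ω => (P ω ∩ B).ncard) = poissonMeasure (lam * volume.real B).toNNReal
  indep : ∀ (m : ℕ) (B : Fin m → Set (Space d)), (∀ i, MeasurableSet (B i)) →
    (∀ i, Bornology.IsBounded (B i)) → Pairwise (fun i j => Disjoint (B i) (B j)) →
    iIndepFun (fun i ω => (P ω ∩ B i).ncard) μ

/-- `h` is strongly stabilizing for the Poisson process `P`, with stabilizing limit `δ`;
the random variable `S` is a radius of stabilization. -/
def StronglyStabilizing {d : ℕ} {Ω : Type*} [MeasurableSpace Ω]
    (h : Set (Space d) → Set (Space d) → ℝ) (P : Ω → Set (Space d)) (μ : Measure Ω)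
    (δ : Ω → ℝ) : Prop :=
  AEMeasurable δ μ ∧ ∃ S : Ω → ℝ, AEMeasurable S μ ∧
    ∀ᵐ ω ∂μ, ∀ A : Set (Space d), RiemannMeasurable A →
      ∀ F : Set (Space d), F.Finite → F ⊆ (Metric.closedBall 0 (S ω))ᶜ →
        (Metric.closedBall 0 (S ω) ⊆ A →
          addOneCost h A ((P ω ∩ Metric.closedBall 0 (S ω)) ∪ F) = δ ω) ∧
        (A ∩ Metric.closedBall 0 (S ω) = ∅ →
          addOneCost h A ((P ω ∩ Metric.closedBall 0 (S ω)) ∪ F) = 0)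

/-- The joint law of `m` independent random vectors, each uniformly distributed on `B`. -/
noncomputable def uniformSampleLaw {d : ℕ} (B : Set (Space d)) (m : ℕ) :
    Measure (Fin m → Space d) :=
  Measure.pi fun _ => ProbabilityTheory.cond volume B

/-- The fourth moments condition: `E[δ(x + tA, x + 𝒰_{m,t})⁴]` is bounded uniformly in `t ≥ 1`,
Riemann measurable `A ⊆ B₀`, `x ∈ -tB₀` and integers `m ∈ [λ t^d |B₀| / 2, 3 λ t^d |B₀| / 2]`. -/
def MomentsCondition {d : ℕ} (h : Set (Space d) → Set (Space d) → ℝ) (lam : ℝ)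
    (B₀ : Set (Space d)) : Prop :=
  ∃ C : ℝ, ∀ t : ℝ, 1 ≤ t → ∀ A : Set (Space d), RiemannMeasurable A → A ⊆ B₀ →
    ∀ x ∈ -(t • B₀), ∀ m : ℕ, lam * t ^ d * volume.real B₀ / 2 ≤ m →
      (m : ℝ) ≤ 3 * (lam * t ^ d * volume.real B₀) / 2 →
      ∫⁻ u, ENNReal.ofReal
          ((addOneCost h (translate x (t • A)) (translate x (Set.range u))) ^ 4)
        ∂(uniformSampleLaw (t • B₀) m) ≤ ENNReal.ofReal C

/-- The uniform polynomial bound on `h(𝒳, A)`. -/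
def PolynomialBound {d : ℕ} (h : Set (Space d) → Set (Space d) → ℝ) : Prop :=
  ∃ β : ℝ, ∀ X : Set (Space d), X.Finite → ∀ A : Set (Space d), RiemannMeasurable A →
    |h X A| ≤ β * (Metric.diam X + X.ncard) ^ β

/-- The `σ`-field generated by the restriction of `P` to the half-space `{x : x₁ < 0}`. -/
noncomputable abbrev halfSpaceSigma {d : ℕ} [NeZero d] {Ω : Type*} (P : Ω → Set (Space d)) : MeasurableSpace Ω :=
  ⨆ (B : Set (Space d)) (_ : MeasurableSet B ∧ Bornology.IsBounded B ∧ B ⊆ {x | x 0 < 0}),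
    MeasurableSpace.comap (fun ω => (P ω ∩ B).ncard) ⊤

/-- `σ_{ij} = E[E(δ^i | ℱ) E(δ^j | ℱ)]`, with `ℱ` the half-space `σ`-field. -/
noncomputable def sigmaMatrix {d k : ℕ} [NeZero d] {Ω : Type*} [MeasurableSpace Ω]
    (P : Ω → Set (Space d)) (μ : Measure Ω) (δ : Fin k → Ω → ℝ) : Matrix (Fin k) (Fin k) ℝ :=
  Matrix.of fun i j =>
    ∫ ω, (μ[δ i | halfSpaceSigma P]) ω * (μ[δ j | halfSpaceSigma P]) ω ∂μ

/-- `τ_{ij} = σ_{ij} |A_i ∩ A_j| / |B₀| - (|A_i| |A_j| / |B₀|²) E[δ^i] E[δ^j]`. -/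
noncomputable def tauMatrix {d k : ℕ} [NeZero d] {Ω : Type*} [MeasurableSpace Ω]
    (P : Ω → Set (Space d)) (μ : Measure Ω) (δ : Fin k → Ω → ℝ)
    (B₀ : Set (Space d)) (A : Fin k → Set (Space d)) : Matrix (Fin k) (Fin k) ℝ :=
  Matrix.of fun i j =>
    sigmaMatrix P μ δ i j * volume.real (A i ∩ A j) / volume.real B₀
      - volume.real (A i) * volume.real (A j) / volume.real B₀ ^ 2
        * ((∫ ω, δ i ω ∂μ) * ∫ ω, δ j ω ∂μ)

/-- The random point set `{U_1(ω), …, U_n(ω)}`. -/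
def sample {d n : ℕ} {Ω : Type*} (U : Fin n → Ω → Space d) (ω : Ω) : Set (Space d) :=
  Set.range fun l => U l ω

end StabCLT

namespace StabCLT

open Bornology (isBounded_iUnion)
open Complex (I exp_sum norm_I norm_exp_ofReal_mul_I norm_real real_smul)
open ENNReal (ofReal ofReal_add ofReal_le_ofReal ofReal_pow ofReal_toReal toReal_le_of_le_ofReal
  toReal_mul)
open Finset (abs_sum_le_sum_abs card_eq_zero card_range card_univ coe_Iio coe_filter coe_insert
  mem_filter mem_range mem_univ mul_sum prod_const range_orderEmbOfFin sum_add_distrib sum_congr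
  sum_const sum_le_sum sum_mul sum_mul_sum sum_nonneg sum_sub_distrib univ)
open Function (Injective comp_apply comp_def)
open MeasureTheory.Measure (addHaar_smul infinitePi infinitePi_eq_pi map_apply pi_pi)
open Metric (closedBall cthickening diam diam_nonneg isBounded_closedBall isClosed_closedBall
  mem_closedBall)
open Real (coe_toNNReal dist_eq exp exp_add exp_pos mul_self_sqrt norm_eq_abs norm_of_nonneg sq_sqrt
  tendsto_sqrt_atTop)
open Set (Iic Iio disjoint_left finite_range image_insert_eq indicator_apply indicator_nonneg
  indicator_of_mem indicator_of_notMem inter_assoc inter_eq_self_of_subset_right inter_self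
  inter_subset_left inter_subset_right mem_compl_iff mem_iUnion mem_image mem_insert_iff
  mem_inter_iff mem_ofPred_eq mem_preimage mem_singleton_iff mem_union ncard_coe_finset
  ncard_image_of_injective ncard_range_of_injective ofPred_forall range range_comp sdiff_subset
  smul_set_mono toFinite union_empty)

/-! Everything is expressed through the cost of adding one point. Translated to the origin, strong
stabilization says that, away from the boundaries of `tB₀` and `tA`, this cost is decided by the
points within a random finite distance: it is a copy of the stabilizing limit if the point lies in
`tA`, and zero if it lies outside. Stabilization holds for every placement of the distant points, so
it can be used for a binomial sample as soon as that sample looks Poisson in one fixed ball. It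
does: the number of points in the ball is binomial and close to Poisson in `ℓ¹`
(`lintegral_iid_mixture`, `tendsto_binomPoissonDist`, `IsPoissonProcess.lintegral_iid_le`). Together
with the moments condition this gives fourth moments of the limit (`integrable_limit_pow_four`) and
mean square approximation of the costs by bounded functions of the points within a fixed distance
(`Setting.exists_approx`).

The variance over Poisson samples comes from a Clark–Ocone type identity. Take two independent
samples and exchange their points one at a time in the order of the first coordinate. The Mecke
formula turns the telescoping sum into `r` times the mean of (cost in the sample) times (cost in the
sample spliced with its copy along the hyperplane through the added point), see
`variance_poissonSample`. After translation the inner mean is the second moment of the conditional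
expectation of the cost given the half-space, which converges to `σ` on `tA_i ∩ tA_j`
(`tendsto_variance_poissonSample`).

To pass from a Poisson number `N` to a fixed number `n` of points, one shows that adding `k = O(√n)`
points changes the functional by `α k` with an error that is `o(√n)` in mean square, where `α` is
the mean add one cost (`integral_sq_increment_le`). As `N` is independent of the points, the Poisson
variance is the binomial variance plus `α² n` up to `o(n)` (`LocalSeq.tendsto_variance`); this is
the subtracted product term of `τ`.

Normality is proved directly for binomial samples. The covariance identity
`integral_smul_sub_eq_sum`, applied to the functional and its complex exponential, yields an
approximate differential equation for the characteristic function. Its coefficient is a quadratic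
form in the increments, and it suffices that this form concentrates (`norm_charFun_sub_exp_le`). For
local costs concentration is the Efron–Stein inequality (`variance_quad_le`), and general costs are
perturbations of local ones.

All hypotheses on sequences are stable under linear combinations, so one functional at a time
suffices: polarization gives the covariances and Cramér–Wold the joint law. Two measure theoretic
points are settled on the way: a process given by its counts is identified in bounded windows with a
Poisson number of independent points (`lintegral_eq_of_counts`), and functionals measurable only up
to null sets are replaced by Borel ones (`exists_isExceptional`). -/

lemma integrable_of_abs_le {α : Type*} [MeasurableSpace α] {μ : Measure α} [IsFiniteMeasure μ]
    {F : α → ℝ} (hF : Measurable F) {b : ℝ} (hb : ∀ w, |F w| ≤ b) : Integrable F μ :=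
  Integrable.of_bound hF.aestronglyMeasurable b (ae_of_all _ hb)

lemma integrable_pow_of_abs_le {α : Type*} [MeasurableSpace α] {μ : Measure α}
    [IsFiniteMeasure μ] {F : α → ℝ} (hF : Measurable F) {b : ℝ} (hb : ∀ w, |F w| ≤ b) (k : ℕ) :
    Integrable (fun w => F w ^ k) μ :=
  integrable_of_abs_le (b := b ^ k) (hF.pow_const k) fun w => by
    rw [abs_pow]; exact pow_le_pow_left₀ (abs_nonneg _) (hb w) k

lemma abs_integral_le_of_abs_le {α : Type*} [MeasurableSpace α] {μ : Measure α}
    [IsProbabilityMeasure μ] {F : α → ℝ} {b : ℝ} (hb : ∀ w, |F w| ≤ b) : |∫ w, F w ∂μ| ≤ b := by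
  simpa using norm_integral_le_of_norm_le_const (μ := μ) (f := F) (ae_of_all _ hb)

lemma memLp_of_abs_le {α : Type*} [MeasurableSpace α] {μ : Measure α} [IsFiniteMeasure μ]
    {F : α → ℝ} (hF : Measurable F) {b : ℝ} (hb : ∀ w, |F w| ≤ b) {p : ℝ≥0∞} : MemLp F p μ :=
  MemLp.of_bound hF.aestronglyMeasurable b (ae_of_all _ hb)

/-! ### Reindexing of product measures -/

section Reindex

variable {ι κ E : Type*} [MeasurableSpace E]

/-- Reindexing an infinite product of probability measures along an injective map. -/
lemma map_comp_infinitePi (μ : ι → Measure E) [∀ i, IsProbabilityMeasure (μ i)]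
    {σ : κ → ι} (hσ : Injective σ) :
    (infinitePi μ).map (fun w k => w (σ k)) = infinitePi fun k => μ (σ k) := by
  classical
  refine Measure.eq_infinitePi _ fun s t ht => ?_
  rw [map_apply (by fun_prop) (.pi s.countable_toSet fun _ _ => ht _)]
  -- Coordinates outside the range of `σ` are left unconstrained, so the cylinder pulls back to a
  -- cylinder over the image of `s`.
  set t' : ι → Set E := fun i => if h : ∃ k, σ k = i then t h.choose else Set.univ with ht'
  have hval : ∀ k, t' (σ k) = t k := fun k => by
    have h : ∃ k', σ k' = σ k := ⟨k, rfl⟩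
    simp only [ht', h, dif_pos]
    rw [hσ h.choose_spec]
  have : (fun (w : ι → E) k => w (σ k)) ⁻¹' ((s : Set κ).pi t) =
      ((s.map ⟨σ, hσ⟩ : Finset ι) : Set ι).pi t' := by
    ext w
    simp [Set.mem_pi, hval]
  rw [this, Measure.infinitePi_pi]
  · simp [hval]
  · intro i hi
    obtain ⟨k, -, rfl⟩ := Finset.mem_map.1 hi
    simpa [hval] using ht k

lemma measurePreserving_comp_infinitePi (μ : ι → Measure E) [∀ i, IsProbabilityMeasure (μ i)]
    {σ : κ → ι} (hσ : Injective σ) :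
    MeasurePreserving (fun (w : ι → E) k => w (σ k)) (infinitePi μ)
      (infinitePi fun k => μ (σ k)) :=
  ⟨by fun_prop, map_comp_infinitePi μ hσ⟩

/-- Families of coordinates along injective maps with disjoint ranges are independent. -/
lemma measurePreserving_prodMk_infinitePi {κ' : Type*} (μ : ι → Measure E)
    [∀ i, IsProbabilityMeasure (μ i)] {σ : κ → ι} {τ : κ' → ι} (hσ : Injective σ)
    (hτ : Injective τ) (hd : ∀ a b, σ a ≠ τ b) :
    MeasurePreserving (fun w : ι → E => ((fun k => w (σ k)), (fun k => w (τ k))))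
      (infinitePi μ)
      ((infinitePi fun k => μ (σ k)).prod (infinitePi fun k => μ (τ k))) := by
  refine ⟨by fun_prop, ?_⟩
  have hi : iIndepFun (fun (i : ι) (w : ι → E) => w i) (infinitePi μ) :=
    iIndepFun_infinitePi (X := fun _ x => x) (fun _ => measurable_id)
  have key : IndepFun (fun (w : ι → E) k => w (σ k)) (fun (w : ι → E) k => w (τ k))
      (infinitePi μ) := by
    have h1 := indep_iSup_of_disjoint (μ := infinitePi μ)
      (m := fun i : ι => MeasurableSpace.comap (fun w : ι → E => w i) inferInstance)
      (fun i => (measurable_pi_apply i).comap_le) hi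
      (S := range σ) (T := range τ)
      (disjoint_left.2 (by rintro _ ⟨a, rfl⟩ ⟨b, hb⟩; exact hd a b hb.symm))
    refine indep_of_indep_of_le_left (indep_of_indep_of_le_right h1 ?_) ?_
    · rw [MeasurableSpace.pi, MeasurableSpace.comap_iSup]
      refine iSup_le fun k => ?_
      rw [MeasurableSpace.comap_comp]
      exact le_iSup₂ (f := fun i (_ : i ∈ range τ) =>
        MeasurableSpace.comap (fun w : ι → E => w i) inferInstance) (τ k) ⟨k, rfl⟩
    · rw [MeasurableSpace.pi, MeasurableSpace.comap_iSup]
      refine iSup_le fun k => ?_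
      rw [MeasurableSpace.comap_comp]
      exact le_iSup₂ (f := fun i (_ : i ∈ range σ) =>
        MeasurableSpace.comap (fun w : ι → E => w i) inferInstance) (σ k) ⟨k, rfl⟩
  rw [(indepFun_iff_map_prod_eq_prod_map_map (measurable_pi_lambda _ fun k => measurable_pi_apply _).aemeasurable
    (measurable_pi_lambda _ fun k => measurable_pi_apply _).aemeasurable).1 key,
    map_comp_infinitePi μ hσ, map_comp_infinitePi μ hτ]

/-- A single coordinate is independent of the others. -/
lemma measurePreserving_eval_prodMk_infinitePi (μ : ι → Measure E)
    [∀ i, IsProbabilityMeasure (μ i)] {τ : κ → ι} (i : ι)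
    (hτ : Injective τ) (hd : ∀ b, i ≠ τ b) :
    MeasurePreserving (fun w : ι → E => (w i, (fun k => w (τ k))))
      (infinitePi μ)
      ((μ i).prod (infinitePi fun k => μ (τ k))) := by
  have h := measurePreserving_prodMk_infinitePi μ (σ := fun _ : Unit => i) (τ := τ)
    (fun _ _ _ => rfl) hτ (fun _ b => hd b)
  have h2 : MeasurePreserving (fun w : Unit → E => w ()) (infinitePi fun _ : Unit => μ i)
      (μ i) := measurePreserving_eval_infinitePi (fun _ : Unit => μ i) ()
  exact (h2.prod (MeasurePreserving.id _)).comp h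

end Reindex

/-! ### Measurable functionals of finite point configurations -/

section Config

variable {E : Type*} [MeasurableSpace E] {β : Type*} [MeasurableSpace β]

/-- A functional of finite sets is measurable if it is a measurable function of every finite
enumeration of the points. -/
def ConfMeasurable (f : Set E → β) : Prop :=
  ∀ m : ℕ, Measurable fun u : Fin m → E => f (range u)

lemma ConfMeasurable.image {α ι : Type*} [MeasurableSpace α] {f : Set E → β}
    (hf : ConfMeasurable f) (s : Finset ι) {v : ι → α → E} (hv : ∀ i, Measurable (v i)) :
    Measurable fun a => f ((fun i => v i a) '' (s : Set ι)) := by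
  have h : ∀ a, (fun i => v i a) '' (s : Set ι) =
      range fun j : Fin s.card => v (s.equivFin.symm j : ι) a := fun a => by
    ext x
    simp only [mem_image, Set.mem_range, SetLike.mem_coe]
    constructor
    · rintro ⟨i, hi, rfl⟩
      exact ⟨s.equivFin ⟨i, hi⟩, by simp⟩
    · rintro ⟨j, rfl⟩
      exact ⟨_, (s.equivFin.symm j).2, rfl⟩
  simp_rw [h]
  exact (hf s.card).comp (measurable_pi_lambda _ fun j => hv _)

/-- Measurability of a functional at the points with random labels. -/
lemma ConfMeasurable.image_filter {α ι : Type*} [MeasurableSpace α] {f : Set E → β}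
    (hf : ConfMeasurable f) (s : Finset ι) {v : ι → α → E} (hv : ∀ i, Measurable (v i))
    {Q : ι → α → Prop} (hQ : ∀ i, MeasurableSet {a | Q i a}) :
    Measurable fun a => f ((fun i => v i a) '' {i | i ∈ s ∧ Q i a}) := by
  classical
  have hset : ∀ t : Finset ι, MeasurableSet {a | s.filter (fun i => Q i a) = t} := fun t => by
    have : {a | s.filter (fun i => Q i a) = t} =
        {a | t ⊆ s} ∩ ⋂ i ∈ s, {a | Q i a ↔ i ∈ t} := by
      ext a
      simp only [mem_ofPred_eq, mem_inter_iff, Set.mem_iInter, Finset.ext_iff, mem_filter]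
      constructor
      · intro h
        exact ⟨fun i hi => ((h i).2 hi).1, fun i hi => by simpa [hi] using h i⟩
      · rintro ⟨h1, h2⟩ i
        by_cases hi : i ∈ s
        · simpa [hi] using h2 i hi
        · simp only [hi, false_and, false_iff]
          exact fun h => hi (h1 h)
    rw [this]
    refine (MeasurableSet.const _).inter (s.measurableSet_biInter fun i _ => ?_)
    by_cases hi : i ∈ t
    · simpa [hi] using hQ i
    · simp only [hi, iff_false]
      exact (hQ i).compl
  have heq : ∀ a, {i | i ∈ s ∧ Q i a} = ((s.filter (fun i => Q i a) : Finset ι) : Set ι) := by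
    intro a; ext; simp
  intro B hB
  -- The random label set takes finitely many values; where it is constant the functional is
  -- evaluated at a fixed list of points.
  have : (fun a => f ((fun i => v i a) '' {i | i ∈ s ∧ Q i a})) ⁻¹' B =
      ⋃ t ∈ s.powerset, {a | s.filter (fun i => Q i a) = t} ∩
        (fun a => f ((fun i => v i a) '' (t : Set ι))) ⁻¹' B := by
    ext a
    simp only [mem_preimage, heq, mem_iUnion, mem_inter_iff, mem_ofPred_eq,
      Finset.mem_powerset, exists_prop]
    constructor
    · intro h
      exact ⟨_, Finset.filter_subset _ _, rfl, h⟩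
    · rintro ⟨t, -, rfl, h⟩
      exact h
  rw [this]
  exact Finset.measurableSet_biUnion _ fun t _ => (hset t).inter ((hf.image t hv) hB)

/-- Measurability of a functional at a random number of random points. -/
lemma ConfMeasurable.image_Iio {α : Type*} [MeasurableSpace α] {f : Set E → β}
    (hf : ConfMeasurable f) {v : ℕ → α → E} (hv : ∀ i, Measurable (v i)) {N : α → ℕ}
    (hN : Measurable N) :
    Measurable fun a => f ((fun i => v i a) '' Iio (N a)) := fun B hB => by
  have : (fun a => f ((fun i => v i a) '' Iio (N a))) ⁻¹' B =
      ⋃ m : ℕ, N ⁻¹' {m} ∩ (fun a => f ((fun i => v i a) '' ((Finset.range m : Finset ℕ) : Set ℕ)))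
        ⁻¹' B := by
    ext a
    simp
  rw [this]
  exact MeasurableSet.iUnion fun m => (hN (measurableSet_singleton m)).inter
    ((hf.image (Finset.range m) hv) hB)

/-- Measurability at the union of two families of points with random labels. -/
lemma ConfMeasurable.image_union {α ι κ : Type*} [MeasurableSpace α] {f : Set E → β}
    (hf : ConfMeasurable f) (s : Finset ι) (t : Finset κ) {v : ι → α → E}
    (hv : ∀ i, Measurable (v i)) {w : κ → α → E} (hw : ∀ i, Measurable (w i))
    {Q : ι → α → Prop} (hQ : ∀ i, MeasurableSet {a | Q i a})
    {R : κ → α → Prop} (hR : ∀ i, MeasurableSet {a | R i a}) :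
    Measurable fun a => f ((fun i => v i a) '' {i | i ∈ s ∧ Q i a} ∪
      (fun i => w i a) '' {i | i ∈ t ∧ R i a}) := by
  have h := hf.image_filter (s.disjSum t) (v := fun i => Sum.elim v w i)
    (by rintro (i | i); exacts [hv i, hw i])
    (Q := fun i a => Sum.elim (fun i => Q i a) (fun i => R i a) i)
    (by rintro (i | i); exacts [hQ i, hR i])
  convert h using 3 with a
  ext x
  simp only [mem_union, mem_image, mem_ofPred_eq, Sum.exists, Finset.inl_mem_disjSum,
    Sum.elim_inl, Finset.inr_mem_disjSum, Sum.elim_inr]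

end Config

set_option linter.unusedSectionVars false

/-! ### Random finite sets are determined by their counts -/

section Counts

/-- The order statistics of a finite set of reals. -/
noncomputable def orderStat (j : ℕ) (r : Set ℝ) : Fin j → ℝ :=
  open Classical in
  if h : r.Finite ∧ r.ncard = j then
    h.1.toFinset.orderEmbOfFin ((Set.ncard_eq_toFinset_card r h.1).symm.trans h.2) else 0

lemma range_orderStat {r : Set ℝ} (hr : r.Finite) : range (orderStat r.ncard r) = r := by
  have h : r.Finite ∧ r.ncard = r.ncard := ⟨hr, rfl⟩
  rw [orderStat, dif_pos h, range_orderEmbOfFin]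
  simp

/-- The `k`-th smallest element, counted from zero, is at most `s` exactly when more than `k`
elements are. Order statistics are thereby functions of counts, which is all that is known about a
point process. -/
lemma orderStat_le_iff {r : Set ℝ} (hr : r.Finite) {j : ℕ} (hj : r.ncard = j) (k : Fin j)
    (s : ℝ) : orderStat j r k ≤ s ↔ (k : ℕ) < (r ∩ Iic s).ncard := by
  subst hj
  have h : r.Finite ∧ r.ncard = r.ncard := ⟨hr, rfl⟩
  have hc := (Set.ncard_eq_toFinset_card r h.1).symm
  rw [orderStat, dif_pos h]
  set g := h.1.toFinset.orderEmbOfFin (hc.trans h.2) with hg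
  have hrange : range g = r := by simp [hg, range_orderEmbOfFin]
  have himg : r ∩ Iic s = g '' {l | g l ≤ s} := by
    ext x
    constructor
    · rintro ⟨hx, hs⟩
      rw [← hrange] at hx
      obtain ⟨l, rfl⟩ := hx
      exact ⟨l, hs, rfl⟩
    · rintro ⟨l, hl, rfl⟩
      exact ⟨hrange.subset ⟨l, rfl⟩, hl⟩
  rw [himg, ncard_image_of_injective _ g.injective]
  constructor
  · intro hk
    have hsub : ((Finset.Iic k : Finset (Fin r.ncard)) : Set (Fin r.ncard)) ⊆ {l | g l ≤ s} := fun l hl =>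
      (g.monotone (by simpa using hl)).trans hk
    have := Set.ncard_le_ncard hsub (toFinite _)
    rw [ncard_coe_finset, Fin.card_Iic] at this
    omega
  · intro hlt
    by_contra hk
    have hsub : {l | g l ≤ s} ⊆ ((Finset.Iio k : Finset (Fin r.ncard)) : Set (Fin r.ncard)) := fun l hl => by
      have hl' : g l ≤ s := hl
      have : g l < g k := hl'.trans_lt (not_le.1 hk)
      simpa using g.lt_iff_lt.1 this
    have := Set.ncard_le_ncard hsub (toFinite _)
    rw [ncard_coe_finset, Fin.card_Iio] at this
    omega

variable {E : Type*} [MeasurableSpace E] [StandardBorelSpace E] [Nonempty E]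
  {Ω : Type*} [MeasurableSpace Ω] {X : Ω → Set E}

/-- The sorted real codes of the points of a finite set. -/
noncomputable def codes (j : ℕ) (X : Set E) : Fin j → ℝ := orderStat j (embeddingReal E '' X)

/-- The point with a given real code. -/
noncomputable def decode (E : Type*) [MeasurableSpace E] [StandardBorelSpace E] [Nonempty E] :
    ℝ → E := Function.extend (embeddingReal E) id fun _ => Classical.arbitrary E

lemma decode_embeddingReal (x : E) : decode E (embeddingReal E x) = x :=
  (measurableEmbedding_embeddingReal E).injective.extend_apply _ _ x

lemma measurable_decode : Measurable (decode E) :=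
  (measurableEmbedding_embeddingReal E).measurable_extend measurable_id measurable_const

lemma ncard_embeddingReal_image (X : Set E) : (embeddingReal E '' X).ncard = X.ncard :=
  ncard_image_of_injective _ (measurableEmbedding_embeddingReal E).injective

lemma range_decode_codes {X : Set E} (hX : X.Finite) {j : ℕ} (hj : X.ncard = j) :
    range (fun k => decode E (codes j X k)) = X := by
  have h := range_orderStat (hX.image (embeddingReal E))
  rw [ncard_embeddingReal_image, hj] at h
  have : range (fun k => decode E (codes j X k)) = decode E '' (range (codes j X)) := by
    rw [← range_comp]; rfl
  rw [this, codes, h, Set.image_image]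
  simp [decode_embeddingReal]

lemma codes_le_iff {X : Set E} (hX : X.Finite) {j : ℕ} (hj : X.ncard = j) (k : Fin j) (s : ℝ) :
    codes j X k ≤ s ↔ (k : ℕ) < (X ∩ embeddingReal E ⁻¹' Iic s).ncard := by
  have h := orderStat_le_iff (hX.image (embeddingReal E))
    ((ncard_embeddingReal_image X).trans hj) k s
  rwa [← Set.image_inter_preimage, ncard_embeddingReal_image] at h

lemma codes_of_ncard_ne {X : Set E} {j : ℕ} (hj : X.ncard ≠ j) : codes j X = 0 := by
  rw [codes, orderStat, dif_neg]
  rw [ncard_embeddingReal_image]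
  tauto

lemma measurable_codes (hfin : ∀ ω, (X ω).Finite)
    (hX : ∀ B, MeasurableSet B → Measurable fun ω => (X ω ∩ B).ncard) (j : ℕ) :
    Measurable fun ω => codes j (X ω) := by
  refine measurable_pi_lambda _ fun k => measurable_of_Iic fun s => ?_
  have hN : Measurable fun ω => (X ω).ncard := by simpa using hX Set.univ .univ
  have hC := hX (embeddingReal E ⁻¹' Iic s)
    ((measurableEmbedding_embeddingReal E).measurable measurableSet_Iic)
  -- When the cardinality is not `j` the codes have the default value `0`, which contributes the
  -- condition `0 ≤ s`.
  have : (fun ω => codes j (X ω) k) ⁻¹' Iic s =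
      ({ω | (X ω).ncard = j} ∩ {ω | (k : ℕ) < (X ω ∩ embeddingReal E ⁻¹' Iic s).ncard}) ∪
      ({ω | (X ω).ncard = j}ᶜ ∩ {_ω | (0 : ℝ) ≤ s}) := by
    ext ω
    by_cases hj : (X ω).ncard = j
    · simp [hj, codes_le_iff (hfin ω) hj]
    · simp [hj, codes_of_ncard_ne hj]
  rw [this]
  have h1 : MeasurableSet {ω | (X ω).ncard = j} := hN (measurableSet_singleton j)
  have h2 : MeasurableSet {ω | (k : ℕ) < (X ω ∩ embeddingReal E ⁻¹' Iic s).ncard} :=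
    hC (measurableSet_Ioi (a := (k : ℕ)))
  exact (h1.inter h2).union (h1.compl.inter (MeasurableSet.const _))

/-- A measurable functional of a random finite set with measurable counts is measurable. -/
lemma ConfMeasurable.comp_of_counts {β : Type*} [MeasurableSpace β] {F : Set E → β}
    (hF : ConfMeasurable F) (hfin : ∀ ω, (X ω).Finite)
    (hX : ∀ B, MeasurableSet B → Measurable fun ω => (X ω ∩ B).ncard) :
    Measurable fun ω => F (X ω) := by
  have hN : Measurable fun ω => (X ω).ncard := by simpa using hX Set.univ .univ
  intro B hB
  have : (fun ω => F (X ω)) ⁻¹' B = ⋃ j : ℕ, {ω | (X ω).ncard = j} ∩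
      (fun ω => F (range fun k => decode E (codes j (X ω) k))) ⁻¹' B := by
    ext ω
    simp only [mem_preimage, mem_iUnion, mem_inter_iff, mem_ofPred_eq]
    constructor
    · intro h
      exact ⟨_, rfl, by rwa [range_decode_codes (hfin ω) rfl]⟩
    · rintro ⟨j, hj, h⟩
      rwa [range_decode_codes (hfin ω) hj] at h
  rw [this]
  refine MeasurableSet.iUnion fun j => (hN (measurableSet_singleton j)).inter ?_
  refine ((hF j).comp (measurable_pi_lambda _ fun k => measurable_decode.comp ?_)) hB
  exact (measurable_pi_apply k).comp (measurable_codes hfin hX j)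

/-- On the event of cardinality `j` the set is recovered from its `j` sorted codes, so its law
reduces to a law on `Fin j → ℝ`. -/
lemma lintegral_eq_tsum_codes {μ : Measure Ω} (hfin : ∀ ω, (X ω).Finite)
    (hX : ∀ B, MeasurableSet B → Measurable fun ω => (X ω ∩ B).ncard)
    {F : Set E → ℝ≥0∞} (hF : ConfMeasurable F) :
    ∫⁻ ω, F (X ω) ∂μ = ∑' j : ℕ, ∫⁻ x, F (range fun k => decode E (x k))
        ∂((μ.restrict {ω | (X ω).ncard = j}).map (fun ω => codes j (X ω))) := by
  have hN : Measurable fun ω => (X ω).ncard := by simpa using hX Set.univ .univ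
  have hm : ∀ j : ℕ, MeasurableSet {ω | (X ω).ncard = j} := fun j => hN (measurableSet_singleton j)
  have hU : (⋃ j : ℕ, {ω | (X ω).ncard = j}) = Set.univ := by ext ω; simp
  rw [← setLIntegral_univ, ← hU, lintegral_iUnion hm]
  · refine tsum_congr fun j => ?_
    have hG : Measurable fun x : Fin j → ℝ => F (range fun k => decode E (x k)) :=
      (hF j).comp (measurable_pi_lambda _ fun k => measurable_decode.comp (measurable_pi_apply k))
    rw [lintegral_map hG (measurable_codes hfin hX j)]
    refine setLIntegral_congr_fun (hm j) fun ω hω => ?_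
    rw [range_decode_codes (hfin ω) hω]
  · intro i j hij
    refine disjoint_left.2 fun ω h1 h2 => hij ?_
    exact (h1 : _ = i).symm.trans h2

/-- The distribution function of the codes read off from a joint law of counts: component `0` is the
total number of points, component `k + 1` the number of points with code at most `s k`. -/
lemma map_codes_pi_Iic {μ : Measure Ω} (hfin : ∀ ω, (X ω).Finite)
    (hX : ∀ B, MeasurableSet B → Measurable fun ω => (X ω ∩ B).ncard) (j : ℕ) (s : Fin j → ℝ) :
    ((μ.restrict {ω | (X ω).ncard = j}).map (fun ω => codes j (X ω)))
        (Set.pi Set.univ fun k => Iic (s k)) =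
      (μ.map (fun ω (i : Fin (j + 1)) => (X ω ∩ (Fin.cons Set.univ
        (fun k => embeddingReal E ⁻¹' Iic (s k)) : Fin (j + 1) → Set E) i).ncard))
        {c | c 0 = j ∧ ∀ k : Fin j, (k : ℕ) < c k.succ} := by
  have hmC : Measurable (fun ω (i : Fin (j + 1)) => (X ω ∩
      (Fin.cons Set.univ (fun k => embeddingReal E ⁻¹' Iic (s k)) :
        Fin (j + 1) → Set E) i).ncard) := by
    refine measurable_pi_lambda _ fun i => hX _ ?_
    refine Fin.cases ?_ (fun k => ?_) i
    · exact .univ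
    · exact (measurableEmbedding_embeddingReal E).measurable measurableSet_Iic
  rw [map_apply (measurable_codes hfin hX j) (.univ_pi fun k => measurableSet_Iic),
    map_apply hmC (MeasurableSet.of_discrete),
    Measure.restrict_apply (measurable_codes hfin hX j (.univ_pi fun k => measurableSet_Iic))]
  congr 1
  ext ω
  simp only [mem_inter_iff, mem_preimage, Set.mem_pi, Set.mem_univ, true_imp_iff,
    Set.mem_Iic, mem_ofPred_eq, Fin.cons_zero, Fin.cons_succ, Set.inter_univ]
  rw [and_comm]
  refine and_congr_right fun hj => forall_congr' fun k => ?_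
  exact codes_le_iff (hfin ω) hj k (s k)

/-- The law of a random finite set is determined by the joint laws of its counts. -/
lemma lintegral_eq_of_counts {Ω' : Type*} [MeasurableSpace Ω'] {X' : Ω' → Set E}
    {μ : Measure Ω} {μ' : Measure Ω'} [IsFiniteMeasure μ] [IsFiniteMeasure μ']
    (hfin : ∀ ω, (X ω).Finite)
    (hX : ∀ B, MeasurableSet B → Measurable fun ω => (X ω ∩ B).ncard)
    (hfin' : ∀ ω, (X' ω).Finite)
    (hX' : ∀ B, MeasurableSet B → Measurable fun ω => (X' ω ∩ B).ncard)
    (hlaw : ∀ (m : ℕ) (C : Fin m → Set E), (∀ i, MeasurableSet (C i)) →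
      μ.map (fun ω i => (X ω ∩ C i).ncard) = μ'.map (fun ω i => (X' ω ∩ C i).ncard))
    {F : Set E → ℝ≥0∞} (hF : ConfMeasurable F) :
    ∫⁻ ω, F (X ω) ∂μ = ∫⁻ ω, F (X' ω) ∂μ' := by
  rw [lintegral_eq_tsum_codes hfin hX hF, lintegral_eq_tsum_codes hfin' hX' hF]
  refine tsum_congr fun j => ?_
  congr 1
  -- Orthants form a generating π-system. Their masses, and the total masses, are functions of joint
  -- laws of counts.
  refine ext_of_generate_finite (Set.pi Set.univ '' Set.pi Set.univ fun _ : Fin j => range Iic)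
    ?_ ?_ ?_ ?_
  · symm
    refine generateFrom_eq_pi (fun _ => (borel_eq_generateFrom_Iic ℝ).symm.trans
      (BorelSpace.measurable_eq (α := ℝ)).symm) fun _ => ?_
    exact ⟨fun n : ℕ => Iic (n : ℝ), fun n => ⟨_, rfl⟩, by
      ext x
      simpa using exists_nat_ge x⟩
  · refine IsPiSystem.pi fun _ => ?_
    rintro _ ⟨a, rfl⟩ _ ⟨b, rfl⟩ -
    exact ⟨min a b, by simp [Set.Iic_inter_Iic]⟩
  · rintro _ ⟨t, ht, rfl⟩
    choose s hs using fun k => ht k (Set.mem_univ k)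
    have : t = fun k => Iic (s k) := by funext k; exact (hs k).symm
    rw [this, map_codes_pi_Iic hfin hX, map_codes_pi_Iic hfin' hX', hlaw]
    intro i
    refine Fin.cases ?_ (fun k => ?_) i
    · exact .univ
    · exact (measurableEmbedding_embeddingReal E).measurable measurableSet_Iic
  · have h := hlaw 1 (fun _ => Set.univ) (fun _ => .univ)
    have hN : Measurable fun ω => (X ω).ncard := by simpa using hX Set.univ .univ
    have hN' : Measurable fun ω => (X' ω).ncard := by simpa using hX' Set.univ .univ
    rw [map_apply (measurable_codes hfin hX j) .univ,
      map_apply (measurable_codes hfin' hX' j) .univ]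
    simp only [Set.preimage_univ, Measure.restrict_apply_univ]
    have h2 := congrArg (fun m => m {c : Fin 1 → ℕ | c 0 = j}) h
    simp only [Set.inter_univ] at h2
    rw [map_apply (measurable_pi_lambda _ fun _ => hN) MeasurableSet.of_discrete,
      map_apply (measurable_pi_lambda _ fun _ => hN') MeasurableSet.of_discrete] at h2
    exact h2

end Counts

/-! ### The law of a Poisson process in a bounded window -/

section PoissonSample

open scoped NNReal

variable {E : Type*} [MeasurableSpace E]

/-- A number of points together with a sequence of points. -/
abbrev Config (E : Type*) := ℕ × (ℕ → E)

/-- The law of a sequence of independent points. -/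
noncomputable abbrev iidSeq (π : Measure E) := infinitePi fun _ : ℕ => π

/-- The law of a Poisson number of independent points. -/
noncomputable def poissonSample (r : ℝ≥0) (π : Measure E) : Measure (Config E) :=
  (poissonMeasure r).prod (iidSeq π)

instance (r : ℝ≥0) (π : Measure E) [IsProbabilityMeasure π] :
    IsProbabilityMeasure (poissonSample r π) := by
  unfold poissonSample; infer_instance

/-- The point configuration of a sample with a random number of points. -/
def points (q : Config E) : Set E := q.2 '' Iio q.1

lemma points_finite (q : Config E) : (points q).Finite := (Set.finite_Iio _).image _

lemma integral_prod_range_infinitePi (π : Measure E) [IsProbabilityMeasure π] (φ : E → ℂ)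
    (hφ : Measurable φ) (m : ℕ) :
    ∫ u, ∏ k ∈ Finset.range m, φ (u k) ∂(iidSeq π) = (∫ x, φ x ∂π) ^ m := by
  have h := map_comp_infinitePi (fun _ : ℕ => π) (σ := fun k : Fin m => (k : ℕ)) Fin.val_injective
  have h2 : ∀ u : ℕ → E, ∏ k ∈ Finset.range m, φ (u k) = ∏ k : Fin m, φ (u k) :=
    fun u => (Fin.prod_univ_eq_prod_range (fun k => φ (u k)) m).symm
  simp_rw [h2]
  have h3 := integral_map (μ := iidSeq π)
    (φ := fun (w : ℕ → E) (k : Fin m) => w k) (f := fun w : Fin m → E => ∏ k, φ (w k))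
    (measurable_pi_lambda _ fun k => measurable_pi_apply _).aemeasurable
    (Finset.measurable_fun_prod _ fun k _ =>
      hφ.comp (measurable_pi_apply k)).aestronglyMeasurable
  rw [← h3, h, infinitePi_eq_pi]
  simpa using integral_fintype_prod_eq_pow (ι := Fin m) (μ := π) φ

/-- The number of sample points in a set. -/
noncomputable def labelCount (C : Set E) (q : Config E) : ℕ :=
  ∑ k ∈ Finset.range q.1, C.indicator (fun _ => 1) (q.2 k)

lemma measurable_labelCount {C : Set E} (hC : MeasurableSet C) : Measurable (labelCount C) := by
  refine measurable_from_prod_countable_right fun m => ?_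
  simp only [labelCount]
  exact Finset.measurable_sum _ fun k _ =>
    (measurable_const.indicator hC).comp (measurable_pi_apply k)

/-- Thinning a Poisson number of points. Given the number `m`, the characteristic function of the
counts is the `m`-th power of `∫ ψ`; averaging over a Poisson `m` gives `exp (r (∫ ψ - 1))`. Since
the sets are disjoint, `ψ - 1` is a sum over the sets, and the exponential factorizes into
characteristic functions of Poisson laws. -/
lemma map_labelCount_poissonSample {ι : Type*} [Fintype ι] (r : ℝ≥0) (π : Measure E)
    [IsProbabilityMeasure π] (C : ι → Set E) (hC : ∀ i, MeasurableSet (C i))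
    (hdisj : Pairwise fun i j => Disjoint (C i) (C j)) :
    (poissonSample r π).map (fun q i => labelCount (C i) q) =
      Measure.pi fun i => poissonMeasure (r * (π (C i)).toNNReal) := by
  classical
  have hm : Measurable fun (q : Config E) (i : ι) => labelCount (C i) q :=
    measurable_pi_lambda _ fun i => measurable_labelCount (hC i)
  have hcast : Measurable fun (c : ι → ℕ) (i : ι) => (c i : ℝ) :=
    measurable_pi_lambda _ fun i => measurable_from_top.comp (measurable_pi_apply i)
  have hfloor : Measurable fun (c : ι → ℝ) (i : ι) => ⌊c i⌋₊ :=
    measurable_pi_lambda _ fun i => Nat.measurable_floor.comp (measurable_pi_apply i)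
  -- Characteristic functions live on `ℝ`; the floor function undoes the cast.
  suffices h : ((poissonSample r π).map (fun q i => labelCount (C i) q)).map
      (fun c i => (c i : ℝ)) =
      (Measure.pi fun i => poissonMeasure (r * (π (C i)).toNNReal)).map (fun c i => (c i : ℝ)) by
    have h2 := congrArg (Measure.map fun (c : ι → ℝ) (i : ι) => ⌊c i⌋₊) h
    rw [Measure.map_map hfloor hcast, Measure.map_map hfloor hcast] at h2
    have hid : (fun (c : ι → ℝ) (i : ι) => ⌊c i⌋₊) ∘ (fun (c : ι → ℕ) (i : ι) => (c i : ℝ)) = id := by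
      funext c i; simp
    rwa [hid, Measure.map_id, Measure.map_id] at h2
  have hp : (Measure.pi fun i => poissonMeasure (r * (π (C i)).toNNReal)).map
      (fun c i => (c i : ℝ)) =
      Measure.pi fun i => (poissonMeasure (r * (π (C i)).toNNReal)).map (Nat.cast : ℕ → ℝ) := by
    have (i : ι) : IsProbabilityMeasure
        ((poissonMeasure (r * (π (C i)).toNNReal)).map (Nat.cast : ℕ → ℝ)) :=
      Measure.isProbabilityMeasure_map (by fun_prop)
    exact Measure.pi_map_pi (fun i => by fun_prop)
  rw [hp, Measure.map_map hcast hm]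
  have (i : ι) : IsProbabilityMeasure
      ((poissonMeasure (r * (π (C i)).toNNReal)).map (Nat.cast : ℕ → ℝ)) :=
    Measure.isProbabilityMeasure_map (by fun_prop)
  rw [← charFun_eq_pi_iff]
  intro s
  rw [Measure.map_map (by fun_prop) (hcast.comp hm), charFun_apply, integral_map
    (((by fun_prop : Measurable (WithLp.toLp 2 : (ι → ℝ) → _)).comp
      (hcast.comp hm)).aemeasurable) (by fun_prop)]
  set ψ : E → ℂ := fun x => 1 + ∑ i, (C i).indicator (fun _ => Complex.exp (s i * I) - 1) x
    with hψ
  have hψm : Measurable ψ := by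
    refine measurable_const.add (Finset.measurable_fun_sum _ fun i _ => ?_)
    exact measurable_const.indicator (hC i)
  have hψe : ∀ x, Complex.exp ((∑ i, (((C i).indicator (fun _ => 1) x : ℕ) : ℝ) * s i : ℝ) *
      I) = ψ x := fun x => by
    by_cases hx : ∃ i, x ∈ C i
    · obtain ⟨i, hi⟩ := hx
      have hne : ∀ j, j ≠ i → x ∉ C j := fun j hj hxj =>
        disjoint_left.1 (hdisj hj) hxj hi
      rw [hψ]
      simp only
      rw [Finset.sum_eq_single i, Finset.sum_eq_single i]
      · simp [hi]
      · intro j _ hj; simp [hne j hj]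
      · simp
      · intro j _ hj; simp [hne j hj]
      · simp
    · push Not at hx
      simp [hψ, hx]
  have hIn : ∀ q : Config E, Complex.exp ((inner ℝ ((WithLp.toLp 2 : (ι → ℝ) → _)
      (fun i => (labelCount (C i) q : ℝ))) s : ℝ) * I) =
      ∏ k ∈ Finset.range q.1, ψ (q.2 k) := fun q => by
    simp_rw [← hψe, ← exp_sum, ← sum_mul, ← Complex.ofReal_sum]
    congr 3
    rw [PiLp.inner_apply, Finset.sum_comm]
    refine sum_congr rfl fun i _ => ?_
    rw [← sum_mul]
    simp [labelCount, mul_comm]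
  have hψn : ∀ x, ‖ψ x‖ ≤ 1 := fun x => by rw [← hψe, norm_exp_ofReal_mul_I]
  simp only [comp_apply]
  simp_rw [hIn]
  have hmeasq : Measurable fun q : Config E => ∏ k ∈ Finset.range q.1, ψ (q.2 k) := by
    refine measurable_from_prod_countable_right fun m => ?_
    simp only
    exact Finset.measurable_fun_prod _ fun k _ => hψm.comp (measurable_pi_apply k)
  rw [poissonSample, integral_prod]
  · simp only
    simp_rw [integral_prod_range_infinitePi π ψ hψm, charFun_map_cast_poissonMeasure, ← exp_sum]
    have hψi : ∫ x, ψ x ∂π = 1 + ∑ i, ((π (C i)).toNNReal : ℂ) * (Complex.exp (s i * I) - 1) := by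
      rw [hψ, integral_add (by simp) (integrable_finsetSum _ fun i _ =>
        (integrable_const _).indicator (hC i)), integral_finsetSum _ fun i _ =>
        (integrable_const _).indicator (hC i)]
      simp only [integral_const, probReal_univ, one_smul]
      congr 1
      refine sum_congr rfl fun i _ => ?_
      rw [integral_indicator (hC i), setIntegral_const]
      simp [Measure.real, ENNReal.toReal]
    rw [integral_poissonMeasure]
    have hsum := (NormedSpace.expSeries_div_hasSum_exp ((r : ℂ) * ∫ x, ψ x ∂π)).mul_left
      (Complex.exp (-r))
    rw [← Complex.exp_eq_exp_ℂ, ← Complex.exp_add] at hsum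
    rw [show (fun n : ℕ => (exp (-r) * r ^ n / n.factorial : ℝ) • (∫ x, ψ x ∂π) ^ n) =
      fun n : ℕ => Complex.exp (-r) * (((r : ℂ) * ∫ x, ψ x ∂π) ^ n / n.factorial) from ?_,
      hsum.tsum_eq, hψi]
    · congr 1
      rw [mul_add, mul_sum]
      push_cast
      simp only [mul_one, neg_add_cancel_left]
      exact sum_congr rfl fun i _ => by ring
    · funext n
      rw [real_smul]
      push_cast
      ring
  · refine Integrable.of_bound hmeasq.aestronglyMeasurable 1 (ae_of_all _ fun q => ?_)
    rw [norm_prod]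
    exact Finset.prod_le_one (fun _ _ => norm_nonneg _) fun k _ => hψn _

end PoissonSample

/-! ### Atoms of finitely many sets -/

section Atoms

variable {E : Type*}

/-- The atoms of the Boolean algebra generated by a finite family of sets. -/
def atomSet {m : ℕ} (C : Fin m → Set E) (T : Fin m → Bool) : Set E :=
  {x | ∀ i, x ∈ C i ↔ T i = true}

lemma measurableSet_atomSet [MeasurableSpace E] {m : ℕ} {C : Fin m → Set E}
    (hC : ∀ i, MeasurableSet (C i)) (T : Fin m → Bool) : MeasurableSet (atomSet C T) := by
  have : atomSet C T = ⋂ i, {x | x ∈ C i ↔ T i = true} := by ext; simp [atomSet]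
  rw [this]
  refine MeasurableSet.iInter fun i => ?_
  by_cases h : T i = true
  · simpa [h] using hC i
  · have : {x | x ∈ C i ↔ T i = true} = (C i)ᶜ := by ext; simp [h]
    exact this ▸ (hC i).compl

lemma disjoint_atomSet {m : ℕ} (C : Fin m → Set E) {T T' : Fin m → Bool} (h : T ≠ T') :
    Disjoint (atomSet C T) (atomSet C T') := by
  refine disjoint_left.2 fun x hx hx' => h (funext fun i => ?_)
  exact Bool.eq_iff_iff.2 ((hx i).symm.trans (hx' i))

/-- Reduces counts in arbitrary sets to counts in disjoint sets, the only ones for which the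
definition of a Poisson process prescribes a joint law. -/
lemma ncard_inter_eq_sum_atomSet {m : ℕ} (C : Fin m → Set E) {X : Set E} (hX : X.Finite)
    (i : Fin m) :
    (X ∩ C i).ncard = ∑ T : Fin m → Bool, if T i = true then (X ∩ atomSet C T).ncard else 0 := by
  classical
  have key : ∀ D : Set E, (X ∩ D).ncard = (hX.toFinset.filter (· ∈ D)).card := fun D => by
    rw [← ncard_coe_finset]
    congr 1
    ext x
    simp
  rw [key, Finset.card_eq_sum_card_fiberwise (t := univ)
    (f := fun x (i : Fin m) => decide (x ∈ C i)) (fun _ _ => by simp)]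
  refine sum_congr rfl fun T _ => ?_
  split_ifs with hT
  · rw [key]
    congr 1
    ext x
    rw [mem_filter, mem_filter, mem_filter, funext_iff]
    constructor
    · rintro ⟨⟨hx, -⟩, h⟩
      exact ⟨hx, fun i => by rw [← h i]; simp⟩
    · rintro ⟨hx, h⟩
      exact ⟨⟨hx, (h i).2 hT⟩, fun j => by rw [Bool.eq_iff_iff]; simp [h j]⟩
  · rw [card_eq_zero, Finset.filter_eq_empty_iff]
    intro x hx h
    refine hT ?_
    rw [← h]
    simpa using (mem_filter.1 hx).2

end Atoms

/-! ### Distinctness of independent points and counting without repetition -/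

section Injective

variable {E : Type*} [MeasurableSpace E]

/-- Independent points have distinct images under a map with diffuse law. -/
lemma ae_injective_infinitePi {ι F : Type*} [Countable ι] [MeasurableSpace F]
    [MeasurableEq F] (π : Measure E) [IsProbabilityMeasure π] {φ : E → F}
    (hφ : Measurable φ) (h0 : ∀ c, π (φ ⁻¹' {c}) = 0) :
    ∀ᵐ u ∂(infinitePi fun _ : ι => π), Injective fun k => φ (u k) := by
  have key : ∀ i j : ι, i ≠ j → ∀ᵐ u ∂(infinitePi fun _ : ι => π), φ (u i) ≠ φ (u j) := fun i j hij => by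
    have hmp := measurePreserving_eval_prodMk_infinitePi (fun _ : ι => π) (κ := Unit) (τ := fun _ => j)
      i (fun _ _ _ => rfl) (fun _ => hij)
    have hs : MeasurableSet {p : E × (Unit → E) | φ p.1 = φ (p.2 ())} :=
      measurableSet_eq_fun (by fun_prop) (by fun_prop)
    have h0' : (π.prod (infinitePi fun _ : Unit => π))
        {p : E × (Unit → E) | φ p.1 = φ (p.2 ())} = 0 := by
      rw [Measure.measure_prod_null hs]
      refine ae_of_all _ fun x => ?_
      have h1 := (measurePreserving_eval_infinitePi (fun _ : Unit => π) ()).measure_preimage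
        (s := φ ⁻¹' {φ x}) ?_
      · rw [h0] at h1
        change _ = (0 : ℝ≥0∞)
        convert h1 using 2
        ext y
        simp [eq_comm]
      · exact (hφ (measurableSet_singleton _)).nullMeasurableSet
    rw [ae_iff]
    rw [← hmp.measure_preimage hs.nullMeasurableSet] at h0'
    simpa using h0'
  have : ∀ᵐ u ∂(infinitePi fun _ : ι => π), ∀ i j : ι, i ≠ j → φ (u i) ≠ φ (u j) := by
    simp_rw [ae_all_iff]
    intro i j hij
    exact key i j hij
  filter_upwards [this] with u hu i j hij
  by_contra hne
  exact hu i j hne hij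

open scoped NNReal in
lemma ae_poissonSample_snd (r : ℝ≥0) {π : Measure E} [IsProbabilityMeasure π]
    {p : (ℕ → E) → Prop} (h : ∀ᵐ u ∂(iidSeq π), p u) :
    ∀ᵐ q ∂(poissonSample r π), p q.2 :=
  (Measure.quasiMeasurePreserving_snd (μ := poissonMeasure r)
    (ν := iidSeq π)).ae h

lemma ncard_points_inter {q : Config E} (hq : Injective q.2) (C : Set E) :
    (points q ∩ C).ncard = labelCount C q := by
  classical
  have : points q ∩ C = q.2 '' ((Finset.range q.1).filter (fun k => q.2 k ∈ C) : Finset ℕ) := by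
    ext x
    simp only [points, mem_inter_iff, mem_image, Set.mem_Iio, coe_filter, mem_range, mem_ofPred_eq]
    constructor
    · rintro ⟨⟨k, hk, rfl⟩, hx⟩
      exact ⟨k, ⟨hk, hx⟩, rfl⟩
    · rintro ⟨k, ⟨hk, hx⟩, rfl⟩
      exact ⟨⟨k, hk, rfl⟩, hx⟩
  rw [this, ncard_image_of_injective _ hq, ncard_coe_finset, labelCount, Finset.card_filter]
  exact sum_congr rfl fun k _ => by simp [indicator_apply]

/-- An enumeration may repeat points, so each point is counted at its first label only. -/
lemma confMeasurable_ncard_inter [MeasurableEq E] {C : Set E} (hC : MeasurableSet C) :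
    ConfMeasurable fun X : Set E => (X ∩ C).ncard := by
  classical
  intro m
  have h : ∀ u : Fin m → E, (range u ∩ C).ncard =
      ∑ k : Fin m, if u k ∈ C ∧ ∀ l < k, u l ≠ u k then 1 else 0 := fun u => by
    rw [← Finset.card_filter, ← ncard_coe_finset]
    symm
    refine Set.ncard_congr (fun k _ => u k) ?_ ?_ ?_
    · intro k hk
      simp only [coe_filter, mem_univ, true_and, mem_ofPred_eq] at hk
      exact ⟨⟨k, rfl⟩, hk.1⟩
    · intro k l hk hl hkl
      simp only [coe_filter, mem_univ, true_and, mem_ofPred_eq] at hk hl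
      rcases lt_trichotomy k l with h | h | h
      · exact absurd hkl (hl.2 k h)
      · exact h
      · exact absurd hkl.symm (hk.2 l h)
    · rintro x ⟨⟨k, rfl⟩, hx⟩
      have hne : (univ.filter fun l => u l = u k).Nonempty := ⟨k, by simp⟩
      refine ⟨(univ.filter fun l => u l = u k).min' hne, ?_, ?_⟩
      · have h1 := Finset.min'_mem _ hne
        simp only [mem_filter, mem_univ, true_and] at h1
        simp only [coe_filter, mem_univ, true_and, mem_ofPred_eq, h1]
        refine ⟨hx, fun l hl heq => ?_⟩
        have := Finset.min'_le (univ.filter fun l => u l = u k) l (by simp [heq])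
        exact absurd hl (not_lt.2 this)
      · have h1 := Finset.min'_mem _ hne
        simpa using h1
  simp_rw [h]
  refine Finset.measurable_fun_sum _ fun k _ => Measurable.ite ?_ measurable_const measurable_const
  refine MeasurableSet.inter ((measurable_pi_apply k) hC) ?_
  have : {u : Fin m → E | ∀ l < k, u l ≠ u k} = ⋂ l, ⋂ (_ : l < k), {u | u l = u k}ᶜ := by
    ext; simp
  change MeasurableSet {u : Fin m → E | ∀ l < k, u l ≠ u k}
  rw [this]
  exact MeasurableSet.iInter fun l => MeasurableSet.iInter fun _ =>
    (measurableSet_eq_fun (measurable_pi_apply l) (measurable_pi_apply k)).compl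

end Injective

/-! ### Identification of the process in a bounded window -/

section Law

open scoped NNReal

variable {d : ℕ} [NeZero d] {Ω : Type*} [MeasurableSpace Ω] {μ : Measure Ω}
  [IsProbabilityMeasure μ] {P : Ω → Set (Space d)} {lam : ℝ}

lemma isProbabilityMeasure_cond_volume {B : Set (Space d)} (hb : Bornology.IsBounded B)
    (h0 : volume B ≠ 0) : IsProbabilityMeasure volume[|B] :=
  ProbabilityTheory.cond_isProbabilityMeasure_of_finite h0 hb.measure_lt_top.ne

lemma cond_volume_singleton (B : Set (Space d)) (x : Space d) : volume[|B] {x} = 0 :=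
  ProbabilityTheory.cond_absolutelyContinuous (by simp)

lemma IsPoissonProcess.measurable_ncard_inter (hP : IsPoissonProcess P lam μ)
    {B : Set (Space d)} (hB : MeasurableSet B) (hb : Bornology.IsBounded B) (C : Set (Space d))
    (hC : MeasurableSet C) : Measurable fun ω => ((P ω ∩ B) ∩ C).ncard := by
  simp_rw [inter_assoc]
  exact hP.measurable_count _ (hB.inter hC) (hb.subset inter_subset_left)

/-- In a bounded window, a Poisson process is a Poisson number of independent uniform points. -/
lemma IsPoissonProcess.lintegral_eq (hP : IsPoissonProcess P lam μ) (hlam : 0 < lam)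
    {B : Set (Space d)} (hB : MeasurableSet B) (hb : Bornology.IsBounded B) (h0 : volume B ≠ 0)
    {F : Set (Space d) → ℝ≥0∞} (hF : ConfMeasurable F) :
    ∫⁻ ω, F (P ω ∩ B) ∂μ = ∫⁻ q, F (points q)
      ∂(poissonSample (lam * volume.real B).toNNReal volume[|B]) := by
  have hpr := isProbabilityMeasure_cond_volume hb h0
  have hcount : ∀ C : Set (Space d), MeasurableSet C → Measurable fun q : Config (Space d) =>
      (points q ∩ C).ncard := fun C hC =>
    (confMeasurable_ncard_inter hC).image_Iio (v := fun i (q : Config (Space d)) => q.2 i)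
      (N := fun q => q.1) (fun i => by fun_prop) measurable_fst
  have hX : ∀ C : Set (Space d), MeasurableSet C → Measurable fun ω => ((P ω ∩ B) ∩ C).ncard :=
    hP.measurable_ncard_inter hB hb
  have hfin : ∀ ω, (P ω ∩ B).Finite := fun ω => hP.locallyFinite ω B hb
  have hfin' : ∀ q : Config (Space d), (points q).Finite := points_finite
  refine lintegral_eq_of_counts hfin hX hfin' hcount ?_ hF
  intro m C hC
  -- On the atoms both sides are products of Poisson laws with the same means; the counts in the `C
  -- i` are then sums over atoms.
  have key : μ.map (fun ω (T : Fin m → Bool) => ((P ω ∩ B) ∩ atomSet C T).ncard) =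
      (poissonSample (lam * volume.real B).toNNReal volume[|B]).map
        (fun q T => (points q ∩ atomSet C T).ncard) := by
    have hae : (fun q (T : Fin m → Bool) => (points q ∩ atomSet C T).ncard) =ᵐ[
        poissonSample (lam * volume.real B).toNNReal volume[|B]]
        fun q T => labelCount (atomSet C T) q := by
      have h1 := ae_injective_infinitePi (ι := ℕ) volume[|B] measurable_id
        (cond_volume_singleton B)
      have h2 := ae_poissonSample_snd (lam * volume.real B).toNNReal h1
      filter_upwards [h2] with q hq
      funext T
      exact ncard_points_inter hq _
    rw [Measure.map_congr hae, map_labelCount_poissonSample _ _ _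
      (measurableSet_atomSet hC) (fun T T' h => disjoint_atomSet C h)]
    have hi : iIndepFun (fun (T : Fin m → Bool) ω => ((P ω ∩ B) ∩ atomSet C T).ncard) μ := by
      let e := Fintype.equivFin (Fin m → Bool)
      have := hP.indep (Fintype.card (Fin m → Bool)) (fun i => B ∩ atomSet C (e.symm i))
        (fun i => hB.inter (measurableSet_atomSet hC _))
        (fun i => hb.subset inter_subset_left)
        (fun i j hij => (disjoint_atomSet C (e.symm.injective.ne hij)).mono
          inter_subset_right inter_subset_right)
      have h3 := this.precomp e.injective
      simp only [Equiv.symm_apply_apply, ← inter_assoc] at h3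
      exact h3
    rw [(iIndepFun_iff_map_fun_eq_pi_map fun T => (hP.measurable_ncard_inter hB hb _
      (measurableSet_atomSet hC T)).aemeasurable).1 hi]
    congr 1
    funext T
    simp_rw [inter_assoc]
    rw [hP.count_law _ (hB.inter (measurableSet_atomSet hC T)) (hb.subset inter_subset_left)]
    congr 1
    rw [ProbabilityTheory.cond_apply hB]
    ext
    have hr : 0 ≤ volume.real B := measureReal_nonneg
    have hr' : volume.real B ≠ 0 := by
      rw [Measure.real, ENNReal.toReal_ne_zero]
      exact ⟨h0, hb.measure_lt_top.ne⟩
    rw [NNReal.coe_mul, coe_toNNReal _ (by positivity), coe_toNNReal _ (by positivity)]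
    rw [show ((((volume B)⁻¹ * volume (B ∩ atomSet C T)).toNNReal : ℝ≥0) : ℝ) =
      ((volume B)⁻¹ * volume (B ∩ atomSet C T)).toReal from rfl, toReal_mul,
      ENNReal.toReal_inv]
    change lam * volume.real (B ∩ atomSet C T) =
      lam * volume.real B * ((volume.real B)⁻¹ * volume.real (B ∩ atomSet C T))
    field_simp
  have hA : Measurable fun (c : (Fin m → Bool) → ℕ) (i : Fin m) =>
      ∑ T : Fin m → Bool, if T i = true then c T else 0 := by
    refine measurable_pi_lambda _ fun i => Finset.measurable_fun_sum _ fun T _ => ?_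
    split_ifs
    · exact measurable_pi_apply T
    · exact measurable_const
  have h4 := congrArg (Measure.map fun (c : (Fin m → Bool) → ℕ) (i : Fin m) =>
      ∑ T : Fin m → Bool, if T i = true then c T else 0) key
  rw [Measure.map_map hA (measurable_pi_lambda _ fun T => hP.measurable_ncard_inter hB hb _
      (measurableSet_atomSet hC T)), Measure.map_map hA (measurable_pi_lambda _ fun T => hcount _
      (measurableSet_atomSet hC T))] at h4
  convert h4 using 2
  · funext ω i
    exact ncard_inter_eq_sum_atomSet C (hP.locallyFinite ω B hb) i
  · funext q i
    exact ncard_inter_eq_sum_atomSet C (points_finite q) i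

end Law

/-! ### Independence over disjoint sets, and conditioning on the restriction to a set -/

section HalfSpace

variable {d : ℕ} [NeZero d] {Ω : Type*} [mΩ : MeasurableSpace Ω] {μ : Measure Ω}
  [IsProbabilityMeasure μ] {P : Ω → Set (Space d)} {lam : ℝ}

/-- The `σ`-field generated by the restriction of a point process to a set `H`. -/
noncomputable abbrev countSigma (P : Ω → Set (Space d)) (H : Set (Space d)) : MeasurableSpace Ω :=
  ⨆ (B : Set (Space d)) (_ : MeasurableSet B ∧ Bornology.IsBounded B ∧ B ⊆ H),
    MeasurableSpace.comap (fun ω => (P ω ∩ B).ncard) ⊤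

lemma IsPoissonProcess.countSigma_le (hP : IsPoissonProcess P lam μ) (H : Set (Space d)) :
    countSigma P H ≤ mΩ :=
  iSup₂_le fun B hB => (hP.measurable_count B hB.1 hB.2.1).comap_le

lemma measurable_count_countSigma {H B : Set (Space d)} (hB : MeasurableSet B)
    (hb : Bornology.IsBounded B) (hH : B ⊆ H) :
    Measurable[countSigma P H] fun ω => (P ω ∩ B).ncard := by
  refine measurable_iff_comap_le.2 ?_
  exact le_iSup₂ (f := fun (B : Set (Space d))
    (_ : MeasurableSet B ∧ Bornology.IsBounded B ∧ B ⊆ H) =>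
    MeasurableSpace.comap (fun ω => (P ω ∩ B).ncard) ⊤) B ⟨hB, hb, hH⟩

/-- Counts in finitely many sets are determined by the counts in the atoms. -/
lemma IsPoissonProcess.comap_count_le (hP : IsPoissonProcess P lam μ) {m : ℕ}
    {C : Fin m → Set (Space d)} (hb : ∀ i, Bornology.IsBounded (C i)) (i : Fin m) :
    MeasurableSpace.comap (fun ω => (P ω ∩ C i).ncard) ⊤ ≤
      MeasurableSpace.comap (fun ω (T : Fin m → Bool) => (P ω ∩ ((⋃ i, C i) ∩ atomSet C T)).ncard)
        inferInstance := by
  have hU : Bornology.IsBounded (⋃ i, C i) := isBounded_iUnion.2 hb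
  have : (fun ω => (P ω ∩ C i).ncard) = (fun c : (Fin m → Bool) → ℕ =>
      ∑ T : Fin m → Bool, if T i = true then c T else 0) ∘
      (fun ω (T : Fin m → Bool) => (P ω ∩ ((⋃ i, C i) ∩ atomSet C T)).ncard) := by
    funext ω
    have h := ncard_inter_eq_sum_atomSet C (hP.locallyFinite ω _ hU) i
    simp only [inter_assoc] at h
    rw [inter_eq_self_of_subset_right (Set.subset_iUnion C i)] at h
    exact h
  rw [this, ← MeasurableSpace.comap_comp]
  refine MeasurableSpace.comap_mono ?_
  refine measurable_iff_comap_le.1 ?_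
  refine Finset.measurable_fun_sum _ fun T _ => ?_
  split_ifs
  · exact measurable_pi_apply T
  · exact measurable_const

/-- Both families are cut into atoms, and all atoms together are disjoint, so the definition applies
to the joint family. Intersecting with the unions keeps the atoms bounded and separates the two
families. -/
lemma IsPoissonProcess.indep_finite (hP : IsPoissonProcess P lam μ) {m m' : ℕ}
    {C : Fin m → Set (Space d)} {C' : Fin m' → Set (Space d)}
    (hC : ∀ i, MeasurableSet (C i)) (hC' : ∀ i, MeasurableSet (C' i))
    (hb : ∀ i, Bornology.IsBounded (C i)) (hb' : ∀ i, Bornology.IsBounded (C' i))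
    (hd : Disjoint (⋃ i, C i) (⋃ i, C' i)) :
    Indep (⨆ i, MeasurableSpace.comap (fun ω => (P ω ∩ C i).ncard) ⊤)
      (⨆ i, MeasurableSpace.comap (fun ω => (P ω ∩ C' i).ncard) ⊤) μ := by
  classical
  let D : (Fin m → Bool) ⊕ (Fin m' → Bool) → Set (Space d) :=
    Sum.elim (fun T => (⋃ i, C i) ∩ atomSet C T) (fun T => (⋃ i, C' i) ∩ atomSet C' T)
  have hD : ∀ j, MeasurableSet (D j) := by
    rintro (T | T)
    · exact (MeasurableSet.iUnion hC).inter (measurableSet_atomSet hC T)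
    · exact (MeasurableSet.iUnion hC').inter (measurableSet_atomSet hC' T)
  have hDb : ∀ j, Bornology.IsBounded (D j) := by
    rintro (T | T)
    · exact (isBounded_iUnion.2 hb).subset inter_subset_left
    · exact (isBounded_iUnion.2 hb').subset inter_subset_left
  have hDd : Pairwise fun i j => Disjoint (D i) (D j) := by
    rintro (T | T) (T' | T') hne
    · exact (disjoint_atomSet C (fun h => hne (by rw [h]))).mono inter_subset_right
        inter_subset_right
    · exact hd.mono inter_subset_left inter_subset_left
    · exact hd.symm.mono inter_subset_left inter_subset_left
    · exact (disjoint_atomSet C' (fun h => hne (by rw [h]))).mono inter_subset_right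
        inter_subset_right
  let e := Fintype.equivFin ((Fin m → Bool) ⊕ (Fin m' → Bool))
  have h1 := hP.indep _ (fun i => D (e.symm i)) (fun i => hD _) (fun i => hDb _)
    (fun i j hij => hDd (e.symm.injective.ne hij))
  have h2 := h1.precomp e.injective
  simp only [Equiv.symm_apply_apply] at h2
  have hcm : ∀ j, Measurable fun ω => (P ω ∩ D j).ncard := fun j =>
    hP.measurable_count _ (hD j) (hDb j)
  let S : Finset ((Fin m → Bool) ⊕ (Fin m' → Bool)) := univ.map Function.Embedding.inl
  let S' : Finset ((Fin m → Bool) ⊕ (Fin m' → Bool)) := univ.map Function.Embedding.inr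
  have h3 := h2.indepFun_finset S S' (by rw [Finset.disjoint_left]; simp [S, S']) hcm
  have h4 := h3.comp
    (φ := fun (c : S → ℕ) (T : Fin m → Bool) => c ⟨Sum.inl T, by simp [S]⟩)
    (ψ := fun (c : S' → ℕ) (T : Fin m' → Bool) => c ⟨Sum.inr T, by simp [S']⟩)
    (measurable_pi_lambda _ fun T => measurable_pi_apply _)
    (measurable_pi_lambda _ fun T => measurable_pi_apply _)
  exact indep_of_indep_of_le_left (indep_of_indep_of_le_right h4
    (iSup_le fun i => hP.comap_count_le hb' i)) (iSup_le fun i => hP.comap_count_le hb i)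

lemma countSigma_eq_iSup_finset (H : Set (Space d)) :
    countSigma P H = ⨆ t : Finset {B : Set (Space d) // MeasurableSet B ∧ Bornology.IsBounded B ∧
      B ⊆ H}, ⨆ B ∈ t, MeasurableSpace.comap (fun ω => (P ω ∩ B.1).ncard) ⊤ := by
  rw [← iSup_eq_iSup_finset, iSup_subtype]

/-- The restrictions of a Poisson process to disjoint sets are independent. -/
lemma IsPoissonProcess.indep_countSigma (hP : IsPoissonProcess P lam μ)
    {H H' : Set (Space d)} (hd : Disjoint H H') :
    Indep (countSigma P H) (countSigma P H') μ := by
  have hdir : ∀ H : Set (Space d), Directed (· ≤ ·) fun t : Finset {B : Set (Space d) //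
      MeasurableSet B ∧ Bornology.IsBounded B ∧ B ⊆ H} =>
      ⨆ B ∈ t, MeasurableSpace.comap (fun ω => (P ω ∩ B.1).ncard) ⊤ := fun H => by
    classical
    refine Monotone.directed_le fun s t hst => ?_
    exact biSup_mono fun B hB => hst hB
  have hle : ∀ (H : Set (Space d)) (t : Finset {B : Set (Space d) //
      MeasurableSet B ∧ Bornology.IsBounded B ∧ B ⊆ H}),
      (⨆ B ∈ t, MeasurableSpace.comap (fun ω => (P ω ∩ B.1).ncard) ⊤) ≤ mΩ := fun H t =>
    iSup₂_le fun B _ => (hP.measurable_count B B.2.1 B.2.2.1).comap_le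
  have hfin : ∀ (H : Set (Space d)) (t : Finset {B : Set (Space d) //
      MeasurableSet B ∧ Bornology.IsBounded B ∧ B ⊆ H}),
      (⨆ B ∈ t, MeasurableSpace.comap (fun ω => (P ω ∩ B.1).ncard) ⊤) =
      ⨆ i : Fin t.card, MeasurableSpace.comap
        (fun ω => (P ω ∩ (t.equivFin.symm i : {B : Set (Space d) //
          MeasurableSet B ∧ Bornology.IsBounded B ∧ B ⊆ H}).1).ncard) ⊤ := fun H t => by
    rw [iSup_subtype', ← t.equivFin.symm.iSup_comp]
  rw [countSigma_eq_iSup_finset, countSigma_eq_iSup_finset]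
  -- Independence passes to the directed union in one argument and then in the other.
  refine indep_iSup_of_directed_le (fun t => ?_) (hle H) (iSup_le (hle H')) (hdir H)
  refine (indep_iSup_of_directed_le (fun t' => ?_) (hle H') (hle H t) (hdir H')).symm
  rw [hfin, hfin]
  refine hP.indep_finite (fun i => (t'.equivFin.symm i).1.2.1) (fun i => (t.equivFin.symm i).1.2.1)
    (fun i => (t'.equivFin.symm i).1.2.2.1) (fun i => (t.equivFin.symm i).1.2.2.1) ?_
  exact hd.symm.mono (Set.iUnion_subset fun i => (t'.equivFin.symm i).1.2.2.2)
    (Set.iUnion_subset fun i => (t.equivFin.symm i).1.2.2.2)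

/-- Two independent variables evaluated at one outcome have the same joint law as when evaluated at
two independent outcomes. -/
lemma integral_of_indepFun {α β : Type*} [MeasurableSpace α] [MeasurableSpace β] {X : Ω → α}
    {Y : Ω → β} (hX : Measurable X) (hY : Measurable Y) (hI : IndepFun X Y μ) {f : α × β → ℝ}
    (hf : Measurable f) :
    (Integrable (fun ω => f (X ω, Y ω)) μ ↔ Integrable (fun p : Ω × Ω => f (X p.1, Y p.2)) (μ.prod μ))
      ∧ ∫ ω, f (X ω, Y ω) ∂μ = ∫ p : Ω × Ω, f (X p.1, Y p.2) ∂(μ.prod μ) := by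
  have h := (indepFun_iff_map_prod_eq_prod_map_map hX.aemeasurable hY.aemeasurable).1 hI
  rw [Measure.map_prod_map _ _ hX hY] at h
  have hXY : Measurable (Prod.map X Y) := hX.prodMap hY
  constructor
  · rw [← comp_def f, ← integrable_map_measure hf.aestronglyMeasurable
      (hX.prodMk hY).aemeasurable, h,
      integrable_map_measure hf.aestronglyMeasurable hXY.aemeasurable]
    rfl
  · rw [← integral_map (f := f) (hX.prodMk hY).aemeasurable hf.aestronglyMeasurable, h,
      integral_map hXY.aemeasurable hf.aestronglyMeasurable]
    rfl

/-- Integration against independent `σ`-fields. -/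
lemma integral_diag_of_indep {m₁ m₂ : MeasurableSpace Ω} (h₁ : m₁ ≤ mΩ) (h₂ : m₂ ≤ mΩ)
    (hI : @Indep Ω m₁ m₂ mΩ μ) {f : Ω × Ω → ℝ} (hf : Measurable[m₁.prod m₂] f) :
    (@Integrable _ _ _ _ mΩ (fun ω => f (ω, ω)) μ ↔
      @Integrable _ _ _ _ (mΩ.prod mΩ) f (@Measure.prod Ω Ω mΩ mΩ μ μ)) ∧
      @integral _ _ _ _ mΩ μ (fun ω => f (ω, ω)) =
        @integral _ _ _ _ (mΩ.prod mΩ) (@Measure.prod Ω Ω mΩ mΩ μ μ) f := by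
  refine @integral_of_indepFun Ω mΩ μ _ Ω Ω m₁ m₂ id id (measurable_id'' h₁) (measurable_id'' h₂)
    ?_ f hf
  rw [@IndepFun_iff_Indep]
  rwa [MeasurableSpace.comap_id, MeasurableSpace.comap_id]

/-- Splicing the configurations of two outcomes along a set `H`. -/
def splice (P : Ω → Set (Space d)) (B H : Set (Space d)) (p : Ω × Ω) : Set (Space d) :=
  (P p.1 ∩ (B ∩ H)) ∪ (P p.2 ∩ (B ∩ Hᶜ))

lemma splice_diag (B H : Set (Space d)) (ω : Ω) : splice P B H (ω, ω) = P ω ∩ B := by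
  rw [splice, ← Set.inter_union_distrib_left, Set.inter_union_compl]

/-- The counts of the splice are a count inside `H` at the first outcome plus a count outside at the
second. Measurability for the product of these two σ-fields is what `integral_diag_of_indep` needs
in order to merge the outcomes. -/
lemma IsPoissonProcess.measurable_splice (hP : IsPoissonProcess P lam μ) {B H : Set (Space d)}
    (hB : MeasurableSet B) (hb : Bornology.IsBounded B) (hH : MeasurableSet H)
    {β : Type*} [MeasurableSpace β] {G : Set (Space d) → β} (hG : ConfMeasurable G) :
    Measurable[(countSigma P H).prod (countSigma P Hᶜ)] fun p : Ω × Ω => G (splice P B H p) := by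
  have hfin : ∀ p, (splice P B H p).Finite := fun p =>
    (hP.locallyFinite _ _ (hb.subset inter_subset_left)).union
      (hP.locallyFinite _ _ (hb.subset inter_subset_left))
  refine @ConfMeasurable.comp_of_counts (Space d) _ _ _ (Ω × Ω)
    ((countSigma P H).prod (countSigma P Hᶜ)) (splice P B H) β _ G hG hfin fun C hC => ?_
  have h : ∀ p, (splice P B H p ∩ C).ncard = (P p.1 ∩ (B ∩ H ∩ C)).ncard +
      (P p.2 ∩ (B ∩ Hᶜ ∩ C)).ncard := fun p => by
    rw [splice, Set.union_inter_distrib_right, inter_assoc (P p.1), inter_assoc (P p.2)]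
    refine Set.ncard_union_eq ?_ ?_ ?_
    · refine disjoint_left.2 fun x hx hx' => hx'.2.1.2 hx.2.1.2
    · exact hP.locallyFinite _ _ (hb.subset fun x hx => hx.1.1)
    · exact hP.locallyFinite _ _ (hb.subset fun x hx => hx.1.1)
  simp_rw [h]
  refine @Measurable.add _ _ _ _ ((countSigma P H).prod (countSigma P Hᶜ)) _ _ _ ?_ ?_
  · exact (measurable_count_countSigma ((hB.inter hH).inter hC) (hb.subset fun x hx => hx.1.1)
      fun x hx => hx.1.2).comp (@measurable_fst _ _ (countSigma P H) (countSigma P Hᶜ))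
  · exact (measurable_count_countSigma ((hB.inter hH.compl).inter hC)
      (hb.subset fun x hx => hx.1.1)
      fun x hx => hx.1.2).comp (@measurable_snd _ _ (countSigma P H) (countSigma P Hᶜ))

lemma IsPoissonProcess.integrable_splice (hP : IsPoissonProcess P lam μ) {B H : Set (Space d)}
    (hB : MeasurableSet B) (hb : Bornology.IsBounded B) (hH : MeasurableSet H)
    {G : Set (Space d) → ℝ} (hG : ConfMeasurable G) (hi : Integrable (fun ω => G (P ω ∩ B)) μ) :
    Integrable (fun p : Ω × Ω => G (splice P B H p)) (μ.prod μ) := by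
  have h := (integral_diag_of_indep (hP.countSigma_le H) (hP.countSigma_le Hᶜ)
    (hP.indep_countSigma disjoint_compl_right) (hP.measurable_splice hB hb hH hG)).1
  simp only [splice_diag] at h
  exact h.1 hi

/-- Conditioning a functional of a Poisson process on its restriction to `H` amounts to averaging
over an independent copy outside `H`. -/
lemma IsPoissonProcess.condExp_eq (hP : IsPoissonProcess P lam μ) {B H : Set (Space d)}
    (hB : MeasurableSet B) (hb : Bornology.IsBounded B) (hH : MeasurableSet H)
    {G : Set (Space d) → ℝ} (hG : ConfMeasurable G) (hi : Integrable (fun ω => G (P ω ∩ B)) μ) :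
    (fun ω => ∫ ω', G (splice P B H (ω, ω')) ∂μ) =ᵐ[μ]
      μ[fun ω => G (P ω ∩ B) | countSigma P H] := by
  have hle := hP.countSigma_le H
  have hle' := hP.countSigma_le Hᶜ
  have hI := hP.indep_countSigma (H := H) (H' := Hᶜ) disjoint_compl_right
  have hm := hP.measurable_splice hB hb hH hG
  have hIn := hP.integrable_splice hB hb hH hG hi
  refine ae_eq_condExp_of_forall_setIntegral_eq hle hi ?_ ?_ ?_
  · intro s _ _
    exact hIn.integral_prod_left.integrableOn
  · intro s hs _
    have hms : Measurable[(countSigma P H).prod (countSigma P Hᶜ)]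
        ((Prod.fst ⁻¹' s).indicator fun p : Ω × Ω => G (splice P B H p)) :=
      hm.indicator (@measurable_fst _ _ (countSigma P H) (countSigma P Hᶜ) _ hs)
    have h := (integral_diag_of_indep hle hle' hI hms).2
    have h1 : ∫ ω in s, G (P ω ∩ B) ∂μ =
        ∫ ω, (Prod.fst ⁻¹' s).indicator (fun p : Ω × Ω => G (splice P B H p)) (ω, ω) ∂μ := by
      rw [← integral_indicator (hle s hs)]
      refine integral_congr_ae (ae_of_all _ fun ω => ?_)
      by_cases hω : ω ∈ s <;> simp [hω, splice_diag]
    rw [h1, h, integral_prod _ (hIn.indicator (measurable_fst (hle s hs))),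
      ← integral_indicator (hle s hs)]
    refine integral_congr_ae (ae_of_all _ fun ω => ?_)
    by_cases hω : ω ∈ s <;> simp [hω, Set.indicator]
  -- Integrating against `μ` trimmed to `countSigma P Hᶜ` makes the parameter integral measurable
  -- for `countSigma P H`.
  · have : StronglyMeasurable[countSigma P H] fun ω => ∫ ω', G (splice P B H (ω, ω')) ∂μ := by
      have h := @StronglyMeasurable.integral_prod_right Ω Ω ℝ (countSigma P H) (countSigma P Hᶜ)
        (μ.trim hle') _ _ _ (fun ω ω' => G (splice P B H (ω, ω'))) hm.stronglyMeasurable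
      convert h using 2 with ω
      rw [← integral_trim hle']
      exact (hm.comp (@measurable_prodMk_left Ω Ω (countSigma P H) (countSigma P Hᶜ) ω)).stronglyMeasurable
    exact this.aestronglyMeasurable

/-- The covariance of conditional expectations, through a spliced copy of the process. -/
lemma IsPoissonProcess.integral_condExp_mul_condExp (hP : IsPoissonProcess P lam μ)
    {B H : Set (Space d)} (hB : MeasurableSet B) (hb : Bornology.IsBounded B)
    (hH : MeasurableSet H) {F G : Set (Space d) → ℝ}
    (hG : ConfMeasurable G) (hFi : MemLp (fun ω => F (P ω ∩ B)) 2 μ)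
    (hGi : MemLp (fun ω => G (P ω ∩ B)) 2 μ) :
    ∫ ω, (∫ ω', F (P ω ∩ B) * G (splice P B H (ω, ω')) ∂μ) ∂μ =
      ∫ ω, (μ[fun ω => F (P ω ∩ B) | countSigma P H]) ω *
        (μ[fun ω => G (P ω ∩ B) | countSigma P H]) ω ∂μ := by
  have hle := hP.countSigma_le H
  have h1 : ∫ ω, (∫ ω', F (P ω ∩ B) * G (splice P B H (ω, ω')) ∂μ) ∂μ =
      ∫ ω, F (P ω ∩ B) * (μ[fun ω => G (P ω ∩ B) | countSigma P H]) ω ∂μ := by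
    refine integral_congr_ae ?_
    filter_upwards [hP.condExp_eq hB hb hH hG (hGi.integrable one_le_two)] with ω hω
    rw [← hω, integral_const_mul]
  have hcG : MemLp (μ[fun ω => G (P ω ∩ B) | countSigma P H]) 2 μ := hGi.condExp one_le_two
  have hprod : Integrable ((fun ω => F (P ω ∩ B)) * (μ[fun ω => G (P ω ∩ B) | countSigma P H])) μ :=
    hFi.integrable_mul hcG
  have h2 := condExp_mul_of_stronglyMeasurable_right (μ := μ) (m := countSigma P H)
    (f := fun ω => F (P ω ∩ B)) (g := μ[fun ω => G (P ω ∩ B) | countSigma P H])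
    stronglyMeasurable_condExp hprod (hFi.integrable one_le_two)
  rw [h1]
  change ∫ ω, ((fun ω => F (P ω ∩ B)) * (μ[fun ω => G (P ω ∩ B) | countSigma P H])) ω ∂μ = _
  rw [← integral_condExp hle]
  exact integral_congr_ae h2

end HalfSpace

/-! ### Covariance identity and the Efron–Stein inequality -/

section EfronStein

lemma integral_comp_of_measurePreserving {α β V : Type*} [MeasurableSpace α] [MeasurableSpace β]
    [NormedAddCommGroup V] [NormedSpace ℝ V] {μ : Measure α} {ν : Measure β} {g : α → β}
    (hg : MeasurePreserving g μ ν) {f : β → V} (hf : StronglyMeasurable f) :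
    ∫ a, f (g a) ∂μ = ∫ b, f b ∂ν := by
  rw [← hg.map_eq, integral_map hg.measurable.aemeasurable hf.aestronglyMeasurable]

variable {E : Type*} [MeasurableSpace E] {n : ℕ}

/-- The sample that takes the second component of the pairs with label in `S`. -/
def sel (S : Finset (Fin n)) (z : Fin n → E × E) : Fin n → E :=
  fun k => if k ∈ S then (z k).2 else (z k).1

/-- Exchange the components of the pairs with label in `S`. -/
def swapAt (S : Finset (Fin n)) (z : Fin n → E × E) : Fin n → E × E :=
  fun k => if k ∈ S then (z k).swap else z k

/-- Swapping preserves the law of the pairs, so an identity in law of selected samples becomes a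
computation with symmetric differences of label sets. -/
lemma sel_swapAt (S T : Finset (Fin n)) (z : Fin n → E × E) :
    sel S (swapAt T z) = sel (symmDiff S T) z := by
  funext k
  by_cases h1 : k ∈ S <;> by_cases h2 : k ∈ T <;> simp [sel, swapAt, h1, h2, Finset.mem_symmDiff]

@[fun_prop]
lemma measurable_sel (S : Finset (Fin n)) : Measurable (sel (E := E) S) := by
  refine measurable_pi_lambda _ fun k => ?_
  by_cases h : k ∈ S
  · simp only [sel, h, if_true]; fun_prop
  · simp only [sel, h, if_false]; fun_prop

/-- The law of `n` independent points. -/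
noncomputable abbrev iid (n : ℕ) (π : Measure E) : Measure (Fin n → E) :=
  infinitePi fun _ : Fin n => π

/-- The law of a point and `n` further points, all independent. -/
noncomputable abbrev rooted (n : ℕ) (π : Measure E) := π.prod (iid n π)

variable (π : Measure E) [IsProbabilityMeasure π]

lemma measurePreserving_swapAt (S : Finset (Fin n)) :
    MeasurePreserving (swapAt (E := E) S) (iid n (π.prod π)) (iid n (π.prod π)) := by
  have hm : ∀ k : Fin n, Measurable fun x : E × E => if k ∈ S then x.swap else x := fun k => by
    split_ifs <;> fun_prop
  refine ⟨measurable_pi_lambda _ fun k => (hm k).comp (measurable_pi_apply k), ?_⟩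
  have h := Measure.infinitePi_map_pi (fun _ : Fin n => π.prod π)
    (f := fun k x => if k ∈ S then x.swap else x) hm
  refine h.trans ?_
  congr 1
  funext k
  split_ifs
  · exact Measure.prod_swap
  · exact Measure.map_id

lemma measurePreserving_sel (S : Finset (Fin n)) :
    MeasurePreserving (sel (E := E) S) (iid n (π.prod π)) (iid n π) := by
  have hm : ∀ k : Fin n, Measurable fun x : E × E => if k ∈ S then x.2 else x.1 := fun k => by
    split_ifs <;> fun_prop
  refine ⟨measurable_sel S, ?_⟩
  have h := Measure.infinitePi_map_pi (fun _ : Fin n => π.prod π)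
    (f := fun k x => if k ∈ S then x.2 else x.1) hm
  refine h.trans ?_
  congr 1
  funext k
  split_ifs
  · exact measurePreserving_snd.map_eq
  · exact measurePreserving_fst.map_eq

lemma measurePreserving_sel_prodMk :
    MeasurePreserving (fun z : Fin n → E × E => (sel ∅ z, sel univ z))
      (iid n (π.prod π)) ((iid n π).prod (iid n π)) := by
  have h := measurePreserving_arrowProdEquivProdArrow E E (Fin n) (fun _ => π) (fun _ => π)
  simp only [iid, infinitePi_eq_pi]
  convert h using 1
  funext z
  refine Prod.ext (funext fun k => ?_) (funext fun k => ?_) <;>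
    simp [sel, MeasurableEquiv.arrowProdEquivProdArrow, Equiv.arrowProdEquivProdArrow]

variable {π}
variable {V : Type*} [NormedAddCommGroup V] [NormedSpace ℝ V] [CompleteSpace V]

/-- The labels from `l` on. -/
def upFrom (n l : ℕ) : Finset (Fin n) := univ.filter fun k => l ≤ (k : ℕ)

lemma symmDiff_upFrom (l : Fin n) : symmDiff (upFrom n (l + 1)) {l} = upFrom n l := by
  ext k
  have h : k = l ↔ (k : ℕ) = l := Fin.ext_iff
  simp only [upFrom, Finset.mem_symmDiff, mem_filter, mem_univ, true_and, Finset.mem_singleton, h]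
  omega

lemma symmDiff_upFrom' (l : Fin n) : symmDiff (upFrom n l) {l} = upFrom n (l + 1) := by
  rw [← symmDiff_upFrom, symmDiff_assoc, symmDiff_self, symmDiff_bot]

/-- A covariance as a sum over the labels of products of increments. -/
lemma integral_smul_sub_eq_sum {Φ : (Fin n → E) → ℝ} {Ψ : (Fin n → E) → V}
    (hΦ : Measurable Φ) (hΨ : StronglyMeasurable Ψ) {M M' : ℝ} (hM : ∀ u, |Φ u| ≤ M)
    (hM' : ∀ u, ‖Ψ u‖ ≤ M') :
    ∫ u, Φ u • Ψ u ∂(iid n π) - (∫ u, Φ u ∂(iid n π)) • ∫ u, Ψ u ∂(iid n π) =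
      (1 / 2 : ℝ) • ∑ l : Fin n, ∫ z, (Φ (sel (upFrom n (l + 1)) z) - Φ (sel (upFrom n l) z)) •
        (Ψ (sel ∅ z) - Ψ (sel {l} z)) ∂(iid n (π.prod π)) := by
  have hi : ∀ S T : Finset (Fin n), Integrable (fun z => Φ (sel S z) • Ψ (sel T z))
      (iid n (π.prod π)) := fun S T => by
    refine Integrable.of_bound ((hΦ.comp (measurable_sel S)).stronglyMeasurable.smul
      (hΨ.comp_measurable (measurable_sel T))).aestronglyMeasurable (M * M') (ae_of_all _ fun z => ?_)
    rw [norm_smul]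
    exact mul_le_mul (hM _) (hM' _) (norm_nonneg _) ((abs_nonneg _).trans (hM (sel S z)))
  have h0 : ∫ u, Φ u • Ψ u ∂(iid n π) = ∫ z, Φ (sel ∅ z) • Ψ (sel ∅ z) ∂(iid n (π.prod π)) :=
    (integral_comp_of_measurePreserving (measurePreserving_sel π ∅)
      (hΦ.stronglyMeasurable.smul hΨ)).symm
  -- `sel univ z` and `sel ∅ z` are independent samples, so the product of the means is one integral
  -- over the pairs.
  have h1 : (∫ u, Φ u ∂(iid n π)) • ∫ u, Ψ u ∂(iid n π) =
      ∫ z, Φ (sel univ z) • Ψ (sel ∅ z) ∂(iid n (π.prod π)) := by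
    have hs : StronglyMeasurable fun p : (Fin n → E) × (Fin n → E) => Φ p.2 • Ψ p.1 :=
      (hΦ.comp measurable_snd).stronglyMeasurable.smul (hΨ.comp_measurable measurable_fst)
    have e1 := integral_map (μ := iid n (π.prod π))
      (measurePreserving_sel_prodMk (n := n) π).measurable.aemeasurable
      (f := fun p : (Fin n → E) × (Fin n → E) => Φ p.2 • Ψ p.1) hs.aestronglyMeasurable
    rw [(measurePreserving_sel_prodMk π).map_eq] at e1
    rw [← e1, integral_prod_symm]
    · simp only
      simp_rw [integral_smul]
      rw [integral_smul_const]
    · refine Integrable.of_bound hs.aestronglyMeasurable (M * M') (ae_of_all _ fun z => ?_)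
      rw [norm_smul]
      exact mul_le_mul (hM _) (hM' _) (norm_nonneg _) ((abs_nonneg _).trans (hM z.2))
  -- Interpolation between the two samples: `upFrom n 0` consists of all labels and `upFrom n n` of
  -- none.
  have htel : ∀ z : Fin n → E × E, Φ (sel ∅ z) - Φ (sel univ z) =
      ∑ l : Fin n, (Φ (sel (upFrom n (l + 1)) z) - Φ (sel (upFrom n l) z)) := fun z => by
    rw [Fin.sum_univ_eq_sum_range (fun l => Φ (sel (upFrom n (l + 1)) z) - Φ (sel (upFrom n l) z)) n,
      Finset.sum_range_sub (fun l => Φ (sel (upFrom n l) z))]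
    congr 3
    · ext k; simp [upFrom]
    · ext k; simp [upFrom]
  have h2 : ∫ u, Φ u • Ψ u ∂(iid n π) - (∫ u, Φ u ∂(iid n π)) • ∫ u, Ψ u ∂(iid n π) =
      ∑ l : Fin n, ∫ z, (Φ (sel (upFrom n (l + 1)) z) - Φ (sel (upFrom n l) z)) • Ψ (sel ∅ z)
        ∂(iid n (π.prod π)) := by
    rw [h0, h1, ← integral_sub (hi _ _) (hi _ _), ← integral_finsetSum]
    · refine integral_congr_ae (ae_of_all _ fun z => ?_)
      simp only
      rw [← sub_smul, htel, Finset.sum_smul]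
    · intro l _
      simp only [sub_smul]
      exact (hi _ _).sub (hi _ _)
  rw [h2, Finset.smul_sum]
  refine sum_congr rfl fun l _ => ?_
  set I : V := ∫ z, (Φ (sel (upFrom n (l + 1)) z) - Φ (sel (upFrom n l) z)) • Ψ (sel ∅ z)
        ∂(iid n (π.prod π)) with hI
  -- Swapping the pair `l` exchanges the two interpolated samples, which reverses the sign, and
  -- turns `sel {l}` into `sel ∅`. Antisymmetrizing thus replaces `Ψ` by half its resampling
  -- increment.
  have h3 : ∫ z, (Φ (sel (upFrom n (l + 1)) z) - Φ (sel (upFrom n l) z)) • Ψ (sel {l} z)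
        ∂(iid n (π.prod π)) = - I := by
    have hmp := measurePreserving_swapAt (n := n) π {l}
    have hsm : StronglyMeasurable fun z : Fin n → E × E =>
        (Φ (sel (upFrom n (l + 1)) z) - Φ (sel (upFrom n l) z)) • Ψ (sel {l} z) :=
      ((hΦ.comp (measurable_sel _)).sub (hΦ.comp (measurable_sel _))).stronglyMeasurable.smul
        (hΨ.comp_measurable (measurable_sel _))
    have e := integral_map (μ := iid n (π.prod π)) hmp.measurable.aemeasurable
      hsm.aestronglyMeasurable
    rw [hmp.map_eq] at e
    rw [e, hI, ← integral_neg]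
    refine integral_congr_ae (ae_of_all _ fun z => ?_)
    simp only [sel_swapAt, symmDiff_upFrom, symmDiff_upFrom', symmDiff_self]
    rw [← neg_smul, neg_sub]
    rfl
  have h4 : ∫ z, (Φ (sel (upFrom n (l + 1)) z) - Φ (sel (upFrom n l) z)) •
        (Ψ (sel ∅ z) - Ψ (sel {l} z)) ∂(iid n (π.prod π)) = I - (-I) := by
    rw [← h3, hI, ← integral_sub]
    · simp only [smul_sub]
    · simp only [sub_smul]; exact (hi _ _).sub (hi _ _)
    · simp only [sub_smul]; exact (hi _ _).sub (hi _ _)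
  rw [h4, sub_neg_eq_add, ← two_smul ℝ I, smul_smul]
  norm_num

lemma sel_upFrom_swapAt (l : Fin n) (z : Fin n → E × E) :
    sel ∅ (swapAt (upFrom n (l + 1)) z) = sel (upFrom n (l + 1)) z ∧
      sel {l} (swapAt (upFrom n (l + 1)) z) = sel (upFrom n l) z := by
  constructor
  · rw [sel_swapAt]; congr 1; exact bot_symmDiff _
  · rw [sel_swapAt, symmDiff_comm, symmDiff_upFrom]

/-- The increments along the interpolation have the same law as the resampling increments. -/
lemma integral_increment_eq {Φ : (Fin n → E) → ℝ} (hΦ : Measurable Φ) {f : ℝ → ℝ}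
    (hf : Measurable f) (l : Fin n) :
    ∫ z, f (Φ (sel (upFrom n (l + 1)) z) - Φ (sel (upFrom n l) z)) ∂(iid n (π.prod π)) =
      ∫ z, f (Φ (sel ∅ z) - Φ (sel {l} z)) ∂(iid n (π.prod π)) := by
  have hmp := measurePreserving_swapAt (n := n) π (upFrom n (l + 1))
  have hm : Measurable fun z : Fin n → E × E => f (Φ (sel ∅ z) - Φ (sel {l} z)) :=
    hf.comp ((hΦ.comp (measurable_sel _)).sub (hΦ.comp (measurable_sel _)))
  have e := integral_map (μ := iid n (π.prod π)) hmp.measurable.aemeasurable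
    hm.aestronglyMeasurable
  rw [hmp.map_eq] at e
  rw [e]
  simp only [sel_upFrom_swapAt]

/-- The Efron–Stein inequality for bounded functions. -/
lemma efronStein {Φ : (Fin n → E) → ℝ} (hΦ : Measurable Φ) {M : ℝ} (hM : ∀ u, |Φ u| ≤ M) :
    Var[Φ; iid n π] ≤
      (1 / 2 : ℝ) * ∑ l : Fin n, ∫ z, (Φ (sel ∅ z) - Φ (sel {l} z)) ^ 2 ∂(iid n (π.prod π)) := by
  have hmem : MemLp Φ 2 (iid n π) :=
    MemLp.of_bound hΦ.aestronglyMeasurable M (ae_of_all _ hM)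
  rw [variance_eq_sub hmem]
  have h := integral_smul_sub_eq_sum (π := π) hΦ hΦ.stronglyMeasurable hM hM
  simp only [smul_eq_mul] at h
  simp only [Pi.pow_apply, pow_two] at h ⊢
  rw [h]
  refine mul_le_mul_of_nonneg_left (sum_le_sum fun l _ => ?_) (by norm_num)
  have e := integral_increment_eq (π := π) hΦ (f := fun x => x * x) (by fun_prop) l
  have hb : ∀ S T : Finset (Fin n), ∀ S' T' : Finset (Fin n), Integrable (fun z =>
      (Φ (sel S z) - Φ (sel T z)) * (Φ (sel S' z) - Φ (sel T' z))) (iid n (π.prod π)) := fun S T S' T' => by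
    refine Integrable.of_bound (by fun_prop) ((M + M) * (M + M)) (ae_of_all _ fun z => ?_)
    rw [norm_mul]
    have hM0 : 0 ≤ M := (abs_nonneg _).trans (hM (sel S z))
    have h1 : ∀ a b, ‖Φ a - Φ b‖ ≤ M + M := fun a b =>
      (norm_sub_le _ _).trans (add_le_add (hM a) (hM b))
    exact mul_le_mul (h1 _ _) (h1 _ _) (norm_nonneg _) (by positivity)
  -- `x y ≤ (x² + y²) / 2`, where both increments have the same second moment.
  calc ∫ z, (Φ (sel (upFrom n (l + 1)) z) - Φ (sel (upFrom n l) z)) *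
        (Φ (sel ∅ z) - Φ (sel {l} z)) ∂(iid n (π.prod π))
      ≤ ∫ z, ((1 / 2 : ℝ) * ((Φ (sel (upFrom n (l + 1)) z) - Φ (sel (upFrom n l) z)) *
          (Φ (sel (upFrom n (l + 1)) z) - Φ (sel (upFrom n l) z))) + (1 / 2 : ℝ) *
          ((Φ (sel ∅ z) - Φ (sel {l} z)) * (Φ (sel ∅ z) - Φ (sel {l} z)))) ∂(iid n (π.prod π)) := by
        refine integral_mono (hb _ _ _ _) (((hb _ _ _ _).const_mul _).add ((hb _ _ _ _).const_mul _))
          fun z => ?_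
        simp only
        nlinarith [sq_nonneg ((Φ (sel (upFrom n (l + 1)) z) - Φ (sel (upFrom n l) z)) -
          (Φ (sel ∅ z) - Φ (sel {l} z)))]
    _ = ∫ z, (Φ (sel ∅ z) - Φ (sel {l} z)) * (Φ (sel ∅ z) - Φ (sel {l} z)) ∂(iid n (π.prod π)) := by
        rw [integral_add ((hb _ _ _ _).const_mul _) ((hb _ _ _ _).const_mul _), integral_const_mul,
          integral_const_mul, e]
        ring

end EfronStein

/-! ### Normal approximation of a bounded function of independent points -/

section CharFun

/-- The Taylor bound for `|y| ≤ 1`; for larger `y` the trivial bound `2 + |y|` is at most `3 y²`. -/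
lemma norm_exp_mul_I_sub_one_sub_le (y : ℝ) : ‖Complex.exp (y * I) - 1 - y * I‖ ≤ 3 * y ^ 2 := by
  have hn : ‖(y : ℂ) * I‖ = |y| := by simp
  rcases le_or_gt |y| 1 with h | h
  · refine (Complex.norm_exp_sub_one_sub_id_le (by rwa [hn])).trans ?_
    rw [hn, sq_abs]
    nlinarith [sq_nonneg y]
  · have h1 : ‖Complex.exp (y * I) - 1 - y * I‖ ≤ 1 + 1 + |y| := by
      refine (norm_sub_le _ _).trans (add_le_add ((norm_sub_le _ _).trans ?_) hn.le)
      rw [norm_exp_ofReal_mul_I, norm_one]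
    rw [← sq_abs y]
    nlinarith

variable {E : Type*} [MeasurableSpace E] {n : ℕ} {π : Measure E} [IsProbabilityMeasure π]

/-- Half the sum over labels of the products of an interpolation and a resampling increment. -/
noncomputable def quad (L : Fin n → (Fin n → E) → ℝ) (z : Fin n → E × E) : ℝ :=
  (1 / 2 : ℝ) * ∑ l : Fin n, (L l (sel (upFrom n (l + 1)) z) - L l (sel (upFrom n l) z)) *
    (L l (sel ∅ z) - L l (sel {l} z))

lemma measurable_quad {L : Fin n → (Fin n → E) → ℝ} (hL : ∀ l, Measurable (L l)) :
    Measurable (quad L) := by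
  unfold quad
  refine Measurable.const_mul (Finset.measurable_fun_sum _ fun l _ => ?_) _
  have := hL l
  fun_prop

lemma hasDerivAt_integral_exp {α : Type*} [MeasurableSpace α] {μ : Measure α}
    [IsProbabilityMeasure μ] {Φ : α → ℝ} (hΦ : Measurable Φ) {M : ℝ} (hM : ∀ u, |Φ u| ≤ M)
    (θ : ℝ) :
    HasDerivAt (fun θ : ℝ => ∫ u, Complex.exp ((θ * Φ u : ℝ) * I) ∂μ)
      (∫ u, Φ u • (I * Complex.exp ((θ * Φ u : ℝ) * I)) ∂μ) θ := by
  refine (hasDerivAt_integral_of_dominated_loc_of_deriv_le (bound := fun _ => M) (μ := μ)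
    (F := fun (θ : ℝ) u => Complex.exp ((θ * Φ u : ℝ) * I))
    (F' := fun (θ : ℝ) u => Φ u • (I * Complex.exp ((θ * Φ u : ℝ) * I)))
    (s := Set.univ) Filter.univ_mem (Eventually.of_forall fun x => ?_) ?_ ?_ ?_ ?_ ?_).2
  · fun_prop
  · refine Integrable.of_bound (by fun_prop) 1 (ae_of_all _ fun u => ?_)
    rw [norm_exp_ofReal_mul_I]
  · fun_prop
  · refine ae_of_all _ fun u x _ => ?_
    rw [norm_smul, norm_mul, norm_exp_ofReal_mul_I, norm_I]
    simpa using hM u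
  · exact integrable_const _
  · refine ae_of_all _ fun u x _ => ?_
    have h1 : HasDerivAt (fun x : ℝ => ((x * Φ u : ℝ) : ℂ) * I) ((Φ u : ℂ) * I) x := by
      have : HasDerivAt (fun x : ℝ => x * Φ u) (Φ u) x := by
        simpa using (hasDerivAt_id x).mul_const (Φ u)
      exact this.ofReal_comp.mul_const I
    refine h1.cexp.congr_deriv ?_
    rw [real_smul]; ring

/-- The derivative of the characteristic function is the covariance of `Φ` with `i exp (iθΦ)`, as
`Φ` is centred. The covariance identity brings in the resampling increments of the exponential.
Their first order expansion produces `-θ` times the mean of `quad` against the exponential, with an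
error controlled by third moments; replacing `quad` by the constant `v` costs `ε`. -/
lemma norm_deriv_charFun_le {Φ : (Fin n → E) → ℝ} (hΦ : Measurable Φ) {M : ℝ}
    (hM : ∀ u, |Φ u| ≤ M) (h0 : ∫ u, Φ u ∂(iid n π) = 0) {v ε η : ℝ}
    (hε : ∫ z, |quad (fun _ => Φ) z - v| ∂(iid n (π.prod π)) ≤ ε)
    (hη : ∑ l : Fin n, ∫ z, |Φ (sel ∅ z) - Φ (sel {l} z)| ^ 3 ∂(iid n (π.prod π)) ≤ η)
    {θ : ℝ} (hθ : 0 ≤ θ) (hθ1 : θ ≤ 1) :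
    ‖∫ u, Φ u • (I * Complex.exp ((θ * Φ u : ℝ) * I)) ∂(iid n π) +
      θ * v * ∫ u, Complex.exp ((θ * Φ u : ℝ) * I) ∂(iid n π)‖ ≤ ε + 2 * η := by
  set Q := iid n (π.prod π) with hQ
  set e : (Fin n → E) → ℂ := fun u => Complex.exp ((θ * Φ u : ℝ) * I) with he
  have hem : Measurable e := by fun_prop
  have hen : ∀ u, ‖e u‖ = 1 := fun u => norm_exp_ofReal_mul_I _
  set D : Fin n → (Fin n → E × E) → ℝ := fun l z =>
    Φ (sel (upFrom n (l + 1)) z) - Φ (sel (upFrom n l) z) with hIdef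
  set J : Fin n → (Fin n → E × E) → ℝ := fun l z => Φ (sel ∅ z) - Φ (sel {l} z) with hJdef
  have hIm : ∀ l, Measurable (D l) := fun l => by simp only [hIdef]; fun_prop
  have hJm : ∀ l, Measurable (J l) := fun l => by simp only [hJdef]; fun_prop
  have hIb : ∀ l z, |D l z| ≤ M + M := fun l z =>
    (abs_sub _ _).trans (add_le_add (hM _) (hM _))
  have hJb : ∀ l z, |J l z| ≤ M + M := fun l z =>
    (abs_sub _ _).trans (add_le_add (hM _) (hM _))
  have hid := integral_smul_sub_eq_sum (π := π) (n := n) hΦ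
    (Ψ := fun u => I * e u) (by fun_prop) hM (M' := 1)
    (fun u => by rw [norm_mul, hen, norm_I, mul_one])
  rw [h0, zero_smul, sub_zero] at hid
  have hqb : ∀ z, |quad (fun _ => Φ) z| ≤ (1 / 2 : ℝ) * ∑ _l : Fin n, (M + M) * (M + M) := fun z => by
    rw [quad, abs_mul, abs_of_nonneg (by norm_num : (0 : ℝ) ≤ 1 / 2)]
    refine mul_le_mul_of_nonneg_left ((abs_sum_le_sum_abs _ _).trans
      (sum_le_sum fun l _ => ?_)) (by norm_num)
    rw [abs_mul]
    exact mul_le_mul (hIb l z) (hJb l z) (abs_nonneg _) ((abs_nonneg _).trans (hIb l z))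
  have hqm : Measurable (quad fun _ : Fin n => Φ) := measurable_quad fun _ => hΦ
  have hqi : Integrable (fun z => (quad (fun _ => Φ) z : ℂ) * e (sel ∅ z)) Q := by
    refine Integrable.of_bound (by fun_prop) ((1 / 2 : ℝ) * ∑ _l : Fin n, (M + M) * (M + M))
      (ae_of_all _ fun z => ?_)
    rw [norm_mul, hen, mul_one, norm_real]
    exact hqb z
  have hei : Integrable (fun z => e (sel ∅ z)) Q :=
    Integrable.of_bound (hem.comp (measurable_sel _)).aestronglyMeasurable 1
      (ae_of_all _ fun z => (hen _).le)
  have heq : ∫ u, e u ∂(iid n π) = ∫ z, e (sel ∅ z) ∂Q :=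
    (integral_comp_of_measurePreserving (measurePreserving_sel π ∅) hem.stronglyMeasurable).symm
  have hab3 : ∀ l, Integrable (fun z => |J l z| ^ 3) Q := fun l =>
    integrable_pow_of_abs_le (hJm l).abs (fun z => (abs_abs _).trans_le (hJb l z)) 3
  have hab3' : ∀ l, Integrable (fun z => |D l z| ^ 3) Q := fun l =>
    integrable_pow_of_abs_le (hIm l).abs (fun z => (abs_abs _).trans_le (hIb l z)) 3
  -- remainder of the first order expansion
  set r : Fin n → (Fin n → E × E) → ℂ := fun l z =>
    D l z • (I * e (sel ∅ z) - I * e (sel {l} z)) + (θ * (D l z * J l z) : ℝ) * e (sel ∅ z) with hr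
  have hrb : ∀ l z, ‖r l z‖ ≤ 3 * (|D l z| ^ 3 / 3 + 2 * |J l z| ^ 3 / 3) := fun l z => by
    have e1 : e (sel {l} z) = e (sel ∅ z) * Complex.exp ((-(θ * J l z) : ℝ) * I) := by
      rw [he]
      simp only
      rw [← Complex.exp_add]
      congr 1
      simp only [hJdef]; push_cast; ring
    have e2 : r l z = -(D l z * I * e (sel ∅ z)) *
        (Complex.exp ((-(θ * J l z) : ℝ) * I) - 1 - (-(θ * J l z) : ℝ) * I) := by
      rw [hr]
      simp only
      rw [e1, real_smul]
      push_cast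
      linear_combination ((D l z : ℂ) * e (sel ∅ z) * θ * J l z) * Complex.I_mul_I
    rw [e2, norm_mul, norm_neg, norm_mul, norm_mul, hen, norm_I, mul_one, mul_one,
      norm_real, norm_eq_abs]
    have h3 := norm_exp_mul_I_sub_one_sub_le (-(θ * J l z))
    have h4 : (-(θ * J l z)) ^ 2 ≤ |J l z| ^ 2 := by
      rw [neg_sq, mul_pow, sq_abs]
      have : θ ^ 2 ≤ 1 := pow_le_one₀ hθ hθ1
      nlinarith [sq_nonneg (J l z)]
    have hA := abs_nonneg (D l z)
    have hB := abs_nonneg (J l z)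
    -- Young's inequality, as `(a - b)² (a + 2 b) = a³ - 3 a b² + 2 b³`.
    have h5 : |D l z| * |J l z| ^ 2 ≤ |D l z| ^ 3 / 3 + 2 * |J l z| ^ 3 / 3 := by
      have : 0 ≤ (|D l z| - |J l z|) ^ 2 * (|D l z| + 2 * |J l z|) := by positivity
      nlinarith
    calc |D l z| * _ ≤ |D l z| * (3 * |J l z| ^ 2) :=
          mul_le_mul_of_nonneg_left (h3.trans (by linarith)) hA
      _ ≤ _ := by linarith
  have hi1 : ∀ l, Integrable (fun z =>
      D l z • (I * e (sel ∅ z) - I * e (sel {l} z))) Q := fun l => by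
    have := hIm l
    refine Integrable.of_bound (by fun_prop) ((M + M) * (1 + 1)) (ae_of_all _ fun z => ?_)
    rw [norm_smul]
    refine mul_le_mul (hIb l z) ((norm_sub_le _ _).trans ?_) (norm_nonneg _)
      ((abs_nonneg _).trans (hIb l z))
    rw [norm_mul, norm_mul, hen, hen, norm_I, mul_one]
  have hi2 : ∀ l, Integrable (fun z => ((θ * (D l z * J l z) : ℝ) : ℂ) * e (sel ∅ z)) Q := fun l => by
    have := hIm l
    have := hJm l
    refine Integrable.of_bound (by fun_prop) (θ * ((M + M) * (M + M))) (ae_of_all _ fun z => ?_)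
    rw [norm_mul, hen, mul_one, norm_real, norm_mul, norm_mul, norm_of_nonneg hθ]
    exact mul_le_mul_of_nonneg_left (mul_le_mul (hIb l z) (hJb l z) (abs_nonneg _)
      ((abs_nonneg _).trans (hIb l z))) hθ
  have hsplit : ∫ u, Φ u • (I * e u) ∂(iid n π) =
      (1 / 2 : ℝ) • ∑ l, ∫ z, r l z ∂Q - θ * ∫ z, (quad (fun _ => Φ) z : ℂ) * e (sel ∅ z) ∂Q := by
    rw [hid]
    simp_rw [hr, fun l => integral_add (hi1 l) (hi2 l)]
    rw [sum_add_distrib, smul_add, add_sub_assoc, left_eq_add, sub_eq_zero,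
      ← integral_finsetSum _ fun l _ => hi2 l, ← integral_smul, ← integral_const_mul]
    refine integral_congr_ae (ae_of_all _ fun z => ?_)
    simp only [quad, real_smul]
    rw [← sum_mul]
    push_cast
    rw [← mul_sum]
    simp only [hIdef, hJdef]
    push_cast
    ring
  have hrsum : ‖(1 / 2 : ℝ) • ∑ l, ∫ z, r l z ∂Q‖ ≤ 2 * η := by
    have hl : ∀ l, ‖∫ z, r l z ∂Q‖ ≤ 3 * ∫ z, |J l z| ^ 3 ∂Q := fun l => by
      have hinc := integral_increment_eq (π := π) hΦ (f := fun x => |x| ^ 3) (by fun_prop) l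
      calc ‖∫ z, r l z ∂Q‖ ≤ ∫ z, 3 * (|D l z| ^ 3 / 3 + 2 * |J l z| ^ 3 / 3) ∂Q :=
            norm_integral_le_of_norm_le ((((hab3' l).div_const 3).add
              (((hab3 l).const_mul 2).div_const 3)).const_mul 3) (ae_of_all _ fun z => hrb l z)
        _ = 3 * ((∫ z, |D l z| ^ 3 ∂Q) / 3 + 2 * (∫ z, |J l z| ^ 3 ∂Q) / 3) := by
            rw [integral_const_mul, integral_add ((hab3' l).div_const 3)
              (((hab3 l).const_mul 2).div_const 3), integral_div, integral_div, integral_const_mul]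
        _ = 3 * ∫ z, |J l z| ^ 3 ∂Q := by
            rw [show ∫ z, |D l z| ^ 3 ∂Q = ∫ z, |J l z| ^ 3 ∂Q from hinc]; ring
    have hs0 : 0 ≤ ∑ l, ∫ z, |J l z| ^ 3 ∂Q :=
      sum_nonneg fun l _ => integral_nonneg fun z => by positivity
    rw [norm_smul]
    have := (norm_sum_le univ fun l => ∫ z, r l z ∂Q).trans
      (sum_le_sum fun l _ => hl l)
    rw [← mul_sum] at this
    norm_num
    linarith [show ∑ l, ∫ z, |J l z| ^ 3 ∂Q ≤ η from hη]
  have hquad : ‖-(θ * ∫ z, (quad (fun _ => Φ) z : ℂ) * e (sel ∅ z) ∂Q) +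
      θ * v * ∫ z, e (sel ∅ z) ∂Q‖ ≤ ε := by
    have h1 : -(θ * ∫ z, (quad (fun _ => Φ) z : ℂ) * e (sel ∅ z) ∂Q) +
        θ * v * ∫ z, e (sel ∅ z) ∂Q =
        -θ * ∫ z, ((quad (fun _ => Φ) z - v : ℝ) : ℂ) * e (sel ∅ z) ∂Q := by
      have : ∀ z, ((quad (fun _ => Φ) z - v : ℝ) : ℂ) * e (sel ∅ z) =
          (quad (fun _ => Φ) z : ℂ) * e (sel ∅ z) - v * e (sel ∅ z) := fun z => by push_cast; ring
      simp_rw [this]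
      rw [integral_sub hqi (hei.const_mul _), integral_const_mul]
      ring
    rw [h1, norm_mul, norm_neg, norm_real, norm_of_nonneg hθ]
    have h2 : ‖∫ z, ((quad (fun _ => Φ) z - v : ℝ) : ℂ) * e (sel ∅ z) ∂Q‖ ≤ ε := by
      refine (norm_integral_le_integral_norm _).trans (le_trans (le_of_eq ?_) hε)
      refine integral_congr_ae (ae_of_all _ fun z => ?_)
      simp only
      rw [norm_mul, hen, mul_one, norm_real, norm_eq_abs]
    have := norm_nonneg (∫ z, ((quad (fun _ => Φ) z - v : ℝ) : ℂ) * e (sel ∅ z) ∂Q)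
    nlinarith
  change ‖∫ u, Φ u • (I * e u) ∂(iid n π) + θ * v * ∫ u, e u ∂(iid n π)‖ ≤ ε + 2 * η
  rw [hsplit, heq]
  calc _ = ‖(-(θ * ∫ z, (quad (fun _ => Φ) z : ℂ) * e (sel ∅ z) ∂Q) +
      θ * v * ∫ z, e (sel ∅ z) ∂Q) + (1 / 2 : ℝ) • ∑ l, ∫ z, r l z ∂Q‖ := by congr 1; ring
    _ ≤ ε + 2 * η := (norm_add_le _ _).trans (add_le_add hquad hrsum)

/-- Characteristic function bound by exchangeable increments. -/
lemma norm_charFun_sub_exp_le {Φ : (Fin n → E) → ℝ} (hΦ : Measurable Φ) {M : ℝ}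
    (hM : ∀ u, |Φ u| ≤ M) (h0 : ∫ u, Φ u ∂(iid n π) = 0) {v ε η : ℝ} (hv : 0 ≤ v)
    (hε : ∫ z, |quad (fun _ => Φ) z - v| ∂(iid n (π.prod π)) ≤ ε)
    (hη : ∑ l : Fin n, ∫ z, |Φ (sel ∅ z) - Φ (sel {l} z)| ^ 3 ∂(iid n (π.prod π)) ≤ η) :
    ‖∫ u, Complex.exp (Φ u * I) ∂(iid n π) - exp (-v / 2)‖ ≤ ε + 2 * η := by
  set ψ : ℝ → ℂ := fun θ => ∫ u, Complex.exp ((θ * Φ u : ℝ) * I) ∂(iid n π) with hψ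
  set ψ' : ℝ → ℂ := fun θ =>
    ∫ u, Φ u • (I * Complex.exp ((θ * Φ u : ℝ) * I)) ∂(iid n π) with hψ'
  -- The integrating factor of the approximate equation `ψ' = -θ v ψ`; the mean value inequality on
  -- `[0, 1]` then compares `ψ 1` with `exp (-v / 2)`.
  have hd : ∀ θ, HasDerivAt (fun θ : ℝ => ψ θ * (exp (v * θ ^ 2 / 2) : ℂ))
      ((ψ' θ + θ * v * ψ θ) * (exp (v * θ ^ 2 / 2) : ℂ)) θ := fun θ => by
    have h1 : HasDerivAt (fun θ : ℝ => exp (v * θ ^ 2 / 2))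
        (exp (v * θ ^ 2 / 2) * (v * θ)) θ := by
      have : HasDerivAt (fun θ : ℝ => v * θ ^ 2 / 2) (v * θ) θ := by
        have h := (((hasDerivAt_id θ).pow 2).const_mul v).div_const 2
        refine h.congr_deriv ?_
        simp only [id]; ring
      exact this.exp
    refine ((hasDerivAt_integral_exp hΦ hM θ).mul h1.ofReal_comp).congr_deriv ?_
    simp only [hψ, hψ']
    push_cast
    ring
  have hε0 : 0 ≤ ε + 2 * η := by
    have h1 : 0 ≤ ε := (integral_nonneg fun z => abs_nonneg _).trans hε
    have h2 : 0 ≤ η := (sum_nonneg fun l _ => integral_nonneg fun z => by positivity).trans hη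
    linarith
  have hmv := norm_image_sub_le_of_norm_deriv_le_segment_01'
    (f := fun θ : ℝ => ψ θ * (exp (v * θ ^ 2 / 2) : ℂ)) (C := (ε + 2 * η) * exp (v / 2))
    (fun θ _ => (hd θ).hasDerivWithinAt) (fun θ hθ => by
      rw [norm_mul, norm_real, norm_of_nonneg (exp_pos _).le]
      refine mul_le_mul (norm_deriv_charFun_le hΦ hM h0 hε hη hθ.1 hθ.2.le) ?_ (exp_pos _).le
        hε0
      refine Real.exp_le_exp.2 ?_
      have : θ ^ 2 ≤ 1 := pow_le_one₀ hθ.1 hθ.2.le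
      nlinarith)
  have e0 : ψ 0 = 1 := by simp [hψ]
  have e1 : ψ 1 = ∫ u, Complex.exp (Φ u * I) ∂(iid n π) := by simp [hψ]
  simp only [e0, e1] at hmv
  have hx : exp (-v / 2) * exp (v / 2) = 1 := by
    rw [← exp_add]; rw [neg_div, neg_add_cancel, Real.exp_zero]
  have hfac : (∫ u, Complex.exp (Φ u * I) ∂(iid n π)) * (exp (v * 1 ^ 2 / 2) : ℂ) -
      1 * (exp (v * 0 ^ 2 / 2) : ℂ) =
      (∫ u, Complex.exp (Φ u * I) ∂(iid n π) - exp (-v / 2)) * exp (v / 2) := by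
    have : (exp (-v / 2) : ℂ) * (exp (v / 2) : ℂ) = 1 := by exact_mod_cast hx
    rw [sub_mul, this]
    simp
  rw [hfac, norm_mul, norm_real, norm_of_nonneg (exp_pos _).le] at hmv
  exact le_of_mul_le_mul_right hmv (exp_pos _)

end CharFun

/-! ### Perturbation of the quadratic form -/

section Quad

variable {E : Type*} [MeasurableSpace E] {n : ℕ} {π : Measure E} [IsProbabilityMeasure π]

lemma abs_quad_le {L : Fin n → (Fin n → E) → ℝ} {M : ℝ} (hM : ∀ l u, |L l u| ≤ M)
    (z : Fin n → E × E) : |quad L z| ≤ 2 * n * M ^ 2 := by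
  rw [quad, abs_mul, abs_of_nonneg (by norm_num : (0 : ℝ) ≤ 1 / 2)]
  have h : ∀ l, ∀ u u', |L l u - L l u'| ≤ 2 * M := fun l u u' => by
    have := (abs_sub _ _).trans (add_le_add (hM l u) (hM l u'))
    linarith
  calc (1 / 2 : ℝ) * |∑ l : Fin n, (L l (sel (upFrom n (l + 1)) z) - L l (sel (upFrom n l) z)) *
        (L l (sel ∅ z) - L l (sel {l} z))| ≤ (1 / 2 : ℝ) * ∑ _l : Fin n, (2 * M) * (2 * M) := by
        refine mul_le_mul_of_nonneg_left ((abs_sum_le_sum_abs _ _).trans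
          (sum_le_sum fun l _ => ?_)) (by norm_num)
        rw [abs_mul]
        exact mul_le_mul (h l _ _) (h l _ _) (abs_nonneg _) ((abs_nonneg _).trans (h l (sel ∅ z) (sel ∅ z)))
    _ = 2 * n * M ^ 2 := by
        rw [sum_const, card_univ, Fintype.card_fin, nsmul_eq_mul]; ring

lemma integrable_quad {L : Fin n → (Fin n → E) → ℝ} (hL : ∀ l, Measurable (L l)) {M : ℝ}
    (hM : ∀ l u, |L l u| ≤ M) : Integrable (quad L) (iid n (π.prod π)) :=
  Integrable.of_bound (measurable_quad hL).aestronglyMeasurable _ (ae_of_all _ fun z =>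
    abs_quad_le hM z)

lemma integral_sq_sel_sub_le {f : (Fin n → E) → ℝ} (hf : Measurable f) {M c : ℝ}
    (hM : ∀ u, |f u| ≤ M) (hc : ∫ u, f u ^ 2 ∂(iid n π) ≤ c) (S T : Finset (Fin n)) :
    Integrable (fun z => (f (sel S z) - f (sel T z)) ^ 2) (iid n (π.prod π)) ∧
      ∫ z, (f (sel S z) - f (sel T z)) ^ 2 ∂(iid n (π.prod π)) ≤ 4 * c := by
  have hi : ∀ S, Integrable (fun z => f (sel S z) ^ 2) (iid n (π.prod π)) := fun S =>
    integrable_pow_of_abs_le (by fun_prop) (fun z => hM _) 2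
  have he : ∀ S, ∫ z, f (sel S z) ^ 2 ∂(iid n (π.prod π)) ≤ c := fun S =>
    (integral_comp_of_measurePreserving (measurePreserving_sel π S) (f := fun u => f u ^ 2)
      (by fun_prop)).trans_le hc
  refine ⟨integrable_pow_of_abs_le (b := M + M) (by fun_prop) (fun z => (abs_sub _ _).trans
    (add_le_add (hM _) (hM _))) 2, (integral_mono_of_nonneg (ae_of_all _ fun z => sq_nonneg _)
    (((hi S).add (hi T)).const_mul 2) (ae_of_all _ fun z => ?_)).trans ?_⟩
  · simp only [Pi.add_apply]
    nlinarith [sq_nonneg (f (sel S z) + f (sel T z))]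
  · simp only [Pi.add_apply]
    rw [integral_const_mul, integral_add (hi S) (hi T)]
    linarith [he S, he T]

/-- Each product is compared through `A B - A' B' = A (B - B') + B' (A - A')` and Young's inequality
with weight `s`, so a mean square error `s²` of the functions costs only order `s` per label. -/
lemma integral_abs_quad_sub_le {L L' : Fin n → (Fin n → E) → ℝ} (hL : ∀ l, Measurable (L l))
    (hL' : ∀ l, Measurable (L' l)) {M M' : ℝ} (hM : ∀ l u, |L l u| ≤ M)
    (hM' : ∀ l u, |L' l u| ≤ M') {c s : ℝ}
    (hs : 0 < s) (hc : ∀ l, ∫ u, L l u ^ 2 ∂(iid n π) ≤ c)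
    (hd : ∀ l, ∫ u, (L l u - L' l u) ^ 2 ∂(iid n π) ≤ s ^ 2) :
    ∫ z, |quad L z - quad L' z| ∂(iid n (π.prod π)) ≤ n * (s * (3 * c + 2 * s ^ 2 + 2)) := by
  have hs' : 0 < s⁻¹ := inv_pos.2 hs
  have key : ∀ x y : ℝ, |x * y| ≤ s / 2 * x ^ 2 + s⁻¹ / 2 * y ^ 2 := fun x y => by
    have h1 : 0 ≤ s⁻¹ / 2 * (s * |x| - |y|) ^ 2 := by positivity
    have h2 : s⁻¹ / 2 * (s * |x| - |y|) ^ 2 =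
        s / 2 * |x| ^ 2 + s⁻¹ / 2 * |y| ^ 2 - |x| * |y| := by field_simp; ring
    rw [sq_abs, sq_abs, ← abs_mul] at h2
    linarith
  have halg : ∀ A B A' B' : ℝ, |A * B - A' * B'| ≤ s / 2 * A ^ 2 + s * B ^ 2 +
      (s + s⁻¹ / 2) * (B - B') ^ 2 + s⁻¹ / 2 * (A - A') ^ 2 := fun A B A' B' => by
    have h1 := abs_add_le (A * (B - B')) (B' * (A - A'))
    rw [show A * (B - B') + B' * (A - A') = A * B - A' * B' by ring] at h1
    have h2 : s / 2 * B' ^ 2 ≤ s * B ^ 2 + s * (B - B') ^ 2 := by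
      nlinarith [mul_nonneg hs.le (sq_nonneg (2 * B - B'))]
    linarith [key A (B - B'), key B' (A - A')]
  have hp := fun l => integral_sq_sel_sub_le (hL l) (hM l) (hc l)
  have hq := fun l => integral_sq_sel_sub_le (f := fun u => L l u - L' l u) ((hL l).sub (hL' l))
    (M := M + M') (fun u => (abs_sub _ _).trans (add_le_add (hM l u) (hM' l u))) (hd l)
  have hi := fun l S T S' T' => ((((hp l S T).1.const_mul (s / 2)).fun_add
    ((hp l S' T').1.const_mul s)).fun_add ((hq l S' T').1.const_mul (s + s⁻¹ / 2))).fun_add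
    ((hq l S T).1.const_mul (s⁻¹ / 2))
  refine (integral_mono_of_nonneg (ae_of_all _ fun z => abs_nonneg _)
    ((integrable_finsetSum univ fun l _ => hi l (upFrom n (l + 1)) (upFrom n l) ∅ {l}).const_mul
      (1 / 2)) (ae_of_all _ fun z => ?_)).trans ?_
  · simp only
    rw [quad, quad, ← mul_sub, ← sum_sub_distrib, abs_mul, abs_of_nonneg (by norm_num)]
    refine mul_le_mul_of_nonneg_left ((abs_sum_le_sum_abs _ _).trans
      (sum_le_sum fun l _ => (halg _ _ _ _).trans (le_of_eq ?_))) (by norm_num)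
    ring
  · rw [integral_const_mul, integral_finsetSum _ fun l _ => hi _ _ _ _ _]
    refine (mul_le_mul_of_nonneg_left (Finset.sum_le_card_nsmul univ _
      (2 * (s * (3 * c + 2 * s ^ 2 + 2))) fun l _ => ?_) (by norm_num)).trans_eq (by simp; ring)
    obtain ⟨i1, b1⟩ := hp l (upFrom n (l + 1)) (upFrom n l)
    obtain ⟨i2, b2⟩ := hp l ∅ {l}
    obtain ⟨i3, b3⟩ := hq l ∅ {l}
    obtain ⟨i4, b4⟩ := hq l (upFrom n (l + 1)) (upFrom n l)
    have j2 := (i1.const_mul (s / 2)).fun_add (i2.const_mul s)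
    rw [integral_add (j2.fun_add (i3.const_mul _)) (i4.const_mul _), integral_add j2 (i3.const_mul _),
      integral_add (i1.const_mul _) (i2.const_mul _), integral_const_mul, integral_const_mul,
      integral_const_mul, integral_const_mul]
    have e : s⁻¹ / 2 * (4 * s ^ 2) = 2 * s := by field_simp; ring
    linarith [mul_le_mul_of_nonneg_left b1 (half_pos hs).le, mul_le_mul_of_nonneg_left b2 hs.le,
      mul_le_mul_of_nonneg_left b3 (by positivity : 0 ≤ s + s⁻¹ / 2),
      mul_le_mul_of_nonneg_left b4 (half_pos hs').le]

lemma integral_abs_sub_integral_le {α : Type*} [MeasurableSpace α] {μ : Measure α}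
    [IsProbabilityMeasure μ] {f : α → ℝ} (hf : MemLp f 2 μ) {w : ℝ} (hw : 0 ≤ w)
    (h : Var[f; μ] ≤ w ^ 2) : ∫ a, |f a - ∫ b, f b ∂μ| ∂μ ≤ w := by
  have hm : MemLp (fun a => |f a - ∫ b, f b ∂μ|) 2 μ :=
    (hf.sub (memLp_const (∫ b, f b ∂μ))).norm
  have h1 := variance_nonneg (fun a => |f a - ∫ b, f b ∂μ|) μ
  rw [variance_eq_sub hm] at h1
  rw [variance_eq_integral hf.aestronglyMeasurable.aemeasurable] at h
  simp only [Pi.pow_apply, sq_abs] at h1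
  exact abs_le_of_sq_le_sq' (by linarith) hw |>.2

end Quad

/-! ### Concentration of the quadratic form for local functions -/

section Variance

variable {E : Type*} [PseudoMetricSpace E] [SecondCountableTopology E] [MeasurableSpace E]
  [BorelSpace E] {n : ℕ} {π : Measure E} [IsProbabilityMeasure π]

/-- Some component of `a` is within `R` of some component of `b`. -/
def Near (R : ℝ) (a : E × E) (b : (E × E) × (E × E)) : Prop :=
  ((dist a.1 b.1.1 ≤ R ∨ dist a.1 b.1.2 ≤ R) ∨ (dist a.1 b.2.1 ≤ R ∨ dist a.1 b.2.2 ≤ R)) ∨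
  ((dist a.2 b.1.1 ≤ R ∨ dist a.2 b.1.2 ≤ R) ∨ (dist a.2 b.2.1 ≤ R ∨ dist a.2 b.2.2 ≤ R))

lemma measurableSet_near (R : ℝ) :
    MeasurableSet {p : (E × E) × ((E × E) × (E × E)) | Near R p.1 p.2} := by
  have : ∀ f g : (E × E) × ((E × E) × (E × E)) → E, Measurable f → Measurable g →
      MeasurableSet {p | dist (f p) (g p) ≤ R} := fun f g hf hg =>
    measurableSet_le (hf.dist hg) measurable_const
  unfold Near
  refine .union (.union (.union ?_ ?_) (.union ?_ ?_)) (.union (.union ?_ ?_) (.union ?_ ?_)) <;>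
    exact this _ _ (by fun_prop) (by fun_prop)

/-- `Near` is a union of eight conditions, each placing a point with law `π` in a ball of radius
`R`. -/
lemma real_near_le {R p : ℝ} (hp : ∀ y, π.real (closedBall y R) ≤ p)
    (b : (E × E) × (E × E)) : (π.prod π).real {a | Near R a b} ≤ 8 * p := by
  have h0 : ∀ f : E × E → E, MeasurePreserving f (π.prod π) π → ∀ y,
      (π.prod π).real {a | dist (f a) y ≤ R} ≤ p := fun f hf y => by
    refine le_trans (le_of_eq ?_) (hp y)
    rw [measureReal_def, measureReal_def, ← hf.measure_preimage (s := closedBall y R)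
      isClosed_closedBall.measurableSet.nullMeasurableSet]
    rfl
  have h1 := h0 _ measurePreserving_fst
  have h2 := h0 _ measurePreserving_snd
  have hU : ∀ (s t : Set (E × E)) (x y : ℝ), (π.prod π).real s ≤ x → (π.prod π).real t ≤ y →
      (π.prod π).real (s ∪ t) ≤ x + y := fun s t x y hx hy =>
    (measureReal_union_le s t).trans (add_le_add hx hy)
  have := hU _ _ _ _ (hU _ _ _ _ (hU _ _ _ _ (h1 b.1.1) (h1 b.1.2)) (hU _ _ _ _ (h1 b.2.1) (h1 b.2.2)))
    (hU _ _ _ _ (hU _ _ _ _ (h2 b.1.1) (h2 b.1.2)) (hU _ _ _ _ (h2 b.2.1) (h2 b.2.2)))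
  refine le_trans this (by linarith)

/-- The probability that all points with labels in `s` are near the point with label `k`. -/
lemma real_forall_near_le {R p : ℝ} (hp : ∀ y, π.real (closedBall y R) ≤ p)
    (k : Fin n) (s : Finset (Fin n)) (hk : k ∉ s) :
    (iid n ((π.prod π).prod (π.prod π))).real {y | ∀ l ∈ s, Near R (y l).1 (y k)} ≤
      (8 * p) ^ s.card := by
  set Q := (π.prod π).prod (π.prod π)
  have hmp := measurePreserving_eval_prodMk_infinitePi (fun _ : Fin n => Q)
    (τ := fun j : s => (j : Fin n)) k Subtype.val_injective (fun b h => hk (h ▸ b.2))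
  set A : Set (((E × E) × (E × E)) × (s → (E × E) × (E × E))) :=
    {q | ∀ j, Near R (q.2 j).1 q.1} with hA
  have hAm : MeasurableSet A := by
    rw [hA, ofPred_forall]
    refine MeasurableSet.iInter fun j => ?_
    have hm : Measurable fun q : ((E × E) × (E × E)) × (s → (E × E) × (E × E)) =>
        ((q.2 j).1, q.1) := by fun_prop
    exact hm (measurableSet_near R)
  have he : {y : Fin n → (E × E) × (E × E) | ∀ l ∈ s, Near R (y l).1 (y k)} =
      (fun w : Fin n → (E × E) × (E × E) => (w k, fun j : s => w (j : Fin n))) ⁻¹' A := by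
    ext y
    simp [hA]
  have hp0 : 0 ≤ 8 * p := by
    obtain ⟨y⟩ := (inferInstance : NeZero π).out |> fun _ => π.nonempty_of_neZero
    have := hp y
    have h2 : 0 ≤ π.real (closedBall y R) := measureReal_nonneg
    linarith
  rw [measureReal_def, he, hmp.measure_preimage hAm.nullMeasurableSet, Measure.prod_apply hAm]
  refine toReal_le_of_le_ofReal (by positivity) ?_
  calc ∫⁻ b, (infinitePi fun _ : s => Q) (Prod.mk b ⁻¹' A) ∂Q
      ≤ ∫⁻ _, ofReal ((8 * p) ^ s.card) ∂Q := by
        refine lintegral_mono fun b => ?_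
        have h1 : Prod.mk b ⁻¹' A = Set.pi Set.univ fun _ : s => {c | Near R c.1 b} := by
          ext w; simp [hA]
        rw [h1, infinitePi_eq_pi, pi_pi, prod_const, card_univ, Fintype.card_coe, ofReal_pow hp0]
        gcongr
        have h2 := (measurePreserving_fst (μ := π.prod π) (ν := π.prod π)).measure_preimage
          (s := {a | Near R a b})
          ((measurableSet_near R).preimage (measurable_id.prodMk measurable_const)).nullMeasurableSet
        refine h2.trans_le ?_
        rw [← ofReal_toReal (measure_ne_top _ _)]
        exact ofReal_le_ofReal (real_near_le hp b)
    _ = ofReal ((8 * p) ^ s.card) := by simp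

/-- Efron–Stein over the independent pairs. Resampling the pair `k` affects only the summands with
label `k` or with points near the old or new pair `k`. The increment is therefore at most `4 K²`
times the number of such labels, a sum of one constant and conditionally independent indicators
whose second moment is bounded when `n p ≤ c`. -/
lemma variance_quad_le {L : Fin n → (Fin n → E) → ℝ} (hL : ∀ l, Measurable (L l)) {K R p c : ℝ}
    (hK : ∀ l u, |L l u| ≤ K) (hp : ∀ y, π.real (closedBall y R) ≤ p) (hc : n * p ≤ c)
    (hloc : ∀ l k, l ≠ k → ∀ u u' : Fin n → E, (∀ j, j ≠ k → u j = u' j) →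
      R < dist (u l) (u k) → R < dist (u l) (u' k) → L l u = L l u') :
    Var[quad L; iid n (π.prod π)] ≤ 16 * n * K ^ 4 * (1 + 8 * c) ^ 2 := by
  classical
  have hp0 : 0 ≤ p := by
    obtain ⟨y⟩ := π.nonempty_of_neZero
    exact measureReal_nonneg.trans (hp y)
  have hc0 : 0 ≤ c := le_trans (by positivity) hc
  set Q := iid n ((π.prod π).prod (π.prod π))
  have hES := efronStein (π := π.prod π) (measurable_quad hL) (abs_quad_le hK)
  set T : Fin n → Fin n → Set (Fin n → (E × E) × (E × E)) := fun k l =>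
    {y | l = k ∨ Near R (y l).1 (y k)} with hT
  have hTm : ∀ k l, MeasurableSet (T k l) := fun k l => by
    have hm : Measurable fun y : Fin n → (E × E) × (E × E) => ((y l).1, y k) := by fun_prop
    by_cases h : l = k
    · simp [hT, h]
    · simp only [hT, h, false_or]
      exact hm (measurableSet_near R)
  have hdiff : ∀ k y, |quad L (sel ∅ y) - quad L (sel {k} y)| ≤
      4 * K ^ 2 * ∑ l, (T k l).indicator 1 y := fun k y => by
    have hprod : ∀ l u1 u2 u3 u4, |(L l u1 - L l u2) * (L l u3 - L l u4)| ≤ 4 * K ^ 2 := fun l u1 u2 u3 u4 => by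
      have h : ∀ u u', |L l u - L l u'| ≤ 2 * K := fun u u' => by
        have := (abs_sub _ _).trans (add_le_add (hK l u) (hK l u'))
        linarith
      rw [abs_mul]
      calc _ ≤ (2 * K) * (2 * K) :=
            mul_le_mul (h _ _) (h _ _) (abs_nonneg _) ((abs_nonneg _).trans (h u1 u2))
        _ = 4 * K ^ 2 := by ring
    rw [quad, quad, ← mul_sub, ← sum_sub_distrib, abs_mul,
      abs_of_nonneg (by norm_num : (0 : ℝ) ≤ 1 / 2)]
    have hsum : |∑ l : Fin n, ((L l (sel (upFrom n (l + 1)) (sel ∅ y)) -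
          L l (sel (upFrom n l) (sel ∅ y))) *
          (L l (sel ∅ (sel ∅ y)) - L l (sel {l} (sel ∅ y))) -
        (L l (sel (upFrom n (l + 1)) (sel {k} y)) - L l (sel (upFrom n l) (sel {k} y))) *
          (L l (sel ∅ (sel {k} y)) - L l (sel {l} (sel {k} y))))| ≤
        ∑ l, 8 * K ^ 2 * (T k l).indicator 1 y := by
      refine (abs_sum_le_sum_abs _ _).trans (sum_le_sum fun l _ => ?_)
      by_cases hy : y ∈ T k l
      · rw [indicator_of_mem hy, Pi.one_apply, mul_one]
        have h1 := hprod l (sel (upFrom n (l + 1)) (sel ∅ y)) (sel (upFrom n l) (sel ∅ y))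
          (sel ∅ (sel ∅ y)) (sel {l} (sel ∅ y))
        have h2 := hprod l (sel (upFrom n (l + 1)) (sel {k} y)) (sel (upFrom n l) (sel {k} y))
          (sel ∅ (sel {k} y)) (sel {l} (sel {k} y))
        have := (abs_sub _ _).trans (add_le_add h1 h2)
        linarith
      · rw [indicator_of_notMem hy, mul_zero]
        obtain ⟨hlk, hfar⟩ : l ≠ k ∧ ¬ Near R (y l).1 (y k) := by simpa [hT] using hy
        have heq : ∀ S, L l (sel S (sel ∅ y)) = L l (sel S (sel {k} y)) := fun S => by
          unfold Near at hfar
          push Not at hfar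
          refine hloc l k hlk _ _ (fun j hj => ?_) ?_ ?_
          · simp [sel, hj]
          · simp only [sel, Finset.notMem_empty, if_false]
            split_ifs
            · exact hfar.2.1.2
            · exact hfar.2.1.1
            · exact hfar.1.1.2
            · exact hfar.1.1.1
          · simp only [sel, Finset.notMem_empty, if_false, Finset.mem_singleton, if_true]
            split_ifs
            · exact hfar.2.2.2
            · exact hfar.2.2.1
            · exact hfar.1.2.2
            · exact hfar.1.2.1
        rw [heq, heq, heq, heq, sub_self, abs_zero]
    rw [← mul_sum] at hsum
    linarith
  set a : Fin n → Fin n → ℝ := fun k l => if l = k then 1 else 8 * p with ha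
  have ha0 : ∀ k l, 0 ≤ a k l := fun k l => by simp only [ha]; split_ifs <;> positivity
  have hone : ∀ k l, Q.real (T k l) ≤ a k l := fun k l => by
    by_cases h : l = k
    · simp [ha, h]
    · have := real_forall_near_le hp k {l} (by simpa using Ne.symm h)
      simpa [ha, hT, h] using this
  -- Given the pair `k` and its copy, the events of two other labels are independent
  -- (`real_forall_near_le`); the last term covers `l = l'`.
  have htwo : ∀ k l l', Q.real (T k l ∩ T k l') ≤ a k l * a k l' + if l = l' then a k l else 0 := fun k l l' => by
    by_cases hll : l = l'
    · subst hll
      rw [inter_self, if_pos rfl]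
      have := hone k l
      have := mul_nonneg (ha0 k l) (ha0 k l)
      linarith
    rw [if_neg hll, add_zero]
    by_cases h : l = k
    · have h1 : a k l = 1 := by simp [ha, h]
      rw [h1, one_mul]
      exact (measureReal_mono inter_subset_right).trans (hone k l')
    by_cases h' : l' = k
    · have h1 : a k l' = 1 := by simp [ha, h']
      rw [h1, mul_one]
      exact (measureReal_mono inter_subset_left).trans (hone k l)
    have h2 := real_forall_near_le hp k {l, l'} (by simp [Ne.symm h, Ne.symm h'])
    rw [Finset.card_pair hll] at h2
    have h3 : T k l ∩ T k l' = {y | ∀ j ∈ ({l, l'} : Finset (Fin n)), Near R (y j).1 (y k)} := by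
      ext y
      simp [hT, h, h']
    rw [h3]
    refine h2.trans (le_of_eq ?_)
    simp [ha, h, h']; ring
  have hsuma : ∀ k, ∑ l, a k l ≤ 1 + 8 * c := fun k => by
    have : ∀ l, a k l ≤ (if l = k then 1 else 0) + 8 * p := fun l => by
      simp only [ha]; split_ifs <;> linarith
    refine (sum_le_sum fun l _ => this l).trans ?_
    rw [sum_add_distrib, Finset.sum_ite_eq' univ k, if_pos (mem_univ k),
      sum_const, card_univ, Fintype.card_fin, nsmul_eq_mul]
    linarith
  have hsq : ∀ k, ∫ y, (∑ l, (T k l).indicator (1 : (Fin n → (E × E) × (E × E)) → ℝ) y) ^ 2 ∂Q ≤ 2 * (1 + 8 * c) ^ 2 := fun k => by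
    have h1 : ∀ y, (∑ l, (T k l).indicator (1 : (Fin n → (E × E) × (E × E)) → ℝ) y) ^ 2 =
        ∑ l, ∑ l', (T k l ∩ T k l').indicator (1 : (Fin n → (E × E) × (E × E)) → ℝ) y := fun y => by
      rw [pow_two, sum_mul_sum]
      refine sum_congr rfl fun l _ => sum_congr rfl fun l' _ => ?_
      rw [Set.inter_indicator_one, Pi.mul_apply]
    have hI : ∀ l l', Integrable ((T k l ∩ T k l').indicator (1 : (Fin n → (E × E) × (E × E)) → ℝ)) Q := fun l l' =>
      (integrable_const (1 : ℝ)).indicator ((hTm k l).inter (hTm k l'))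
    simp_rw [h1]
    rw [integral_finsetSum _ fun l _ => integrable_finsetSum _ fun l' _ => hI l l']
    have h2 : ∀ l, ∫ y, ∑ l', (T k l ∩ T k l').indicator (1 : (Fin n → (E × E) × (E × E)) → ℝ) y ∂Q =
        ∑ l', Q.real (T k l ∩ T k l') := fun l => by
      rw [integral_finsetSum _ fun l' _ => hI l l']
      exact sum_congr rfl fun l' _ => integral_indicator_one ((hTm k l).inter (hTm k l'))
    simp_rw [h2]
    refine (sum_le_sum fun l _ => sum_le_sum fun l' _ => htwo k l l').trans ?_
    simp_rw [sum_add_distrib, Finset.sum_ite_eq univ, mem_univ, if_true]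
    rw [← sum_mul_sum]
    have h3 := hsuma k
    have h4 : 0 ≤ ∑ l, a k l := sum_nonneg fun l _ => ha0 k l
    nlinarith
  refine hES.trans ?_
  have hk : ∀ k : Fin n, ∫ y, (quad L (sel ∅ y) - quad L (sel {k} y)) ^ 2 ∂Q ≤
      (4 * K ^ 2) ^ 2 * (2 * (1 + 8 * c) ^ 2) := fun k => by
    refine le_trans ?_ (mul_le_mul_of_nonneg_left (hsq k) (by positivity))
    rw [← integral_const_mul]
    refine integral_mono_of_nonneg (ae_of_all _ fun y => sq_nonneg _) ?_ (ae_of_all _ fun y => ?_)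
    · refine Integrable.const_mul ?_ _
      have hm : Measurable fun y => ∑ l, (T k l).indicator (1 : (Fin n → (E × E) × (E × E)) → ℝ) y :=
        Finset.measurable_fun_sum _ fun l _ => measurable_one.indicator (hTm k l)
      refine integrable_pow_of_abs_le hm (b := n) (fun y => ?_) 2
      rw [abs_of_nonneg (sum_nonneg fun l _ => indicator_nonneg (fun _ _ => zero_le_one) _)]
      refine (sum_le_sum (g := fun _ => (1 : ℝ)) fun l _ =>
        Set.indicator_le_self' (fun _ _ => zero_le_one) _).trans ?_
      simp
    · simp only
      rw [← sq_abs, ← mul_pow]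
      exact pow_le_pow_left₀ (abs_nonneg _) (hdiff k y) 2
  refine (mul_le_mul_of_nonneg_left (sum_le_sum fun k _ => hk k) (by norm_num)).trans ?_
  rw [sum_const, card_univ, Fintype.card_fin, nsmul_eq_mul]
  apply le_of_eq; ring

end Variance

/-! ### Central limit theorem for functionals with local add one costs -/

section Cost

variable {E : Type*} [MeasurableSpace E]

/-- The cost of adding the point `x` to the configuration `X`. -/
def cost (f : Set E → ℝ) (x : E) (X : Set E) : ℝ := f (insert x X) - f X

/-- Measurability of a function of a point and a finite configuration. -/
def JointMeasurable (g : E → Set E → ℝ) : Prop :=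
  ∀ m : ℕ, Measurable fun p : E × (Fin m → E) => g p.1 (range p.2)

lemma ConfMeasurable.jointMeasurable_cost {f : Set E → ℝ} (hf : ConfMeasurable f) :
    JointMeasurable (cost f) := fun m => by
  have h1 : Measurable fun p : E × (Fin m → E) => (Fin.cons p.1 p.2 : Fin (m + 1) → E) := by
    refine measurable_pi_lambda _ fun j => ?_
    refine Fin.cases ?_ (fun i => ?_) j
    · simpa using measurable_fst
    · simp only [Fin.cons_succ]; fun_prop
  have h2 := (hf (m + 1)).comp h1
  have h3 : Measurable fun p : E × (Fin m → E) => f (range p.2) := (hf m).comp measurable_snd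
  convert h2.sub h3 using 1
  funext p
  simp [cost, Fin.range_cons]

variable {m : ℕ}

/-- A function of the point with label `l` and the configuration of the others. -/
def leaveOut (g : E → Set E → ℝ) (l : Fin (m + 1)) (u : Fin (m + 1) → E) : ℝ :=
  g (u l) (range fun j => u (l.succAbove j))

lemma measurable_leaveOut {g : E → Set E → ℝ} (hg : JointMeasurable g) (l : Fin (m + 1)) :
    Measurable (leaveOut g l) := by
  have : Measurable fun u : Fin (m + 1) → E => (u l, fun j => u (l.succAbove j)) :=
    (measurable_pi_apply l).prodMk (measurable_pi_lambda _ fun j => measurable_pi_apply _)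
  exact (hg m).comp this

lemma integral_leaveOut {π : Measure E} [IsProbabilityMeasure π] (l : Fin (m + 1))
    {F : E → Set E → ℝ} (hF : JointMeasurable F) :
    ∫ u, leaveOut F l u ∂(iid (m + 1) π) =
      ∫ p, F p.1 (range p.2) ∂(rooted m π) := by
  have hmp := measurePreserving_eval_prodMk_infinitePi (fun _ : Fin (m + 1) => π)
    (τ := fun j : Fin m => l.succAbove j) l (Fin.succAbove_right_injective)
    (fun b => (Fin.succAbove_ne l b).symm)
  exact integral_comp_of_measurePreserving hmp (hF m).stronglyMeasurable

lemma insert_range_succAbove (l : Fin (m + 1)) (u : Fin (m + 1) → E) :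
    insert (u l) (range fun j => u (l.succAbove j)) = range u := by
  ext x
  constructor
  · rintro (rfl | ⟨j, rfl⟩)
    · exact ⟨l, rfl⟩
    · exact ⟨_, rfl⟩
  · rintro ⟨j, rfl⟩
    by_cases h : j = l
    · exact Or.inl (by rw [h])
    · obtain ⟨i, rfl⟩ := Fin.exists_succAbove_eq h
      exact Or.inr ⟨i, rfl⟩

/-- The configuration of the unchanged points cancels. Hence all increments, and with them `quad`,
depend on `f` only through its add one costs. -/
lemma sub_eq_leaveOut_cost_sub (f : Set E → ℝ) (l : Fin (m + 1)) {u u' : Fin (m + 1) → E}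
    (h : ∀ j, j ≠ l → u j = u' j) :
    f (range u) - f (range u') = leaveOut (cost f) l u - leaveOut (cost f) l u' := by
  have h1 : (fun j => u (l.succAbove j)) = fun j => u' (l.succAbove j) :=
    funext fun j => h _ (Fin.succAbove_ne l j)
  rw [leaveOut, leaveOut, cost, cost, insert_range_succAbove, insert_range_succAbove, h1]
  ring

lemma sel_upFrom_of_ne {n : ℕ} (l : Fin n) (z : Fin n → E × E) (j : Fin n) (h : j ≠ l) :
    sel (upFrom n (l + 1)) z j = sel (upFrom n l) z j := by
  have h' : (j : ℕ) ≠ l := fun h' => h (Fin.ext h')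
  have : j ∈ upFrom n (l + 1) ↔ j ∈ upFrom n l := by
    simp only [upFrom, mem_filter, mem_univ, true_and]; omega
  simp [sel, this]

end Cost

section CLT

/-- The covariance identity with both functions equal to `Φ`. It shows that the constant around
which `quad` has to concentrate is the variance. -/
lemma integral_quad {E : Type*} [MeasurableSpace E] {n : ℕ} {π : Measure E}
    [IsProbabilityMeasure π] {Φ : (Fin n → E) → ℝ} (hΦ : Measurable Φ) {M : ℝ}
    (hM : ∀ u, |Φ u| ≤ M) :
    ∫ z, quad (fun _ => Φ) z ∂(iid n (π.prod π)) = Var[Φ; iid n π] := by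
  have hmem : MemLp Φ 2 (iid n π) :=
    MemLp.of_bound hΦ.aestronglyMeasurable M (ae_of_all _ hM)
  rw [variance_eq_sub hmem]
  have h := integral_smul_sub_eq_sum (π := π) hΦ hΦ.stronglyMeasurable hM hM
  simp only [smul_eq_mul] at h
  simp only [Pi.pow_apply, pow_two] at h ⊢
  rw [h]
  simp only [quad]
  rw [integral_const_mul, integral_finsetSum]
  intro l _
  refine Integrable.of_bound (by fun_prop) ((M + M) * (M + M)) (ae_of_all _ fun z => ?_)
  rw [norm_mul]
  have hM0 : 0 ≤ M := (abs_nonneg _).trans (hM (sel ∅ z))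
  have h1 : ∀ a b, ‖Φ a - Φ b‖ ≤ M + M := fun a b =>
    (norm_sub_le _ _).trans (add_le_add (hM a) (hM b))
  exact mul_le_mul (h1 _ _) (h1 _ _) (norm_nonneg _) (by positivity)

variable {E : Type*} [PseudoMetricSpace E] [SecondCountableTopology E] [MeasurableSpace E]
  [BorelSpace E] {m : ℕ} {π : Measure E} [IsProbabilityMeasure π]

/-- Normal approximation for one functional of `m + 1` independent points. -/
lemma norm_charFun_sub_exp_le_of_local {f : Set E → ℝ} (hf : ConfMeasurable f) {M : ℝ}
    (hM : ∀ u : Fin (m + 1) → E, |f (range u)| ≤ M)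
    (hM' : ∀ u : Fin m → E, |f (range u)| ≤ M) {C : ℝ}
    (hC : ∫ p, cost f p.1 (range p.2) ^ 4 ∂(rooted m π) ≤ C)
    {g : E → Set E → ℝ} (hg : JointMeasurable g) {K R s c : ℝ} (hK : ∀ x X, |g x X| ≤ K)
    (hloc : ∀ x X, g x X = g x (X ∩ closedBall x R)) (hs : 0 < s)
    (happ : ∫ p, (cost f p.1 (range p.2) - g p.1 (range p.2)) ^ 2 ∂(rooted m π) ≤ s ^ 2)
    (hc : ∀ y, (m + 1 : ℝ) * π.real (closedBall y R) ≤ c) :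
    ‖∫ u, Complex.exp (((√(m + 1 : ℝ))⁻¹ * (f (range u) -
        ∫ u', f (range u') ∂(iid (m + 1) π)) : ℝ) * I) ∂(iid (m + 1) π) -
      exp (-((m + 1 : ℝ)⁻¹ * Var[fun u => f (range u); iid (m + 1) π]) / 2)‖ ≤
      2 * (s * (3 * (1 + C) + 2 * s ^ 2 + 2)) +
        (4 * K ^ 2 * (1 + 8 * c) + 16 * (1 + C)) / √(m + 1 : ℝ) := by
  set n : ℝ := (m + 1 : ℝ) with hn
  have hn0 : 0 < n := by positivity
  set b := ∫ u', f (range u') ∂(iid (m + 1) π) with hb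
  set F : (Fin (m + 1) → E) → ℝ := fun u => f (range u) with hF
  have hFm : Measurable F := hf (m + 1)
  set Φ : (Fin (m + 1) → E) → ℝ := fun u => (√n)⁻¹ * (F u - b) with hΦ
  have hΦm : Measurable Φ := (hFm.sub_const b).const_mul _
  have hFi : Integrable F (iid (m + 1) π) :=
    integrable_of_abs_le hFm hM
  have hsn : 0 < √n := Real.sqrt_pos.2 hn0
  have hsn2 : √n * √n = n := mul_self_sqrt hn0.le
  have hΦM : ∀ u, |Φ u| ≤ (√n)⁻¹ * (M + |b|) := fun u => by
    rw [hΦ]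
    simp only
    rw [abs_mul, abs_of_nonneg (by positivity : 0 ≤ (√n)⁻¹)]
    exact mul_le_mul_of_nonneg_left ((abs_sub _ _).trans (add_le_add (hM u) le_rfl)) (by positivity)
  have hΦ0 : ∫ u, Φ u ∂(iid (m + 1) π) = 0 := by
    simp only [hΦ]
    rw [integral_const_mul, integral_sub hFi (integrable_const _)]
    simp [hb, hF]
  set L : Fin (m + 1) → (Fin (m + 1) → E) → ℝ := fun l => leaveOut (cost f) l with hL
  set L' : Fin (m + 1) → (Fin (m + 1) → E) → ℝ := fun l => leaveOut g l with hL'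
  have hLm : ∀ l, Measurable (L l) := fun l => measurable_leaveOut hf.jointMeasurable_cost l
  have hLm' : ∀ l, Measurable (L' l) := fun l => measurable_leaveOut hg l
  have hLb : ∀ l u, |L l u| ≤ 2 * M := fun l u => by
    simp only [hL, leaveOut, cost]
    rw [insert_range_succAbove]
    have := (abs_sub _ _).trans (add_le_add (hM u) (hM' fun j => u (l.succAbove j)))
    linarith
  have hLb' : ∀ l u, |L' l u| ≤ K := fun l u => hK _ _
  have hL4i : ∀ l, Integrable (fun u => L l u ^ 4) (iid (m + 1) π) := fun l =>
    integrable_pow_of_abs_le (hLm l) (hLb l) 4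
  have hL4 : ∀ l, ∫ u, L l u ^ 4 ∂(iid (m + 1) π) ≤ C := fun l =>
    (integral_leaveOut l (F := fun x X => cost f x X ^ 4)
      fun k => (hf.jointMeasurable_cost k).pow_const 4).trans_le hC
  have hL2 : ∀ l, ∫ u, L l u ^ 2 ∂(iid (m + 1) π) ≤ 1 + C := fun l => by
    have : ∫ u, L l u ^ 2 ∂(iid (m + 1) π) ≤ ∫ u, (1 + L l u ^ 4) ∂(iid (m + 1) π) := by
      refine integral_mono_of_nonneg (ae_of_all _ fun u => sq_nonneg _)
        ((integrable_const 1).add (hL4i l)) (ae_of_all _ fun u => ?_)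
      simp only
      nlinarith [sq_nonneg (L l u ^ 2 - 1), sq_nonneg (L l u)]
    rw [integral_add (integrable_const 1) (hL4i l)] at this
    simp only [integral_const, probReal_univ, smul_eq_mul, mul_one] at this
    linarith [hL4 l]
  have hLd : ∀ l, ∫ u, (L l u - L' l u) ^ 2 ∂(iid (m + 1) π) ≤ s ^ 2 := fun l =>
    (integral_leaveOut l (F := fun x X => (cost f x X - g x X) ^ 2)
      fun k => ((hf.jointMeasurable_cost k).sub (hg k)).pow_const 2).trans_le happ
  -- The normalization `√n` enters twice, and increments of `Φ` are differences of leave-one-out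
  -- costs. Only now can the costs be replaced by the local functions `L'`.
  have hquad : ∀ z, quad (fun _ => Φ) z = n⁻¹ * quad L z := fun z => by
    simp only [quad]
    rw [mul_left_comm n⁻¹, mul_sum (a := n⁻¹)]
    congr 1
    refine sum_congr rfl fun l _ => ?_
    have e1 : F (sel (upFrom (m + 1) (l + 1)) z) - F (sel (upFrom (m + 1) l) z) = _ :=
      sub_eq_leaveOut_cost_sub f l (fun j hj => sel_upFrom_of_ne l z j hj)
    have e2 : F (sel ∅ z) - F (sel {l} z) = _ :=
      sub_eq_leaveOut_cost_sub f l (fun j hj => by simp [sel, hj])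
    simp only [hΦ]
    have : n⁻¹ = (√n)⁻¹ * (√n)⁻¹ := by rw [← mul_inv, hsn2]
    rw [← mul_sub, ← mul_sub, sub_sub_sub_cancel_right, sub_sub_sub_cancel_right, e1, e2, this]
    ring
  have hvar : Var[Φ; iid (m + 1) π] = n⁻¹ * Var[F; iid (m + 1) π] := by
    simp only [hΦ]
    rw [variance_const_mul, variance_sub_const hFm.aestronglyMeasurable, inv_pow, pow_two, hsn2]
  set v := n⁻¹ * Var[F; iid (m + 1) π] with hv
  have hv0 : 0 ≤ v := mul_nonneg (by positivity) (variance_nonneg _ _)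
  have hQ : ∫ z, quad L z ∂(iid (m + 1) (π.prod π)) = n * v := by
    have := integral_quad (π := π) hΦm hΦM
    simp_rw [hquad] at this
    rw [integral_const_mul, hvar] at this
    rw [← this]; field_simp
  set Q := iid (m + 1) (π.prod π) with hQdef
  have hi : Integrable (quad L) Q := integrable_quad hLm hLb
  have hi' : Integrable (quad L') Q := integrable_quad hLm' hLb'
  have hpert : ∫ z, |quad L z - quad L' z| ∂Q ≤ n * (s * (3 * (1 + C) + 2 * s ^ 2 + 2)) := by
    have := integral_abs_quad_sub_le (π := π) hLm hLm' hLb hLb' hs hL2 hLd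
    push_cast at this
    exact this
  have hc0 : 0 ≤ c := by
    obtain ⟨y⟩ := π.nonempty_of_neZero
    exact (mul_nonneg hn0.le measureReal_nonneg).trans (hc y)
  have hvq : Var[quad L'; Q] ≤ (4 * √n * K ^ 2 * (1 + 8 * c)) ^ 2 := by
    have h1 := variance_quad_le (π := π) (n := m + 1) hLm' (R := R) (p := c / n) (c := c) hLb'
      (fun y => by rw [le_div_iff₀ hn0, mul_comm]; exact hc y)
      (by push_cast; rw [← hn]; field_simp; exact le_rfl)
      (by
        intro l k hlk u u' huu hR hR'
        simp only [hL', leaveOut]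
        have hul : u l = u' l := huu l hlk
        have hsub : ∀ v w : Fin (m + 1) → E, (∀ j, j ≠ k → v j = w j) → R < dist (u l) (v k) →
            (range fun j => v (l.succAbove j)) ∩ closedBall (u l) R ⊆
              (range fun j => w (l.succAbove j)) ∩ closedBall (u l) R := by
          rintro v w hvw hv _ ⟨⟨j, rfl⟩, hx⟩
          refine ⟨⟨j, (hvw _ ?_).symm⟩, hx⟩
          rintro h
          simp only [mem_closedBall, h, dist_comm (v k)] at hx
          exact absurd hx (not_le.2 hv)
        rw [hloc, hloc (u' l), ← hul, (hsub u u' huu hR).antisymm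
          (hsub u' u (fun j hj => (huu j hj).symm) hR')])
    refine h1.trans (le_of_eq ?_)
    push_cast
    rw [← hn]
    nlinarith [hsn2]
  have hdev : ∫ z, |quad L' z - ∫ y, quad L' y ∂Q| ∂Q ≤ 4 * √n * K ^ 2 * (1 + 8 * c) :=
    integral_abs_sub_integral_le
      (MemLp.of_bound (measurable_quad hLm').aestronglyMeasurable _
        (ae_of_all _ fun z => abs_quad_le hLb' z)) (by positivity) hvq
  set ε := n⁻¹ * (2 * (n * (s * (3 * (1 + C) + 2 * s ^ 2 + 2))) + 4 * √n * K ^ 2 * (1 + 8 * c))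
    with hε
  -- The error consists of the perturbation of `quad`, the fluctuation of the local form around its
  -- mean, and the difference of the two means, which is again at most the perturbation; hence the
  -- factor `2` in `ε`.
  have hεb : ∫ z, |quad (fun _ => Φ) z - v| ∂Q ≤ ε := by
    have h1 : ∀ z, |quad (fun _ => Φ) z - v| ≤ n⁻¹ * (|quad L z - quad L' z| +
        |quad L' z - ∫ y, quad L' y ∂Q| + |∫ y, quad L y ∂Q - ∫ y, quad L' y ∂Q|) := fun z => by
      have : quad (fun _ => Φ) z - v = n⁻¹ * ((quad L z - quad L' z) +
          (quad L' z - ∫ y, quad L' y ∂Q) - (∫ y, quad L y ∂Q - ∫ y, quad L' y ∂Q)) := by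
        rw [hquad, hQ]; field_simp; ring
      rw [this, abs_mul, abs_of_nonneg (by positivity : 0 ≤ n⁻¹)]
      exact mul_le_mul_of_nonneg_left ((abs_sub _ _).trans (add_le_add (abs_add_le _ _) le_rfl))
        (by positivity)
    have i1 : Integrable (fun z => |quad L z - quad L' z|) Q := (hi.sub hi').abs
    have i2 : Integrable (fun z => |quad L' z - ∫ y, quad L' y ∂Q|) Q :=
      (hi'.sub (integrable_const _)).abs
    have h2 : |∫ y, quad L y ∂Q - ∫ y, quad L' y ∂Q| ≤ ∫ z, |quad L z - quad L' z| ∂Q := by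
      rw [← integral_sub hi hi']
      exact abs_integral_le_integral_abs
    calc ∫ z, |quad (fun _ => Φ) z - v| ∂Q ≤ ∫ z, n⁻¹ * (|quad L z - quad L' z| +
        |quad L' z - ∫ y, quad L' y ∂Q| + |∫ y, quad L y ∂Q - ∫ y, quad L' y ∂Q|) ∂Q :=
          integral_mono_of_nonneg (ae_of_all _ fun z => abs_nonneg _)
            (((i1.fun_add i2).fun_add (integrable_const _)).const_mul _) (ae_of_all _ h1)
      _ ≤ ε := by
          rw [integral_const_mul, integral_add (i1.fun_add i2) (integrable_const _),
            integral_add i1 i2]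
          simp only [integral_const, probReal_univ, smul_eq_mul, one_mul]
          refine mul_le_mul_of_nonneg_left ?_ (by positivity)
          linarith
  set η := (8 * (1 + C)) / √n with hη
  have hηb : ∑ l : Fin (m + 1), ∫ z, |Φ (sel ∅ z) - Φ (sel {l} z)| ^ 3 ∂Q ≤ η := by
    have h1 : ∀ l : Fin (m + 1), ∫ z, |Φ (sel ∅ z) - Φ (sel {l} z)| ^ 3 ∂Q ≤
        (√n)⁻¹ ^ 3 * (8 * (1 + C)) := fun l => by
      have hp : ∀ z, |Φ (sel ∅ z) - Φ (sel {l} z)| ^ 3 ≤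
          (√n)⁻¹ ^ 3 * (8 + (4 * L l (sel ∅ z) ^ 4 + 4 * L l (sel {l} z) ^ 4)) := fun z => by
        have e2 : F (sel ∅ z) - F (sel {l} z) = L l (sel ∅ z) - L l (sel {l} z) :=
          sub_eq_leaveOut_cost_sub f l (fun j hj => by simp [sel, hj])
        simp only [hΦ]
        rw [← mul_sub, sub_sub_sub_cancel_right, e2, abs_mul, mul_pow,
          abs_of_nonneg (by positivity : 0 ≤ (√n)⁻¹)]
        refine mul_le_mul_of_nonneg_left ?_ (by positivity)
        have h4 := (by decide : Even 4).add_pow_le (a := L l (sel ∅ z)) (b := -L l (sel {l} z))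
        rw [← sub_eq_add_neg, ← Even.pow_abs (by decide : Even 4) (_ - _),
          Even.neg_pow (by decide)] at h4
        set x := |L l (sel ∅ z) - L l (sel {l} z)|
        norm_num at h4
        -- The two squares give `x³ ≤ 1 + x⁴ / 2`.
        nlinarith [sq_nonneg (x ^ 2 - x - 1), sq_nonneg (x - 1)]
      have hS : ∀ S, ∫ z, L l (sel S z) ^ 4 ∂Q ≤ C := fun S =>
        (integral_comp_of_measurePreserving (measurePreserving_sel π S)
          (f := fun u => L l u ^ 4) (by have := hLm l; fun_prop)).trans_le (hL4 l)
      have hSi : ∀ S, Integrable (fun z => L l (sel S z) ^ 4) Q := fun S =>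
        (measurePreserving_sel π S).integrable_comp_of_integrable (hL4i l)
      have i1 := ((hSi ∅).const_mul 4).fun_add ((hSi {l}).const_mul 4)
      refine (integral_mono_of_nonneg (ae_of_all _ fun z => by positivity)
        (((integrable_const (8 : ℝ)).fun_add i1).const_mul _) (ae_of_all _ hp)).trans ?_
      rw [integral_const_mul, integral_add (integrable_const _) i1,
        integral_add ((hSi ∅).const_mul 4) ((hSi {l}).const_mul 4), integral_const_mul,
        integral_const_mul]
      simp only [integral_const, probReal_univ, smul_eq_mul, one_mul]
      refine mul_le_mul_of_nonneg_left ?_ (by positivity)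
      have := hS ∅
      have := hS {l}
      linarith
    refine (sum_le_sum fun l _ => h1 l).trans (le_of_eq ?_)
    rw [sum_const, card_univ, Fintype.card_fin, nsmul_eq_mul]
    push_cast
    rw [← hn, hη, ← hsn2]
    have : √(√n * √n) = √n := by rw [hsn2]
    rw [this]
    field_simp
  have key := norm_charFun_sub_exp_le (π := π) hΦm hΦM hΦ0 hv0 hεb hηb
  refine key.trans (le_of_eq ?_)
  have e1 : n⁻¹ * (4 * √n * K ^ 2 * (1 + 8 * c)) = 4 * K ^ 2 * (1 + 8 * c) / √n := by
    rw [eq_div_iff hsn.ne']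
    calc _ = n⁻¹ * (√n * √n) * (4 * K ^ 2 * (1 + 8 * c)) := by ring
      _ = _ := by rw [hsn2, inv_mul_cancel₀ hn0.ne', one_mul]
  have e2 : n⁻¹ * (2 * (n * (s * (3 * (1 + C) + 2 * s ^ 2 + 2)))) =
      2 * (s * (3 * (1 + C) + 2 * s ^ 2 + 2)) := by field_simp
  rw [hε, mul_add, e1, e2, hη]
  ring

/-- Central limit theorem, in terms of characteristic functions, for functionals with uniformly
bounded fourth moments of the add one costs, if these are well approximated by local functions. -/
lemma tendsto_charFun_of_local {π : ℕ → Measure E} [∀ m, IsProbabilityMeasure (π m)]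
    {f : ℕ → Set E → ℝ} (hf : ∀ m, ConfMeasurable (f m))
    (hM : ∀ m, ∃ M, ∀ k ≤ m + 1, ∀ u : Fin k → E, |f m (range u)| ≤ M) {C : ℝ}
    (hC : ∀ᶠ m in atTop, ∫ p, cost (f m) p.1 (range p.2) ^ 4 ∂(rooted m (π m)) ≤ C)
    (hloc : ∀ s > 0, ∃ R K c : ℝ, ∀ᶠ m in atTop, ∃ g : E → Set E → ℝ, JointMeasurable g ∧
      (∀ x X, |g x X| ≤ K) ∧ (∀ x X, g x X = g x (X ∩ closedBall x R)) ∧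
      ∫ p, (cost (f m) p.1 (range p.2) - g p.1 (range p.2)) ^ 2
        ∂(rooted m (π m)) ≤ s ^ 2 ∧
      ∀ y, (m + 1 : ℝ) * (π m).real (closedBall y R) ≤ c) {τ : ℝ}
    (hτ : Tendsto (fun m : ℕ => (m + 1 : ℝ)⁻¹ *
      Var[fun u => f m (range u); iid (m + 1) (π m)]) atTop (𝓝 τ)) :
    Tendsto (fun m : ℕ => ∫ u, Complex.exp (((√(m + 1 : ℝ))⁻¹ * (f m (range u) -
        ∫ u', f m (range u') ∂(iid (m + 1) (π m))) : ℝ) * I) ∂(iid (m + 1) (π m)))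
      atTop (𝓝 (exp (-τ / 2) : ℂ)) := by
  set V : ℕ → ℝ := fun m => (m + 1 : ℝ)⁻¹ * Var[fun u => f m (range u); iid (m + 1) (π m)]
  set ψ : ℕ → ℂ := fun m => ∫ u, Complex.exp (((√(m + 1 : ℝ))⁻¹ * (f m (range u) -
        ∫ u', f m (range u') ∂(iid (m + 1) (π m))) : ℝ) * I) ∂(iid (m + 1) (π m))
  have hexp : Tendsto (fun m => (exp (-(V m) / 2) : ℂ)) atTop (𝓝 (exp (-τ / 2) : ℂ)) := by
    have h1 : Tendsto (fun m => exp (-(V m) / 2)) atTop (𝓝 (exp (-τ / 2))) :=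
      (Real.continuous_exp.tendsto _).comp (hτ.neg.div_const 2)
    exact (Complex.continuous_ofReal.tendsto _).comp h1
  have hdiff : Tendsto (fun m => ψ m - (exp (-(V m) / 2) : ℂ)) atTop (𝓝 0) := by
    rw [Metric.tendsto_nhds]
    intro ε hε
    have hlim : Tendsto (fun s : ℝ => 2 * (s * (3 * (1 + C) + 2 * s ^ 2 + 2))) (𝓝[>] 0) (𝓝 0) := by
      have : Tendsto (fun s : ℝ => 2 * (s * (3 * (1 + C) + 2 * s ^ 2 + 2))) (𝓝 0)
          (𝓝 (2 * (0 * (3 * (1 + C) + 2 * 0 ^ 2 + 2)))) := Continuous.tendsto (by fun_prop) 0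
      rw [zero_mul, mul_zero] at this
      exact this.mono_left nhdsWithin_le_nhds
    -- The accuracy `s` is fixed first; then `R`, `K` and `c` are constants and the remaining error
    -- is of order `m ^ (-1/2)`.
    obtain ⟨s, hs1, hs⟩ := ((hlim.eventually (gt_mem_nhds (half_pos hε))).and
      self_mem_nhdsWithin).exists
    obtain ⟨R, K, c, h⟩ := hloc s hs
    have hsq : Tendsto (fun m : ℕ => (4 * K ^ 2 * (1 + 8 * c) + 16 * (1 + C)) / √(m + 1 : ℝ))
        atTop (𝓝 0) := by
      refine Tendsto.div_atTop tendsto_const_nhds ?_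
      refine tendsto_sqrt_atTop.comp ?_
      exact tendsto_atTop_add_const_right _ _ tendsto_natCast_atTop_atTop
    filter_upwards [h, hC, hsq.eventually (gt_mem_nhds (half_pos hε))] with m ⟨g, hg, hK, hl, ha, hc⟩
      hCm hm
    obtain ⟨M, hMm⟩ := hM m
    have key := norm_charFun_sub_exp_le_of_local (hf m) (hMm (m + 1) le_rfl)
      (hMm m (Nat.le_succ m)) hCm hg hK hl hs ha hc
    rw [dist_zero_right]
    refine lt_of_le_of_lt key ?_
    linarith
  have := hdiff.add hexp
  simpa using this

end CLT

/-! ### Binomial samples seen through a small window -/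

section BinomialPoisson

/-- The weights of the binomial distribution. -/
noncomputable def binomWeight (m : ℕ) (p : ℝ) (j : ℕ) : ℝ := m.choose j * p ^ j * (1 - p) ^ (m - j)

/-- The weights of the Poisson distribution. -/
noncomputable def poissonWeight (a : ℝ) (j : ℕ) : ℝ := exp (-a) * a ^ j / (j.factorial : ℝ)

/-- The `ℓ¹` distance of a binomial and a Poisson distribution. -/
noncomputable def binomPoissonDist (m : ℕ) (p a : ℝ) : ℝ :=
  ∑' j, |binomWeight m p j - poissonWeight a j|

lemma summable_poissonWeight (a : ℝ) : Summable (poissonWeight a) := by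
  have := (Real.summable_pow_div_factorial a).mul_left (exp (-a))
  refine this.congr fun j => ?_
  simp only [poissonWeight]; ring

lemma binomWeight_eq_zero {m j : ℕ} (p : ℝ) (h : m < j) : binomWeight m p j = 0 := by
  simp [binomWeight, Nat.choose_eq_zero_of_lt h]

lemma summable_abs_binomWeight_sub (m : ℕ) (p a : ℝ) :
    Summable fun j => |binomWeight m p j - poissonWeight a j| := by
  refine Summable.abs (Summable.sub ?_ (summable_poissonWeight a))
  refine summable_of_hasFiniteSupport ((Set.finite_Iic m).subset fun j hj => ?_)
  by_contra h
  exact hj (binomWeight_eq_zero p (not_le.1 h))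

variable {ι : Type*} {l : Filter ι} {m : ι → ℕ} {p : ι → ℝ} {a : ℝ}

lemma tendsto_zero_of_mul_nat (hm : Tendsto m l atTop)
    (ha : Tendsto (fun i => (m i : ℝ) * p i) l (𝓝 a)) : Tendsto p l (𝓝 0) := by
  have h1 : Tendsto (fun i => ((m i : ℝ))⁻¹) l (𝓝 0) :=
    tendsto_inv_atTop_zero.comp (tendsto_natCast_atTop_atTop.comp hm)
  have h2 := h1.mul ha
  rw [zero_mul] at h2
  refine h2.congr' ?_
  filter_upwards [hm.eventually (eventually_ge_atTop 1)] with i hi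
  have : (m i : ℝ) ≠ 0 := by positivity
  field_simp

lemma tendsto_one_sub_pow (hp : Tendsto p l (𝓝 0))
    (ha : Tendsto (fun i => (m i : ℝ) * p i) l (𝓝 a)) :
    Tendsto (fun i => (1 - p i) ^ m i) l (𝓝 (exp (-a))) := by
  have hlt : ∀ᶠ i in l, p i < 1 := hp.eventually (gt_mem_nhds one_pos)
  have hlog : Tendsto (fun i => (m i : ℝ) * Real.log (1 - p i)) l (𝓝 (-a)) := by
    have h1 : Tendsto (fun i => -((m i : ℝ) * p i)) l (𝓝 (-a)) := ha.neg
    have h2 : Tendsto (fun i => -((m i : ℝ) * p i) * (1 - p i)⁻¹) l (𝓝 (-a)) := by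
      have : Tendsto (fun i => (1 - p i)⁻¹) l (𝓝 (1 - 0)⁻¹) :=
        (tendsto_const_nhds.sub hp).inv₀ (by norm_num)
      simpa using h1.mul this
    refine tendsto_of_tendsto_of_tendsto_of_le_of_le' h2 h1 ?_ ?_
    · filter_upwards [hlt] with i hi
      have h3 := Real.one_sub_inv_le_log_of_pos (sub_pos.2 hi)
      have h4 : 1 - (1 - p i)⁻¹ = -p i * (1 - p i)⁻¹ := by
        have : 1 - p i ≠ 0 := (sub_pos.2 hi).ne'
        field_simp; ring
      rw [h4] at h3
      calc -((m i : ℝ) * p i) * (1 - p i)⁻¹ = (m i : ℝ) * (-p i * (1 - p i)⁻¹) := by ring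
        _ ≤ _ := mul_le_mul_of_nonneg_left h3 (Nat.cast_nonneg _)
    · filter_upwards [hlt] with i hi
      have h3 := Real.log_le_sub_one_of_pos (sub_pos.2 hi)
      calc (m i : ℝ) * Real.log (1 - p i) ≤ (m i : ℝ) * (1 - p i - 1) :=
            mul_le_mul_of_nonneg_left h3 (Nat.cast_nonneg _)
        _ = _ := by ring
  refine ((Real.continuous_exp.tendsto _).comp hlog).congr' ?_
  filter_upwards [hlt] with i hi
  simp only [Function.comp]
  rw [← Real.log_pow, Real.exp_log (pow_pos (sub_pos.2 hi) _)]

lemma tendsto_binomWeight (hm : Tendsto m l atTop)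
    (ha : Tendsto (fun i => (m i : ℝ) * p i) l (𝓝 a)) (j : ℕ) :
    Tendsto (fun i => binomWeight (m i) (p i) j) l (𝓝 (poissonWeight a j)) := by
  have hp := tendsto_zero_of_mul_nat hm ha
  have hsub : ∀ k : ℕ, Tendsto (fun i => ((m i - k : ℕ) : ℝ) * p i) l (𝓝 a) := fun k => by
    have h1 : Tendsto (fun i => (m i : ℝ) * p i - k * p i) l (𝓝 (a - k * 0)) :=
      ha.sub (hp.const_mul _)
    rw [mul_zero, sub_zero] at h1
    refine h1.congr' ?_
    filter_upwards [hm.eventually (eventually_ge_atTop k)] with i hi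
    rw [Nat.cast_sub hi]; ring
  have h1 : Tendsto (fun i => ((m i).choose j : ℝ) * p i ^ j) l (𝓝 (a ^ j / (j.factorial : ℝ))) := by
    have h2 : Tendsto (fun i => (∏ k ∈ Finset.range j, (((m i - k : ℕ) : ℝ) * p i)) / (j.factorial : ℝ))
        l (𝓝 ((∏ _k ∈ Finset.range j, a) / (j.factorial : ℝ))) :=
      (tendsto_finsetProd _ fun k _ => hsub k).div_const _
    rw [prod_const, card_range] at h2
    refine h2.congr fun i => ?_
    rw [Finset.prod_mul_distrib, prod_const, card_range, ← Nat.cast_prod,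
      ← Nat.descFactorial_eq_prod_range, Nat.descFactorial_eq_factorial_mul_choose]
    push_cast
    have : (j.factorial : ℝ) ≠ 0 := by positivity
    field_simp
  have h3 := h1.mul (tendsto_one_sub_pow (m := fun i => m i - j) hp (hsub j))
  have e : poissonWeight a j = a ^ j / (j.factorial : ℝ) * exp (-a) := by
    rw [poissonWeight]; ring
  rw [e]
  exact h3

/-- Pointwise convergence of the weights together with the summable bound `(a + 1)^j / j!`. The `ℓ¹`
form controls arbitrary functionals with values in `[0, 1]`. -/
lemma tendsto_binomPoissonDist (hm : Tendsto m l atTop)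
    (ha : Tendsto (fun i => (m i : ℝ) * p i) l (𝓝 a)) (hp0 : ∀ᶠ i in l, 0 ≤ p i) (ha0 : 0 ≤ a) :
    Tendsto (fun i => binomPoissonDist (m i) (p i) a) l (𝓝 0) := by
  have hp := tendsto_zero_of_mul_nat hm ha
  have h := tendsto_tsum_of_dominated_convergence (𝓕 := l)
    (f := fun i j => |binomWeight (m i) (p i) j - poissonWeight a j|) (g := fun _ => (0 : ℝ))
    (bound := fun j => (a + 1) ^ j / (j.factorial : ℝ) + poissonWeight a j)
    ((Real.summable_pow_div_factorial (a + 1)).add (summable_poissonWeight a))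
    (fun j => by
      have := ((tendsto_binomWeight hm ha j).sub_const (poissonWeight a j)).abs
      simpa using this)
    (by
      filter_upwards [hp0, hp.eventually (gt_mem_nhds one_pos),
        ha.eventually (gt_mem_nhds (lt_add_one a))] with i h0 h1 h2 j
      rw [norm_eq_abs, abs_abs]
      have hpw : 0 ≤ poissonWeight a j := by unfold poissonWeight; positivity
      have hbw : 0 ≤ binomWeight (m i) (p i) j := by
        have : 0 ≤ 1 - p i := by linarith
        unfold binomWeight; positivity
      have hb : binomWeight (m i) (p i) j ≤ (a + 1) ^ j / (j.factorial : ℝ) := by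
        unfold binomWeight
        have c1 := Nat.choose_le_pow_div (α := ℝ) j (m i)
        have c2 : (1 - p i) ^ (m i - j) ≤ 1 := pow_le_one₀ (by linarith) (by linarith)
        have c3 : 0 ≤ 1 - p i := by linarith
        calc ((m i).choose j : ℝ) * p i ^ j * (1 - p i) ^ (m i - j)
            ≤ ((m i : ℝ) ^ j / (j.factorial : ℝ)) * p i ^ j * 1 := by gcongr
          _ = ((m i : ℝ) * p i) ^ j / (j.factorial : ℝ) := by rw [mul_pow]; ring
          _ ≤ _ := by gcongr
      refine (abs_sub _ _).trans ?_
      rw [abs_of_nonneg hbw, abs_of_nonneg hpw]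
      linarith)
  simpa [binomPoissonDist] using h

end BinomialPoisson

/-! ### Sampling from a mixture of two laws -/

section Splitting

variable {E : Type*} [MeasurableSpace E]

lemma ConfMeasurable.comp_range {α ι β : Type*} [Fintype ι] [MeasurableSpace α] [MeasurableSpace β]
    {f : Set E → β} (hf : ConfMeasurable f) {v : ι → α → E} (hv : ∀ i, Measurable (v i)) :
    Measurable fun a => f (range fun i => v i a) := by
  simpa using hf.image univ hv

lemma ConfMeasurable.insert_range_union {β : Type*} [MeasurableSpace β] {f : Set E → β}
    (hf : ConfMeasurable f) (i j : ℕ) :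
    Measurable fun q : E × ((Fin i → E) × (Fin j → E)) =>
      f (insert q.1 (range q.2.1 ∪ range q.2.2)) := by
  have h := hf.comp_range (ι := Unit ⊕ (Fin i ⊕ Fin j)) (α := E × ((Fin i → E) × (Fin j → E)))
    (v := fun k q => Sum.elim (fun _ => q.1) (Sum.elim q.2.1 q.2.2) k) (by
      rintro (_ | k | k)
      · exact measurable_fst
      · simp only [Sum.elim_inr, Sum.elim_inl]; fun_prop
      · simp only [Sum.elim_inr]; fun_prop)
  convert h using 3 with q
  simp only [Set.Sum.elim_range, Set.range_const]
  rfl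

lemma ConfMeasurable.range_union {β : Type*} [MeasurableSpace β] {f : Set E → β}
    (hf : ConfMeasurable f) (i j : ℕ) :
    Measurable fun q : (Fin i → E) × (Fin j → E) => f (range q.1 ∪ range q.2) := by
  have h := hf.comp_range (ι := Fin i ⊕ Fin j) (α := (Fin i → E) × (Fin j → E))
    (v := fun k q => Sum.elim q.1 q.2 k) (by
      rintro (k | k)
      · simp only [Sum.elim_inl]; fun_prop
      · simp only [Sum.elim_inr]; fun_prop)
  simpa only [Set.Sum.elim_range] using h

lemma ConfMeasurable.insert {β : Type*} [MeasurableSpace β] {f : Set E → β}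
    (hf : ConfMeasurable f) (x : E) : ConfMeasurable fun X => f (insert x X) := fun m => by
  have h1 : Measurable fun u : Fin m → E => (x, (u, (Fin.elim0 : Fin 0 → E))) := by fun_prop
  have := (hf.insert_range_union m 0).comp h1
  simpa [comp_def] using this

lemma lintegral_iid_succ {π : Measure E} [IsProbabilityMeasure π] {F : Set E → ℝ≥0∞}
    (hF : ConfMeasurable F) (m : ℕ) :
    ∫⁻ u, F (range u) ∂(iid (m + 1) π) =
      ∫⁻ x, ∫⁻ u, F (insert x (range u)) ∂(iid m π) ∂π := by
  have hmp := measurePreserving_eval_prodMk_infinitePi (fun _ : Fin (m + 1) => π)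
    (τ := fun j : Fin m => (0 : Fin (m + 1)).succAbove j) 0 (Fin.succAbove_right_injective)
    (fun b => (Fin.succAbove_ne 0 b).symm)
  have hm : Measurable fun p : E × (Fin m → E) => F (insert p.1 (range p.2)) := by
    have h1 : Measurable fun p : E × (Fin m → E) => (p.1, (p.2, (Fin.elim0 : Fin 0 → E))) := by
      fun_prop
    have := (hF.insert_range_union m 0).comp h1
    simpa [comp_def] using this
  rw [← lintegral_prod _ hm.aemeasurable, ← hmp.lintegral_comp hm]
  simp only [insert_range_succAbove]

/-- The mean of `F` over `i` points with law `ρ` and `j` points with law `κ`. -/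
noncomputable def mixMean (ρ κ : Measure E) (F : Set E → ℝ≥0∞) (i j : ℕ) : ℝ≥0∞ :=
  ∫⁻ b, ∫⁻ v, F (range b ∪ range v) ∂(iid j κ) ∂(iid i ρ)

variable {ρ κ : Measure E} [IsProbabilityMeasure ρ] [IsProbabilityMeasure κ]

lemma mixMean_succ_left {F : Set E → ℝ≥0∞} (hF : ConfMeasurable F) (i j : ℕ) :
    mixMean ρ κ F (i + 1) j = ∫⁻ x, mixMean ρ κ (fun X => F (insert x X)) i j ∂ρ := by
  have hG : ConfMeasurable fun X => ∫⁻ v, F (X ∪ range v) ∂(iid j κ) := fun k =>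
    (hF.range_union k j).lintegral_prod_right'
  rw [mixMean, lintegral_iid_succ hG]
  simp only [mixMean, Set.insert_union]

lemma mixMean_succ_right {F : Set E → ℝ≥0∞} (hF : ConfMeasurable F) (i j : ℕ) :
    mixMean ρ κ F i (j + 1) = ∫⁻ x, mixMean ρ κ (fun X => F (insert x X)) i j ∂κ := by
  have h1 : ∀ b : Fin i → E, ∫⁻ v, F (range b ∪ range v) ∂(iid (j + 1) κ) =
      ∫⁻ x, ∫⁻ v, F (insert x (range b ∪ range v)) ∂(iid j κ) ∂κ := fun b => by
    have hG : ConfMeasurable fun X => F (range b ∪ X) := fun k =>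
      (hF.range_union i k).comp measurable_prodMk_left
    rw [lintegral_iid_succ hG]
    simp only [Set.union_insert]
  simp only [mixMean, h1]
  rw [lintegral_lintegral_swap]
  have hm : Measurable fun q : ((Fin i → E) × E) × (Fin j → E) =>
      F (insert q.1.2 (range q.1.1 ∪ range q.2)) :=
    (hF.insert_range_union i j).comp
      ((measurable_snd.comp measurable_fst).prodMk
        ((measurable_fst.comp measurable_fst).prodMk measurable_snd))
  exact (hm.lintegral_prod_right').aemeasurable

lemma measurable_mixMean_insert {F : Set E → ℝ≥0∞} (hF : ConfMeasurable F) (i j : ℕ) :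
    Measurable fun x => mixMean ρ κ (fun X => F (insert x X)) i j := by
  have hm : Measurable fun q : (E × (Fin i → E)) × (Fin j → E) =>
      F (insert q.1.1 (range q.1.2 ∪ range q.2)) :=
    (hF.insert_range_union i j).comp
      ((measurable_fst.comp measurable_fst).prodMk
        ((measurable_snd.comp measurable_fst).prodMk measurable_snd))
  exact (hm.lintegral_prod_right').lintegral_prod_right'

/-- Sampling from a mixture: the number of points from the first law is binomial. -/
lemma lintegral_iid_mixture {π : Measure E} [IsProbabilityMeasure π] {a b : ℝ≥0∞}
    (hπ : π = a • ρ + b • κ) (m : ℕ) : ∀ {F : Set E → ℝ≥0∞}, ConfMeasurable F →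
    ∫⁻ u, F (range u) ∂(iid m π) =
      ∑ ij ∈ Finset.HasAntidiagonal.antidiagonal m, (m.choose ij.1 : ℝ≥0∞) * (a ^ ij.1 * b ^ ij.2 *
        mixMean ρ κ F ij.1 ij.2) := by
  induction m with
  | zero =>
    intro F hF
    simp only [Finset.Nat.antidiagonal_zero, Finset.sum_singleton, Nat.choose_self, Nat.cast_one,
      pow_zero, one_mul, mixMean]
    have h1 : ∀ u : Fin 0 → E, range u = ∅ := fun u => Set.range_eq_empty u
    simp [h1]
  | succ m ih =>
    intro F hF
    rw [lintegral_iid_succ hF]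
    simp_rw [fun x => ih (hF.insert x)]
    have hmeas := fun i j => measurable_mixMean_insert (ρ := ρ) (κ := κ) hF i j
    rw [lintegral_finsetSum _ fun ij _ => ((hmeas _ _).const_mul _).const_mul _]
    have h2 : ∀ ij : ℕ × ℕ, ∫⁻ x, (m.choose ij.1 : ℝ≥0∞) * (a ^ ij.1 * b ^ ij.2 *
        mixMean ρ κ (fun X => F (insert x X)) ij.1 ij.2) ∂π =
        (m.choose ij.1 : ℝ≥0∞) * (a ^ ij.1 * b ^ ij.2 * (a * mixMean ρ κ F (ij.1 + 1) ij.2 +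
          b * mixMean ρ κ F ij.1 (ij.2 + 1))) := fun ij => by
      rw [lintegral_const_mul _ ((hmeas _ _).const_mul _), lintegral_const_mul _ (hmeas _ _)]
      congr 2
      rw [hπ, lintegral_add_measure, lintegral_smul_measure, lintegral_smul_measure,
        mixMean_succ_left hF, mixMean_succ_right hF, smul_eq_mul, smul_eq_mul]
    simp_rw [h2]
    -- The first point falls under `ρ` or under `κ`; Pascal's rule collects the two sums.
    rw [Finset.sum_antidiagonal_choose_succ_mul
      (fun i j => a ^ i * b ^ j * mixMean ρ κ F i j), ← sum_add_distrib]
    refine sum_congr rfl fun ij hij => ?_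
    have hc : m.choose ij.2 = m.choose ij.1 := by
      rw [Finset.HasAntidiagonal.mem_antidiagonal] at hij
      exact Nat.choose_symm_of_eq_add (by omega)
    rw [hc]
    ring

end Splitting

/-! ### Comparison of a binomial sample with the Poisson process in a subwindow -/

section Transfer

variable {d : ℕ} [NeZero d] {Ω : Type*} [MeasurableSpace Ω] {μ : Measure Ω}
  [IsProbabilityMeasure μ] {P : Ω → Set (Space d)} {lam : ℝ}

lemma image_Iio_eq_range {α : Type*} (w : ℕ → α) (j : ℕ) :
    w '' Iio j = range fun i : Fin j => w i := by
  ext x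
  constructor
  · rintro ⟨i, hi, rfl⟩
    exact ⟨⟨i, hi⟩, rfl⟩
  · rintro ⟨i, rfl⟩
    exact ⟨i, i.2, rfl⟩

lemma cond_volume_eq_add {W B : Set (Space d)} (hB : MeasurableSet B) (hBW : B ⊆ W)
    (hWb : Bornology.IsBounded W) (hB0 : volume B ≠ 0) (hC0 : volume (W \ B) ≠ 0) :
    volume[|W] = (volume B / volume W) • volume[|B] +
        (volume (W \ B) / volume W) • volume[|W \ B] := by
  have hBt : volume B ≠ ⊤ := (hWb.subset hBW).measure_lt_top.ne
  have hCt : volume (W \ B) ≠ ⊤ := (hWb.subset sdiff_subset).measure_lt_top.ne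
  simp only [ProbabilityTheory.cond]
  rw [smul_smul, smul_smul, ENNReal.div_eq_inv_mul, ENNReal.div_eq_inv_mul, mul_assoc, mul_assoc,
    ENNReal.mul_inv_cancel hB0 hBt, ENNReal.mul_inv_cancel hC0 hCt, mul_one, ← smul_add]
  congr 1
  have := Measure.restrict_inter_add_sdiff (μ := volume) W hB
  rw [inter_eq_self_of_subset_right hBW] at this
  exact this.symm

lemma lintegral_mixMean {E : Type*} [MeasurableSpace E] {ρ κ : Measure E}
    [IsProbabilityMeasure ρ] [IsProbabilityMeasure κ] {F : Set E → ℝ≥0∞} (hF : ConfMeasurable F)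
    (i j : ℕ) :
    mixMean ρ κ F i j = ∫⁻ v, ∫⁻ w, F (w '' Iio i ∪ v '' Iio j)
      ∂(iidSeq ρ) ∂(iidSeq κ) := by
  have h1 := measurePreserving_comp_infinitePi (fun _ : ℕ => ρ) (σ := fun k : Fin i => (k : ℕ))
    Fin.val_injective
  have h2 := measurePreserving_comp_infinitePi (fun _ : ℕ => κ) (σ := fun k : Fin j => (k : ℕ))
    Fin.val_injective
  have hm := hF.range_union i j
  simp only [image_Iio_eq_range]
  rw [mixMean, lintegral_lintegral_swap hm.aemeasurable, ← h2.lintegral_comp]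
  · refine lintegral_congr fun v => ?_
    exact (h1.lintegral_comp (hm.comp measurable_prodMk_right)).symm
  · exact (hm.comp measurable_swap).lintegral_prod_right'

lemma lintegral_poissonMeasure (r : NNReal) (f : ℕ → ℝ≥0∞) :
    ∫⁻ k, f k ∂(poissonMeasure r) = ∑' k, ofReal (poissonWeight r k) * f k := by
  rw [lintegral_countable']
  refine tsum_congr fun k => ?_
  rw [poissonMeasure_singleton, mul_comm]
  rfl

lemma measurable_of_nat_index {α β : Type*} [MeasurableSpace α] [MeasurableSpace β] {N : α → ℕ}
    (hN : Measurable N) {Φ : ℕ → α → β} (hΦ : ∀ k, Measurable (Φ k)) :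
    Measurable fun a => Φ (N a) a := by
  have h : Measurable fun p : ℕ × α => Φ p.1 p.2 := measurable_from_prod_countable_right hΦ
  exact h.comp (hN.prodMk measurable_id)

/-- A functional of a binomial sample that is controlled by the Poisson process in a window, however
the points outside of it are placed. -/
lemma IsPoissonProcess.lintegral_iid_le (hP : IsPoissonProcess P lam μ) (hlam : 0 < lam)
    {W B : Set (Space d)} (hW : MeasurableSet W) (hWb : Bornology.IsBounded W)
    (hB : MeasurableSet B) (hBW : B ⊆ W) (hB0 : volume B ≠ 0) (hC0 : volume (W \ B) ≠ 0)
    {F : Set (Space d) → ℝ≥0∞} (hF : ConfMeasurable F) (hF1 : ∀ X, F X ≤ 1) {G : Ω → ℝ≥0∞}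
    (hG : ∀ᵐ ω ∂μ, ∀ V : Set (Space d), V.Finite → V ⊆ Bᶜ → F ((P ω ∩ B) ∪ V) ≤ G ω) (m : ℕ) :
    ∫⁻ u, F (range u) ∂(iid m volume[|W]) ≤ ∫⁻ ω, G ω ∂μ + ofReal
        (binomPoissonDist m (volume.real B / volume.real W) (lam * volume.real B)) := by
  have hBb := hWb.subset hBW
  have hBt : volume B ≠ ⊤ := hBb.measure_lt_top.ne
  have hWt : volume W ≠ ⊤ := hWb.measure_lt_top.ne
  have hW0 : volume W ≠ 0 := fun h => hB0 (measure_mono_null hBW h)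
  have hCb : Bornology.IsBounded (W \ B) := hWb.subset sdiff_subset
  have := isProbabilityMeasure_cond_volume hBb hB0
  have := isProbabilityMeasure_cond_volume hWb hW0
  have := isProbabilityMeasure_cond_volume hCb hC0
  set ρ := volume[|B] with hρ
  set κ := volume[|W \ B] with hκ
  set p := volume.real B / volume.real W with hp
  have hWpos : 0 < volume.real W := ENNReal.toReal_pos hW0 hWt
  have hp0 : 0 ≤ p := by positivity
  have hp1 : p ≤ 1 := by
    rw [hp, div_le_one hWpos]
    exact measureReal_mono hBW hWt
  have hpe : volume B / volume W = ofReal p := by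
    rw [hp, ENNReal.ofReal_div_of_pos hWpos, measureReal_def, measureReal_def,
      ofReal_toReal hBt, ofReal_toReal hWt]
  have hqe : volume (W \ B) / volume W = ofReal (1 - p) := by
    have h1 : 1 - p = volume.real (W \ B) / volume.real W := by
      rw [measureReal_sdiff hBW hB hWt, hp]; field_simp
    rw [h1, ENNReal.ofReal_div_of_pos hWpos, measureReal_def, measureReal_def,
      ofReal_toReal hCb.measure_lt_top.ne, ofReal_toReal hWt]
  set a := lam * volume.real B with ha
  have ha0 : 0 ≤ a := by positivity
  set M : ℕ → ℝ≥0∞ := fun j => mixMean ρ κ F j (m - j) with hM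
  have hM1 : ∀ j, M j ≤ 1 := fun j => by
    exact (lintegral_mono fun b => lintegral_mono fun v => hF1 _).trans (by simp)
  -- the Poisson side
  have hpois : ∑' j, ofReal (poissonWeight a j) * M j ≤ ∫⁻ ω, G ω ∂μ := by
    -- A configuration `Y` in `B` is completed by `m - Y.ncard` of the outside points `v`, none if
    -- `Y` has more than `m` points. Since the hypothesis allows every finite set outside `B`, the
    -- bound `G` survives for almost every fixed `v`.
    set Fv : (ℕ → Space d) → Set (Space d) → ℝ≥0∞ := fun v Y => F (Y ∪ v '' Iio (m - Y.ncard))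
      with hFv
    have hFvm : ∀ v, ConfMeasurable (Fv v) := fun v k => by
      have hN : Measurable fun u : Fin k → Space d => (range u).ncard := by
        have := confMeasurable_ncard_inter (E := Space d) MeasurableSet.univ k
        simpa using this
      refine measurable_of_nat_index hN
        (Φ := fun j (u : Fin k → Space d) => F (range u ∪ v '' Iio (m - j))) fun j => ?_
      simp only [image_Iio_eq_range]
      exact (hF.range_union k (m - j)).comp measurable_prodMk_right
    have h1 : ∀ᵐ v ∂(iidSeq κ), ∫⁻ q, Fv v (points q)
        ∂(poissonSample a.toNNReal ρ) ≤ ∫⁻ ω, G ω ∂μ := by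
      have hv : ∀ᵐ v ∂(iidSeq κ), ∀ k, v k ∈ Bᶜ := by
        rw [ae_all_iff]
        intro k
        have hk : ∀ᵐ x ∂κ, x ∈ Bᶜ := (ae_cond_mem (hW.diff hB)).mono fun x hx => hx.2
        exact (measurePreserving_eval_infinitePi (fun _ : ℕ => κ) k).quasiMeasurePreserving.ae hk
      filter_upwards [hv] with v hv
      rw [← hP.lintegral_eq hlam hB hBb hB0 (hFvm v)]
      refine lintegral_mono_ae ?_
      filter_upwards [hG] with ω hω
      refine hω _ ((Set.finite_Iio _).image _) ?_
      rintro x ⟨k, _, rfl⟩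
      exact hv k
    refine le_trans (le_of_eq ?_) ((lintegral_mono_ae h1).trans (by simp))
    have hinj := ae_injective_infinitePi (ι := ℕ) ρ (φ := id) measurable_id
      (fun c => cond_volume_singleton B c)
    have h3 : ∀ v, ∫⁻ q, Fv v (points q) ∂(poissonSample a.toNNReal ρ) =
        ∑' j, ofReal (poissonWeight a j) *
          ∫⁻ w, F (w '' Iio j ∪ v '' Iio (m - j)) ∂(iidSeq ρ) := fun v => by
      have hmeas : Measurable fun q : Config (Space d) => Fv v (points q) :=
        (hFvm v).image_Iio (v := fun i (q : Config (Space d)) => q.2 i) (fun i => by fun_prop)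
          measurable_fst
      rw [poissonSample, lintegral_prod _ hmeas.aemeasurable, lintegral_poissonMeasure]
      refine tsum_congr fun j => ?_
      rw [coe_toNNReal a ha0]
      congr 1
      refine lintegral_congr_ae ?_
      filter_upwards [hinj] with w hw
      have hc : (w '' Iio j).ncard = j := by
        rw [ncard_image_of_injective _ (f := w) hw]
        simp [← coe_Iio]
      simp only [hFv, points, hc]
    simp_rw [h3]
    have hmm : ∀ j, Measurable fun q : (ℕ → Space d) × (ℕ → Space d) =>
        F (q.2 '' Iio j ∪ q.1 '' Iio (m - j)) := fun j => by
      simp only [image_Iio_eq_range]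
      exact (hF.range_union j (m - j)).comp
        (f := fun q : (ℕ → Space d) × (ℕ → Space d) =>
          ((fun i : Fin j => q.2 i), (fun i : Fin (m - j) => q.1 i)))
        ((measurable_pi_lambda _ fun k => (measurable_pi_apply _).comp measurable_snd).prodMk
          (measurable_pi_lambda _ fun k => (measurable_pi_apply _).comp measurable_fst))
    rw [lintegral_tsum fun j => ((hmm j).lintegral_prod_right'.const_mul _).aemeasurable]
    refine tsum_congr fun j => ?_
    rw [lintegral_const_mul _ (hmm j).lintegral_prod_right', hM]
    simp only
    rw [lintegral_mixMean hF]
  rw [lintegral_iid_mixture (cond_volume_eq_add hB hBW hWb hB0 hC0) m hF, hpe, hqe,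
    Finset.Nat.sum_antidiagonal_eq_sum_range_succ (fun i j => (m.choose i : ℝ≥0∞) *
      (ofReal p ^ i * ofReal (1 - p) ^ j * mixMean ρ κ F i j))]
  -- As `F ≤ 1`, exchanging the binomial weights for Poisson weights costs at most their `ℓ¹`
  -- distance.
  have hterm : ∀ j, (m.choose j : ℝ≥0∞) * (ofReal p ^ j * ofReal (1 - p) ^ (m - j) *
      mixMean ρ κ F j (m - j)) ≤ ofReal (poissonWeight a j) * M j +
        ofReal |binomWeight m p j - poissonWeight a j| := fun j => by
    have e1 : (m.choose j : ℝ≥0∞) * (ofReal p ^ j * ofReal (1 - p) ^ (m - j) *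
        mixMean ρ κ F j (m - j)) = ofReal (binomWeight m p j) * M j := by
      rw [binomWeight, ENNReal.ofReal_mul (by positivity), ENNReal.ofReal_mul (by positivity),
        ENNReal.ofReal_natCast, ofReal_pow hp0, ofReal_pow (by linarith)]
      ring
    rw [e1]
    have e2 : ofReal (binomWeight m p j) ≤ ofReal (poissonWeight a j) +
        ofReal |binomWeight m p j - poissonWeight a j| := by
      rw [← ofReal_add (by unfold poissonWeight; positivity) (abs_nonneg _)]
      refine ofReal_le_ofReal ?_
      linarith [le_abs_self (binomWeight m p j - poissonWeight a j)]
    refine (mul_le_mul_left e2 _).trans ?_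
    rw [add_mul]
    exact add_le_add le_rfl (mul_le_of_le_one_right' (hM1 j))
  refine (sum_le_sum fun j _ => hterm j).trans ((ENNReal.sum_le_tsum _).trans ?_)
  rw [ENNReal.tsum_add]
  refine add_le_add hpois (le_of_eq ?_)
  rw [binomPoissonDist, ENNReal.ofReal_tsum_of_nonneg (fun j => abs_nonneg _)
    (summable_abs_binomWeight_sub m p a)]

end Transfer

/-! ### Moments of the Poisson distribution -/

section PoissonMoments

lemma integral_poissonMeasure_weight (r : NNReal) (f : ℕ → ℝ) :
    ∫ k, f k ∂(poissonMeasure r) = ∑' k, poissonWeight r k * f k := by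
  rw [integral_poissonMeasure]; rfl

lemma integrable_poissonMeasure_weight {r : NNReal} {f : ℕ → ℝ} :
    Integrable f (poissonMeasure r) ↔ Summable fun k => poissonWeight r k * |f k| :=
  integrable_poissonMeasure_iff

lemma poissonWeight_succ (r : ℝ) (k : ℕ) :
    poissonWeight r (k + 1) * (k + 1 : ℝ) = r * poissonWeight r k := by
  have : ((k + 1).factorial : ℝ) = (k + 1) * k.factorial := by
    rw [Nat.factorial_succ]; push_cast; ring
  have h0 : (k.factorial : ℝ) ≠ 0 := by positivity
  have h1 : (k + 1 : ℝ) ≠ 0 := by positivity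
  rw [poissonWeight, poissonWeight, this, pow_succ]
  field_simp

/-- The Stein–Chen identity of the Poisson distribution. -/
lemma integral_natCast_mul_poissonMeasure (r : NNReal) (f : ℕ → ℝ) :
    ∫ k, (k : ℝ) * f k ∂(poissonMeasure r) = r * ∫ k, f (k + 1) ∂(poissonMeasure r) := by
  rw [integral_poissonMeasure_weight, integral_poissonMeasure_weight, ← tsum_mul_left]
  have h : ∀ k, poissonWeight r (k + 1) * (((k + 1 : ℕ) : ℝ) * f (k + 1)) =
      r * (poissonWeight r k * f (k + 1)) := fun k => by
    push_cast
    rw [← mul_assoc, poissonWeight_succ, mul_assoc]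
  rw [← tsum_congr h]
  refine (Injective.tsum_eq (g := fun k : ℕ => k + 1) (fun a b h => by simpa using h)
    fun k hk => ?_).symm
  cases k with
  | zero => simp at hk
  | succ k => exact ⟨k, rfl⟩

lemma hasSum_poissonWeight_exp (r : NNReal) (s : ℝ) :
    HasSum (fun k : ℕ => poissonWeight r k * exp (s * (k - r)))
      (exp (r * (exp s - 1 - s))) := by
  have h := (hasSum_one_poissonMeasure (r * (exp s).toNNReal)).mul_left
    (exp (r * (exp s - 1 - s)))
  rw [mul_one] at h
  refine h.congr_fun fun k => ?_
  have h1 : ((r * (exp s).toNNReal : NNReal) : ℝ) = r * exp s := by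
    rw [NNReal.coe_mul, coe_toNNReal _ (exp_pos s).le]
  rw [h1, poissonWeight, mul_pow, ← Real.exp_nat_mul]
  have h2 : exp (-(r : ℝ)) * exp (s * (k - r)) =
      exp (r * (exp s - 1 - s)) * (exp (-(r * exp s)) * exp (k * s)) := by
    rw [← exp_add, ← exp_add, ← exp_add]
    congr 1; ring
  calc _ = (exp (-(r : ℝ)) * exp (s * (k - r))) * r ^ k / (k.factorial : ℝ) := by ring
    _ = _ := by rw [h2]; ring

lemma exp_sub_one_sub_le {s : ℝ} (hs : |s| ≤ 1) : exp s - 1 - s ≤ s ^ 2 :=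
  (le_abs_self _).trans (Real.abs_exp_sub_one_sub_id_le hs)

/-- The moment generating function of the centred law at `s = ±1/√r` is at most `e`, and `2 e ≤ 6`.
This gives concentration on the scale `√r` and the tail factor `exp (-(η √r))` used below. -/
lemma integrable_exp_abs_poisson (r : NNReal) (hr : 1 ≤ r) :
    Integrable (fun k : ℕ => exp (|(k : ℝ) - r| / √(r : ℝ))) (poissonMeasure r) ∧
      ∫ k : ℕ, exp (|(k : ℝ) - r| / √(r : ℝ)) ∂(poissonMeasure r) ≤ 6 := by
  have hr1 : (1 : ℝ) ≤ r := hr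
  set s : ℝ := (√(r : ℝ))⁻¹ with hs
  have hsq : 1 ≤ √(r : ℝ) := Real.one_le_sqrt.2 hr1
  have hs0 : 0 ≤ s := by positivity
  have hs1 : |s| ≤ 1 := by rw [abs_of_nonneg hs0]; exact inv_le_one_of_one_le₀ hsq
  have hrs : r * s ^ 2 = 1 := by
    rw [hs, inv_pow, sq_sqrt (by positivity)]; field_simp
  have hb : ∀ σ : ℝ, σ ^ 2 = s ^ 2 → |σ| ≤ 1 →
      Integrable (fun k : ℕ => exp (σ * (k - r))) (poissonMeasure r) ∧
      ∫ k : ℕ, exp (σ * (k - r)) ∂(poissonMeasure r) ≤ exp 1 := fun σ hσ hσ1 => by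
    have h := hasSum_poissonWeight_exp r σ
    refine ⟨integrable_poissonMeasure_weight.2 ?_, ?_⟩
    · simpa only [Real.abs_exp] using h.summable
    · rw [integral_poissonMeasure_weight, h.tsum_eq]
      refine Real.exp_le_exp.2 ?_
      refine (mul_le_mul_of_nonneg_left (exp_sub_one_sub_le hσ1) r.2).trans (le_of_eq ?_)
      rw [hσ]; exact hrs
  obtain ⟨i1, b1⟩ := hb s rfl hs1
  obtain ⟨i2, b2⟩ := hb (-s) (neg_sq s) (by rwa [abs_neg])
  have hpt : ∀ k : ℕ, exp (|(k : ℝ) - r| / √(r : ℝ)) ≤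
      exp (s * (k - r)) + exp (-s * (k - r)) := fun k => by
    rw [div_eq_mul_inv, mul_comm, ← hs]
    rcases abs_cases ((k : ℝ) - r) with ⟨h, _⟩ | ⟨h, _⟩ <;> rw [h]
    · have := exp_pos (-s * (k - r)); linarith
    · have := exp_pos (s * (k - r))
      rw [show s * -((k : ℝ) - r) = -s * (k - r) by ring]; linarith
  have hi : Integrable (fun k : ℕ => exp (|(k : ℝ) - r| / √(r : ℝ))) (poissonMeasure r) :=
    (i1.add i2).mono' Measurable.of_discrete.aestronglyMeasurable (ae_of_all _ fun k => by
      rw [norm_of_nonneg (exp_pos _).le]; exact hpt k)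
  refine ⟨hi, (integral_mono hi (i1.add i2) hpt).trans ?_⟩
  have e : ∫ k : ℕ, (exp (s * (k - r)) + exp (-s * (k - r))) ∂(poissonMeasure r) ≤
      exp 1 + exp 1 := by
    rw [integral_add i1 i2]; exact add_le_add b1 b2
  refine le_trans e ?_
  have := Real.exp_one_lt_d9
  linarith

/-- `x⁴ / 4! ≤ exp x` on the scale `√r`; the constant is `24 * 6`. -/
lemma integral_sub_pow_four_poisson_le (r : NNReal) (hr : 1 ≤ r) :
    Integrable (fun k : ℕ => ((k : ℝ) - r) ^ 4) (poissonMeasure r) ∧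
      ∫ k : ℕ, ((k : ℝ) - r) ^ 4 ∂(poissonMeasure r) ≤ 144 * (r : ℝ) ^ 2 := by
  obtain ⟨hi, hb⟩ := integrable_exp_abs_poisson r hr
  have hr1 : (1 : ℝ) ≤ r := hr
  have hsq : 0 < √(r : ℝ) := Real.sqrt_pos.2 (by linarith)
  have hpt : ∀ k : ℕ, ((k : ℝ) - r) ^ 4 ≤ 24 * (r : ℝ) ^ 2 * exp (|(k : ℝ) - r| / √(r : ℝ)) := fun k => by
    have h := Real.pow_div_factorial_le_exp (x := |(k : ℝ) - r| / √(r : ℝ)) (by positivity) 4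
    have h2 : √(r : ℝ) ^ 4 = (r : ℝ) ^ 2 := by
      rw [show (4 : ℕ) = 2 * 2 by norm_num, pow_mul, sq_sqrt (NNReal.coe_nonneg r)]
    rw [div_pow, h2, show (Nat.factorial 4 : ℝ) = 24 by norm_num [Nat.factorial], div_div,
      div_le_iff₀ (by positivity)] at h
    rw [← abs_of_nonneg (by positivity : (0 : ℝ) ≤ ((k : ℝ) - r) ^ 4), abs_pow]
    linarith
  have hi4 : Integrable (fun k : ℕ => ((k : ℝ) - r) ^ 4) (poissonMeasure r) :=
    (hi.const_mul _).mono' Measurable.of_discrete.aestronglyMeasurable (ae_of_all _ fun k => by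
      rw [norm_of_nonneg (by positivity)]; exact hpt k)
  refine ⟨hi4, (integral_mono hi4 (hi.const_mul _) hpt).trans ?_⟩
  rw [integral_const_mul]
  nlinarith [sq_nonneg (r : ℝ)]

lemma memLp_natCast_poisson (r : NNReal) (hr : 1 ≤ r) :
    MemLp (fun k : ℕ => (k : ℝ)) 2 (poissonMeasure r) := by
  have h4 := (integral_sub_pow_four_poisson_le r hr).1
  have h2 : MemLp (fun k : ℕ => (k : ℝ) - r) 2 (poissonMeasure r) := by
    rw [memLp_two_iff_integrable_sq Measurable.of_discrete.aestronglyMeasurable]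
    refine ((integrable_const (1 : ℝ)).add h4).mono' Measurable.of_discrete.aestronglyMeasurable
      (ae_of_all _ fun k => ?_)
    rw [norm_of_nonneg (sq_nonneg _)]
    simp only [Pi.add_apply]
    nlinarith [sq_nonneg (((k : ℝ) - r) ^ 2 - 1), sq_nonneg ((k : ℝ) - r)]
  have := h2.add (memLp_const (r : ℝ))
  refine this.congr_norm Measurable.of_discrete.aestronglyMeasurable (ae_of_all _ fun k => ?_)
  simp

lemma integral_natCast_poisson (r : NNReal) : ∫ k : ℕ, (k : ℝ) ∂(poissonMeasure r) = r := by
  have := integral_natCast_mul_poissonMeasure r fun _ => 1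
  simpa using this

lemma variance_natCast_poisson (r : NNReal) (hr : 1 ≤ r) :
    Var[fun k : ℕ => (k : ℝ); poissonMeasure r] = r := by
  have hm := memLp_natCast_poisson r hr
  have h2 := integral_natCast_mul_poissonMeasure r fun k => (k : ℝ)
  have hi : Integrable (fun k : ℕ => (k : ℝ)) (poissonMeasure r) := hm.integrable one_le_two
  push_cast at h2
  rw [integral_add hi (integrable_const _), integral_natCast_poisson] at h2
  rw [variance_eq_sub hm, integral_natCast_poisson]
  simp only [Pi.pow_apply, pow_two]
  rw [h2]
  simp
  ring

end PoissonMoments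

/-! ### Covariances of functionals of a Poisson sample -/

section Mecke

variable {E : Type*} [MeasurableSpace E] {π : Measure E} [IsProbabilityMeasure π]

lemma ae_poissonSample_eq {r : NNReal} {F : ℕ → (ℕ → E) → ℝ}
    (hF : Integrable (fun q : Config E => F q.1 q.2) (poissonSample r π)) :
    ∫ q, F q.1 q.2 ∂(poissonSample r π) = ∫ k, ∫ w, F k w ∂(iidSeq π) ∂(poissonMeasure r) :=
  integral_prod _ hF

lemma JointMeasurable.comp_points {g : E → Set E → ℝ} (hg : JointMeasurable g) (k : ℕ) :
    Measurable fun p : E × (ℕ → E) => g p.1 (p.2 '' Iio k) := by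
  simp only [image_Iio_eq_range]
  exact (hg k).comp (measurable_fst.prodMk
    (measurable_pi_lambda _ fun i => (measurable_pi_apply _).comp measurable_snd))

lemma JointMeasurable.measurable_points {g : E → Set E → ℝ} (hg : JointMeasurable g) :
    Measurable fun p : E × (Config E) => g p.1 (points p.2) := by
  refine measurable_of_nat_index (N := fun p : E × (Config E) => p.2.1)
    (measurable_fst.comp measurable_snd)
    (Φ := fun k (p : E × (Config E)) => g p.1 (p.2.2 '' Iio k)) fun k => ?_
  exact (hg.comp_points k).comp
    (measurable_fst.prodMk (measurable_snd.comp measurable_snd))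

lemma image_Iio_diff_eq_range {k n : ℕ} (hk : k < n + 1) (w : ℕ → E) :
    w '' (Iio (n + 1) \ {k}) = range fun j : Fin n => w ((⟨k, hk⟩ : Fin (n + 1)).succAbove j) := by
  ext x
  constructor
  · rintro ⟨i, ⟨hi, hik⟩, rfl⟩
    have : (⟨i, hi⟩ : Fin (n + 1)) ≠ ⟨k, hk⟩ := fun h => hik (Fin.mk.inj h)
    obtain ⟨j, hj⟩ := Fin.exists_succAbove_eq this
    exact ⟨j, by simp [hj]⟩
  · rintro ⟨j, rfl⟩
    refine ⟨_, ⟨Fin.is_lt _, fun h => ?_⟩, rfl⟩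
    exact Fin.succAbove_ne (⟨k, hk⟩ : Fin (n + 1)) j (Fin.ext h)

lemma JointMeasurable.measurable_image_diff {g : E → Set E → ℝ} (hg : JointMeasurable g)
    {k n : ℕ} (hk : k < n) :
    Measurable fun w : ℕ → E => g (w k) (w '' (Iio n \ {k})) := by
  obtain ⟨n, rfl⟩ := Nat.exists_eq_succ_of_ne_zero (by omega : n ≠ 0)
  simp only [Nat.succ_eq_add_one, image_Iio_diff_eq_range hk]
  have hm : Measurable fun w : ℕ → E =>
      (w k, fun j : Fin n => w ((⟨k, hk⟩ : Fin (n + 1)).succAbove j)) :=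
    (measurable_pi_apply k).prodMk (measurable_pi_lambda _ fun i => measurable_pi_apply _)
  exact (hg n).comp hm

lemma integral_image_diff {g : E → Set E → ℝ} (hg : JointMeasurable g) {k n : ℕ} (hk : k < n + 1) :
    ∫ w, g (w k) (w '' (Iio (n + 1) \ {k})) ∂(iidSeq π) =
      ∫ p, g p.1 (range p.2) ∂(rooted n π) := by
  have hmp := measurePreserving_eval_prodMk_infinitePi (fun _ : ℕ => π)
    (τ := fun j : Fin n => (((⟨k, hk⟩ : Fin (n + 1)).succAbove j : Fin (n + 1)) : ℕ)) k
    (Fin.val_injective.comp Fin.succAbove_right_injective)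
    (fun b h => Fin.succAbove_ne (⟨k, hk⟩ : Fin (n + 1)) b (Fin.ext h.symm))
  simp only [image_Iio_diff_eq_range hk]
  exact integral_comp_of_measurePreserving hmp (hg n).stronglyMeasurable

lemma integral_prod_poissonSample {r : NNReal} {g : E → Set E → ℝ} (hg : JointMeasurable g)
    {M : ℝ} (hM : ∀ x X, |g x X| ≤ M) :
    ∫ p, g p.1 (points p.2) ∂(π.prod (poissonSample r π)) =
      ∫ n, ∫ p, g p.1 (range p.2) ∂(rooted n π) ∂(poissonMeasure r) := by
  have hgi : Integrable (fun p : E × (Config E) => g p.1 (points p.2))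
      (π.prod (poissonSample r π)) :=
    Integrable.of_bound hg.measurable_points.aestronglyMeasurable M (ae_of_all _ fun p => hM _ _)
  have hgi' : Integrable (fun q : Config E => ∫ x, g x (points q) ∂π) (poissonSample r π) :=
    hgi.integral_prod_right
  rw [integral_prod_symm _ hgi]
  refine (ae_poissonSample_eq (F := fun n w => ∫ x, g x (w '' Iio n) ∂π) hgi').trans
    (integral_congr_ae (ae_of_all _ fun k => ?_))
  simp only
  have hmp := (MeasurePreserving.id π).prod (measurePreserving_comp_infinitePi (fun _ : ℕ => π)
    (σ := fun j : Fin k => (j : ℕ)) Fin.val_injective)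
  rw [← integral_comp_of_measurePreserving hmp (hg k).stronglyMeasurable]
  refine (integral_prod_symm _ (Integrable.of_bound (hg.comp_points k).aestronglyMeasurable M
    (ae_of_all _ fun p => hM _ _))).symm.trans ?_
  simp only [image_Iio_eq_range]
  rfl

/-- A finite tuple as an initial segment of a sequence. -/
def extendTuple (x : E) {m : ℕ} (u : Fin m → E) : Config E :=
  (m, fun j => if hj : j < m then u ⟨j, hj⟩ else x)

/-- Lets measurability in a sample of random size be specialized to tuples of fixed size. -/
lemma points_extendTuple (x : E) {m : ℕ} (u : Fin m → E) : points (extendTuple x u) = range u := by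
  ext y; constructor
  · rintro ⟨j, hj, rfl⟩
    simp only [extendTuple, Set.mem_Iio] at hj ⊢
    rw [dif_pos hj]; exact ⟨_, rfl⟩
  · rintro ⟨j, rfl⟩
    exact ⟨j, j.2, by simp [extendTuple]⟩

lemma measurable_extendTuple {α : Type*} [MeasurableSpace α] {m : ℕ} {x : α → E}
    (hx : Measurable x) {u : α → Fin m → E} (hu : Measurable u) :
    Measurable fun a => extendTuple (x a) (u a) := by
  refine measurable_const.prodMk (measurable_pi_lambda _ fun j => ?_)
  by_cases hj : j < m
  · simpa only [dif_pos hj] using! (measurable_pi_apply _).comp hu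
  · simpa only [dif_neg hj] using hx

/-- The Mecke formula for bounded functions that depend on an independent parameter. -/
lemma mecke_poissonSample {β : Type*} [MeasurableSpace β] (ρ : Measure β) [IsProbabilityMeasure ρ]
    {r : NNReal} (hr : 1 ≤ r) {g : β → E → Set E → ℝ}
    (hg : ∀ m, Measurable fun p : β × (E × (Fin m → E)) => g p.1 p.2.1 (range p.2.2))
    {M : ℝ} (hM : ∀ b x X, |g b x X| ≤ M) :
    Integrable (fun p : (Config E) × β =>
        ∑ k ∈ Finset.range p.1.1, g p.2 (p.1.2 k) (p.1.2 '' (Iio p.1.1 \ {k})))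
        ((poissonSample r π).prod ρ) ∧
      ∫ p, ∑ k ∈ Finset.range p.1.1, g p.2 (p.1.2 k) (p.1.2 '' (Iio p.1.1 \ {k}))
        ∂((poissonSample r π).prod ρ) =
      r * ∫ p, g p.2.2 p.1 (points p.2.1) ∂(π.prod ((poissonSample r π).prod ρ)) := by
  set PS := poissonSample r π
  have hgb : ∀ b, JointMeasurable (g b) := fun b m => (hg m).comp measurable_prodMk_left
  have hIn : Integrable (fun p : (Config E) × β =>
      ∑ k ∈ Finset.range p.1.1, g p.2 (p.1.2 k) (p.1.2 '' (Iio p.1.1 \ {k}))) (PS.prod ρ) := by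
    refine ((((memLp_natCast_poisson r hr).integrable one_le_two).comp_fst _).comp_fst ρ
      |>.const_mul M).mono' (measurable_of_nat_index (N := fun p : (Config E) × β => p.1.1)
      (by fun_prop) (Φ := fun n p => ∑ k ∈ Finset.range n, g p.2 (p.1.2 k)
        (p.1.2 '' (Iio n \ {k}))) fun n => ?_).aestronglyMeasurable (ae_of_all _ fun p => ?_)
    · refine Finset.measurable_fun_sum _ fun k hk => ?_
      obtain ⟨n, rfl⟩ := Nat.exists_eq_succ_of_ne_zero (Nat.ne_zero_of_lt (mem_range.1 hk))
      simp only [Nat.succ_eq_add_one, image_Iio_diff_eq_range (mem_range.1 hk)]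
      exact (hg n).comp (measurable_snd.prodMk ((by fun_prop : Measurable fun p : (Config E) × β =>
        p.1.2 k).prodMk (measurable_pi_lambda _ fun j => by fun_prop)))
    · refine (abs_sum_le_sum_abs _ _).trans
        ((sum_le_sum fun k _ => hM _ _ _).trans (le_of_eq ?_))
      rw [sum_const, card_range, nsmul_eq_mul, mul_comm]
  refine ⟨hIn, ?_⟩
  -- By exchangeability all labels contribute the same; for `n = 0` the factor `n` removes the
  -- truncated `n - 1`.
  have h1 : ∀ b, ∀ n : ℕ, ∫ w, ∑ k ∈ Finset.range n, g b (w k) (w '' (Iio n \ {k}))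
      ∂(iidSeq π) = n * ∫ p, g b p.1 (range p.2) ∂(rooted (n - 1) π) := fun b n => by
    cases n with
    | zero => simp
    | succ n =>
      rw [integral_finsetSum _ fun k hk => integrable_of_abs_le
        ((hgb b).measurable_image_diff (mem_range.1 hk)) fun w => hM _ _ _,
        sum_congr rfl fun k hk => integral_image_diff (hgb b) (mem_range.1 hk),
        sum_const, card_range, nsmul_eq_mul]
      simp
  have hm : Measurable fun p : E × ((Config E) × β) => g p.2.2 p.1 (points p.2.1) := by
    refine measurable_of_nat_index (N := fun p : E × ((Config E) × β) => p.2.1.1)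
      (by fun_prop) (Φ := fun k p => g p.2.2 p.1 (p.2.1.2 '' Iio k)) fun k => ?_
    simp only [image_Iio_eq_range]
    exact (hg k).comp ((by fun_prop : Measurable fun p : E × ((Config E) × β) => p.2.2).prodMk
      (measurable_fst.prodMk (measurable_pi_lambda _ fun j => by fun_prop)))
  rw [integral_prod_symm _ hIn, ← (measurePreserving_prodAssoc π PS ρ).integral_comp'
    (g := fun p : E × ((Config E) × β) => g p.2.2 p.1 (points p.2.1)),
    integral_prod_symm _ (integrable_of_abs_le (F := fun p => g _ _ (points (MeasurableEquiv.prodAssoc p).2.1))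
      (hm.comp MeasurableEquiv.prodAssoc.measurable) fun p => hM _ _ _),
    ← integral_const_mul]
  refine integral_congr_ae ?_
  filter_upwards [hIn.prod_left_ae] with b hb
  rw [ae_poissonSample_eq (F := fun n w => ∑ k ∈ Finset.range n, g b (w k) (w '' (Iio n \ {k}))) hb]
  simp_rw [h1]
  -- Stein–Chen trades the factor `n` and the `n - 1` remaining points for the factor `r` and `n`
  -- points.
  rw [integral_natCast_mul_poissonMeasure r fun n => ∫ p, g b p.1 (range p.2)
    ∂(rooted (n - 1) π)]
  exact congrArg _ (integral_prod_poissonSample (hgb b) (hM b)).symm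

end Mecke

/-! ### The variance of a Poisson functional along a spatial order -/

section ClarkOcone

variable {E : Type*}

/-- The configuration that agrees with `Y` before `x` and with `Y'` from `x` on. -/
def mixAt (c : E → ℝ) (x : E) (Y Y' : Set E) : Set E :=
  (Y ∩ {y | c y < c x}) ∪ (Y' ∩ {y | c y < c x}ᶜ)

lemma insert_mixAt (c : E → ℝ) (x : E) (Y Y' : Set E) :
    insert x (mixAt c x Y Y') = mixAt c x Y (insert x Y') := by
  ext y
  by_cases h : y = x <;> simp [mixAt, h]

lemma mixAt_insert_right {c : E → ℝ} {x z : E} (h : c x ≤ c z) (Y Y' : Set E) :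
    mixAt c x Y (insert z Y') = insert z (mixAt c x Y Y') := by
  ext y
  by_cases h' : y = z <;> simp [mixAt, h', h]

lemma mixAt_insert_left {c : E → ℝ} {x z : E} (h : c x ≤ c z) (Y Y' : Set E) :
    mixAt c x (insert z Y) Y' = mixAt c x Y Y' := by
  ext y
  by_cases h' : y = z <;> simp [mixAt, h', not_lt.2 h]

lemma mixAt_of_lt {c : E → ℝ} {z : E} {Y Y' : Set E} (h : ∀ y ∈ Y, c y < c z)
    (h' : ∀ y ∈ Y', c y < c z) : mixAt c z Y Y' = Y := by
  ext y
  have := h y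
  have := h' y
  simp only [mixAt, mem_union, mem_inter_iff, mem_ofPred_eq, mem_compl_iff]
  tauto

/-- Exchange the points of `X'` for those of `X` one at a time, in the order of their levels. -/
lemma sub_eq_sum_cost_mixAt [DecidableEq E] (c : E → ℝ) (n : ℕ) : ∀ (G : Set E → ℝ) (X X' : Finset E),
    X.card + X'.card = n → Set.InjOn c (↑X ∪ ↑X') → Disjoint X X' →
    G X - G X' = ∑ x ∈ X, cost G x (mixAt c x (↑X \ {x}) ↑X') -
      ∑ x ∈ X', cost G x (mixAt c x ↑X (↑X' \ {x})) := by
  induction n with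
  | zero =>
    intro G X X' hn _ _
    simp [card_eq_zero.1 (by omega : X.card = 0), card_eq_zero.1 (by omega : X'.card = 0)]
  | succ n ih =>
    intro G X X' hn hinj hd
    have hne : (X ∪ X').Nonempty := by
      rw [← Finset.card_pos, Finset.card_union_of_disjoint hd]; omega
    obtain ⟨z, hz, hmax⟩ := Finset.exists_max_image (X ∪ X') c hne
    have hlt : ∀ y, (y ∈ X ∨ y ∈ X') → y ≠ z → c y < c z := fun y hy hyz =>
      lt_of_le_of_ne (hmax y (Finset.mem_union.2 hy)) fun h =>
        hyz (hinj (by simpa using hy) (by simpa using hz) h)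
    have hdz : ∀ X₁ : Finset E, z ∉ X₁ → ((insert z X₁ : Finset E) : Set E) \ {z} = ↑X₁ := by
      simp +contextual
    have hdx : ∀ (X₁ : Finset E) x, x ≠ z →
        ((insert z X₁ : Finset E) : Set E) \ {x} = insert z (↑X₁ \ {x}) := fun X₁ x hx => by
      rw [coe_insert, Set.insert_sdiff_of_notMem _ (by simpa using hx.symm)]
    -- The point `z` of highest level is split off. In `X` it is invisible to the mixtures at lower
    -- points. In `X'` it belongs to all of them, and the induction is applied to `fun Y => G
    -- (insert z Y)`.
    rcases Finset.mem_union.1 hz with hzX | hzX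
    · obtain ⟨X₁, hz1, rfl⟩ : ∃ X₁, z ∉ X₁ ∧ X = insert z X₁ :=
        ⟨_, Finset.notMem_erase z X, (Finset.insert_erase hzX).symm⟩
      have hz' : z ∉ X' := Finset.disjoint_left.1 hd hzX
      have hs := Finset.subset_insert z X₁
      rw [Finset.card_insert_of_notMem hz1] at hn
      have hIH := ih G X₁ X' (by omega)
        (hinj.mono (Set.union_subset_union_left _ (by exact_mod_cast hs)))
        (Finset.disjoint_of_subset_left hs hd)
      rw [Finset.sum_insert hz1, hdz X₁ hz1, mixAt_of_lt (fun y hy => hlt y (Or.inl (hs hy))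
        (ne_of_mem_of_not_mem hy hz1)) fun y hy => hlt y (Or.inr hy) (ne_of_mem_of_not_mem hy hz'),
        sum_congr rfl fun x hx => by
          have hxz := ne_of_mem_of_not_mem hx hz1
          rw [hdx X₁ x hxz, mixAt_insert_left (hlt x (Or.inl (hs hx)) hxz).le],
        sum_congr (s₁ := X') rfl fun x hx => by
          rw [coe_insert, mixAt_insert_left
            (hlt x (Or.inr hx) (ne_of_mem_of_not_mem hx hz')).le], cost, coe_insert]
      linarith
    · obtain ⟨X₁, hz1, rfl⟩ : ∃ X₁, z ∉ X₁ ∧ X' = insert z X₁ :=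
        ⟨_, Finset.notMem_erase z X', (Finset.insert_erase hzX).symm⟩
      have hz' : z ∉ X := Finset.disjoint_right.1 hd hzX
      have hs := Finset.subset_insert z X₁
      rw [Finset.card_insert_of_notMem hz1] at hn
      have hIH := ih (fun Y => G (insert z Y)) X X₁ (by omega)
        (hinj.mono (Set.union_subset_union_right _ (by exact_mod_cast hs)))
        (Finset.disjoint_of_subset_right hs hd)
      have hcost : ∀ x Y, cost G x (insert z Y) = cost (fun Y => G (insert z Y)) x Y :=
        fun x Y => by rw [cost, cost, Set.insert_comm]
      rw [Finset.sum_insert hz1, hdz X₁ hz1, mixAt_of_lt (fun y hy => hlt y (Or.inl hy)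
        (ne_of_mem_of_not_mem hy hz')) fun y hy => hlt y (Or.inr (hs hy))
        (ne_of_mem_of_not_mem hy hz1), sum_congr (s₁ := X₁) rfl fun x hx => by
          have hxz := ne_of_mem_of_not_mem hx hz1
          rw [hdx X₁ x hxz, mixAt_insert_right (hlt x (Or.inr (hs hx)) hxz).le, hcost],
        sum_congr (s₁ := X) rfl fun x hx => by
          rw [coe_insert, mixAt_insert_right
            (hlt x (Or.inl hx) (ne_of_mem_of_not_mem hx hz')).le, hcost], cost, coe_insert]
      linarith

variable [MeasurableSpace E]

lemma ConfMeasurable.comp_mixAt {α ι κ β : Type*} [MeasurableSpace α] [MeasurableSpace β]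
    {G : Set E → β} (hG : ConfMeasurable G) {c : E → ℝ} (hc : Measurable c) (s : Finset ι)
    (t : Finset κ) {x : α → E} (hx : Measurable x) {v : ι → α → E} (hv : ∀ i, Measurable (v i))
    {w : κ → α → E} (hw : ∀ i, Measurable (w i)) :
    Measurable fun a => G (mixAt c (x a) ((fun i => v i a) '' s) ((fun i => w i a) '' t)) := by
  have h := hG.image_union s t hv hw (Q := fun i a => c (v i a) < c (x a))
    (fun i => measurableSet_lt (hc.comp (hv i)) (hc.comp hx))
    (R := fun i a => ¬ c (w i a) < c (x a))
    (fun i => (measurableSet_lt (hc.comp (hw i)) (hc.comp hx)).compl)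
  convert h using 3 with a
  ext y
  simp only [mixAt, mem_union, mem_inter_iff, mem_image, SetLike.mem_coe,
    mem_ofPred_eq, mem_compl_iff]
  grind

lemma ConfMeasurable.comp_cost_mixAt {α ι κ : Type*} [MeasurableSpace α]
    {G : Set E → ℝ} (hG : ConfMeasurable G) {c : E → ℝ} (hc : Measurable c) (s : Finset ι)
    (t : Finset κ) {x : α → E} (hx : Measurable x) {v : ι → α → E} (hv : ∀ i, Measurable (v i))
    {w : κ → α → E} (hw : ∀ i, Measurable (w i)) :
    Measurable fun a =>
      cost G (x a) (mixAt c (x a) ((fun i => v i a) '' s) ((fun i => w i a) '' t)) := by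
  have h1 := hG.comp_mixAt hc s t hx hv hw
  have h2 := hG.comp_mixAt hc s (Finset.insertNone t) hx hv
    (w := fun i a => Option.elim i (x a) fun i => w i a)
    (by rintro (_ | i); exacts [hx, hw i])
  have h3 : ∀ a, (fun i : Option κ => Option.elim i (x a) fun i => w i a) ''
      (Finset.insertNone t : Set (Option κ)) = Insert.insert (x a) ((fun i => w i a) '' t) := fun a => by
    ext y
    simp only [mem_image, SetLike.mem_coe, mem_insert_iff, Option.exists, Option.elim_none,
      Option.elim_some, Finset.none_mem_insertNone, true_and, Finset.some_mem_insertNone]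
    exact or_congr ⟨Eq.symm, Eq.symm⟩ Iff.rfl
  simp only [h3, ← insert_mixAt] at h2
  exact h2.sub h1

lemma measurable_cost_mixAt_points {α : Type*} [MeasurableSpace α] {G : Set E → ℝ}
    (hG : ConfMeasurable G) {c : E → ℝ} (hc : Measurable c) {x : α → E} (hx : Measurable x)
    {q q' : α → Config E} (hq : Measurable q) (hq' : Measurable q') :
    Measurable fun a => cost G (x a) (mixAt c (x a) (points (q a)) (points (q' a))) := by
  refine measurable_of_nat_index (N := fun a => (q a).1) (by fun_prop)
    (Φ := fun n a => cost G (x a) (mixAt c (x a) ((q a).2 '' Iio n) (points (q' a)))) fun n => ?_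
  refine measurable_of_nat_index (N := fun a => (q' a).1) (by fun_prop)
    (Φ := fun n' a => cost G (x a) (mixAt c (x a) ((q a).2 '' Iio n) ((q' a).2 '' Iio n')))
    fun n' => ?_
  have := hG.comp_cost_mixAt hc (Finset.Iio n) (Finset.Iio n') hx (v := fun i a => (q a).2 i)
    (fun i => by fun_prop) (w := fun i a => (q' a).2 i) (fun i => by fun_prop)
  simpa using this

lemma abs_cost_le {f : Set E → ℝ} {M : ℝ} (hM : ∀ X, |f X| ≤ M) (x : E) (X : Set E) :
    |cost f x X| ≤ 2 * M := by
  have := (abs_sub _ _).trans (add_le_add (hM (insert x X)) (hM X))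
  rw [cost]; linarith

lemma ConfMeasurable.measurable_points {β : Type*} [MeasurableSpace β] {f : Set E → β}
    (hf : ConfMeasurable f) : Measurable fun q : Config E => f (points q) :=
  hf.image_Iio (v := fun i (q : Config E) => q.2 i) (fun i => by fun_prop) measurable_fst

/-- The variance of a functional of a Poisson sample through the add one costs along a spatial
order. -/
lemma variance_poissonSample {π : Measure E} [IsProbabilityMeasure π] {r : NNReal}
    (hr : 1 ≤ r) {G : Set E → ℝ} (hG : ConfMeasurable G) {M : ℝ}
    (hM : ∀ X, |G X| ≤ M) {c : E → ℝ} (hc : Measurable c) (h0 : ∀ s, π (c ⁻¹' {s}) = 0) :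
    Integrable (fun x => ∫ q, ∫ q', cost G x (points q) *
      cost G x (mixAt c x (points q) (points q')) ∂(poissonSample r π) ∂(poissonSample r π)) π ∧
    Var[fun q => G (points q); poissonSample r π] =
      r * ∫ x, ∫ q, ∫ q', cost G x (points q) * cost G x (mixAt c x (points q) (points q'))
        ∂(poissonSample r π) ∂(poissonSample r π) ∂π := by
  classical
  set PS := poissonSample r π
  have hM0 : 0 ≤ M := (abs_nonneg _).trans (hM ∅)
  have hGp := hG.measurable_points
  have hb : ∀ X Y x, |G X * cost G x Y| ≤ M * (2 * M) := fun X Y x => by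
    rw [abs_mul]; exact mul_le_mul (hM X) (abs_cost_le hM x Y) (abs_nonneg _) hM0
  have hins : JointMeasurable fun x X => G (insert x X) := fun m => by
    simpa [cost, comp_def, Pi.add_def] using (hG.jointMeasurable_cost m).add ((hG m).comp measurable_snd)
  obtain ⟨hI1, hA1⟩ := mecke_poissonSample (π := π) PS hr
    (g := fun q' x Y => G (insert x Y) * cost G x (mixAt c x Y (points q')))
    (fun m => ((hins m).comp measurable_snd).mul (by
      simpa only [points_extendTuple, comp_apply] using measurable_cost_mixAt_points hG hc
        (measurable_fst.comp measurable_snd) (measurable_extendTuple (measurable_fst.comp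
        measurable_snd) (measurable_snd.comp measurable_snd)) measurable_fst)) fun _ _ _ => hb _ _ _
  obtain ⟨hI2, hA2⟩ := mecke_poissonSample (π := π) PS hr
    (g := fun q x Y' => G (points q) * cost G x (mixAt c x (points q) Y'))
    (fun m => (hGp.comp measurable_fst).mul (by
      simpa only [points_extendTuple, comp_apply] using measurable_cost_mixAt_points hG hc
        (measurable_fst.comp measurable_snd) measurable_fst (measurable_extendTuple
        (measurable_fst.comp measurable_snd) (measurable_snd.comp measurable_snd)))) fun _ _ _ => hb _ _ _
  have hmix : Measurable fun p : E × ((Config E) × (Config E)) =>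
      cost G p.1 (mixAt c p.1 (points p.2.1) (points p.2.2)) :=
    measurable_cost_mixAt_points hG hc measurable_fst (by fun_prop) (by fun_prop)
  have hK1 : Integrable (fun p : E × ((Config E) × (Config E)) =>
      G (insert p.1 (points p.2.1)) * cost G p.1 (mixAt c p.1 (points p.2.1) (points p.2.2)))
      (π.prod (PS.prod PS)) := integrable_of_abs_le ((hins.measurable_points.comp
    (measurable_fst.prodMk (measurable_fst.comp measurable_snd))).mul hmix) fun _ => hb _ _ _
  have hK2m := (hGp.comp (measurable_fst.comp measurable_snd)).mul hmix
  have hK2 : Integrable (fun p : E × ((Config E) × (Config E)) =>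
      G (points p.2.1) * cost G p.1 (mixAt c p.1 (points p.2.1) (points p.2.2)))
      (π.prod (PS.prod PS)) := integrable_of_abs_le hK2m fun _ => hb _ _ _
  have hsw := integral_comp_of_measurePreserving ((MeasurePreserving.id π).prod
    (Measure.measurePreserving_swap (μ := PS) (ν := PS))) hK2m.stronglyMeasurable
  -- The mean of the left side is the variance. Distinct levels hold almost surely because the level
  -- sets of `c` are null.
  have htel : ∀ᵐ q ∂PS, ∀ᵐ q' ∂PS, G (points q) * (G (points q) - G (points q')) =
      ∑ k ∈ Finset.range q.1, G (insert (q.2 k) (q.2 '' (Iio q.1 \ {k}))) *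
        cost G (q.2 k) (mixAt c (q.2 k) (q.2 '' (Iio q.1 \ {k})) (points q')) -
      ∑ k ∈ Finset.range q'.1, G (points q) *
        cost G (q'.2 k) (mixAt c (q'.2 k) (points q) (q'.2 '' (Iio q'.1 \ {k}))) := by
    have hinj : ∀ᵐ q ∂PS, Injective fun k => c (q.2 k) :=
      ae_poissonSample_snd r (ae_injective_infinitePi π hc h0)
    filter_upwards [hinj] with q hq
    have hne : ∀ᵐ q' ∂PS, ∀ j i, c (q'.2 j) ≠ c (q.2 i) := by
      refine ae_poissonSample_snd r (p := fun u => ∀ j i, c (u j) ≠ c (q.2 i)) ?_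
      refine ae_all_iff.2 fun j => ae_all_iff.2 fun i => ?_
      have : ∀ᵐ x ∂π, c x ≠ c (q.2 i) := by
        rw [ae_iff]
        convert h0 (c (q.2 i)) using 2
        ext x; simp
      exact (measurePreserving_eval_infinitePi (fun _ : ℕ => π) j).quasiMeasurePreserving.ae this
    filter_upwards [hinj, hne] with q' hq' hqq
    have hw : Injective q.2 := fun a b h => hq (by simp [h])
    have hw' : Injective q'.2 := fun a b h => hq' (by simp [h])
    have hX : ∀ p : Config E, points p = (((Finset.range p.1).image p.2 : Finset E) : Set E) :=
      fun p => by simp [points]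
    have ht := sub_eq_sum_cost_mixAt c _ G ((Finset.range q.1).image q.2)
      ((Finset.range q'.1).image q'.2) rfl (by
        rintro a ha b hb hab
        simp only [mem_union, SetLike.mem_coe, Finset.mem_image] at ha hb
        rcases ha with ⟨i, -, rfl⟩ | ⟨i, -, rfl⟩ <;> rcases hb with ⟨j, -, rfl⟩ | ⟨j, -, rfl⟩
        · rw [hq hab]
        · exact absurd hab.symm (hqq j i)
        · exact absurd hab (hqq i j)
        · rw [hq' hab]) (by
        simp only [Finset.disjoint_left, Finset.mem_image]
        rintro _ ⟨i, -, rfl⟩ ⟨j, -, h⟩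
        exact hqq j i (by rw [h]))
    rw [← hX, ← hX, Finset.sum_image fun a _ b _ h => hw h,
      Finset.sum_image fun a _ b _ h => hw' h] at ht
    have hd1 : ∀ (p : Config E), Injective p.2 → ∀ k,
        points p \ {p.2 k} = p.2 '' (Iio p.1 \ {k}) := fun p hp k => by
      rw [Set.image_sdiff hp, Set.image_singleton, points]
    simp only [hd1 q hw, hd1 q' hw'] at ht
    rw [ht, mul_sub, mul_sum, mul_sum]
    congr 1
    refine sum_congr rfl fun k hk => ?_
    rw [← image_insert_eq, Set.insert_sdiff_singleton,
      Set.insert_eq_of_mem (Set.mem_Iio.2 (mem_range.1 hk)), points]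
  -- In the difference of the two Mecke terms the factors `G (insert x X)` and `G X` combine into a
  -- second add one cost.
  have hi := (hK1.sub hK2).congr (ae_of_all _ fun p => show _ = cost G p.1 (points p.2.1) *
    cost G p.1 (mixAt c p.1 (points p.2.1) (points p.2.2)) by
      simp only [Pi.sub_apply, ← sub_mul]; rfl)
  have hin := hi.prod_right_ae.mono fun x hx => integral_prod _ hx
  have hG1 : Integrable (fun p => G (points p.1) ^ 2) (PS.prod PS) :=
    integrable_pow_of_abs_le (hGp.comp measurable_fst) (fun p => hM _) 2
  have hG2 := ((integrable_of_abs_le (μ := PS) hGp fun q => hM _).mul_prod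
    (integrable_of_abs_le (μ := PS) hGp fun q => hM _))
  have e := integral_fun_fst (μ := PS) (ν := PS) fun q => G (points q) ^ 2
  rw [probReal_univ, one_smul] at e
  refine ⟨hi.integral_prod_left.congr hin, ?_⟩
  rw [← integral_congr_ae hin, ← integral_prod _ hi, variance_eq_sub (memLp_of_abs_le hGp fun q => hM _)]
  simp only [Pi.pow_apply]
  rw [← e, sq (∫ q, _ ∂_), ← integral_prod_mul, ← integral_sub hG1 hG2]
  refine Eq.trans ?_ (congrArg (HMul.hMul (r : ℝ)) ((integral_congr_ae (ae_of_all _ fun p =>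
    sub_mul _ _ _)).trans (integral_sub hK1 hK2)).symm)
  rw [mul_sub, ← hA1]
  refine Eq.trans ?_ (congrArg (HSub.hSub _) ((integral_prod_swap _).trans
    (hA2.trans (congrArg (HMul.hMul (r : ℝ)) hsw))))
  refine ((integral_prod _ (hG1.sub hG2)).trans ?_).trans (((integral_prod _
    (hI1.sub hI2.swap)).symm).trans (integral_sub hI1 hI2.swap))
  refine integral_congr_ae (htel.mono fun q hq => integral_congr_ae (hq.mono fun q' h => ?_))
  simp only [Pi.sub_apply, comp_apply] at *
  rw [sq, ← mul_sub, h]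
  rfl

end ClarkOcone

/-! ### Growth of a functional with local add one costs under additional points -/

section Increments

variable {E : Type*} [PseudoMetricSpace E] [SecondCountableTopology E] [MeasurableSpace E]
  [BorelSpace E] {π : Measure E} [IsProbabilityMeasure π]

/-- The mean of `g x X` over a random `x`. -/
noncomputable def meanCost (π : Measure E) (g : E → Set E → ℝ) (X : Set E) : ℝ := ∫ x, g x X ∂π

lemma JointMeasurable.confMeasurable_meanCost {g : E → Set E → ℝ} (hg : JointMeasurable g) :
    ConfMeasurable (meanCost π g) := fun m =>
  ((hg m).comp measurable_swap).stronglyMeasurable.integral_prod_right'.measurable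

lemma JointMeasurable.measurable_left {g : E → Set E → ℝ} (hg : JointMeasurable g) {X : Set E}
    (hX : X.Finite) : Measurable fun x => g x X := by
  obtain ⟨m, u, rfl⟩ : ∃ m, ∃ u : Fin m → E, range u = X := by
    have := hX.to_subtype
    obtain ⟨m, ⟨e⟩⟩ := Finite.exists_equiv_fin X
    exact ⟨m, fun i => (e.symm i : E), by
      rw [show (fun i => (e.symm i : E)) = Subtype.val ∘ e.symm from rfl, range_comp,
        e.symm.surjective.range_eq]; simp⟩
  exact (hg m).comp (measurable_id.prodMk measurable_const)

lemma abs_meanCost_le {g : E → Set E → ℝ} {K : ℝ} (hK : ∀ x X, |g x X| ≤ K) (X : Set E) :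
    |meanCost π g X| ≤ K :=
  abs_integral_le_of_abs_le fun x => hK x X

/-- Efron–Stein: moving one point changes `g x X` only for `x` in the balls around its old and new
positions, which have mass at most `2 p`. -/
lemma variance_meanCost_le {g : E → Set E → ℝ} (hg : JointMeasurable g) {K R p : ℝ}
    (hK : ∀ x X, |g x X| ≤ K) (hloc : ∀ x X, g x X = g x (X ∩ closedBall x R))
    (hp : ∀ y, π.real (closedBall y R) ≤ p) (l : ℕ) :
    Var[fun u => meanCost π g (range u); iid l π] ≤ 8 * l * (K * p) ^ 2 := by
  have hne : Nonempty E := π.nonempty_of_neZero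
  have hK0 : 0 ≤ K := (abs_nonneg _).trans (hK hne.some ∅)
  refine (efronStein (hg.confMeasurable_meanCost (π := π) l)
    fun u => abs_meanCost_le hK _).trans ?_
  have hpt : ∀ (j : Fin l) (z : Fin l → E × E), (meanCost π g (range (sel ∅ z)) -
      meanCost π g (range (sel {j} z))) ^ 2 ≤ (4 * (K * p)) ^ 2 := fun j z => by
    refine sq_le_sq.2 ?_
    have hi : ∀ X : Set E, X.Finite → Integrable (fun x => g x X) π := fun X hX =>
      integrable_of_abs_le (hg.measurable_left hX) fun x => hK x X
    set X := range (sel ∅ z)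
    set X' := range (sel {j} z)
    set T := closedBall (z j).1 R ∪ closedBall (z j).2 R with hT
    have hTm : MeasurableSet T :=
      isClosed_closedBall.measurableSet.union isClosed_closedBall.measurableSet
    have hz : ∀ x ∉ T, g x X = g x X' := fun x hx => by
      rw [hloc x X, hloc x X']
      have hs : ∀ U V : Finset (Fin l), (∀ i, i ≠ j → sel U z i = sel V z i) →
          range (sel U z) ∩ closedBall x R ⊆ range (sel V z) ∩ closedBall x R := by
        rintro U V h _ ⟨⟨i, rfl⟩, hy⟩
        refine ⟨⟨i, (h i ?_).symm⟩, hy⟩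
        rintro rfl
        rw [mem_closedBall, dist_comm] at hy
        have : sel U z i = (z i).1 ∨ sel U z i = (z i).2 := by simp only [sel]; split_ifs <;> simp
        exact hx (this.imp (fun h => by rwa [h] at hy) fun h => by rwa [h] at hy)
      rw [(hs ∅ {j} fun i hi => by simp [sel, hi]).antisymm
        (hs {j} ∅ fun i hi => by simp [sel, hi])]
    have h1 : |meanCost π g X - meanCost π g X'| ≤ ∫ x, T.indicator (fun _ => 2 * K) x ∂π := by
      rw [meanCost, meanCost, ← integral_sub (hi _ (finite_range _)) (hi _ (finite_range _))]
      rw [← norm_eq_abs]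
      refine norm_integral_le_of_norm_le ((integrable_const (μ := π) (2 * K)).indicator hTm)
        (ae_of_all _ fun x => ?_)
      by_cases hx : x ∈ T
      · rw [indicator_of_mem hx, norm_eq_abs]
        have a := hK x X; have b := hK x X'
        rw [abs_le] at *; constructor <;> linarith
      · rw [indicator_of_notMem hx, hz x hx, sub_self, norm_zero]
    have hp0 : 0 ≤ p := measureReal_nonneg.trans (hp hne.some)
    rw [abs_of_nonneg (by positivity : 0 ≤ 4 * (K * p))]
    refine h1.trans ?_
    rw [integral_indicator_const _ hTm, smul_eq_mul]
    have := (measureReal_union_le (μ := π) (closedBall (z j).1 R)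
      (closedBall (z j).2 R)).trans (add_le_add (hp _) (hp _))
    rw [← hT] at this
    nlinarith
  have hsum : ∑ j : Fin l, ∫ z, (meanCost π g (range (sel ∅ z)) -
      meanCost π g (range (sel {j} z))) ^ 2 ∂(iid l (π.prod π)) ≤
      ∑ _j : Fin l, (4 * (K * p)) ^ 2 := by
    refine sum_le_sum fun j _ => ?_
    refine (integral_mono_of_nonneg (ae_of_all _ fun _ => sq_nonneg _) (integrable_const _)
      (ae_of_all _ fun z => hpt j z)).trans ?_
    simp
  refine (mul_le_mul_of_nonneg_left hsum (by norm_num)).trans (le_of_eq ?_)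
  simp; ring

/-- The first `l` points of a sequence. -/
abbrev firstPoints (w : ℕ → E) (l : ℕ) : Set E := w '' Iio l

lemma firstPoints_succ (w : ℕ → E) (l : ℕ) :
    firstPoints w (l + 1) = insert (w l) (firstPoints w l) := by
  rw [firstPoints, ← image_insert_eq]
  congr 1; ext i; simp [le_iff_eq_or_lt]

lemma integral_firstPoints {g : E → Set E → ℝ} (hg : JointMeasurable g) (l : ℕ) :
    ∫ w, g (w l) (firstPoints w l) ∂(iidSeq π) =
      ∫ p, g p.1 (range p.2) ∂(rooted l π) := by
  rw [← integral_image_diff hg (Nat.lt_succ_self l)]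
  have : Iio (l + 1) \ {l} = Iio l := by ext i; simp; omega
  rw [this]

lemma JointMeasurable.measurable_firstPoints {g : E → Set E → ℝ} (hg : JointMeasurable g)
    (l : ℕ) : Measurable fun w : ℕ → E => g (w l) (firstPoints w l) :=
  (hg.comp_points l).comp (f := fun w : ℕ → E => (w l, w))
    ((measurable_pi_apply l).prodMk measurable_id)

lemma ConfMeasurable.measurable_firstPoints {f : Set E → ℝ} (hf : ConfMeasurable f)
    (l : ℕ) : Measurable fun w : ℕ → E => f (firstPoints w l) :=
  hf.image_Iio (fun i => measurable_pi_apply i) measurable_const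

lemma measurePreserving_firstPoints (l : ℕ) : MeasurePreserving (fun (w : ℕ → E) (i : Fin l) => w i)
      (iidSeq π) (iid l π) :=
  measurePreserving_comp_infinitePi _ Fin.val_injective

lemma integral_sq_sum_le {α : Type*} [MeasurableSpace α] {μ : Measure α} {k : ℕ}
    {a : ℕ → α → ℝ} {b : ℝ} (hi : ∀ i < k, Integrable (fun w => a i w ^ 2) μ)
    (h : ∀ i < k, ∫ w, a i w ^ 2 ∂μ ≤ b) :
    ∫ w, (∑ i ∈ Finset.range k, a i w) ^ 2 ∂μ ≤ k ^ 2 * b := by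
  have hi' : ∀ i ∈ Finset.range k, Integrable (fun w => a i w ^ 2) μ :=
    fun i h => hi i (mem_range.1 h)
  calc ∫ w, (∑ i ∈ Finset.range k, a i w) ^ 2 ∂μ
      ≤ ∫ w, (k : ℝ) * ∑ i ∈ Finset.range k, a i w ^ 2 ∂μ := by
        refine integral_mono_of_nonneg (ae_of_all _ fun _ => sq_nonneg _)
          ((integrable_finsetSum _ hi').const_mul _) (ae_of_all _ fun w => ?_)
        simpa using sq_sum_le_card_mul_sum_sq (s := Finset.range k) (f := fun i => a i w)
    _ = k * ∑ i ∈ Finset.range k, ∫ w, a i w ^ 2 ∂μ := by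
        rw [integral_const_mul, integral_finsetSum _ hi']
    _ ≤ k * ∑ i ∈ Finset.range k, b := by
        gcongr with i hi
        exact h i (mem_range.1 hi)
    _ = k ^ 2 * b := by simp; ring

/-- The summands are bounded martingale differences: given the first `l` points, the next one is
independent of them and `meanCost` is the conditional mean. Orthogonality makes the second moment
linear in `k`. -/
lemma integral_sq_martingale_le {g : E → Set E → ℝ} (hg : JointMeasurable g) {K : ℝ}
    (hK : ∀ x X, |g x X| ≤ K) (n k : ℕ) :
    ∫ w, (∑ i ∈ Finset.range k, (g (w (n + i)) (firstPoints w (n + i)) -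
        meanCost π g (firstPoints w (n + i)))) ^ 2 ∂(iidSeq π) ≤
      4 * K ^ 2 * k := by
  set Q := iidSeq π
  set M : ℕ → (ℕ → E) → ℝ := fun l w => g (w l) (firstPoints w l) - meanCost π g (firstPoints w l)
    with hM
  have hMm : ∀ l, Measurable (M l) := fun l =>
    (hg.measurable_firstPoints l).sub (hg.confMeasurable_meanCost.measurable_firstPoints l)
  have hMb : ∀ l w, |M l w| ≤ 2 * K := fun l w => by
    have a := hK (w l) (firstPoints w l); have b := abs_meanCost_le (π := π) hK (firstPoints w l)
    simp only [hM]
    rw [abs_le] at *; constructor <;> linarith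
  have hSb : ∀ k w, |∑ i ∈ Finset.range k, M (n + i) w| ≤ k * (2 * K) := fun k w => by
    refine (abs_sum_le_sum_abs _ _).trans ((sum_le_sum fun i _ => hMb _ w).trans ?_)
    simp
  have hSm : ∀ k, Measurable fun w => ∑ i ∈ Finset.range k, M (n + i) w := fun k =>
    Finset.measurable_sum _ fun i _ => hMm _
  induction k with
  | zero => simp
  | succ k ih =>
    set S := fun w => ∑ i ∈ Finset.range k, M (n + i) w with hS
    set l := n + k with hl
    have horth : ∫ w, S w * M l w ∂Q = 0 := by
      -- The sequence with the entry `l` removed: it has the same first `l` points and is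
      -- independent of `w l`.
      set τ : ℕ → ℕ := fun j => if j < l then j else j + 1 with hτ
      have hτi : Injective τ := by
        intro a b h; simp only [hτ] at h; split_ifs at h <;> omega
      have hτd : ∀ b, l ≠ τ b := by intro b; simp only [hτ]; split_ifs <;> omega
      have hfp : ∀ (w : ℕ → E) j, j ≤ l → firstPoints (fun i => w (τ i)) j = firstPoints w j := fun w j hj => by
        refine Set.image_congr fun i hi => ?_
        have : i < l := lt_of_lt_of_le hi hj
        simp [hτ, this]
      have hSτ : ∀ w, S (fun i => w (τ i)) = S w := fun w => by
        refine sum_congr rfl fun i hi => ?_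
        have hi' := mem_range.1 hi
        have : τ (n + i) = n + i := by simp only [hτ]; rw [if_pos]; omega
        simp only [hM]
        rw [hfp w _ (by omega), this]
      have hmp := measurePreserving_eval_prodMk_infinitePi (fun _ : ℕ => π) l hτi hτd
      have hmeas : Measurable fun p : E × (ℕ → E) => S p.2 * (g p.1 (firstPoints p.2 l) -
          meanCost π g (firstPoints p.2 l)) :=
        ((hSm k).comp measurable_snd).mul ((hg.comp_points l).sub
          ((hg.confMeasurable_meanCost.measurable_firstPoints l).comp measurable_snd))
      have h1 : ∫ w, S w * M l w ∂Q = ∫ p, S p.2 * (g p.1 (firstPoints p.2 l) -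
          meanCost π g (firstPoints p.2 l)) ∂(π.prod Q) := by
        rw [← integral_comp_of_measurePreserving hmp hmeas.stronglyMeasurable]
        refine integral_congr_ae (ae_of_all _ fun w => ?_)
        simp only [hM, hSτ, hfp w l le_rfl]
      have hIn : Integrable (fun p : E × (ℕ → E) => S p.2 * (g p.1 (firstPoints p.2 l) -
          meanCost π g (firstPoints p.2 l))) (π.prod Q) := by
        refine integrable_of_abs_le hmeas (b := k * (2 * K) * (2 * K)) fun p => ?_
        rw [abs_mul]
        have a := hK p.1 (firstPoints p.2 l)
        have b := abs_meanCost_le (π := π) hK (firstPoints p.2 l)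
        have hK0 : 0 ≤ K := (abs_nonneg _).trans a
        refine mul_le_mul (hSb k _) ?_ (abs_nonneg _) (by positivity)
        rw [abs_le] at *; constructor <;> linarith
      rw [h1, integral_prod_symm _ hIn]
      refine integral_eq_zero_of_ae (ae_of_all _ fun w => ?_)
      have hgi : Integrable (fun x => g x (firstPoints w l)) π :=
        integrable_of_abs_le (hg.measurable_left (toFinite _)) fun x => hK _ _
      simp only [Pi.zero_apply]
      rw [integral_const_mul, integral_sub hgi (integrable_const _)]
      simp [meanCost]
    have hi1 : Integrable (fun w => S w ^ 2) Q := integrable_pow_of_abs_le (hSm k) (hSb k) 2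
    have hi2 : Integrable (fun w => M l w ^ 2) Q := integrable_pow_of_abs_le (hMm l) (hMb l) 2
    have hi3 : Integrable (fun w => S w * M l w) Q :=
      integrable_of_abs_le (b := k * (2 * K) * (2 * K)) ((hSm k).mul (hMm l)) fun w => by
        rw [abs_mul]
        exact mul_le_mul (hSb k w) (hMb l w) (abs_nonneg _) ((abs_nonneg _).trans (hSb k w))
    have h2 : ∫ w, M l w ^ 2 ∂Q ≤ 4 * K ^ 2 := by
      refine (integral_mono hi2 (integrable_const (4 * K ^ 2)) fun w => ?_).trans (by simp)
      have := pow_le_pow_left₀ (abs_nonneg _) (hMb l w) 2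
      rw [sq_abs] at this
      simp only; linarith
    have hexp : ∀ w, (∑ i ∈ Finset.range (k + 1), M (n + i) w) ^ 2 =
        (S w ^ 2 + 2 * (S w * M l w)) + M l w ^ 2 := fun w => by
      rw [Finset.sum_range_succ]; ring
    change ∫ w, (∑ i ∈ Finset.range (k + 1), M (n + i) w) ^ 2 ∂Q ≤ _
    change ∫ w, S w ^ 2 ∂Q ≤ _ at ih
    simp_rw [hexp]
    have hi13 : Integrable (fun w => S w ^ 2 + 2 * (S w * M l w)) Q := hi1.add (hi3.const_mul 2)
    rw [integral_add hi13 hi2, integral_add hi1 (hi3.const_mul 2), integral_const_mul, horth]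
    push_cast; linarith

/-- The growth along the sequence minus `α k` has four parts: the errors of replacing costs by `g`,
a martingale, the fluctuations of the conditional means, and the deviation of the means from `α`.
The first and last are of order `s k` in mean square sense; the other two have second moment of
order `k`, for the third because `k ≤ n + k` and `(n + k) p ≤ c`. -/
lemma integral_sq_increment_le {f : Set E → ℝ} (hf : ConfMeasurable f) {M : ℝ}
    (hM : ∀ X, |f X| ≤ M) {g : E → Set E → ℝ} (hg : JointMeasurable g) {K R p c s α : ℝ}
    (hK : ∀ x X, |g x X| ≤ K) (hloc : ∀ x X, g x X = g x (X ∩ closedBall x R))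
    (hp : ∀ y, π.real (closedBall y R) ≤ p) (n k : ℕ) (hc : (n + k) * p ≤ c)
    (happ : ∀ l, n ≤ l → l < n + k → ∫ q, (cost f q.1 (range q.2) - g q.1 (range q.2)) ^ 2
      ∂(rooted l π) ≤ s ^ 2 ∧ |∫ q, g q.1 (range q.2) ∂(rooted l π) - α| ≤ s) :
    ∫ w, (f (firstPoints w (n + k)) - f (firstPoints w n) - α * k) ^ 2
      ∂(iidSeq π) ≤
      8 * s ^ 2 * k ^ 2 + (16 + 32 * c ^ 2) * K ^ 2 * k := by
  set Q := iidSeq π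
  have hne : Nonempty E := π.nonempty_of_neZero
  have hp0 : 0 ≤ p := measureReal_nonneg.trans (hp hne.some)
  set φ : ℕ → ℝ := fun l => ∫ q, g q.1 (range q.2) ∂(rooted l π) with hφ
  have hcm := hf.jointMeasurable_cost
  have hmm : ConfMeasurable (meanCost π g) := hg.confMeasurable_meanCost
  have hsub : ∀ a b : ℝ, ∀ A B : ℝ, |a| ≤ A → |b| ≤ B → |a - b| ≤ A + B := fun a b A B ha hb =>
    (abs_sub _ _).trans (add_le_add ha hb)
  set a : ℕ → (ℕ → E) → ℝ := fun i w =>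
    cost f (w (n + i)) (firstPoints w (n + i)) - g (w (n + i)) (firstPoints w (n + i)) with ha
  set b : ℕ → (ℕ → E) → ℝ := fun i w =>
    g (w (n + i)) (firstPoints w (n + i)) - meanCost π g (firstPoints w (n + i)) with hb
  set e : ℕ → (ℕ → E) → ℝ := fun i w => meanCost π g (firstPoints w (n + i)) - φ (n + i) with he
  have ham : ∀ i, Measurable (a i) := fun i =>
    (hcm.measurable_firstPoints _).sub (hg.measurable_firstPoints _)
  have hbm : ∀ i, Measurable (b i) := fun i =>
    (hg.measurable_firstPoints _).sub (hmm.measurable_firstPoints _)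
  have hem : ∀ i, Measurable (e i) := fun i => (hmm.measurable_firstPoints _).sub_const _
  have hab : ∀ i w, |a i w| ≤ 2 * M + K := fun i w => hsub _ _ _ _ (abs_cost_le hM _ _) (hK _ _)
  have hbb : ∀ i w, |b i w| ≤ K + K := fun i w => hsub _ _ _ _ (hK _ _) (abs_meanCost_le hK _)
  have hφb : ∀ l, |φ l| ≤ K := fun l => abs_integral_le_of_abs_le fun q => hK _ _
  have heb : ∀ i w, |e i w| ≤ K + K := fun i w => hsub _ _ _ _ (abs_meanCost_le hK _) (hφb _)
  have htel : ∀ w : ℕ → E, f (firstPoints w (n + k)) - f (firstPoints w n) - α * k =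
      (∑ i ∈ Finset.range k, a i w) + (∑ i ∈ Finset.range k, b i w) +
        (∑ i ∈ Finset.range k, e i w) + ∑ i ∈ Finset.range k, (φ (n + i) - α) := fun w => by
    have := Finset.sum_range_sub (fun i => f (firstPoints w (n + i))) k
    simp only [add_zero] at this
    rw [← this, ← sum_add_distrib, ← sum_add_distrib, ← sum_add_distrib,
      show α * k = ∑ _i ∈ Finset.range k, α by simp [mul_comm], ← sum_sub_distrib]
    refine sum_congr rfl fun i _ => ?_
    simp only [ha, hb, he, cost]
    rw [← add_assoc, firstPoints_succ]; ring
  have hI : ∀ (x : ℕ → (ℕ → E) → ℝ) (B : ℝ), (∀ i, Measurable (x i)) → (∀ i w, |x i w| ≤ B) →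
      Integrable (fun w => (∑ i ∈ Finset.range k, x i w) ^ 2) Q := fun x B hm hx =>
    integrable_pow_of_abs_le (Finset.measurable_fun_sum _ fun i _ => hm i) (b := k * B) (fun w =>
      (abs_sum_le_sum_abs _ _).trans ((sum_le_sum fun i _ => hx i w).trans (by simp))) 2
  have hIa := hI a _ ham hab
  have hIb := hI b _ hbm hbb
  have hIe := hI e _ hem heb
  have hJa : ∫ w, (∑ i ∈ Finset.range k, a i w) ^ 2 ∂Q ≤ k ^ 2 * s ^ 2 := by
    refine integral_sq_sum_le (fun i _ => integrable_pow_of_abs_le (ham i) (hab i) 2) fun i hi => ?_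
    have hjm : JointMeasurable fun x X => (cost f x X - g x X) ^ 2 := fun m =>
      ((hcm m).sub (hg m)).pow_const 2
    exact (integral_firstPoints hjm (n + i)).trans_le (happ (n + i) (by omega) (by omega)).1
  have hJb : ∫ w, (∑ i ∈ Finset.range k, b i w) ^ 2 ∂Q ≤ 4 * K ^ 2 * k :=
    integral_sq_martingale_le hg hK n k
  have hJe : ∫ w, (∑ i ∈ Finset.range k, e i w) ^ 2 ∂Q ≤ k ^ 2 * (8 * (n + k) * (K * p) ^ 2) := by
    refine integral_sq_sum_le (fun i _ => integrable_pow_of_abs_le (hem i) (heb i) 2) fun i hi => ?_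
    have hmp := measurePreserving_firstPoints (π := π) (n + i)
    have hfr : ∀ w : ℕ → E, firstPoints w (n + i) = range fun j : Fin (n + i) => w j :=
      fun w => image_Iio_eq_range w _
    have hmean : ∫ u, meanCost π g (range u) ∂(iid (n + i) π) = φ (n + i) := by
      simp only [hφ]
      rw [integral_prod_symm _ (integrable_of_abs_le (hg _) fun q => hK _ _)]
      rfl
    have hv : ∫ w, e i w ^ 2 ∂Q = Var[fun u => meanCost π g (range u); iid (n + i) π] := by
      rw [variance_eq_integral (hmm _).aemeasurable, hmean, ← integral_comp_of_measurePreserving hmp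
        (((hmm _).sub_const _).pow_const 2).stronglyMeasurable]
      simp only [he, hfr, Q]
    rw [hv]
    refine (variance_meanCost_le hg hK hloc hp _).trans ?_
    push_cast
    gcongr
  have hJφ : (∑ i ∈ Finset.range k, (φ (n + i) - α)) ^ 2 ≤ k ^ 2 * s ^ 2 := by
    have := (abs_sum_le_sum_abs (fun i => φ (n + i) - α) (Finset.range k)).trans
      (sum_le_sum fun i hi => (happ (n + i) (by omega) (by have := mem_range.1 hi; omega)).2)
    rw [← mul_pow, ← sq_abs]
    exact pow_le_pow_left₀ (abs_nonneg _) (by simpa using this) 2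
  set D := ∑ i ∈ Finset.range k, (φ (n + i) - α)
  have hpt : ∀ w, (f (firstPoints w (n + k)) - f (firstPoints w n) - α * k) ^ 2 ≤
      4 * (((∑ i ∈ Finset.range k, a i w) ^ 2 + (∑ i ∈ Finset.range k, b i w) ^ 2) +
        (∑ i ∈ Finset.range k, e i w) ^ 2 + D ^ 2) := fun w => by
    rw [htel w]
    set x := ∑ i ∈ Finset.range k, a i w
    set y := ∑ i ∈ Finset.range k, b i w
    set z := ∑ i ∈ Finset.range k, e i w
    nlinarith [sq_nonneg (x - y), sq_nonneg (x - z), sq_nonneg (x - D), sq_nonneg (y - z),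
      sq_nonneg (y - D), sq_nonneg (z - D)]
  have hIab := hIa.fun_add hIb
  have hIabe := hIab.fun_add hIe
  refine (integral_mono_of_nonneg (ae_of_all _ fun _ => sq_nonneg _)
    ((hIabe.fun_add (integrable_const (D ^ 2))).const_mul 4)
    (ae_of_all _ hpt)).trans ?_
  rw [integral_const_mul, integral_add hIabe (integrable_const _), integral_add hIab hIe,
    integral_add hIa hIb]
  have hkp : (k : ℝ) ^ 2 * (8 * (n + k) * (K * p) ^ 2) ≤ 8 * c ^ 2 * K ^ 2 * k := by
    have h1 : ((n + k : ℝ) * p) ^ 2 ≤ c ^ 2 := pow_le_pow_left₀ (by positivity) hc 2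
    calc (k : ℝ) ^ 2 * (8 * (n + k) * (K * p) ^ 2) =
        8 * k * K ^ 2 * p ^ 2 * (k * (n + k)) := by ring
      _ ≤ 8 * k * K ^ 2 * p ^ 2 * ((n + k) * (n + k)) := by gcongr; simp
      _ = 8 * k * K ^ 2 * ((n + k) * p) ^ 2 := by ring
      _ ≤ 8 * k * K ^ 2 * c ^ 2 := by gcongr
      _ = _ := by ring
  simp only [integral_const, probReal_univ, one_smul]
  nlinarith

end Increments

/-! ### Sequences of functionals with asymptotically local add one costs -/

section LocalSeq

variable {E : Type*} [PseudoMetricSpace E] [SecondCountableTopology E] [MeasurableSpace E]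
  [BorelSpace E]

/-- Functionals `f n` of samples of about `r n` points from `π n` whose add one costs are
approximated in mean square by bounded local functions, with asymptotic mean `α`. -/
structure LocalSeq (π : ℕ → Measure E) (r : ℕ → NNReal) (f : ℕ → Set E → ℝ) (α : ℝ) : Prop where
  conf : ∀ n, ConfMeasurable (f n)
  bound : ∃ M : ℕ → ℝ, (∀ n X, |f n X| ≤ M n) ∧
    ∀ η > 0, Tendsto (fun n => M n ^ 2 * exp (-(η * √(r n : ℝ)))) atTop (𝓝 0)
  moment : ∃ C : ℝ, ∀ᶠ n in atTop, ∀ l : ℕ, |(l : ℝ) - r n| ≤ r n / 4 →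
    ∫ p, cost (f n) p.1 (range p.2) ^ 4 ∂(rooted l (π n)) ≤ C
  approx : ∀ s > 0, ∃ R K η : ℝ, 0 < η ∧ ∀ᶠ n in atTop, ∃ g : E → Set E → ℝ, JointMeasurable g ∧
    (∀ x X, |g x X| ≤ K) ∧ (∀ x X, g x X = g x (X ∩ closedBall x R)) ∧
    ∀ l : ℕ, |(l : ℝ) - r n| ≤ η * r n →
      ∫ p, (cost (f n) p.1 (range p.2) - g p.1 (range p.2)) ^ 2
        ∂(rooted l (π n)) ≤ s ^ 2 ∧
      |∫ p, g p.1 (range p.2) ∂(rooted l (π n)) - α| ≤ s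

lemma local_mono {g : E → Set E → ℝ} {R R' : ℝ} (hR : R ≤ R')
    (hg : ∀ x X, g x X = g x (X ∩ closedBall x R)) (x : E) (X : Set E) :
    g x X = g x (X ∩ closedBall x R') := by
  rw [hg x X, hg x (X ∩ closedBall x R'), inter_assoc,
    inter_eq_self_of_subset_right (Metric.closedBall_subset_closedBall hR)]

variable {π : ℕ → Measure E} [∀ n, IsProbabilityMeasure (π n)] {r : ℕ → NNReal}
  {f f' : ℕ → Set E → ℝ} {α α' : ℝ}

lemma LocalSeq.add (h : LocalSeq π r f α) (h' : LocalSeq π r f' α') :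
    LocalSeq π r (fun n X => f n X + f' n X) (α + α') := by
  obtain ⟨M, hM, hMt⟩ := h.bound
  obtain ⟨M', hM', hMt'⟩ := h'.bound
  have hcost : ∀ n x X, cost (fun X => f n X + f' n X) x X = cost (f n) x X + cost (f' n) x X :=
    fun n x X => by simp only [cost]; ring
  have hcm : ∀ n l, Measurable fun p : E × (Fin l → E) => cost (f n) p.1 (range p.2) :=
    fun n l => (h.conf n).jointMeasurable_cost l
  have hcm' : ∀ n l, Measurable fun p : E × (Fin l → E) => cost (f' n) p.1 (range p.2) :=
    fun n l => (h'.conf n).jointMeasurable_cost l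
  have hcb := fun n => abs_cost_le (hM n)
  have hcb' := fun n => abs_cost_le (hM' n)
  refine ⟨fun n m => ((h.conf n) m).add ((h'.conf n) m), ⟨fun n => M n + M' n, fun n X =>
    (abs_add_le _ _).trans (add_le_add (hM n X) (hM' n X)), fun η hη => ?_⟩, ?_, ?_⟩
  · refine squeeze_zero (fun n => by positivity) (fun n => ?_)
      (by simpa using ((hMt η hη).add (hMt' η hη)).const_mul 2)
    rw [← add_mul, ← mul_assoc]
    gcongr
    nlinarith [sq_nonneg (M n - M' n)]
  · obtain ⟨C, hC⟩ := h.moment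
    obtain ⟨C', hC'⟩ := h'.moment
    refine ⟨8 * (C + C'), ?_⟩
    filter_upwards [hC, hC'] with n h1 h2 l hl
    have i1 := integrable_pow_of_abs_le (μ := rooted l (π n)) (hcm n l)
      (fun p => hcb n p.1 (range p.2)) 4
    have i2 := integrable_pow_of_abs_le (μ := rooted l (π n)) (hcm' n l)
      (fun p => hcb' n p.1 (range p.2)) 4
    refine (integral_mono_of_nonneg (ae_of_all _ fun p => by positivity)
      ((i1.fun_add i2).const_mul 8) (ae_of_all _ fun p => ?_)).trans ?_
    · simp only [hcost]
      set a := cost (f n) p.1 (range p.2)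
      set b := cost (f' n) p.1 (range p.2)
      have := pow_le_pow_left₀ (sq_nonneg (a + b))
        (by nlinarith [sq_nonneg (a - b)] : (a + b) ^ 2 ≤ 2 * (a ^ 2 + b ^ 2)) 2
      nlinarith [sq_nonneg (a ^ 2 - b ^ 2)]
    · rw [integral_const_mul, integral_add i1 i2]
      have := h1 l hl; have := h2 l hl; linarith
  · intro s hs
    obtain ⟨R, K, η, hη, hE⟩ := h.approx (s / 2) (by positivity)
    obtain ⟨R', K', η', hη', hE'⟩ := h'.approx (s / 2) (by positivity)
    refine ⟨max R R', K + K', min η η', lt_min hη hη', ?_⟩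
    filter_upwards [hE, hE'] with n h1 h2
    obtain ⟨g, hg, hgK, hgl, hga⟩ := h1
    obtain ⟨g', hg', hgK', hgl', hga'⟩ := h2
    refine ⟨fun x X => g x X + g' x X, fun m => (hg m).add (hg' m), fun x X =>
      (abs_add_le _ _).trans (add_le_add (hgK x X) (hgK' x X)), fun x X => ?_, fun l hl => ?_⟩
    · simp only
      rw [local_mono (le_max_left R R') hgl x X, local_mono (le_max_right R R') hgl' x X]
    obtain ⟨a1, a2⟩ := hga l (hl.trans (by gcongr; exact min_le_left _ _))
    obtain ⟨b1, b2⟩ := hga' l (hl.trans (by gcongr; exact min_le_right _ _))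
    have i1 := integrable_pow_of_abs_le (μ := rooted l (π n)) ((hcm n l).fun_sub (hg l))
      (fun p => (abs_sub _ _).trans (add_le_add (hcb n p.1 _) (hgK p.1 _))) 2
    have i2 := integrable_pow_of_abs_le (μ := rooted l (π n)) ((hcm' n l).fun_sub (hg' l))
      (fun p => (abs_sub _ _).trans (add_le_add (hcb' n p.1 _) (hgK' p.1 _))) 2
    refine ⟨(integral_mono_of_nonneg (ae_of_all _ fun p => sq_nonneg _)
      ((i1.fun_add i2).const_mul 2) (ae_of_all _ fun p => ?_)).trans ?_, ?_⟩
    · simp only [hcost]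
      nlinarith [sq_nonneg ((cost (f n) p.1 (range p.2) - g p.1 (range p.2)) -
        (cost (f' n) p.1 (range p.2) - g' p.1 (range p.2)))]
    · rw [integral_const_mul, integral_add i1 i2]
      nlinarith
    · rw [integral_add (integrable_of_abs_le (hg l) fun p => hgK _ _)
        (integrable_of_abs_le (hg' l) fun p => hgK' _ _)]
      rw [abs_le] at *
      constructor <;> linarith

lemma LocalSeq.const_mul (h : LocalSeq π r f α) (c : ℝ) :
    LocalSeq π r (fun n X => c * f n X) (c * α) := by
  obtain ⟨M, hM, hMt⟩ := h.bound
  have hcost : ∀ n x X, cost (fun X => c * f n X) x X = c * cost (f n) x X :=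
    fun n x X => by simp only [cost]; ring
  refine ⟨fun n m => ((h.conf n) m).const_mul c, ⟨fun n => |c| * M n, fun n X => ?_, fun η hη => ?_⟩,
    ?_, ?_⟩
  · rw [abs_mul]; exact mul_le_mul_of_nonneg_left (hM n X) (abs_nonneg _)
  · have := (hMt η hη).const_mul (c ^ 2)
    rw [mul_zero] at this
    refine this.congr fun n => ?_
    rw [mul_pow, sq_abs]; ring
  · obtain ⟨C, hC⟩ := h.moment
    refine ⟨c ^ 4 * C, ?_⟩
    filter_upwards [hC] with n h1 l hl
    simp only [hcost, mul_pow, integral_const_mul]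
    exact mul_le_mul_of_nonneg_left (h1 l hl) (by positivity)
  · intro s hs
    have hc0 : 0 < |c| + 1 := by positivity
    obtain ⟨R, K, η, hη, hE⟩ := h.approx (s / (|c| + 1)) (by positivity)
    refine ⟨R, |c| * K, η, hη, ?_⟩
    filter_upwards [hE] with n h1
    obtain ⟨g, hg, hgK, hgl, hga⟩ := h1
    refine ⟨fun x X => c * g x X, fun m => (hg m).const_mul c, fun x X => ?_, fun x X => ?_,
      fun l hl => ?_⟩
    · rw [abs_mul]; exact mul_le_mul_of_nonneg_left (hgK x X) (abs_nonneg _)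
    · simp only
      rw [hgl x X]
    have hs' : |c| * (s / (|c| + 1)) ≤ s := by
      rw [mul_div_assoc', div_le_iff₀ hc0]; nlinarith [abs_nonneg c]
    obtain ⟨a1, a2⟩ := hga l hl
    simp only [hcost, ← mul_sub, mul_pow, integral_const_mul]
    constructor
    · calc _ ≤ c ^ 2 * (s / (|c| + 1)) ^ 2 := by gcongr
        _ = (|c| * (s / (|c| + 1))) ^ 2 := by rw [mul_pow, sq_abs]
        _ ≤ s ^ 2 := by gcongr
    · rw [abs_mul]
      exact (mul_le_mul_of_nonneg_left a2 (abs_nonneg _)).trans hs'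

/-- Stability under linear combinations is what makes one-dimensional limit theorems sufficient. -/
lemma LocalSeq.sum {k : ℕ} {f : Fin k → ℕ → Set E → ℝ} {α : Fin k → ℝ}
    (h : ∀ i, LocalSeq π r (f i) (α i)) (c : Fin k → ℝ) :
    LocalSeq π r (fun n X => ∑ i, c i * f i n X) (∑ i, c i * α i) := by
  induction k with
  | zero =>
    have hc : ∀ x X, cost (fun _ : Set E => (0 : ℝ)) x X = 0 := fun x X => sub_self _
    refine ⟨fun n m => by simp, ⟨fun _ => 0, by simp, by simp⟩, ⟨0, ?_⟩, fun s hs =>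
      ⟨0, 0, 1, one_pos, Eventually.of_forall fun n => ⟨fun _ _ => 0, fun m => by simp, by simp,
        by simp, fun l _ => ?_⟩⟩⟩
    · simp [hc]
    · simp [hc, hs.le]
  | succ k ih =>
    simp only [Fin.sum_univ_succ]
    exact ((h 0).const_mul (c 0)).add (ih (fun i => h i.succ) fun i => c i.succ)

/-- The covariance is bounded by expanding `Var[θX ± Y] ≥ 0`. -/
lemma abs_variance_sub_le {Ω : Type*} [MeasurableSpace Ω] {μ : Measure Ω} [IsProbabilityMeasure μ]
    {X Y : Ω → ℝ} (hX : MemLp X 2 μ) (hY : MemLp Y 2 μ) {θ : ℝ} (hθ : 0 < θ) :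
    |Var[X - Y; μ] - Var[X; μ]| ≤ θ * Var[X; μ] + (1 + θ⁻¹) * Var[Y; μ] := by
  have hV := variance_nonneg Y μ
  have h1 := variance_nonneg (θ • X + Y) μ
  have h2 := variance_nonneg (θ • X - Y) μ
  rw [variance_add (hX.const_smul θ) hY, variance_smul, covariance_smul_left] at h1
  rw [variance_sub (hX.const_smul θ) hY, variance_smul, covariance_smul_left] at h2
  rw [variance_sub hX hY]
  have e : θ⁻¹ * θ = 1 := inv_mul_cancel₀ hθ.ne'
  have h1' := mul_nonneg (inv_nonneg.2 hθ.le) h1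
  have h2' := mul_nonneg (inv_nonneg.2 hθ.le) h2
  have e1 : θ⁻¹ * (θ ^ 2 * Var[X; μ] + 2 * (θ * cov[X, Y; μ]) + Var[Y; μ]) =
    θ * Var[X; μ] + 2 * cov[X, Y; μ] + θ⁻¹ * Var[Y; μ] := by field_simp
  have e2 : θ⁻¹ * (θ ^ 2 * Var[X; μ] - 2 * (θ * cov[X, Y; μ]) + Var[Y; μ]) =
    θ * Var[X; μ] - 2 * cov[X, Y; μ] + θ⁻¹ * Var[Y; μ] := by field_simp
  rw [e1] at h1'
  rw [e2] at h2'
  rw [abs_le]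
  constructor <;> linarith

/-- An error of mean square `o(n)` does not affect a variance of order `n`. -/
lemma tendsto_variance_of_perturbation {Ω : ℕ → Type*} [∀ n, MeasurableSpace (Ω n)]
    {μ : ∀ n, Measure (Ω n)} [∀ n, IsProbabilityMeasure (μ n)] {X Y : ∀ n, Ω n → ℝ}
    (hX : ∀ᶠ n in atTop, MemLp (X n) 2 (μ n)) (hY : ∀ᶠ n in atTop, MemLp (Y n) 2 (μ n)) {v : ℝ}
    (hv : Tendsto (fun n : ℕ => (n : ℝ)⁻¹ * Var[X n; μ n]) atTop (𝓝 v))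
    (h0 : Tendsto (fun n : ℕ => (n : ℝ)⁻¹ * ∫ ω, Y n ω ^ 2 ∂(μ n)) atTop (𝓝 0)) :
    Tendsto (fun n : ℕ => (n : ℝ)⁻¹ * Var[X n - Y n; μ n]) atTop (𝓝 v) := by
  have key : Tendsto (fun n : ℕ => (n : ℝ)⁻¹ * Var[X n - Y n; μ n] -
      (n : ℝ)⁻¹ * Var[X n; μ n]) atTop (𝓝 0) := by
    rw [Metric.tendsto_atTop']
    intro ε hε
    have hv0 : 0 ≤ v := ge_of_tendsto' hv fun n =>
      mul_nonneg (by positivity) (variance_nonneg _ _)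
    set θ := ε / (2 * (v + 1)) with hθd
    have hθ : 0 < θ := by positivity
    have hlim := (hv.const_mul θ).add (h0.const_mul (1 + θ⁻¹))
    have hlt : θ * v + (1 + θ⁻¹) * 0 < ε := by
      rw [mul_zero, add_zero, hθd, div_mul_eq_mul_div, div_lt_iff₀ (by positivity)]; nlinarith
    obtain ⟨N, hN⟩ := eventually_atTop.1 ((hlim.eventually_lt_const hlt).and (hX.and hY))
    refine ⟨N, fun n hn => ?_⟩
    obtain ⟨h1, h2, h3⟩ := hN n hn.le
    rw [dist_eq, sub_zero, ← mul_sub, abs_mul, abs_of_nonneg (by positivity)]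
    refine lt_of_le_of_lt ?_ h1
    have hYv : Var[Y n; μ n] ≤ ∫ ω, Y n ω ^ 2 ∂(μ n) := variance_le_expectation_sq h3.1
    calc (n : ℝ)⁻¹ * |Var[X n - Y n; μ n] - Var[X n; μ n]| ≤
        (n : ℝ)⁻¹ * (θ * Var[X n; μ n] + (1 + θ⁻¹) * ∫ ω, Y n ω ^ 2 ∂(μ n)) := by
          gcongr
          refine (abs_variance_sub_le h2 h3 hθ).trans ?_
          gcongr
      _ = _ := by ring
  simpa using key.add hv

/-- Both signs of `m - n` are covered by symmetry. The constant becomes `2 c` because `η ≤ 1` bounds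
the sample sizes by `2 ρ`. -/
lemma integral_sq_increment_le_of_window {p : Measure E} [IsProbabilityMeasure p]
    {f : Set E → ℝ} (hf : ConfMeasurable f) {M : ℝ}
    (hM : ∀ X, |f X| ≤ M) {g : E → Set E → ℝ} (hg : JointMeasurable g) {K R c s α ρ η : ℝ}
    (hK : ∀ x X, |g x X| ≤ K) (hloc : ∀ x X, g x X = g x (X ∩ closedBall x R))
    (hρ : 0 < ρ) (hp : ∀ y, p.real (closedBall y R) * ρ ≤ c) (hη : η ≤ 1)
    (happ : ∀ l : ℕ, |(l : ℝ) - ρ| ≤ η * ρ →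
      ∫ q, (cost f q.1 (range q.2) - g q.1 (range q.2)) ^ 2
      ∂(rooted l p) ≤ s ^ 2 ∧ |∫ q, g q.1 (range q.2) ∂(rooted l p) - α| ≤ s)
    {m n : ℕ} (hm : |(m : ℝ) - ρ| ≤ η * ρ) (hn : |(n : ℝ) - ρ| ≤ η * ρ) :
    ∫ w, (f (firstPoints w m) - f (firstPoints w n) - α * ((m : ℝ) - n)) ^ 2
      ∂(iidSeq p) ≤
      8 * s ^ 2 * ((m : ℝ) - n) ^ 2 + (16 + 32 * (2 * c) ^ 2) * K ^ 2 * |(m : ℝ) - n| := by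
  have main : ∀ m n : ℕ, n ≤ m → |(m : ℝ) - ρ| ≤ η * ρ → |(n : ℝ) - ρ| ≤ η * ρ →
      ∫ w, (f (firstPoints w m) - f (firstPoints w n) - α * ((m : ℝ) - n)) ^ 2
      ∂(iidSeq p) ≤
      8 * s ^ 2 * ((m : ℝ) - n) ^ 2 + (16 + 32 * (2 * c) ^ 2) * K ^ 2 * |(m : ℝ) - n| := fun m n hnm hm hn => by
    obtain ⟨k, rfl⟩ := Nat.exists_eq_add_of_le hnm
    have hk : ((n + k : ℕ) : ℝ) - n = k := by push_cast; ring
    rw [hk, abs_of_nonneg (Nat.cast_nonneg k)]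
    refine integral_sq_increment_le hf hM hg hK hloc (p := c / ρ)
      (fun y => by rw [le_div_iff₀ hρ]; exact hp y) n k ?_ fun l hl hl' => happ l ?_
    · have hne : Nonempty E := p.nonempty_of_neZero
      have hc : 0 ≤ c := (mul_nonneg measureReal_nonneg hρ.le).trans (hp hne.some)
      rw [mul_div_assoc', div_le_iff₀ hρ]
      have : (n + k : ℝ) ≤ 2 * ρ := by
        have := (abs_le.1 hm).2; push_cast at this; nlinarith
      nlinarith
    · have h1 : (n : ℝ) ≤ l := by exact_mod_cast hl
      have h2 : (l : ℝ) ≤ (n + k : ℕ) := by exact_mod_cast hl'.le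
      rw [abs_le] at *
      constructor <;> linarith
  rcases le_total n m with h | h
  · exact main m n h hm hn
  · have := main n m h hn hm
    rw [abs_sub_comm, ← neg_sub (n : ℝ) m, neg_sq]
    refine le_trans (le_of_eq ?_) this
    congr 1; ext w; ring

end LocalSeq

/-! ### De-Poissonization of the variance -/

section Decorrelation

variable {E : Type*} [PseudoMetricSpace E] [SecondCountableTopology E] [MeasurableSpace E]
  [BorelSpace E]

lemma integral_sq_sub_poisson (r : NNReal) (hr : 1 ≤ r) :
    Integrable (fun k : ℕ => ((k : ℝ) - r) ^ 2) (poissonMeasure r) ∧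
      ∫ k : ℕ, ((k : ℝ) - r) ^ 2 ∂(poissonMeasure r) = r := by
  have hm := memLp_natCast_poisson r hr
  refine ⟨(hm.sub (memLp_const (r : ℝ))).integrable_sq, ?_⟩
  have := variance_natCast_poisson r hr
  rwa [variance_eq_integral hm.aemeasurable, integral_natCast_poisson] at this

/-- If the Poisson number is within `η ρ` of `ρ`, the window estimate applies, its linear term being
absorbed by `|x| ≤ x² / a + a`. Otherwise the crude bounds `M` and `α |k - n|` are used, made small
by `1 ≤ exp (-(η √ρ)) exp (|k - ρ| / √ρ)` and by the fourth moment. -/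
lemma integral_sq_poisson_increment_le {p : Measure E} [IsProbabilityMeasure p]
    {f : Set E → ℝ} (hf : ConfMeasurable f) {M : ℝ}
    (hM : ∀ X, |f X| ≤ M) {g : E → Set E → ℝ} (hg : JointMeasurable g) {K R c s α η a D : ℝ}
    {ρ : NNReal}
    (hK : ∀ x X, |g x X| ≤ K) (hloc : ∀ x X, g x X = g x (X ∩ closedBall x R))
    (hρ : 1 ≤ ρ) (hp : ∀ y, p.real (closedBall y R) * ρ ≤ c) (hη0 : 0 < η) (hη : η ≤ 1)
    (happ : ∀ l : ℕ, |(l : ℝ) - ρ| ≤ η * ρ →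
      ∫ q, (cost f q.1 (range q.2) - g q.1 (range q.2)) ^ 2
      ∂(rooted l p) ≤ s ^ 2 ∧ |∫ q, g q.1 (range q.2) ∂(rooted l p) - α| ≤ s)
    {n : ℕ} (hn : |(n : ℝ) - ρ| ≤ η * ρ) (ha : 0 < a) (hD : ((n : ℝ) - ρ) ^ 2 ≤ D) :
    ∫ q, (f (points q) - f (firstPoints q.2 n) - α * ((q.1 : ℝ) - n)) ^ 2 ∂(poissonSample ρ p) ≤
      (8 * s ^ 2 + (16 + 32 * (2 * c) ^ 2) * K ^ 2 / a) * (2 * ρ + 2 * D) +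
        (16 + 32 * (2 * c) ^ 2) * K ^ 2 * a +
        (8 * M ^ 2 + 4 * α ^ 2 * D) * exp (-(η * √(ρ : ℝ))) * 6 +
        4 * α ^ 2 / (η * ρ) ^ 2 * (144 * (ρ : ℝ) ^ 2) := by
  have hρ0 : (0 : ℝ) < ρ := lt_of_lt_of_le one_pos (by exact_mod_cast hρ)
  set C := (16 + 32 * (2 * c) ^ 2) * K ^ 2 with hC
  have hC0 : 0 ≤ C := by positivity
  obtain ⟨i2, e2⟩ := integral_sq_sub_poisson ρ hρ
  obtain ⟨i4, e4⟩ := integral_sub_pow_four_poisson_le ρ hρ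
  obtain ⟨ix, ex⟩ := integrable_exp_abs_poisson ρ hρ
  set F : ℕ → (ℕ → E) → ℝ := fun k w =>
    (f (firstPoints w k) - f (firstPoints w n) - α * ((k : ℝ) - n)) ^ 2 with hF
  have hM0 : 0 ≤ M := (abs_nonneg _).trans (hM ∅)
  have hFb : ∀ k w, F k w ≤ 8 * M ^ 2 + 2 * α ^ 2 * ((k : ℝ) - n) ^ 2 := fun k w => by
    have h1 : |f (firstPoints w k) - f (firstPoints w n)| ≤ 2 * M :=
      (abs_sub _ _).trans (by have := hM (firstPoints w k); have := hM (firstPoints w n); linarith)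
    have h2 := sq_le_sq' (by linarith [(abs_le.1 h1).1]) (abs_le.1 h1).2
    simp only [hF]
    nlinarith [sq_nonneg (f (firstPoints w k) - f (firstPoints w n) + α * ((k : ℝ) - n))]
  have hx2 : ∀ k : ℕ, ((k : ℝ) - n) ^ 2 ≤ 2 * ((k : ℝ) - ρ) ^ 2 + 2 * D := fun k => by
    nlinarith [sq_nonneg (((k : ℝ) - ρ) + (n - ρ))]
  have hFm : Measurable fun q : Config E => F q.1 q.2 := by
    have h1 : Measurable fun q : Config E => f (points q) := hf.measurable_points
    have h2 : Measurable fun q : Config E => f (firstPoints q.2 n) :=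
      (hf.measurable_firstPoints n).comp measurable_snd
    have h3 : Measurable fun q : Config E => (q.1 : ℝ) :=
      (measurable_of_countable (fun k : ℕ => (k : ℝ))).comp measurable_fst
    exact ((h1.sub h2).sub ((h3.sub_const _).const_mul α)).pow_const 2
  have hFi : Integrable (fun q : Config E => F q.1 q.2) (poissonSample ρ p) := by
    have := (((i2.const_mul 2).add (integrable_const (2 * D))).const_mul (2 * α ^ 2)).add
      (integrable_const (8 * M ^ 2))
    refine (this.comp_fst (iidSeq p)).mono' hFm.aestronglyMeasurable
      (ae_of_all _ fun q => ?_)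
    rw [norm_of_nonneg (sq_nonneg _)]
    have h1 := hFb q.1 q.2
    have h2 := mul_le_mul_of_nonneg_left (hx2 q.1) (by positivity : 0 ≤ 2 * α ^ 2)
    simp only [Pi.add_apply]
    linarith
  have hpt : ∀ k : ℕ, ∫ w, F k w ∂(iidSeq p) ≤
      (8 * s ^ 2 + C / a) * (2 * ((k : ℝ) - ρ) ^ 2 + 2 * D) + C * a +
        (8 * M ^ 2 + 4 * α ^ 2 * D) * exp (-(η * √(ρ : ℝ))) *
          exp (|(k : ℝ) - ρ| / √(ρ : ℝ)) + 4 * α ^ 2 / (η * ρ) ^ 2 * ((k : ℝ) - ρ) ^ 4 := fun k => by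
    have hD0 : 0 ≤ D := (sq_nonneg _).trans hD
    by_cases hk : |(k : ℝ) - ρ| ≤ η * ρ
    · have h1 := integral_sq_increment_le_of_window hf hM hg hK hloc hρ0 hp hη happ hk hn
      have h2 : |(k : ℝ) - n| ≤ ((k : ℝ) - n) ^ 2 / a + a := by
        rw [div_add' _ _ _ ha.ne', le_div_iff₀ ha, ← sq_abs ((k : ℝ) - n)]
        nlinarith [sq_nonneg (|(k : ℝ) - n| - a), abs_nonneg ((k : ℝ) - n)]
      have h3 : 8 * s ^ 2 * ((k : ℝ) - n) ^ 2 + C * |(k : ℝ) - n| ≤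
          (8 * s ^ 2 + C / a) * ((k : ℝ) - n) ^ 2 + C * a := by
        have := mul_le_mul_of_nonneg_left h2 hC0
        calc _ ≤ 8 * s ^ 2 * ((k : ℝ) - n) ^ 2 + C * (((k : ℝ) - n) ^ 2 / a + a) := by linarith
          _ = _ := by ring
      have h4 := mul_le_mul_of_nonneg_left (hx2 k) (by positivity : 0 ≤ 8 * s ^ 2 + C / a)
      have h5 : 0 ≤ (8 * M ^ 2 + 4 * α ^ 2 * D) * exp (-(η * √(ρ : ℝ))) *
          exp (|(k : ℝ) - ρ| / √(ρ : ℝ)) := by positivity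
      have h6 : 0 ≤ 4 * α ^ 2 / (η * ρ) ^ 2 * ((k : ℝ) - ρ) ^ 4 := by positivity
      linarith
    · rw [not_le] at hk
      have h1 : ∫ w, F k w ∂(iidSeq p) ≤ 8 * M ^ 2 + 2 * α ^ 2 * ((k : ℝ) - n) ^ 2 :=
        (integral_mono_of_nonneg (ae_of_all _ fun _ => sq_nonneg _) (integrable_const _)
          (ae_of_all _ fun w => hFb k w)).trans (by simp)
      have h2 : 1 ≤ exp (-(η * √(ρ : ℝ))) * exp (|(k : ℝ) - ρ| / √(ρ : ℝ)) := by
        rw [← exp_add, Real.one_le_exp_iff]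
        have : η * √(ρ : ℝ) ≤ |(k : ℝ) - ρ| / √(ρ : ℝ) := by
          rw [le_div_iff₀ (by positivity), mul_assoc, mul_self_sqrt hρ0.le]; exact hk.le
        linarith
      have h5 : 4 * α ^ 2 * ((k : ℝ) - ρ) ^ 2 ≤
          4 * α ^ 2 / (η * ρ) ^ 2 * ((k : ℝ) - ρ) ^ 4 := by
        rw [div_mul_eq_mul_div, le_div_iff₀ (by positivity), mul_assoc]
        refine mul_le_mul_of_nonneg_left ?_ (by positivity)
        have := pow_le_pow_left₀ (by positivity) hk.le 2
        rw [sq_abs] at this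
        nlinarith [sq_nonneg ((k : ℝ) - ρ)]
      have h4 := mul_le_mul_of_nonneg_left (hx2 k) (by positivity : 0 ≤ 2 * α ^ 2)
      have h6 := mul_le_mul_of_nonneg_left h2 (by positivity : 0 ≤ 8 * M ^ 2 + 4 * α ^ 2 * D)
      have h7 : 0 ≤ (8 * s ^ 2 + C / a) * (2 * ((k : ℝ) - ρ) ^ 2 + 2 * D) + C * a := by positivity
      rw [← mul_assoc, mul_one] at h6
      linarith
  have j1 : Integrable (fun k : ℕ => (8 * s ^ 2 + C / a) * (2 * ((k : ℝ) - ρ) ^ 2 + 2 * D) + C * a)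
      (poissonMeasure ρ) :=
    (((i2.const_mul 2).add (integrable_const _)).const_mul _).add (integrable_const _)
  have j2 := ix.const_mul ((8 * M ^ 2 + 4 * α ^ 2 * D) * exp (-(η * √(ρ : ℝ))))
  have j3 := i4.const_mul (4 * α ^ 2 / (η * ρ) ^ 2)
  calc ∫ q, (f (points q) - f (firstPoints q.2 n) - α * ((q.1 : ℝ) - n)) ^ 2 ∂(poissonSample ρ p)
      = ∫ k, ∫ w, F k w ∂(iidSeq p) ∂(poissonMeasure ρ) :=
        ae_poissonSample_eq hFi
    _ ≤ _ := integral_mono_of_nonneg (ae_of_all _ fun k => integral_nonneg fun w => sq_nonneg _)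
        ((j1.fun_add j2).fun_add j3) (ae_of_all _ hpt)
    _ ≤ _ := by
        rw [integral_add (j1.fun_add j2) j3, integral_add j1 j2,
          integral_add (((i2.const_mul 2).fun_add (integrable_const _)).const_mul _)
            (integrable_const _), integral_const_mul, integral_const_mul, integral_const_mul,
          integral_add (i2.const_mul 2) (integrable_const _), integral_const_mul, e2]
        simp only [integral_const, probReal_univ, one_smul]
        have hD0 : 0 ≤ D := (sq_nonneg _).trans hD
        rw [integral_const_mul]
        gcongr

variable {π : ℕ → Measure E} [∀ n, IsProbabilityMeasure (π n)] {r : ℕ → NNReal}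
  {f : ℕ → Set E → ℝ} {α : ℝ}

lemma tendsto_div_natCast {b : ℝ} (hr : ∀ᶠ n : ℕ in atTop, |(r n : ℝ) - n| ≤ b * √(n : ℝ)) :
    Tendsto (fun n : ℕ => (r n : ℝ) / n) atTop (𝓝 1) := by
  have h0 : Tendsto (fun n : ℕ => b * (√(n : ℝ))⁻¹) atTop (𝓝 0) := by
    simpa using (tendsto_inv_atTop_zero.comp (tendsto_sqrt_atTop.comp
      tendsto_natCast_atTop_atTop)).const_mul b
  have h1 : Tendsto (fun n : ℕ => (r n : ℝ) / n - 1) atTop (𝓝 0) := by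
    refine squeeze_zero_norm' ?_ h0
    filter_upwards [hr, eventually_gt_atTop 0] with n hn h
    have hn0 : (0 : ℝ) < n := by exact_mod_cast h
    rw [div_sub_one hn0.ne', norm_div, norm_eq_abs, norm_of_nonneg hn0.le, div_le_iff₀ hn0]
    refine hn.trans (le_of_eq ?_)
    have : (n : ℝ) = √n * √n := (mul_self_sqrt hn0.le).symm
    have h3 : √(n : ℝ) ≠ 0 := by positivity
    rw [mul_assoc]
    congr 1
    rw [eq_inv_mul_iff_mul_eq₀ h3]; exact this.symm
  simpa using h1.add_const 1

lemma tendsto_atTop_of_sub_le {b : ℝ} (hr : ∀ᶠ n : ℕ in atTop, |(r n : ℝ) - n| ≤ b * √(n : ℝ)) :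
    Tendsto (fun n => (r n : ℝ)) atTop atTop := by
  have := (tendsto_div_natCast hr).pos_mul_atTop one_pos tendsto_natCast_atTop_atTop
  refine this.congr' ?_
  filter_upwards [eventually_gt_atTop 0] with n h
  have hn0 : (n : ℝ) ≠ 0 := by exact_mod_cast h.ne'
  field_simp

/-- The previous estimate with `a = √n` and `D = b² n`. After division by `n` only a multiple of
`s²` remains, because the growth condition in `bound` kills the contribution of atypical sample
sizes. -/
lemma LocalSeq.tendsto_decorrelation (h : LocalSeq π r f α) {b : ℝ}
    (hr : ∀ᶠ n : ℕ in atTop, |(r n : ℝ) - n| ≤ b * √(n : ℝ))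
    (hπ : ∀ R, ∃ c, ∀ᶠ n in atTop, ∀ y, (π n).real (closedBall y R) * r n ≤ c) :
    Tendsto (fun n : ℕ => (n : ℝ)⁻¹ * ∫ q, (f n (points q) - f n (firstPoints q.2 n) -
      α * ((q.1 : ℝ) - n)) ^ 2 ∂(poissonSample (r n) (π n))) atTop (𝓝 0) := by
  obtain ⟨M, hM, hMt⟩ := h.bound
  have hrn := tendsto_div_natCast hr
  have hr1 := tendsto_atTop_of_sub_le hr
  rw [Metric.tendsto_atTop']
  intro ε hε
  obtain ⟨s, hs, hsε⟩ : ∃ s > 0, 8 * s ^ 2 * (2 * 1 + 2 * b ^ 2) < ε := by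
    have : Tendsto (fun s : ℝ => 8 * s ^ 2 * (2 * 1 + 2 * b ^ 2)) (𝓝[>] 0) (𝓝 0) := by
      refine Tendsto.mono_left ?_ nhdsWithin_le_nhds
      have : Continuous fun s : ℝ => 8 * s ^ 2 * (2 * 1 + 2 * b ^ 2) := by fun_prop
      simpa using this.tendsto 0
    obtain ⟨s, h1, h2⟩ := ((this.eventually_lt_const hε).and self_mem_nhdsWithin).exists
    exact ⟨s, h2, h1⟩
  obtain ⟨R, K, η', hη', happ⟩ := h.approx s hs
  obtain ⟨c, hc⟩ := hπ R
  set η := min η' 1 with hηd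
  have hη : 0 < η := lt_min hη' one_pos
  set C := (16 + 32 * (2 * c) ^ 2) * K ^ 2 with hC
  have hsq : Tendsto (fun n : ℕ => (√(n : ℝ))⁻¹) atTop (𝓝 0) :=
    tendsto_inv_atTop_zero.comp (tendsto_sqrt_atTop.comp tendsto_natCast_atTop_atTop)
  have hinv : Tendsto (fun n : ℕ => (n : ℝ)⁻¹) atTop (𝓝 0) :=
    tendsto_inv_atTop_zero.comp tendsto_natCast_atTop_atTop
  have hexp : Tendsto (fun n : ℕ => exp (-(η * √(r n : ℝ)))) atTop (𝓝 0) :=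
    Real.tendsto_exp_neg_atTop_nhds_zero.comp ((tendsto_sqrt_atTop.comp hr1).const_mul_atTop hη)
  have hlim : Tendsto (fun n : ℕ => (8 * s ^ 2 + C * (√(n : ℝ))⁻¹) * (2 * ((r n : ℝ) / n) + 2 * b ^ 2) +
      C * (√(n : ℝ))⁻¹ + (8 * (M n ^ 2 * exp (-(η * √(r n : ℝ)))) * (n : ℝ)⁻¹ +
        4 * α ^ 2 * b ^ 2 * exp (-(η * √(r n : ℝ)))) * 6 +
      4 * α ^ 2 / η ^ 2 * 144 * (n : ℝ)⁻¹) atTop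
      (𝓝 ((8 * s ^ 2 + C * 0) * (2 * 1 + 2 * b ^ 2) + C * 0 +
        (8 * 0 * 0 + 4 * α ^ 2 * b ^ 2 * 0) * 6 + 4 * α ^ 2 / η ^ 2 * 144 * 0)) :=
    (((tendsto_const_nhds.add (hsq.const_mul C)).mul ((hrn.const_mul 2).add_const _)).add
      (hsq.const_mul C)).add ((((((hMt η hη).const_mul 8).mul hinv).add
        (hexp.const_mul _)).mul_const 6)) |>.add (hinv.const_mul _)
  have hb : ∀ᶠ n : ℕ in atTop, |(n : ℝ) - r n| ≤ η * r n := by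
    have h1 : Tendsto (fun n : ℕ => b * (√(n : ℝ))⁻¹) atTop (𝓝 (b * 0)) := hsq.const_mul b
    have h2 := hrn.const_mul η
    filter_upwards [h1.eventually_lt h2 (by simpa using hη), hr, eventually_gt_atTop 0] with n h3 h4 h5
    have hn0 : (0 : ℝ) < n := by exact_mod_cast h5
    rw [abs_sub_comm]
    refine h4.trans ?_
    have h6 := mul_le_mul_of_nonneg_right h3.le hn0.le
    have h7 : η * ((r n : ℝ) / n) * n = η * r n := by field_simp
    have h8 : b * (√(n : ℝ))⁻¹ * n = b * √n := by
      have : √(n : ℝ) ≠ 0 := by positivity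
      field_simp
      rw [sq_sqrt hn0.le]
    rw [h7, h8] at h6
    exact h6
  have hlt : (8 * s ^ 2 + C * 0) * (2 * 1 + 2 * b ^ 2) + C * 0 +
        (8 * 0 * 0 + 4 * α ^ 2 * b ^ 2 * 0) * 6 + 4 * α ^ 2 / η ^ 2 * 144 * 0 < ε := by
    simpa using hsε
  obtain ⟨N, hN⟩ := eventually_atTop.1 ((hlim.eventually_lt_const hlt).and
    (happ.and (hc.and (hb.and (hr.and ((hr1.eventually_ge_atTop 1).and (eventually_gt_atTop 0)))))))
  refine ⟨N, fun n hn => ?_⟩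
  obtain ⟨h1, ⟨g, hg, hgK, hgl, hga⟩, h3, h4, h5, h6, h7⟩ := hN n hn.le
  have hn0 : (0 : ℝ) < n := by exact_mod_cast h7
  have hr0 : (0 : ℝ) < r n := by linarith
  have hsq0 : 0 < √(n : ℝ) := by positivity
  have hD : ((n : ℝ) - r n) ^ 2 ≤ b ^ 2 * n := by
    have := pow_le_pow_left₀ (abs_nonneg _) h5 2
    rw [sq_abs, mul_pow, sq_sqrt hn0.le] at this
    linarith [sq_nonneg ((n : ℝ) - r n), (by ring : ((n : ℝ) - r n) ^ 2 = ((r n : ℝ) - n) ^ 2)]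
  have hmain := integral_sq_poisson_increment_le (h.conf n) (hM n) hg hgK hgl
    (by exact_mod_cast h6) h3 hη (min_le_right _ _)
    (fun l hl => hga l (hl.trans (by gcongr; exact min_le_left _ _))) h4 hsq0 hD
  rw [dist_eq, sub_zero, abs_of_nonneg (mul_nonneg (by positivity)
    (integral_nonneg fun _ => sq_nonneg _))]
  refine lt_of_le_of_lt ((mul_le_mul_of_nonneg_left hmain (by positivity)).trans (le_of_eq ?_)) h1
  rw [← hC]
  have e1 : (n : ℝ) = √n * √n := (mul_self_sqrt hn0.le).symm
  have e2 : (n : ℝ)⁻¹ * √n = (√(n : ℝ))⁻¹ := by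
    rw [inv_mul_eq_div, eq_comm, inv_eq_one_div, div_eq_div_iff hsq0.ne' hn0.ne', one_mul]
    exact e1
  have e3 : (n : ℝ)⁻¹ * n = 1 := inv_mul_cancel₀ hn0.ne'
  have e4 : 4 * α ^ 2 / (η * r n) ^ 2 * (144 * (r n : ℝ) ^ 2) = 4 * α ^ 2 / η ^ 2 * 144 := by
    field_simp
  rw [e4]
  set x := (√(n : ℝ))⁻¹
  set X := exp (-(η * √(r n : ℝ)))
  calc _ = (8 * s ^ 2 + C * x) * (2 * ((r n : ℝ) * (n : ℝ)⁻¹) + 2 * b ^ 2 * ((n : ℝ)⁻¹ * n)) +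
      C * ((n : ℝ)⁻¹ * √n) + (8 * (M n ^ 2 * X) * (n : ℝ)⁻¹ +
        4 * α ^ 2 * b ^ 2 * X * ((n : ℝ)⁻¹ * n)) * 6 + 4 * α ^ 2 / η ^ 2 * 144 * (n : ℝ)⁻¹ := by
        rw [div_eq_mul_inv C]; ring
    _ = _ := by rw [e2, e3, mul_one, mul_one, div_eq_mul_inv (r n : ℝ)]

/-- The Poisson functional is `α (N - n)` plus the functional of the first `n` points, up to `o(√n)`
in mean square. The two summands are independent, and `N` has variance `r ~ n`; this is the origin
of `-α²`. -/
lemma LocalSeq.tendsto_variance (h : LocalSeq π r f α) {b : ℝ}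
    (hr : ∀ᶠ n : ℕ in atTop, |(r n : ℝ) - n| ≤ b * √(n : ℝ))
    (hπ : ∀ R, ∃ c, ∀ᶠ n in atTop, ∀ y, (π n).real (closedBall y R) * r n ≤ c) {v : ℝ}
    (hv : Tendsto (fun n : ℕ => (r n : ℝ)⁻¹ * Var[fun q => f n (points q); poissonSample (r n) (π n)])
      atTop (𝓝 v)) :
    Tendsto (fun n : ℕ => (n : ℝ)⁻¹ * Var[fun u => f n (range u); iid n (π n)]) atTop
      (𝓝 (v - α ^ 2)) := by
  obtain ⟨M, hM, -⟩ := h.bound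
  have hr1 := tendsto_atTop_of_sub_le hr
  have hrn := tendsto_div_natCast hr
  set H : ∀ n : ℕ, Config E → ℝ := fun n q => f n (points q) with hH
  set Z : ∀ n : ℕ, Config E → ℝ := fun n q => α * ((q.1 : ℝ) - n) + f n (firstPoints q.2 n)
    with hZ
  have hHL : ∀ n, MemLp (H n) 2 (poissonSample (r n) (π n)) := fun n =>
    memLp_of_abs_le (h.conf n).measurable_points fun q => hM n _
  have hN : ∀ n, 1 ≤ r n → MemLp (fun k : ℕ => α * ((k : ℝ) - n)) 2 (poissonMeasure (r n)) :=
    fun n hn => ((memLp_natCast_poisson (r n) hn).sub (memLp_const (n : ℝ))).const_mul α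
  have hF : ∀ n, MemLp (fun w => f n (firstPoints w n)) 2 (iidSeq (π n)) :=
    fun n => memLp_of_abs_le ((h.conf n).measurable_firstPoints n) fun q => hM n _
  have hr1' : ∀ᶠ n in atTop, 1 ≤ r n := (hr1.eventually_ge_atTop 1).mono fun n hn => by
    exact_mod_cast hn
  have hZL : ∀ᶠ n in atTop, MemLp (Z n) 2 (poissonSample (r n) (π n)) := by
    filter_upwards [hr1'] with n hn
    exact ((hN n hn).comp_fst _).add ((hF n).comp_snd _)
  have hv' : Tendsto (fun n : ℕ => (n : ℝ)⁻¹ * Var[H n; poissonSample (r n) (π n)]) atTop (𝓝 v) := by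
    have := hv.mul hrn
    rw [mul_one] at this
    refine this.congr' ?_
    filter_upwards [hr1'] with n hn
    have : (r n : ℝ) ≠ 0 := by
      have : (1 : ℝ) ≤ r n := by exact_mod_cast hn
      positivity
    field_simp
    rfl
  have hdec := h.tendsto_decorrelation hr hπ
  have key := tendsto_variance_of_perturbation (X := H) (Y := fun n => H n - Z n)
    (Eventually.of_forall hHL) (hZL.mono fun n hn => (hHL n).sub hn) hv' (hdec.congr fun n => by
      congr 2; ext q; simp only [Pi.sub_apply, hH, hZ]; ring)
  have hlim := key.sub (hrn.const_mul (α ^ 2))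
  rw [mul_one] at hlim
  refine hlim.congr' ?_
  filter_upwards [hr1', eventually_gt_atTop 0] with n hn h0
  have hn0 : (n : ℝ) ≠ 0 := by exact_mod_cast h0.ne'
  rw [sub_sub_cancel]
  have e1 : Var[Z n; poissonSample (r n) (π n)] = α ^ 2 * r n +
      Var[fun u => f n (range u); iid n (π n)] := by
    have := variance_add_prod (hN n hn) (hF n)
    rw [show Z n = fun p : Config E => α * ((p.1 : ℝ) - n) + f n (firstPoints p.2 n) from rfl]
    rw [poissonSample, this, variance_const_mul, variance_sub_const
      Measurable.of_discrete.aestronglyMeasurable, variance_natCast_poisson _ hn]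
    congr 1
    have hmp := measurePreserving_firstPoints (π := π n) n
    have := hmp.variance_fun_comp (f := fun u => f n (range u)) (h.conf n n).aemeasurable
    rw [← this]
    congr 1; ext w
    exact congrArg (f n) (image_Iio_eq_range w n)
  rw [e1]
  field_simp
  ring

end Decorrelation

/-! ### Characteristic functions over binomial samples -/

section CharFunLimit

variable {E : Type*} [PseudoMetricSpace E] [SecondCountableTopology E] [MeasurableSpace E]
  [BorelSpace E] {π : ℕ → Measure E} [∀ n, IsProbabilityMeasure (π n)] {r : ℕ → NNReal}
  {f : ℕ → Set E → ℝ} {α : ℝ}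

lemma LocalSeq.tendsto_charFun (h : LocalSeq π r f α) {b : ℝ}
    (hr : ∀ᶠ n : ℕ in atTop, |(r n : ℝ) - n| ≤ b * √(n : ℝ))
    (hπ : ∀ R, ∃ c, ∀ᶠ n in atTop, ∀ y, (π n).real (closedBall y R) * r n ≤ c) {τ : ℝ}
    (hτ : Tendsto (fun n : ℕ => (n : ℝ)⁻¹ * Var[fun u => f n (range u); iid n (π n)]) atTop
      (𝓝 τ)) :
    Tendsto (fun n : ℕ => ∫ u, Complex.exp (((√(n : ℝ))⁻¹ * (f n (range u) -
        ∫ u', f n (range u') ∂(iid n (π n))) : ℝ) * I) ∂(iid n (π n)))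
      atTop (𝓝 (exp (-τ / 2) : ℂ)) := by
  obtain ⟨M, hM, -⟩ := h.bound
  have hr1 := tendsto_atTop_of_sub_le hr
  have hrn := tendsto_div_natCast hr
  have hwin : ∀ η > 0, ∀ᶠ m : ℕ in atTop, |(m : ℝ) - r (m + 1)| ≤ η * r (m + 1) := fun η hη => by
    have h1 : Tendsto (fun n : ℕ => |(n : ℝ)⁻¹ + ((r n : ℝ) / n - 1)|) atTop (𝓝 0) := by
      have := ((tendsto_inv_atTop_zero.comp tendsto_natCast_atTop_atTop).add
        (hrn.sub_const 1)).abs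
      simpa using this
    have h2 := hrn.const_mul η
    have h3 := (h1.eventually_lt h2 (by simpa using hη)).and (eventually_gt_atTop 0)
    filter_upwards [(tendsto_add_atTop_nat 1).eventually h3] with m hm
    obtain ⟨h4, -⟩ := hm
    have hn0 : (0 : ℝ) < ((m + 1 : ℕ) : ℝ) := by positivity
    have h5 := mul_le_mul_of_nonneg_right h4.le hn0.le
    rw [← abs_of_pos hn0, ← abs_mul, abs_of_pos hn0] at h5
    have e1 : (((m + 1 : ℕ) : ℝ)⁻¹ + ((r (m + 1) : ℝ) / (m + 1 : ℕ) - 1)) * (m + 1 : ℕ) =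
        r (m + 1) - m := by field_simp; push_cast; ring
    have e2 : η * ((r (m + 1) : ℝ) / (m + 1 : ℕ)) * (m + 1 : ℕ) = η * r (m + 1) := by field_simp
    rw [e1, e2] at h5
    rw [abs_sub_comm]; exact h5
  -- The limit theorem is stated for `m + 1` points, each being added to `m` others; hence the shift
  -- `n = m + 1`.
  rw [← tendsto_add_atTop_iff_nat 1]
  obtain ⟨C, hC⟩ := h.moment
  have hs := fun {p : ℕ → Prop} (hp : ∀ᶠ n in atTop, p n) => (tendsto_add_atTop_nat 1).eventually hp
  have := tendsto_charFun_of_local (π := fun m => π (m + 1)) (f := fun m => f (m + 1)) (τ := τ)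
    (fun m => h.conf _) (fun m => ⟨M (m + 1), fun k _ u => hM _ _⟩) (C := C) ?_ ?_ ?_
  · refine this.congr fun m => ?_
    push_cast; rfl
  · filter_upwards [hs hC, hwin (1 / 4) (by norm_num)] with m h1 h2
    exact h1 m (h2.trans (by linarith))
  · intro s hs0
    obtain ⟨R, K, η, hη, hE⟩ := h.approx s hs0
    obtain ⟨c, hc⟩ := hπ R
    refine ⟨R, K, 2 * c, ?_⟩
    filter_upwards [hs hE, hs hc, hwin η hη, hwin (1 / 2) (by norm_num),
      hs (hr1.eventually_ge_atTop 2)] with m h1 h2 h3 h4 h5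
    obtain ⟨g, hg, hgK, hgl, hga⟩ := h1
    refine ⟨g, hg, hgK, hgl, (hga m h3).1, fun y => ?_⟩
    have h6 := h2 y
    have h7 : (m + 1 : ℝ) ≤ 2 * r (m + 1) := by
      have := (abs_le.1 h4).2
      linarith
    have h8 : 0 ≤ (π (m + 1)).real (closedBall y R) := measureReal_nonneg
    nlinarith
  · have := (tendsto_add_atTop_iff_nat 1).2 hτ
    refine this.congr fun m => ?_
    push_cast; rfl

end CharFunLimit

/-! ### Regularization of functionals that are only almost everywhere measurable -/

section Exceptional

variable {E : Type*} [MeasurableSpace E] [MeasurableEq E]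

/-- The range of any tuple is enumerated without repetition by some subset of its labels, so
formulas for injective tuples suffice. -/
lemma confMeasurable_of_injective {β : Type*} [MeasurableSpace β] {F : Set E → β}
    {φ : ∀ m, (Fin m → E) → β} (hφ : ∀ m, Measurable (φ m))
    (h : ∀ m (u : Fin m → E), Injective u → F (range u) = φ m u) :
    ConfMeasurable F := fun m T hT => by
  set e : ∀ S : Finset (Fin m), (Fin m → E) → Fin S.card → E :=
    fun S u i => u (S.orderEmbOfFin rfl i) with he
  have hem : ∀ S, Measurable (e S) := fun S => measurable_pi_lambda _ fun i => measurable_pi_apply _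
  set D : Finset (Fin m) → Set (Fin m → E) := fun S =>
    {u | (∀ i ∈ S, ∀ j ∈ S, u i = u j → i = j) ∧ ∀ i, ∃ j ∈ S, u i = u j} with hD
  have hDm : ∀ S, MeasurableSet (D S) := fun S => by
    have hij : ∀ i j : Fin m, MeasurableSet {u : Fin m → E | u i = u j} := fun i j =>
      measurableSet_eq_fun (measurable_pi_apply i) (measurable_pi_apply j)
    have h1 : MeasurableSet {u : Fin m → E | ∀ i ∈ S, ∀ j ∈ S, u i = u j → i = j} := by
      simp only [ofPred_forall]
      refine MeasurableSet.iInter fun i => MeasurableSet.iInter fun _ => MeasurableSet.iInter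
        fun j => MeasurableSet.iInter fun _ => ?_
      exact (hij i j).imp (MeasurableSet.const _)
    have h2 : MeasurableSet {u : Fin m → E | ∀ i, ∃ j ∈ S, u i = u j} := by
      have : {u : Fin m → E | ∀ i, ∃ j ∈ S, u i = u j} =
          ⋂ i, ⋃ j ∈ S, {u : Fin m → E | u i = u j} := by ext u; simp
      rw [this]
      exact MeasurableSet.iInter fun i => Finset.measurableSet_biUnion _ fun j _ => hij i j
    exact h1.inter h2
  have hval : ∀ S, ∀ u ∈ D S, F (range u) = φ S.card (e S u) := by
    rintro S u ⟨h1, h2⟩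
    rw [← h S.card (e S u) fun i j hij => (S.orderEmbOfFin rfl).injective
      (h1 _ (S.orderEmbOfFin_mem rfl i) _ (S.orderEmbOfFin_mem rfl j) hij)]
    congr 1
    ext y
    constructor
    · rintro ⟨i, rfl⟩
      obtain ⟨j, hj, hij⟩ := h2 i
      have : j ∈ range (S.orderEmbOfFin rfl) := by rw [range_orderEmbOfFin]; exact hj
      obtain ⟨l, rfl⟩ := this
      exact ⟨l, hij.symm⟩
    · rintro ⟨i, rfl⟩; exact ⟨_, rfl⟩
  have hex : ∀ u, ∃ S, u ∈ D S := fun u => by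
    classical
    obtain ⟨s, -, hs⟩ := Set.exists_subset_bijOn Set.univ u
    refine ⟨s.toFinset, fun i hi j hj hij => hs.injOn (by simpa using hi) (by simpa using hj) hij,
      fun i => ?_⟩
    obtain ⟨j, hj, hij⟩ := hs.surjOn ⟨i, trivial, rfl⟩
    exact ⟨j, by simpa using hj, hij.symm⟩
  have : (fun u : Fin m → E => F (range u)) ⁻¹' T =
      ⋃ S, D S ∩ (fun u => φ S.card (e S u)) ⁻¹' T := by
    ext u
    simp only [mem_preimage, mem_iUnion, mem_inter_iff]
    constructor
    · intro hu
      obtain ⟨S, hS⟩ := hex u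
      exact ⟨S, hS, by rwa [hval S u hS] at hu⟩
    · rintro ⟨S, hS, hu⟩
      rwa [hval S u hS]
  rw [this]
  exact MeasurableSet.iUnion fun S => (hDm S).inter ((hφ _).comp (hem S) hT)

/-- A family `𝔈` of exceptional configurations, negligible for samples of at most `k` points, off
which `H` is measurable and configurations lie in `W` and have at most `k` points. -/
structure IsExceptional (π : Measure E) (H : Set E → ℝ) (W : Set E) (k : ℝ) (𝔈 : Set (Set E)) :
    Prop where
  conf_mem : ConfMeasurable fun X => X ∈ 𝔈
  ae_notMem : ∀ m : ℕ, (m : ℝ) ≤ k → ∀ᵐ u ∂(iid m π), range u ∉ 𝔈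
  finite_of_notMem : ∀ X ∉ 𝔈, X.Finite ∧ X ⊆ W ∧ (X.ncard : ℝ) ≤ k
  conf : ConfMeasurable (𝔈ᶜ.indicator H)

lemma exists_isExceptional {π : Measure E} [IsProbabilityMeasure π]
    (h0 : ∀ x, π {x} = 0) {H : Set E → ℝ}
    (hH : ∀ m, AEMeasurable (fun u : Fin m → E => H (range u)) (iid m π)) {W : Set E}
    (hW : MeasurableSet W) (hπW : ∀ᵐ x ∂π, x ∈ W) (k : ℝ) :
    ∃ 𝔈, IsExceptional π H W k 𝔈 := by
  choose K hK hHK using hH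
  set N : ∀ m, Set (Fin m → E) := fun m => toMeasurable (iid m π) {u | H (range u) ≠ K m u}
    with hN
  have hN0 : ∀ m, iid m π (N m) = 0 := fun m => by
    rw [hN, measure_toMeasurable]; exact hHK m
  set G : ∀ m, Set (Fin m → E) := fun m => {u | Injective u ∧ (∀ i, u i ∈ W) ∧
    (m : ℝ) ≤ k ∧ ∀ σ : Equiv.Perm (Fin m), (fun i => u (σ i)) ∉ N m} with hG
  have hGm : ∀ m, MeasurableSet (G m) := fun m => by
    have h1 : MeasurableSet {u : Fin m → E | Injective u} := by
      simp only [Injective, ofPred_forall]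
      refine MeasurableSet.iInter fun i => MeasurableSet.iInter fun j => ?_
      exact (measurableSet_eq_fun (measurable_pi_apply i) (measurable_pi_apply j)).imp
        (MeasurableSet.const _)
    have h2 : MeasurableSet {u : Fin m → E | ∀ i, u i ∈ W} := by
      simp only [ofPred_forall]
      exact MeasurableSet.iInter fun i => measurable_pi_apply i hW
    have h3 : MeasurableSet {u : Fin m → E | ∀ σ : Equiv.Perm (Fin m),
        (fun i => u (σ i)) ∉ N m} := by
      simp only [ofPred_forall]
      refine MeasurableSet.iInter fun σ => ?_
      have hσ : Measurable fun (u : Fin m → E) i => u (σ i) :=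
        measurable_pi_lambda _ fun k => measurable_pi_apply _
      exact hσ (measurableSet_toMeasurable _ _).compl
    exact h1.inter (h2.inter ((MeasurableSet.const _).inter h3))
  have hperm : ∀ m (u : Fin m → E) (σ : Equiv.Perm (Fin m)), u ∈ G m →
      (fun i => u (σ i)) ∈ G m := by
    rintro m u σ ⟨h1, h2, h3, h4⟩
    exact ⟨h1.comp σ.injective, fun i => h2 _, h3, fun τ => h4 (τ.trans σ)⟩
  set 𝔈 : Set (Set E) := {X | ∀ m, ∀ u ∈ G m, range u ≠ X} with h𝔈
  have hinj : ∀ m (u : Fin m → E), Injective u → (range u ∈ 𝔈 ↔ u ∉ G m) := fun m u hu => by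
    constructor
    · intro h hG; exact h m u hG rfl
    · intro h m' v hv hvu
      have hc : m' = m := by
        have h1 := ncard_range_of_injective hv.1
        have h2 := ncard_range_of_injective hu
        rw [hvu] at h1
        simpa [h1] using h2
      subst hc
      have hex : ∀ i, ∃ j, v j = u i := fun i => by
        have : u i ∈ range v := hvu ▸ ⟨i, rfl⟩
        exact this
      choose σ hσ using hex
      have hσi : Injective σ := fun i j hij => hu (by rw [← hσ i, ← hσ j, hij])
      refine h ?_
      have := hperm _ v (Equiv.ofBijective σ (Finite.injective_iff_bijective.1 hσi)) hv
      have e : (fun i => v ((Equiv.ofBijective σ (Finite.injective_iff_bijective.1 hσi)) i)) = u := by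
        ext i; exact hσ i
      rwa [e] at this
  refine ⟨𝔈, ?_, ?_, ?_, ?_⟩
  · refine confMeasurable_of_injective (φ := fun m u => u ∉ G m) (fun m => ?_) fun m u hu =>
      propext (hinj m u hu)
    exact measurableSet_setOfPred.1 (hGm m).compl
  · intro m hm
    have h1 : ∀ᵐ u ∂(iid m π), Injective u :=
      ae_injective_infinitePi π (φ := id) measurable_id (by simpa using h0)
    have h2 : ∀ᵐ u ∂(iid m π), ∀ i, u i ∈ W := by
      rw [ae_all_iff]
      intro i
      exact (measurePreserving_eval_infinitePi (fun _ : Fin m => π) i).quasiMeasurePreserving.ae hπW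
    have h3 : ∀ᵐ u ∂(iid m π), ∀ σ : Equiv.Perm (Fin m), (fun i => u (σ i)) ∉ N m := by
      rw [ae_all_iff]
      intro σ
      exact (measurePreserving_comp_infinitePi (fun _ : Fin m => π)
        σ.injective).quasiMeasurePreserving.ae (measure_eq_zero_iff_ae_notMem.1 (hN0 m))
    filter_upwards [h1, h2, h3] with u a b c
    rw [hinj m u a, not_not]
    exact ⟨a, b, hm, c⟩
  · intro X hX
    simp only [h𝔈, mem_ofPred_eq, not_forall, not_not] at hX
    obtain ⟨m, u, ⟨h1, h2, h3, -⟩, rfl⟩ := hX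
    refine ⟨finite_range _, by rintro _ ⟨i, rfl⟩; exact h2 i, ?_⟩
    rw [ncard_range_of_injective h1]; simpa using h3
  · classical
    refine confMeasurable_of_injective (φ := fun m => (G m).indicator (K m))
      (fun m => (hK m).indicator (hGm m)) fun m u hu => ?_
    by_cases h : u ∈ G m
    · rw [indicator_of_mem h, indicator_of_mem (by
        rw [mem_compl_iff, hinj m u hu, not_not]; exact h)]
      have := h.2.2.2 (Equiv.refl _)
      by_contra hne
      exact this (subset_toMeasurable _ _ hne)
    · rw [indicator_of_notMem h, indicator_of_notMem (by
        rw [mem_compl_iff, hinj m u hu, not_not]; exact h)]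

end Exceptional

variable {d k : ℕ} [NeZero d] {Ω : Type*} [MeasurableSpace Ω] {μ : Measure Ω}
  [IsProbabilityMeasure μ] {P : Ω → Set (Space d)} {lam t R K : ℝ} {B A X V W : Set (Space d)}
  {h : Set (Space d) → Set (Space d) → ℝ} {δ S : Ω → ℝ} {x : Space d}

/-- A Riemann measurable set of positive volume. -/
class IsWindow (B : Set (Space d)) : Prop where
  riem : RiemannMeasurable B
  pos : 0 < volume B

variable [hB : IsWindow B]

/-! ### Samples from the dilated window -/

section Window

lemma RiemannMeasurable.smul (hA : RiemannMeasurable A) (ht : 0 < t) : RiemannMeasurable (t • A) := by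
  refine ⟨hA.1.smul₀ t, ?_⟩
  rw [frontier, closure_smul₀, interior_smul₀ ht.ne', ← Set.smul_set_sdiff₀ ht.ne', ← frontier,
    addHaar_smul, hA.2, mul_zero]

lemma RiemannMeasurable.translate (hA : RiemannMeasurable A) (y : Space d) :
    RiemannMeasurable (translate y A) := by
  have h : StabCLT.translate y A = y +ᵥ A := rfl
  rw [h]
  refine ⟨hA.1.vadd y, ?_⟩
  rw [frontier, closure_vadd, interior_vadd, ← Set.vadd_set_sdiff, ← frontier, measure_vadd, hA.2]

lemma riemannMeasurable_closedBall (x : Space d) (R : ℝ) : RiemannMeasurable (closedBall x R) := by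
  refine ⟨isBounded_closedBall, ?_⟩
  have : Nontrivial (Space d) := inferInstance
  exact measure_mono_null Metric.frontier_closedBall_subset_sphere (Measure.addHaar_sphere _ x R)

/-- The dilated window, up to a null set. -/
def win (B : Set (Space d)) (t : ℝ) : Set (Space d) := t • interior B

/-- The uniform distribution on the dilated window. -/
noncomputable abbrev unif (B : Set (Space d)) (t : ℝ) : Measure (Space d) :=
  volume[|win B t]

/-- The mean number of points of the Poisson process in the dilated window. -/
noncomputable def meanCount (lam : ℝ) (B : Set (Space d)) (t : ℝ) : ℝ :=
  lam * t ^ d * volume.real B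

lemma measurableSet_win (ht : 0 < t) : MeasurableSet (win B t) :=
  (isOpen_interior.smul₀ ht.ne').measurableSet

lemma isBounded_win : Bornology.IsBounded (win B t) :=
  (hB.riem.1.subset interior_subset).smul₀ t

lemma volume_interior : volume (interior B) = volume B :=
  measure_interior_of_null_frontier hB.riem.2

lemma volume_smul_real (s : Set (Space d)) (ht : 0 < t) :
    volume.real (t • s) = t ^ d * volume.real s := by
  rw [Measure.real, addHaar_smul, finrank_euclideanSpace_fin, toReal_mul,
    ENNReal.toReal_ofReal (abs_nonneg _), abs_of_pos (by positivity)]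
  rfl

lemma volume_real_win (ht : 0 < t) : volume.real (win B t) = t ^ d * volume.real B := by
  rw [win, volume_smul_real _ ht, Measure.real, volume_interior]; rfl

lemma meanCount_eq (ht : 0 < t) : meanCount lam B t = lam * volume.real (win B t) := by
  rw [volume_real_win ht, meanCount]; ring

lemma volume_win_ne_zero (ht : 0 < t) : volume (win B t) ≠ 0 := by
  rw [win, addHaar_smul, volume_interior]
  exact mul_ne_zero (by simp [ht.ne']) hB.pos.ne'

variable (B) in
lemma volume_real_pos : 0 < volume.real B :=
  ENNReal.toReal_pos hB.pos.ne' hB.riem.1.measure_lt_top.ne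

variable (B) in
lemma isProbabilityMeasure_unif (ht : 0 < t) : IsProbabilityMeasure (unif B t) :=
  isProbabilityMeasure_cond_volume isBounded_win (volume_win_ne_zero ht)

variable (B) in
lemma smul_ae_eq_win (ht : 0 < t) : (t • B : Set _) =ᵐ[volume] win B t := by
  have := (interior_ae_eq_of_null_frontier (hB.riem.smul ht).2).symm
  rwa [interior_smul₀ ht.ne'] at this

lemma cond_smul_eq_unif (ht : 0 < t) : volume[|t • B] = unif B t := by
  have := smul_ae_eq_win B ht
  rw [unif, ProbabilityTheory.cond, ProbabilityTheory.cond, measure_congr this,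
    Measure.restrict_congr_set this]

lemma uniformSampleLaw_eq (ht : 0 < t) (m : ℕ) : uniformSampleLaw (t • B) m = iid m (unif B t) := by
  have := isProbabilityMeasure_unif B ht
  rw [uniformSampleLaw, cond_smul_eq_unif ht, iid, infinitePi_eq_pi]

lemma ae_unif_mem (ht : 0 < t) : ∀ᵐ x ∂(unif B t), x ∈ win B t :=
  ProbabilityTheory.ae_cond_mem (measurableSet_win ht)

lemma unif_real_apply (ht : 0 < t) (s : Set (Space d)) :
    (unif B t).real s = (volume.real (win B t))⁻¹ * volume.real (win B t ∩ s) :=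
  by rw [Measure.real, ProbabilityTheory.cond_apply (measurableSet_win ht), toReal_mul,
    ENNReal.toReal_inv]; rfl

/-- Carries measurability up to Lebesgue null sets over to the law of a uniform sample. -/
lemma iid_unif_absolutelyContinuous (ht : 0 < t) (m : ℕ) : iid m (unif B t) ≪ volume := by
  have := isProbabilityMeasure_unif B ht
  have hc : (volume (win B t))⁻¹ ≠ ∞ := ENNReal.inv_ne_top.2 (volume_win_ne_zero ht)
  have e : iid m (unif B t) = (volume (win B t))⁻¹ ^ m •
      Measure.pi fun _ : Fin m => volume.restrict (win B t) := by
    rw [iid, infinitePi_eq_pi]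
    refine Measure.pi_eq fun s hs => ?_
    rw [Measure.smul_apply, pi_pi, smul_eq_mul]
    simp only [unif, ProbabilityTheory.cond, Measure.smul_apply, smul_eq_mul,
      Finset.prod_mul_distrib, prod_const, card_univ, Fintype.card_fin]
  rw [e, ← Measure.restrict_pi_pi]
  exact (Measure.absolutelyContinuous_of_le Measure.restrict_le_self).smul_left _

lemma unif_real_closedBall_mul_le (hlam : 0 < lam) (ht : 0 < t) (y : Space d) (R : ℝ) :
    (unif B t).real (closedBall y R) * meanCount lam B t ≤
      lam * volume.real (closedBall (0 : Space d) R) := by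
  have h0 : 0 < volume.real (win B t) := by
    rw [volume_real_win ht]; have := volume_real_pos B; positivity
  rw [unif_real_apply ht, meanCount_eq ht]
  have h1 : volume.real (win B t ∩ closedBall y R) ≤
      volume.real (closedBall (0 : Space d) R) := by
    rw [show volume.real (closedBall (0 : Space d) R) =
      volume.real (closedBall y R) by
        rw [Measure.real, Measure.real, Measure.addHaar_closedBall_center volume y]]
    exact measureReal_mono inter_subset_right isBounded_closedBall.measure_lt_top.ne
  calc _ = lam * volume.real (win B t ∩ closedBall y R) := by field_simp
    _ ≤ _ := by gcongr

/-- A family of configurations to be ignored when `h(·, tA)` is evaluated. -/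
noncomputable def exc (h : Set (Space d) → Set (Space d) → ℝ) (lam : ℝ) (B A : Set (Space d))
    (t : ℝ) : Set (Set (Space d)) :=
  Classical.epsilon fun 𝔈 => IsExceptional (unif B t) (fun X => h X (t • A)) (win B t)
    (3 * meanCount lam B t / 2) 𝔈

/-- The regularization of `h(·, tA)`. -/
noncomputable def regular (h : Set (Space d) → Set (Space d) → ℝ) (lam : ℝ) (B A : Set (Space d))
    (t : ℝ) : Set (Space d) → ℝ :=
  (exc h lam B A t)ᶜ.indicator fun X => h X (t • A)

lemma aemeasurable_range (hh : IsPointProcessSetFunction h) (hA : RiemannMeasurable A) (ht : 0 < t) (m : ℕ) :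
    AEMeasurable (fun u : Fin m → Space d => h (range u) (t • A)) (iid m (unif B t)) :=
  (hh.aemeasurable m _ (hA.smul ht)).mono_ac (iid_unif_absolutelyContinuous ht m)

variable (lam B) in
lemma isExceptional_exc (hh : IsPointProcessSetFunction h) (hA : RiemannMeasurable A) (ht : 0 < t) :
    IsExceptional (unif B t) (fun X => h X (t • A)) (win B t) (3 * meanCount lam B t / 2)
      (exc h lam B A t) := by
  have := isProbabilityMeasure_unif B ht
  exact Classical.epsilon_spec (exists_isExceptional (cond_volume_singleton _)
    (aemeasurable_range hh hA ht) (measurableSet_win ht) (ae_unif_mem ht) _)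

lemma cost_regular (h1 : X ∉ exc h lam B A t) (h2 : insert x X ∉ exc h lam B A t) :
    cost (regular h lam B A t) x X = h (insert x X) (t • A) - h X (t • A) := by
  rw [cost, regular, indicator_of_mem h2, indicator_of_mem h1]

variable (lam B) in
-- The exceptional family is negligible for `m + 1` independent points, one of which plays the role
-- of `x`; this is why `m + 1` must obey the bound on sample sizes.
lemma ae_notMem_exc (hh : IsPointProcessSetFunction h) (hA : RiemannMeasurable A) (ht : 0 < t) {m : ℕ}
    (hm : (m : ℝ) + 1 ≤ 3 * meanCount lam B t / 2) :
    ∀ᵐ x ∂(unif B t), ∀ᵐ u ∂(iid m (unif B t)),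
      range u ∉ exc h lam B A t ∧ insert x (range u) ∉ exc h lam B A t := by
  have := isProbabilityMeasure_unif B ht
  have hE := isExceptional_exc lam B hh hA ht
  have h1 := hE.ae_notMem m (by linarith)
  have h2 := hE.ae_notMem (m + 1) (by push_cast; exact hm)
  classical
  set F : Set (Space d) → ℝ≥0∞ := fun X => if X ∈ exc h lam B A t then 1 else 0 with hF
  have hFm : ConfMeasurable F := fun m =>
    Measurable.ite (measurableSet_setOfPred.2 (hE.conf_mem m)) measurable_const measurable_const
  have h3 : ∫⁻ u, F (range u) ∂(iid (m + 1) (unif B t)) = 0 := by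
    rw [lintegral_eq_zero_iff (hFm _)]
    filter_upwards [h2] with u hu
    simp [hF, hu]
  rw [lintegral_iid_succ hFm, lintegral_eq_zero_iff] at h3
  · filter_upwards [h3] with x hx
    rw [Pi.zero_apply, lintegral_eq_zero_iff ((hFm.insert x) m)] at hx
    filter_upwards [h1, hx] with u hu hxu
    refine ⟨hu, fun hmem => ?_⟩
    simp [hF, hmem] at hxu
  · have : Measurable fun p : Space d × (Fin m → Space d) => F (insert p.1 (range p.2)) := by
      have := (hFm (m + 1)).comp (measurable_pi_lambda
        (fun (p : Space d × (Fin m → Space d)) (i : Fin (m + 1)) =>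
          (Fin.cons p.1 p.2 : Fin (m + 1) → Space d) i) fun i => by
            refine Fin.cases ?_ (fun j => ?_) i
            · exact measurable_fst
            · exact (measurable_pi_apply j).comp measurable_snd)
      convert this using 2 with p
      exact congrArg F (Fin.range_cons _ _).symm
    exact this.lintegral_prod_right'

/-- Translation invariance moves the added point from `x` to the origin, where stabilization and
moments are assumed. -/
lemma addOneCost_translate (hh : IsPointProcessSetFunction h) (hA : RiemannMeasurable A)
    (x : Space d) (hX : X.Finite) :
    addOneCost h (translate (-x) A) (translate (-x) X) = h (insert x X) A - h X A := by
  have e : translate (-x) X ∪ {0} = translate (-x) (insert x X) := by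
    rw [translate, translate, image_insert_eq, Set.union_singleton, neg_add_cancel]
  rw [addOneCost, e, hh.translation_invariant A hA _ _ (hX.insert x),
    hh.translation_invariant A hA _ _ hX]

/-- The moments condition at `-x`, averaged over the window; exceptional configurations have
probability zero. -/
lemma regular_moment (hh : IsPointProcessSetFunction h) (hA : RiemannMeasurable A) (hAB : A ⊆ B)
    (hmom : MomentsCondition h lam B) : ∃ C, 0 ≤ C ∧ ∀ t, 1 ≤ t → ∀ m : ℕ,
      meanCount lam B t / 2 ≤ m → (m : ℝ) + 1 ≤ 3 * meanCount lam B t / 2 →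
      ∫⁻ p, ofReal (cost (regular h lam B A t) p.1 (range p.2) ^ 4)
        ∂(rooted m (unif B t)) ≤ ofReal C := by
  obtain ⟨C, hC⟩ := hmom
  refine ⟨max C 0, le_max_right _ _, fun t ht m hm hm' => ?_⟩
  have ht0 : 0 < t := by linarith
  have := isProbabilityMeasure_unif B ht0
  have hE := isExceptional_exc lam B hh hA ht0
  have hmeas : Measurable fun p : Space d × (Fin m → Space d) =>
      ofReal (cost (regular h lam B A t) p.1 (range p.2) ^ 4) :=
    ((hE.conf.jointMeasurable_cost m).pow_const 4).ennreal_ofReal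
  rw [lintegral_prod _ hmeas.aemeasurable]
  calc _ ≤ ∫⁻ _x, ofReal C ∂(unif B t) := by
        refine lintegral_mono_ae ?_
        filter_upwards [ae_notMem_exc lam B hh hA ht0 hm', ae_unif_mem ht0]
          with x hx hxW
        have hxB : -x ∈ -(t • B) := by
          rw [Set.neg_mem_neg]; exact smul_set_mono interior_subset hxW
        have := hC t ht A hA hAB (-x) hxB m hm (by unfold meanCount at hm'; linarith)
        rw [uniformSampleLaw_eq ht0] at this
        refine le_trans (le_of_eq (lintegral_congr_ae ?_)) this
        filter_upwards [hx] with u hu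
        rw [addOneCost_translate hh (hA.smul ht0) x (finite_range u), cost_regular hu.1 hu.2]
    _ ≤ _ := by simp

variable (lam B) in
-- Configurations that are not exceptional lie in the window and have at most `3/2` times the mean
-- count of points, so the polynomial bound becomes a power of the mean count. The diameter is
-- absorbed by `t ≤ t ^ d`.
lemma regular_bound (hh : IsPointProcessSetFunction h) (hA : RiemannMeasurable A) (hlam : 0 < lam) (hpoly : PolynomialBound h) :
    ∃ C q : ℝ, 0 ≤ C ∧ 0 ≤ q ∧ ∀ t, 1 ≤ t → ∀ X,
      |regular h lam B A t X| ≤ C * meanCount lam B t ^ q := by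
  obtain ⟨β, hβ⟩ := hpoly
  have hv := volume_real_pos B
  set c := diam (interior B) / (lam * volume.real B) + 3 / 2 with hc
  have hc0 : 0 ≤ c := by have := diam_nonneg (s := interior B); positivity
  refine ⟨|β| * c ^ |β|, |β|, by positivity, abs_nonneg _, fun t ht X => ?_⟩
  have ht0 : 0 < t := by linarith
  have hm0 : 0 < meanCount lam B t := by unfold meanCount; positivity
  have hrhs : 0 ≤ |β| * c ^ |β| * meanCount lam B t ^ |β| := by positivity
  have hE := isExceptional_exc lam B hh hA ht0
  by_cases hX : X ∈ exc h lam B A t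
  · rw [regular, indicator_of_notMem (by simpa using hX), abs_zero]; exact hrhs
  rw [regular, indicator_of_mem hX]
  obtain ⟨hf, hXW, hXc⟩ := hE.finite_of_notMem X hX
  refine (hβ X hf _ (hA.smul ht0)).trans ?_
  have hb0 : 0 ≤ diam X + (X.ncard : ℝ) := by have := diam_nonneg (s := X); positivity
  rcases le_or_gt 0 β with hβ0 | hβ0
  · rw [abs_of_nonneg hβ0, mul_assoc, ← Real.mul_rpow hc0 hm0.le]
    gcongr
    have h1 : diam X ≤ t * diam (interior B) := by
      refine (Metric.diam_mono hXW isBounded_win).trans (le_of_eq ?_)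
      rw [win, diam_smul₀, norm_of_nonneg ht0.le]
    have h2 : t ≤ t ^ d := le_self_pow₀ ht (NeZero.ne d)
    have h3 : t * diam (interior B) ≤
        diam (interior B) / (lam * volume.real B) * meanCount lam B t := by
      have : diam (interior B) / (lam * volume.real B) * meanCount lam B t =
          t ^ d * diam (interior B) := by unfold meanCount; field_simp
      rw [this]
      exact mul_le_mul_of_nonneg_right h2 diam_nonneg
    rw [hc, add_mul]; linarith
  -- For `β < 0` the assumed bound is itself nonpositive.
  · refine le_trans (mul_nonpos_of_nonpos_of_nonneg hβ0.le (Real.rpow_nonneg hb0 _)) hrhs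

end Window

/-! ### Stabilization inside the window -/

section Geometry

/-- The points within distance `R` of the boundary of `tA` or `tB`. -/
def nearBoundary (B A : Set (Space d)) (R t : ℝ) : Set (Space d) :=
  cthickening R (t • frontier A) ∪ cthickening R (t • frontier B)

lemma measurableSet_nearBoundary : MeasurableSet (nearBoundary B A R t) :=
  (Metric.isClosed_cthickening.union Metric.isClosed_cthickening).measurableSet

/-- A ball is connected, so one that misses the boundary of `tA` lies in the interior or in the
exterior. -/
lemma closedBall_subset_or_disjoint (ht : 0 < t) (hx : x ∉ cthickening R (t • frontier A)) :
    closedBall x R ⊆ t • interior A ∨ closedBall x R ⊆ (t • A)ᶜ := by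
  have hf : t • frontier A = frontier (t • A) := by
    rw [frontier, frontier, closure_smul₀, interior_smul₀ ht.ne', Set.smul_set_sdiff₀ ht.ne']
  rw [← interior_smul₀ ht.ne']
  have h1 : closedBall x R ⊆ interior (t • A) ∪ (closure (t • A))ᶜ := fun y hy => by
    by_contra hn
    refine hx (Metric.mem_cthickening_of_dist_le x y R _ ?_ (by rwa [dist_comm]))
    rw [hf, frontier]
    simp only [mem_union, mem_compl_iff, not_or, not_not] at hn
    exact ⟨hn.2, hn.1⟩
  rcases (convex_closedBall x R).isPreconnected.subset_or_subset isOpen_interior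
    isClosed_closure.isOpen_compl (Set.disjoint_compl_right_iff_subset.2
      (interior_subset.trans subset_closure)) h1 with h | h
  · exact Or.inl h
  · exact Or.inr (h.trans (Set.compl_subset_compl.2 subset_closure))

lemma closedBall_subset_win (ht : 0 < t) (hR : 0 ≤ R) (hx : x ∈ win B t)
    (hx' : x ∉ nearBoundary B A R t) : closedBall x R ⊆ win B t := by
  rcases closedBall_subset_or_disjoint (A := B) ht (fun h => hx' (Or.inr h)) with h | h
  · exact h
  · exact absurd (smul_set_mono interior_subset hx) (h (Metric.mem_closedBall_self hR))

lemma cthickening_smul_subset (ht : 0 < t) (F : Set (Space d)) (hF : IsCompact F) (hR : 0 ≤ R) :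
    cthickening R (t • F) ⊆ t • cthickening (R / t) F := by
  rw [(hF.smul t).cthickening_eq_biUnion_closedBall hR]
  refine Set.iUnion₂_subset ?_
  rintro _ ⟨z, hz, rfl⟩ y hy
  refine ⟨t⁻¹ • y, Metric.mem_cthickening_of_dist_le _ z _ _ hz ?_, by simp [smul_smul, ht.ne']⟩
  have h1 := dist_smul₀ t⁻¹ y (t • z)
  rw [smul_smul, inv_mul_cancel₀ ht.ne', one_smul, norm_of_nonneg (inv_nonneg.2 ht.le)] at h1
  rw [h1, div_eq_inv_mul]
  exact mul_le_mul_of_nonneg_left hy (inv_nonneg.2 ht.le)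

/-- Rescaling by `t` gives the `R / t` neighbourhoods of the compact null boundaries of `A` and `B`,
whose volumes tend to zero. -/
lemma tendsto_unif_nearBoundary (hA : RiemannMeasurable A) (hR : 0 ≤ R) :
    Tendsto (fun t => (unif B t).real (nearBoundary B A R t)) atTop (𝓝 0) := by
  have hv := volume_real_pos B
  have key : ∀ F : Set (Space d), IsCompact F → volume F = 0 →
      Tendsto (fun t : ℝ => volume.real (cthickening (R / t) F)) atTop (𝓝 0) := fun F hF hF0 => by
    have h1 : Tendsto (fun s => volume (cthickening s F)) (𝓝 0) (𝓝 (volume F)) :=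
      tendsto_measure_cthickening_of_isClosed
        ⟨1, one_pos, hF.isBounded.cthickening.measure_lt_top.ne⟩ hF.isClosed
    have h2 : Tendsto (fun t : ℝ => R / t) atTop (𝓝 0) := tendsto_const_nhds.div_atTop tendsto_id
    rw [hF0] at h1
    exact (ENNReal.tendsto_toReal ENNReal.zero_ne_top).comp (h1.comp h2)
  have hbd : ∀ {D : Set (Space d)}, RiemannMeasurable D → IsCompact (frontier D) := fun hD =>
    Metric.isCompact_of_isClosed_isBounded isClosed_frontier
      (hD.1.closure.subset frontier_subset_closure)
  have h0 := ((key _ (hbd hA) hA.2).add (key _ (hbd hB.riem) hB.riem.2)).const_mul (volume.real B)⁻¹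
  rw [add_zero, mul_zero] at h0
  refine squeeze_zero' (Eventually.of_forall fun _ => measureReal_nonneg) ?_ h0
  filter_upwards [eventually_gt_atTop 0] with t ht
  have hle : ∀ F : Set (Space d), IsCompact F → volume.real (cthickening R (t • F)) ≤
      t ^ d * volume.real (cthickening (R / t) F) := fun F hF => by
    rw [← volume_smul_real _ ht]
    exact measureReal_mono (cthickening_smul_subset ht F hF hR)
      (hF.isBounded.cthickening.smul₀ t).measure_lt_top.ne
  rw [unif_real_apply ht, volume_real_win ht]
  have h1 : volume.real (win B t ∩ nearBoundary B A R t) ≤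
      t ^ d * (volume.real (cthickening (R / t) (frontier A)) +
        volume.real (cthickening (R / t) (frontier B))) := by
    rw [mul_add]
    refine le_trans (measureReal_mono inter_subset_right ?_) ((measureReal_union_le _ _).trans
      (add_le_add (hle _ (hbd hA)) (hle _ (hbd hB.riem))))
    exact (((hbd hA).isBounded.smul₀ t).cthickening.union
      ((hbd hB.riem).isBounded.smul₀ t).cthickening).measure_lt_top.ne
  calc _ ≤ (t ^ d * volume.real B)⁻¹ * _ := mul_le_mul_of_nonneg_left h1 (by positivity)
    _ = _ := by field_simp

lemma translate_neg_translate (x : Space d) (X : Set (Space d)) :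
    translate (-x) (translate x X) = X := by
  rw [translate, translate, Set.image_image]; simp

lemma translate_inter (x : Space d) (X Y : Set (Space d)) :
    translate x (X ∩ Y) = translate x X ∩ translate x Y :=
  Set.image_inter (add_right_injective x)

lemma translate_union (x : Space d) (X Y : Set (Space d)) :
    translate x (X ∪ Y) = translate x X ∪ translate x Y := Set.image_union ..

lemma translate_inter_eq (x : Space d) (X C : Set (Space d)) :
    translate x X ∩ C = translate x (X ∩ translate (-x) C) := by
  have := translate_neg_translate (-x) C
  rw [neg_neg] at this
  rw [translate_inter, this]

lemma translate_eq_preimage (x : Space d) (C : Set (Space d)) :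
    translate x C = (fun y => -x + y) ⁻¹' C := by
  ext y; constructor
  · rintro ⟨z, hz, rfl⟩; simpa using hz
  · intro hy; exact ⟨-x + y, hy, by simp⟩

lemma translate_closedBall (x y : Space d) (R : ℝ) :
    translate x (closedBall y R) = closedBall (x + y) R := by
  rw [translate_eq_preimage]
  ext z
  simp only [mem_preimage, mem_closedBall, dist_eq_norm]
  rw [show -x + z - y = z - (x + y) by abel]

lemma measurableSet_translate (x : Space d) {C : Set (Space d)} (hC : MeasurableSet C) :
    MeasurableSet (translate x C) := by
  rw [translate_eq_preimage]; exact (measurable_const_add _) hC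

lemma isBounded_translate (x : Space d) {C : Set (Space d)} (hC : Bornology.IsBounded C) :
    Bornology.IsBounded (translate x C) :=
  Bornology.IsBounded.vadd hC x

lemma IsPoissonProcess.translate {Ω : Type*} [MeasurableSpace Ω] {μ : Measure Ω}
    {P : Ω → Set (Space d)} (hP : IsPoissonProcess P lam μ) (x : Space d) :
    IsPoissonProcess (fun ω => StabCLT.translate x (P ω)) lam μ := by
  have hinj : Injective fun y : Space d => x + y := add_right_injective x
  have hcard : ∀ ω C, (StabCLT.translate x (P ω) ∩ C).ncard =
      (P ω ∩ StabCLT.translate (-x) C).ncard := fun ω C => by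
    rw [translate_inter_eq, StabCLT.translate, ncard_image_of_injective _ hinj]
  refine ⟨fun ω C hC => ?_, fun C hC hCb => ?_, fun C hC hCb => ?_, fun m C hC hCb hd => ?_⟩
  · rw [translate_inter_eq]
    exact (hP.locallyFinite ω _ (isBounded_translate _ hC)).image _
  · simp only [hcard]
    exact hP.measurable_count _ (measurableSet_translate _ hC) (isBounded_translate _ hCb)
  · simp only [hcard]
    rw [hP.count_law _ (measurableSet_translate _ hC) (isBounded_translate _ hCb)]
    have : volume (StabCLT.translate (-x) C) = volume C := measure_vadd volume (-x) C
    rw [Measure.real, this]; rfl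
  · simp only [hcard]
    refine hP.indep m _ (fun i => measurableSet_translate _ (hC i))
      (fun i => isBounded_translate _ (hCb i)) fun i j hij => ?_
    exact Set.disjoint_image_of_injective (add_right_injective (-x)) (hd hij)

end Geometry

/-! ### Stabilization radii and truncated local costs -/

section Stabilization

/-- Inside the ball of radius `R` the configuration `X` determines the add one cost `δ`. -/
def StabilizesAt (h : Set (Space d) → Set (Space d) → ℝ) (X : Set (Space d)) (R δ : ℝ) : Prop :=
  ∀ A, RiemannMeasurable A → ∀ V : Set (Space d), V.Finite → V ⊆ (closedBall 0 R)ᶜ →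
    (closedBall 0 R ⊆ A → addOneCost h A ((X ∩ closedBall 0 R) ∪ V) = δ) ∧
    (closedBall 0 R ⊆ Aᶜ → addOneCost h A ((X ∩ closedBall 0 R) ∪ V) = 0)

/-- Any larger radius also works, since the points between the two radii can be counted among the
arbitrary outside points. The radius is also replaced by a measurable version. -/
lemma StronglyStabilizing.exists_radius {Ω : Type*} [MeasurableSpace Ω] {μ : Measure Ω}
    {P : Ω → Set (Space d)} {lam : ℝ} (hP : IsPoissonProcess P lam μ) {δ : Ω → ℝ}
    (hs : StronglyStabilizing h P μ δ) :
    ∃ S : Ω → ℝ, Measurable S ∧ ∀ᵐ ω ∂μ, ∀ R, S ω ≤ R → StabilizesAt h (P ω) R (δ ω) := by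
  obtain ⟨-, S, hS, hst⟩ := hs
  refine ⟨hS.mk, hS.measurable_mk, ?_⟩
  filter_upwards [hst, hS.ae_eq_mk] with ω hω hmk R hR A hA V hV hVR
  rw [← hmk] at hR
  have hsub := Metric.closedBall_subset_closedBall (x := (0 : Space d)) hR
  have e : (P ω ∩ closedBall 0 R) ∪ V = (P ω ∩ closedBall 0 (S ω)) ∪
      ((P ω ∩ (closedBall 0 R \ closedBall 0 (S ω))) ∪ V) := by
    rw [← Set.union_assoc, ← Set.inter_union_distrib_left, Set.union_sdiff_cancel hsub]
  have hfin : ((P ω ∩ (closedBall 0 R \ closedBall 0 (S ω))) ∪ V).Finite :=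
    (hP.locallyFinite ω _ (isBounded_closedBall.subset sdiff_subset)).union hV
  have hout : (P ω ∩ (closedBall 0 R \ closedBall 0 (S ω))) ∪ V ⊆
      (closedBall 0 (S ω))ᶜ :=
    Set.union_subset (fun y hy => hy.2.2) (hVR.trans (Set.compl_subset_compl.2 hsub))
  obtain ⟨h1, h2⟩ := hω A hA _ hfin hout
  rw [e]
  exact ⟨fun hA => h1 (hsub.trans hA), fun hA => h2 (Set.disjoint_iff_inter_eq_empty.1
    (disjoint_left.2 fun y hy hy' => hA (hsub hy') hy))⟩

/-- The value of `y` truncated to `[-K, K]`. -/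
noncomputable def clip (K y : ℝ) : ℝ := max (-K) (min K y)

lemma abs_clip_le (hK : 0 ≤ K) (y : ℝ) : |clip K y| ≤ K :=
  abs_le.2 ⟨le_max_left _ _, max_le (by linarith) (min_le_left _ _)⟩

lemma clip_eq {K y : ℝ} (h : |y| ≤ K) : clip K y = y := by
  rw [clip, min_eq_right (abs_le.1 h).2, max_eq_right (abs_le.1 h).1]

lemma measurable_clip (K : ℝ) : Measurable (clip K) :=
  measurable_const.max (measurable_const.min measurable_id)

/-- The truncated add one cost computed from the points in the ball of radius `R`. -/
noncomputable def localCost (h : Set (Space d) → Set (Space d) → ℝ) (K R : ℝ)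
    (X : Set (Space d)) : ℝ :=
  clip K (addOneCost h (closedBall 0 R) (X ∩ closedBall 0 R))

/-- The local approximation to the add one cost of `h(·, tA)` at `x`. -/
noncomputable def approxCost (h : Set (Space d) → Set (Space d) → ℝ) (A : Set (Space d))
    (K R t : ℝ) (x : Space d) (X : Set (Space d)) : ℝ :=
  (t • interior A).indicator (fun x => localCost h K R (translate (-x) X)) x

lemma localCost_inter (K R : ℝ) (X : Set (Space d)) :
    localCost h K R (X ∩ closedBall 0 R) = localCost h K R X := by
  rw [localCost, localCost, inter_assoc, inter_self]

lemma abs_localCost_le (hK : 0 ≤ K) (R : ℝ) (X : Set (Space d)) :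
    |localCost h K R X| ≤ K := abs_clip_le hK _

lemma abs_approxCost_le (hK : 0 ≤ K) (A : Set (Space d)) (R t : ℝ) (x : Space d)
    (X : Set (Space d)) : |approxCost h A K R t x X| ≤ K := by
  by_cases hx : x ∈ t • interior A
  · rw [approxCost, indicator_of_mem hx]; exact abs_localCost_le hK _ _
  · rw [approxCost, indicator_of_notMem hx]; simpa using hK

lemma approxCost_inter (A : Set (Space d)) (K R t : ℝ) (x : Space d) (X : Set (Space d)) :
    approxCost h A K R t x X = approxCost h A K R t x (X ∩ closedBall x R) := by
  by_cases hx : x ∈ t • interior A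
  · rw [approxCost, approxCost, indicator_of_mem hx, indicator_of_mem hx, translate_inter,
      translate_closedBall, neg_add_cancel, localCost_inter]
  · rw [approxCost, approxCost, indicator_of_notMem hx, indicator_of_notMem hx]

/-- Stabilization with the ball itself as test set and no outside points. -/
lemma StabilizesAt.localCost_eq {K R δ : ℝ} (hX : StabilizesAt h X R δ)
    (hδ : |δ| ≤ K) : localCost h K R X = δ := by
  have := (hX _ (riemannMeasurable_closedBall 0 R) ∅ Set.finite_empty (Set.empty_subset _)).1
    subset_rfl
  rw [union_empty] at this
  rw [localCost, this, clip_eq hδ]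

/-- The test set is a ball, hence Borel, so the functional is genuinely measurable here and no
exceptional sets are needed. -/
lemma measurable_localCost (hh : IsPointProcessSetFunction h) {α ι : Type*} [MeasurableSpace α]
    [Fintype ι] (K R : ℝ) {v : ι → α → Space d} (hv : ∀ i, Measurable (v i)) :
    Measurable fun a => localCost h K R (range fun i => v i a) := by
  have hc : ConfMeasurable fun X => h X (closedBall 0 R) := fun m =>
    hh.measurable m _ (riemannMeasurable_closedBall 0 R) isClosed_closedBall.measurableSet
  have hQ : ∀ i, MeasurableSet {a | v i a ∈ closedBall (0 : Space d) R} := fun i =>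
    hv i isClosed_closedBall.measurableSet
  have e : ∀ a, (range fun i => v i a) ∩ closedBall 0 R =
      (fun i => v i a) '' {i | i ∈ univ ∧ v i a ∈ closedBall (0 : Space d) R} := by
    intro a; ext y; constructor
    · rintro ⟨⟨i, rfl⟩, hi⟩; exact ⟨i, ⟨mem_univ _, hi⟩, rfl⟩
    · rintro ⟨i, ⟨-, hi⟩, rfl⟩; exact ⟨⟨i, rfl⟩, hi⟩
  simp only [localCost, addOneCost, e, Set.union_singleton]
  exact (measurable_clip K).comp (((hc.insert 0).image_filter univ hv hQ).sub
    (hc.image_filter univ hv hQ))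

lemma confMeasurable_localCost (hh : IsPointProcessSetFunction h) (K R : ℝ) :
    ConfMeasurable (localCost h K R) := fun _ =>
  measurable_localCost hh K R fun i => measurable_pi_apply i

lemma jointMeasurable_approxCost (hh : IsPointProcessSetFunction h) (A : Set (Space d))
    (K R : ℝ) (ht : 0 < t) : JointMeasurable (approxCost h A K R t) := fun m => by
  have h1 : Measurable fun p : Space d × (Fin m → Space d) =>
      localCost h K R (translate (-p.1) (range p.2)) := by
    have e : ∀ p : Space d × (Fin m → Space d), translate (-p.1) (range p.2) =
        range fun i => -p.1 + p.2 i := fun p => (range_comp _ _).symm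
    simp only [e]
    exact measurable_localCost hh K R fun i => measurable_fst.neg.add
      ((measurable_pi_apply i).comp measurable_snd)
  exact h1.indicator (measurable_fst (isOpen_interior.smul₀ ht.ne').measurableSet)

lemma JointMeasurable.confMeasurable {E : Type*} [MeasurableSpace E] {g : E → Set E → ℝ}
    (hg : JointMeasurable g) (x : E) : ConfMeasurable (g x) := fun m =>
  (hg m).comp (measurable_const.prodMk measurable_id)

end Stabilization

/-! ### Add one costs in a binomial sample against the stabilizing limit -/

section Coupling

/-- Distance between binomial and Poisson counts in a ball of radius `R`. -/
noncomputable def countDist (lam : ℝ) (B : Set (Space d)) (R t : ℝ) (m : ℕ) : ℝ :=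
  binomPoissonDist m (volume.real (closedBall (0 : Space d) R) / (t ^ d * volume.real B))
    (lam * volume.real (closedBall (0 : Space d) R))

lemma volume_real_closedBall_center (x : Space d) (R : ℝ) :
    volume.real (closedBall x R) = volume.real (closedBall (0 : Space d) R) := by
  rw [Measure.real, Measure.addHaar_closedBall_center]; rfl

/-- The comparison in the ball around `x`, with the process translated by `x`; this keeps the bound
`G` free of `x`. The volume condition leaves room in the window outside the ball. -/
lemma lintegral_unif_le (hP : IsPoissonProcess P lam μ) (hlam : 0 < lam) (ht : 0 < t) (hR : 0 < R)
    (hvol : volume.real (closedBall (0 : Space d) R) < t ^ d * volume.real B)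
    (hx : closedBall x R ⊆ win B t) {F : Set (Space d) → ℝ≥0∞} (hF : ConfMeasurable F)
    (hF1 : ∀ X, F X ≤ 1) {G : Ω → ℝ≥0∞}
    (hG : ∀ᵐ ω ∂μ, ∀ V : Set (Space d), V.Finite → V ⊆ (closedBall x R)ᶜ →
      F (translate x (P ω) ∩ closedBall x R ∪ V) ≤ G ω) (m : ℕ) :
    ∫⁻ u, F (range u) ∂(iid m (unif B t)) ≤
      ∫⁻ ω, G ω ∂μ + ofReal (countDist lam B R t m) := by
  have hbm : MeasurableSet (closedBall x R) := isClosed_closedBall.measurableSet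
  have h1 : volume (closedBall x R) ≠ 0 := (Metric.measure_closedBall_pos _ _ hR).ne'
  have h2 : volume (win B t \ closedBall x R) ≠ 0 := fun h0 => by
    have := measureReal_sdiff (μ := volume) hx hbm isBounded_win.measure_lt_top.ne
    rw [Measure.real, h0, volume_real_win ht, volume_real_closedBall_center] at this
    simp at this; linarith
  have := (hP.translate x).lintegral_iid_le hlam (measurableSet_win ht) isBounded_win hbm hx
    h1 h2 hF hF1 hG m
  rwa [volume_real_win ht, volume_real_closedBall_center] at this

lemma translate_neg_union : translate (-x) (translate x X ∩ closedBall x R ∪ V) =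
      X ∩ closedBall 0 R ∪ translate (-x) V := by
  rw [translate_union, translate_inter, translate_neg_translate, translate_closedBall,
    neg_add_cancel]

lemma translate_neg_subset (hV : V ⊆ (closedBall x R)ᶜ) : translate (-x) V ⊆ (closedBall 0 R)ᶜ := by
  rintro _ ⟨v, hv, rfl⟩ h0
  refine hV hv ?_
  simp only [mem_closedBall, dist_zero_right] at h0 ⊢
  rwa [dist_eq_norm, sub_eq_neg_add]

lemma approxCost_union (hx : x ∈ t • interior A) (hV : V ⊆ (closedBall x R)ᶜ) :
    approxCost h A K R t x (translate x X ∩ closedBall x R ∪ V) = localCost h K R X := by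
  rw [approxCost, indicator_of_mem hx, translate_neg_union, ← localCost_inter,
    Set.union_inter_distrib_right, inter_assoc, inter_self,
    Set.disjoint_iff_inter_eq_empty.1 (disjoint_left.2 fun y hy => translate_neg_subset hV hy),
    union_empty, localCost_inter]

/-- Stabilization at the origin with the test set `tA` translated by `-x`. -/
lemma StabilizesAt.cost_eq (hP : IsPoissonProcess P lam μ) (hh : IsPointProcessSetFunction h)
    (hA : RiemannMeasurable A) (ht : 0 < t) {ω : Ω} (hs : StabilizesAt h (P ω) R (δ ω))
    (hV : V.Finite) (hVR : V ⊆ (closedBall x R)ᶜ)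
    (h1 : translate x (P ω) ∩ closedBall x R ∪ V ∉ exc h lam B A t)
    (h2 : insert x (translate x (P ω) ∩ closedBall x R ∪ V) ∉ exc h lam B A t) :
    (closedBall x R ⊆ t • interior A →
      cost (regular h lam B A t) x (translate x (P ω) ∩ closedBall x R ∪ V) = δ ω) ∧
    (closedBall x R ⊆ (t • A)ᶜ →
      cost (regular h lam B A t) x (translate x (P ω) ∩ closedBall x R ∪ V) = 0) := by
  have hfin : (translate x (P ω) ∩ closedBall x R ∪ V).Finite :=
    ((hP.translate x).locallyFinite ω _ isBounded_closedBall).union hV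
  rw [cost_regular h1 h2, ← addOneCost_translate hh (hA.smul ht) x hfin, translate_neg_union]
  obtain ⟨a, b⟩ := hs (translate (-x) (t • A)) ((hA.smul ht).translate _) _ (hV.image _)
    (translate_neg_subset hVR)
  have e : closedBall (0 : Space d) R = translate (-x) (closedBall x R) := by
    rw [translate_closedBall, neg_add_cancel]
  refine ⟨fun hsub => a ?_, fun hsub => b ?_⟩
  · rw [e]
    exact Set.image_mono (hsub.trans (smul_set_mono interior_subset))
  · rw [e]
    rintro _ ⟨y, hy, rfl⟩ ⟨z, hz, hzy⟩
    exact hsub hy (add_left_cancel hzy ▸ hz)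

/-- Unless the radius exceeds `R` or the limit exceeds `K`, the true and the approximate cost agree
whatever the outside points are: both equal the limit inside `tA` and both vanish outside. -/
lemma lintegral_ne_approxCost_le (hP : IsPoissonProcess P lam μ) (hlam : 0 < lam)
    (hh : IsPointProcessSetFunction h)
    (hA : RiemannMeasurable A)
    (hst : ∀ᵐ ω ∂μ, ∀ R, S ω ≤ R → StabilizesAt h (P ω) R (δ ω)) (ht : 0 < t) (hR : 0 < R)
    (hvol : volume.real (closedBall (0 : Space d) R) < t ^ d * volume.real B) {m : ℕ}
    (hx : x ∈ win B t) (hx' : x ∉ nearBoundary B A R t)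
    (hxe : ∀ᵐ u ∂(iid m (unif B t)),
      range u ∉ exc h lam B A t ∧ insert x (range u) ∉ exc h lam B A t) :
    iid m (unif B t) {u | cost (regular h lam B A t) x (range u) ≠
        approxCost h A K R t x (range u)} ≤
      μ {ω | R < S ω} + μ {ω | K < |δ ω|} + ofReal (countDist lam B R t m) := by
  classical
  have hE := isExceptional_exc lam B hh hA ht
  have hcm : ConfMeasurable (cost (regular h lam B A t) x) :=
    hE.conf.jointMeasurable_cost.confMeasurable x
  have ham : ConfMeasurable (approxCost h A K R t x) :=
    (jointMeasurable_approxCost hh A K R ht).confMeasurable x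
  set F : Set (Space d) → ℝ≥0∞ := fun X => if (X ∉ exc h lam B A t ∧ insert x X ∉ exc h lam B A t) ∧
    cost (regular h lam B A t) x X ≠ approxCost h A K R t x X then 1 else 0 with hF
  have hFm : ConfMeasurable F := fun k => Measurable.ite
    (((measurableSet_setOfPred.2 (hE.conf_mem k)).compl.inter
      (measurableSet_setOfPred.2 ((hE.conf_mem.insert x) k)).compl).inter
      (measurableSet_eq_fun (hcm k) (ham k)).compl) measurable_const measurable_const
  have hF1 : ∀ X, F X ≤ 1 := fun X => by simp only [hF]; split_ifs <;> simp
  have hG : ∀ᵐ ω ∂μ, ∀ V : Set (Space d), V.Finite → V ⊆ (closedBall x R)ᶜ →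
      F (translate x (P ω) ∩ closedBall x R ∪ V) ≤
        ({ω | R < S ω} ∪ {ω | K < |δ ω|}).indicator 1 ω := by
    filter_upwards [hst] with ω hω V hV hVR
    by_cases hmem : ω ∈ {ω | R < S ω} ∪ {ω | K < |δ ω|}
    · rw [indicator_of_mem hmem]; exact hF1 _
    rw [indicator_of_notMem hmem]
    simp only [mem_union, mem_ofPred_eq, not_or, not_lt] at hmem
    simp only [hF]
    rw [if_neg]
    rintro ⟨⟨h1, h2⟩, h3⟩
    have hs := hω R hmem.1
    obtain ⟨a, b⟩ := hs.cost_eq hP hh hA ht hV hVR h1 h2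
    have hself : x ∈ closedBall x R := Metric.mem_closedBall_self hR.le
    rcases closedBall_subset_or_disjoint (A := A) ht (fun h => hx' (Or.inl h)) with hsub | hsub
    · exact h3 (by rw [a hsub, approxCost_union (hsub hself) hVR, hs.localCost_eq hmem.2])
    · refine h3 ?_
      rw [b hsub, approxCost, indicator_of_notMem]
      exact fun hxA => hsub hself (smul_set_mono interior_subset hxA)
  have hmain := lintegral_unif_le hP hlam ht hR hvol (closedBall_subset_win ht hR.le hx hx') hFm
    hF1 hG m
  calc _ = ∫⁻ u, F (range u) ∂(iid m (unif B t)) := by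
        have hms : MeasurableSet {u : Fin m → Space d | cost (regular h lam B A t) x (range u) ≠
          approxCost h A K R t x (range u)} := (measurableSet_eq_fun (hcm m) (ham m)).compl
        rw [← lintegral_indicator_one hms]
        refine lintegral_congr_ae ?_
        filter_upwards [hxe] with u hu
        simp only [hF, indicator_apply, hu, not_false_eq_true, true_and, Pi.one_apply]
        rfl
    _ ≤ _ := hmain.trans (add_le_add_left ((lintegral_indicator_one_le _).trans
        (measure_union_le _ _)) _)

end Coupling

/-! ### Moments of the stabilizing limit -/

section Limit

/-- Pairs of a scale `t` and a sample size `m`, with `t → ∞` and `m` asymptotic to the mean count. -/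
noncomputable def scaleFilter (lam : ℝ) (B : Set (Space d)) : Filter (ℝ × ℕ) :=
  comap Prod.fst atTop ⊓ comap (fun p : ℝ × ℕ => (p.2 : ℝ) / meanCount lam B p.1) (𝓝 1)

variable (B) in
lemma tendsto_meanCount (hlam : 0 < lam) : Tendsto (meanCount lam B) atTop atTop := by
  have hv := volume_real_pos B
  have : Tendsto (fun t : ℝ => t ^ d) atTop atTop := tendsto_pow_atTop (NeZero.ne d)
  exact (this.const_mul_atTop hlam).atTop_mul_const hv

lemma tendsto_scaleFilter_fst : Tendsto Prod.fst (scaleFilter lam B) atTop :=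
  tendsto_comap.mono_left inf_le_left

lemma tendsto_scaleFilter_ratio :
    Tendsto (fun p : ℝ × ℕ => (p.2 : ℝ) / meanCount lam B p.1) (scaleFilter lam B) (𝓝 1) :=
  tendsto_comap.mono_left inf_le_right

lemma scaleFilter_neBot (hlam : 0 < lam) : (scaleFilter lam B).NeBot := by
  have hm := tendsto_meanCount B hlam
  have h2 : Tendsto (fun t : ℝ => ((⌈meanCount lam B t⌉₊ : ℕ) : ℝ) / meanCount lam B t) atTop (𝓝 1) :=
    (tendsto_nat_ceil_div_atTop (R := ℝ)).comp hm
  have : Tendsto (fun t : ℝ => (t, ⌈meanCount lam B t⌉₊)) atTop (scaleFilter lam B) :=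
    tendsto_inf.2 ⟨tendsto_comap_iff.2 tendsto_id, tendsto_comap_iff.2 h2⟩
  exact this.neBot

lemma tendsto_countDist (hlam : 0 < lam) (R : ℝ) :
    Tendsto (fun p : ℝ × ℕ => countDist lam B R p.1 p.2) (scaleFilter lam B) (𝓝 0) := by
  have hv := volume_real_pos B
  have hm := (tendsto_meanCount B hlam).comp (tendsto_scaleFilter_fst (lam := lam) (B := B))
  have hr := tendsto_scaleFilter_ratio (lam := lam) (B := B)
  have hpos := hm.eventually_gt_atTop 0
  refine tendsto_binomPoissonDist ?_ ?_ ?_ (by positivity)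
  · rw [← tendsto_natCast_atTop_iff (R := ℝ)]
    refine (hr.pos_mul_atTop one_pos hm).congr' ?_
    filter_upwards [hpos] with p hp
    simp only [comp_apply] at hp ⊢
    rw [div_mul_cancel₀ _ hp.ne']
  · have := hr.mul_const (lam * volume.real (closedBall (0 : Space d) R))
    rw [one_mul] at this
    refine this.congr' ?_
    filter_upwards [hpos, tendsto_scaleFilter_fst.eventually_gt_atTop 0] with p hp ht
    unfold meanCount
    field_simp
  · filter_upwards [tendsto_scaleFilter_fst.eventually_gt_atTop 0] with p hp
    positivity

/-- The conditions on a scale and a sample size under which samples are compared with `P`. -/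
structure Admissible (lam : ℝ) (B : Set (Space d)) (R : ℝ) (p : ℝ × ℕ) : Prop where
  one_le : 1 ≤ p.1
  lower : meanCount lam B p.1 / 2 ≤ p.2
  upper : (p.2 : ℝ) + 1 ≤ 3 * meanCount lam B p.1 / 2
  vol : volume.real (closedBall (0 : Space d) R) < p.1 ^ d * volume.real B

lemma eventually_admissible (hlam : 0 < lam)
    (R : ℝ) : ∀ᶠ p in scaleFilter lam B, Admissible lam B R p := by
  have hm := (tendsto_meanCount B hlam).comp (tendsto_scaleFilter_fst (lam := lam) (B := B))
  have hr := tendsto_scaleFilter_ratio (lam := lam) (B := B)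
  filter_upwards [hm.eventually_ge_atTop 4,
    hm.eventually_gt_atTop (lam * volume.real (closedBall (0 : Space d) R)),
    hr.eventually_le_const (by norm_num : (1 : ℝ) < 5 / 4),
    hr.eventually_const_le (by norm_num : (1 / 2 : ℝ) < 1),
    tendsto_scaleFilter_fst.eventually_ge_atTop 1] with p h1 h2 h3 h4 h5
  simp only [comp_apply] at h1 h2
  have h0 : 0 < meanCount lam B p.1 := by linarith
  rw [div_le_iff₀ h0] at h3
  rw [le_div_iff₀ h0] at h4
  refine ⟨h5, by linarith, by linarith, ?_⟩
  rw [meanCount, mul_assoc] at h2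
  exact lt_of_mul_lt_mul_left h2 hlam.le

variable (lam B) in
lemma regular_abs_le (hh : IsPointProcessSetFunction h) (hA : RiemannMeasurable A) (hlam : 0 < lam) (hpoly : PolynomialBound h)
    (ht : 1 ≤ t) : ∃ M, ∀ X, |regular h lam B A t X| ≤ M := by
  obtain ⟨C, q, -, -, hC⟩ := regular_bound lam B hh hA hlam hpoly
  exact ⟨_, hC t ht⟩

lemma regular_moment_integral (hh : IsPointProcessSetFunction h) (hA : RiemannMeasurable A) (hAB : A ⊆ B)
    (hmom : MomentsCondition h lam B) : ∃ C, 0 ≤ C ∧ ∀ t, 1 ≤ t → ∀ m : ℕ,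
      meanCount lam B t / 2 ≤ m → (m : ℝ) + 1 ≤ 3 * meanCount lam B t / 2 →
      ∫ p, cost (regular h lam B A t) p.1 (range p.2) ^ 4
        ∂(rooted m (unif B t)) ≤ C := by
  obtain ⟨C, hC0, hC⟩ := regular_moment hh hA hAB hmom
  refine ⟨C, hC0, fun t ht m hm hm' => ?_⟩
  have hE := isExceptional_exc lam B hh hA (by linarith : 0 < t)
  have hcm : Measurable fun p : Space d × (Fin m → Space d) =>
      cost (regular h lam B A t) p.1 (range p.2) := hE.conf.jointMeasurable_cost m
  rw [integral_eq_lintegral_of_nonneg_ae (ae_of_all _ fun p => by positivity)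
    (hcm.pow_const 4).aestronglyMeasurable]
  exact toReal_le_of_le_ofReal hC0 (hC t ht m hm hm')

lemma lintegral_ofReal_one_sub {α : Type*} [MeasurableSpace α] {ρ : Measure α}
    [IsProbabilityMeasure ρ] {f : α → ℝ} (hf : Integrable f ρ) (h1 : ∀ a, f a ≤ 1) :
    ∫⁻ a, ofReal (1 - f a) ∂ρ = ofReal (1 - ∫ a, f a ∂ρ) := by
  have hi : Integrable (fun a => 1 - f a) ρ := (integrable_const _).sub hf
  rw [← ofReal_integral_eq_lintegral_ofReal hi (ae_of_all _ fun a => by simpa using h1 a),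
    integral_sub (integrable_const _) hf]
  simp

/-- With `A = B` the cost at an interior point equals `δ` when `S ≤ R`. A bounded truncation of its
fourth power is compared with a binomial sample, for which the moments condition gives the bound
`C`; boundary effects and count distance vanish as the scale grows. -/
lemma integral_truncated_le (hP : IsPoissonProcess P lam μ) (hlam : 0 < lam)
    (hh : IsPointProcessSetFunction h)
    (hpoly : PolynomialBound h) (hδ : AEMeasurable δ μ) (hS : AEMeasurable S μ)
    (hst : ∀ᵐ ω ∂μ, ∀ R, S ω ≤ R → StabilizesAt h (P ω) R (δ ω)) (hR : 0 < R) {L C : ℝ} (hL : 0 < L)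
    (hC : ∀ t, 1 ≤ t → ∀ m : ℕ,
      meanCount lam B t / 2 ≤ m → (m : ℝ) + 1 ≤ 3 * meanCount lam B t / 2 →
      ∫ p, cost (regular h lam B B t) p.1 (range p.2) ^ 4
        ∂(rooted m (unif B t)) ≤ C) :
    ∫⁻ ω, {ω | S ω ≤ R}.indicator (fun ω => ofReal (min (δ ω ^ 4) L)) ω ∂μ ≤
      ofReal C := by
  classical
  set φ : ℝ → ℝ := fun y => min (y ^ 4) L / L with hφ
  have hφ0 : ∀ y, 0 ≤ φ y := fun y => div_nonneg (le_min (by positivity) hL.le) hL.le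
  have hφ1 : ∀ y, φ y ≤ 1 := fun y => (div_le_one hL).2 (min_le_right _ _)
  have hφm : Measurable φ := ((measurable_id.pow_const 4).min measurable_const).div_const L
  set ψ : Ω → ℝ := {ω | S ω ≤ R}.indicator fun ω => φ (δ ω) with hψ
  have hSm : NullMeasurableSet {ω | S ω ≤ R} μ := nullMeasurableSet_le hS aemeasurable_const
  have hψm : AEMeasurable ψ μ := (hφm.comp_aemeasurable hδ).indicator₀ hSm
  have hψ0 : ∀ ω, 0 ≤ ψ ω := fun ω => indicator_nonneg (fun _ _ => hφ0 _) _
  have hψ1 : ∀ ω, ψ ω ≤ 1 := fun ω => Set.indicator_le' (fun _ _ => hφ1 _) (fun _ _ => zero_le_one) _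
  have hψi : Integrable ψ μ := Integrable.of_bound hψm.aestronglyMeasurable 1
    (ae_of_all _ fun ω => by rw [norm_of_nonneg (hψ0 ω)]; exact hψ1 ω)
  have h1ψ : ∫ ω, ψ ω ∂μ ≤ 1 := (integral_mono hψi (integrable_const _) hψ1).trans (by simp)
  have key : ∫ ω, ψ ω ∂μ ≤ C / L := by
    have hev : ∀ᶠ p in scaleFilter lam B, ∫ ω, ψ ω ∂μ ≤
        (unif B p.1).real (nearBoundary B B R p.1) + C / L + |countDist lam B R p.1 p.2| := by
      filter_upwards [eventually_admissible hlam R] with p hp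
      obtain ⟨t, m⟩ := p
      obtain ⟨ht, hm, hm', hvol⟩ := hp
      simp only at ht hm hm' hvol ⊢
      have ht0 : 0 < t := by linarith
      have hprob := isProbabilityMeasure_unif B ht0
      set f := regular h lam B B t
      have hE := isExceptional_exc lam B hh hB.riem ht0
      obtain ⟨M, hM⟩ := regular_abs_le lam B hh hB.riem hlam hpoly ht
      have hcm := hE.conf.jointMeasurable_cost
      have hx : ∀ᵐ x ∂(unif B t), x ∉ nearBoundary B B R t → ∫ ω, ψ ω ∂μ ≤
          ∫ u, φ (cost f x (range u)) ∂(iid m (unif B t)) + |countDist lam B R t m| := by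
        filter_upwards [ae_notMem_exc lam B hh hB.riem ht0 hm', ae_unif_mem ht0]
          with x hxe hxW hxb
        -- The comparison only bounds functionals of the sample from above, so it is applied to `1 -
        -- φ` to bound `φ` from below.
        set F : Set (Space d) → ℝ≥0∞ := fun X => if X ∉ exc h lam B B t ∧
          insert x X ∉ exc h lam B B t then ofReal (1 - φ (cost f x X)) else 0 with hF
        have hFm : ConfMeasurable F := fun k => Measurable.ite
          ((measurableSet_setOfPred.2 (hE.conf_mem k)).compl.inter
            (measurableSet_setOfPred.2 ((hE.conf_mem.insert x) k)).compl)
          (measurable_const.sub (hφm.comp (hcm.confMeasurable x k))).ennreal_ofReal measurable_const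
        have hF1 : ∀ X, F X ≤ 1 := fun X => by
          simp only [hF]; split_ifs
          · exact ENNReal.ofReal_le_one.2 (by linarith [hφ0 (cost f x X)])
          · simp
        have hsub := closedBall_subset_win ht0 hR.le hxW hxb
        have hG : ∀ᵐ ω ∂μ, ∀ V : Set (Space d), V.Finite → V ⊆ (closedBall x R)ᶜ →
            F (translate x (P ω) ∩ closedBall x R ∪ V) ≤ ofReal (1 - ψ ω) := by
          filter_upwards [hst] with ω hω V hV hVR
          simp only [hF]
          split_ifs with hc
          · refine ofReal_le_ofReal ?_
            by_cases hSR : S ω ≤ R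
            · rw [((hω R hSR).cost_eq hP hh hB.riem ht0 hV hVR hc.1 hc.2).1 hsub, hψ,
                indicator_of_mem (by exact hSR)]
            · rw [hψ, indicator_of_notMem (by exact hSR)]
              linarith [hφ0 (cost f x (translate x (P ω) ∩ closedBall x R ∪ V))]
          · simp
        have hmain := lintegral_unif_le hP hlam ht0 hR hvol hsub hFm hF1 hG m
        have hφi : Integrable (fun u => φ (cost f x (range u))) (iid m (unif B t)) :=
          integrable_of_abs_le (hφm.comp (hcm.confMeasurable x m)) (b := 1) fun u => by
            rw [abs_of_nonneg (hφ0 _)]; exact hφ1 _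
        have e1 : ∫⁻ u, F (range u) ∂(iid m (unif B t)) =
            ofReal (1 - ∫ u, φ (cost f x (range u)) ∂(iid m (unif B t))) := by
          rw [← lintegral_ofReal_one_sub hφi fun u => hφ1 _]
          exact lintegral_congr_ae (hxe.mono fun u hu => if_pos hu)
        rw [e1, lintegral_ofReal_one_sub hψi hψ1] at hmain
        have := hmain.trans (add_le_add_right (ofReal_le_ofReal
          (le_abs_self (countDist lam B R t m))) _)
        rw [← ofReal_add (by linarith) (abs_nonneg _),
          ENNReal.ofReal_le_ofReal_iff (by linarith [abs_nonneg (countDist lam B R t m)])] at this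
        linarith
      have hcφ : Integrable (fun p : Space d × (Fin m → Space d) => φ (cost f p.1 (range p.2)))
          (rooted m (unif B t)) :=
        integrable_of_abs_le (hφm.comp (hcm m)) (b := 1) fun u => by
          rw [abs_of_nonneg (hφ0 _)]; exact hφ1 _
      have hbad : Integrable ((nearBoundary B B R t).indicator fun _ : Space d => (1 : ℝ)) (unif B t) :=
        (integrable_const _).indicator measurableSet_nearBoundary
      calc ∫ ω, ψ ω ∂μ = ∫ _x, ∫ ω, ψ ω ∂μ ∂(unif B t) := by simp
        _ ≤ ∫ x, ((nearBoundary B B R t).indicator (fun _ => (1 : ℝ)) x +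
            ∫ u, φ (cost f x (range u)) ∂(iid m (unif B t)) + |countDist lam B R t m|)
              ∂(unif B t) := by
            refine integral_mono_ae (integrable_const _)
              ((hbad.add hcφ.integral_prod_left).add (integrable_const _)) ?_
            filter_upwards [hx] with x hx
            have h0 : 0 ≤ ∫ u, φ (cost f x (range u)) ∂(iid m (unif B t)) :=
              integral_nonneg fun u => hφ0 _
            by_cases hxb : x ∈ nearBoundary B B R t
            · rw [indicator_of_mem hxb]
              linarith [abs_nonneg (countDist lam B R t m)]
            · rw [indicator_of_notMem hxb]
              linarith [hx hxb]
        _ = (unif B t).real (nearBoundary B B R t) +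
            ∫ p, φ (cost f p.1 (range p.2)) ∂(rooted m (unif B t)) +
            |countDist lam B R t m| := by
            rw [integral_add (hbad.fun_add hcφ.integral_prod_left) (integrable_const _),
              integral_add hbad hcφ.integral_prod_left, integral_prod _ hcφ,
              integral_indicator_const _ measurableSet_nearBoundary]
            simp
        _ ≤ _ := by
            gcongr
            rw [le_div_iff₀ hL, ← integral_mul_const]
            refine le_trans (integral_mono (hcφ.mul_const L)
              (integrable_pow_of_abs_le (hcm m) (fun p => abs_cost_le hM p.1 _) 4) fun p => ?_)
              (hC t ht m hm hm')
            simp only [hφ]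
            rw [div_mul_cancel₀ _ hL.ne']
            exact min_le_left _ _
    have hlim : Tendsto (fun p : ℝ × ℕ => (unif B p.1).real (nearBoundary B B R p.1) + C / L +
        |countDist lam B R p.1 p.2|) (scaleFilter lam B) (𝓝 (0 + C / L + |0|)) :=
      (((tendsto_unif_nearBoundary hB.riem hR.le).comp tendsto_scaleFilter_fst).add_const _).add
        (tendsto_countDist hlam R).abs
    have := scaleFilter_neBot (B := B) hlam
    simpa using ge_of_tendsto hlim hev
  have e : ∀ ω, {ω | S ω ≤ R}.indicator (fun ω => ofReal (min (δ ω ^ 4) L)) ω =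
      ofReal (ψ ω * L) := fun ω => by
    by_cases hω : ω ∈ {ω | S ω ≤ R}
    · rw [hψ, indicator_of_mem hω, indicator_of_mem hω, hφ, div_mul_cancel₀ _ hL.ne']
    · rw [hψ, indicator_of_notMem hω, indicator_of_notMem hω]; simp
  simp_rw [e]
  rw [← ofReal_integral_eq_lintegral_ofReal (hψi.mul_const L)
    (ae_of_all _ fun ω => mul_nonneg (hψ0 ω) hL.le), integral_mul_const]
  exact ofReal_le_ofReal ((le_div_iff₀ hL).1 key)

/-- Fatou's lemma as radius and truncation level tend to infinity together. -/
lemma integrable_limit_pow_four (hP : IsPoissonProcess P lam μ) (hlam : 0 < lam)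
    (hh : IsPointProcessSetFunction h)
    (hpoly : PolynomialBound h) (hmom : MomentsCondition h lam B) (hδ : AEMeasurable δ μ)
    (hS : AEMeasurable S μ)
    (hst : ∀ᵐ ω ∂μ, ∀ R, S ω ≤ R → StabilizesAt h (P ω) R (δ ω)) :
    Integrable (fun ω => δ ω ^ 4) μ := by
  obtain ⟨C, hC0, hC⟩ := regular_moment_integral hh hB.riem subset_rfl hmom
  have hb := fun n : ℕ => integral_truncated_le hP hlam hh hpoly hδ hS hst
    (R := (n : ℝ) + 1) (by positivity) (L := (n : ℝ) + 1) (by positivity) hC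
  set Φ : ℕ → Ω → ℝ≥0∞ := fun n =>
    {ω | S ω ≤ (n : ℝ) + 1}.indicator (fun ω => ofReal (min (δ ω ^ 4) ((n : ℝ) + 1)))
  have hΦ : ∀ n, AEMeasurable (Φ n) μ := fun n =>
    (((hδ.pow_const 4).min aemeasurable_const).ennreal_ofReal).indicator₀
      (nullMeasurableSet_le hS aemeasurable_const)
  have hlim : ∀ ω, Tendsto (fun n => Φ n ω) atTop (𝓝 (ofReal (δ ω ^ 4))) := fun ω => by
    refine tendsto_const_nhds.congr' ?_
    filter_upwards [tendsto_natCast_atTop_atTop.eventually_ge_atTop (S ω),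
      tendsto_natCast_atTop_atTop.eventually_ge_atTop (δ ω ^ 4)] with n h1 h2
    have hmem : ω ∈ {ω | S ω ≤ (n : ℝ) + 1} := by
      simp only [mem_ofPred_eq]; linarith
    simp only [Φ]
    rw [indicator_of_mem hmem, min_eq_left (by linarith)]
  have hfat : ∫⁻ ω, ofReal (δ ω ^ 4) ∂μ ≤ ofReal C := by
    calc _ = ∫⁻ ω, liminf (fun n => Φ n ω) atTop ∂μ := by simp_rw [fun ω => (hlim ω).liminf_eq]
      _ ≤ liminf (fun n => ∫⁻ ω, Φ n ω ∂μ) atTop := lintegral_liminf_le' hΦ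
      _ ≤ liminf (fun _ : ℕ => ofReal C) atTop := liminf_le_liminf (Eventually.of_forall hb)
      _ = _ := liminf_const _
  exact (lintegral_ofReal_ne_top_iff_integrable (hδ.pow_const 4).aestronglyMeasurable
    (ae_of_all _ fun ω => by positivity)).1 (hfat.trans_lt ENNReal.ofReal_lt_top).ne

end Limit

/-! ### Local approximation of the add one cost -/

section Approximation

/-- The standing assumptions on a functional, with a measurable radius of stabilization. -/
structure Setting (μ : Measure Ω) (P : Ω → Set (Space d)) (lam : ℝ)
    (h : Set (Space d) → Set (Space d) → ℝ) (B A : Set (Space d)) (δ S : Ω → ℝ) : Prop where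
  process : IsPoissonProcess P lam μ
  pos : 0 < lam
  fn : IsPointProcessSetFunction h
  riem : RiemannMeasurable A
  sub : A ⊆ B
  poly : PolynomialBound h
  mom : MomentsCondition h lam B
  lim : AEMeasurable δ μ
  radius : Measurable S
  stab : ∀ᵐ ω ∂μ, ∀ R, S ω ≤ R → StabilizesAt h (P ω) R (δ ω)

lemma Setting.integrable_pow_four (H : Setting μ P lam h B A δ S) :
    Integrable (fun ω => δ ω ^ 4) μ :=
  integrable_limit_pow_four H.process H.pos H.fn H.poly H.mom H.lim
    H.radius.aemeasurable H.stab

lemma Setting.memLp (H : Setting μ P lam h B A δ S) : MemLp δ 2 μ := by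
  refine (memLp_two_iff_integrable_sq H.lim.aestronglyMeasurable).2
    (((integrable_const 1).add H.integrable_pow_four).mono'
      (H.lim.pow_const 2).aestronglyMeasurable (ae_of_all _ fun ω => ?_))
  rw [norm_of_nonneg (sq_nonneg _)]
  simp only [Pi.add_apply]
  nlinarith [sq_nonneg (δ ω ^ 2 - 1)]

lemma Setting.measurable_localCost (H : Setting μ P lam h B A δ S) (K R : ℝ) :
    Measurable fun ω => localCost h K R (P ω) := by
  simp_rw [← localCost_inter (h := h) K R (P _)]
  exact (confMeasurable_localCost H.fn K R).comp_of_counts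
    (fun ω => H.process.locallyFinite ω _ isBounded_closedBall)
    (H.process.measurable_ncard_inter isClosed_closedBall.measurableSet
      isBounded_closedBall)

/-- Where `|δ| > K` the square is at most `4 δ² ≤ 4 δ⁴ / K²`; where `S > R` it is at most `4 K²`;
elsewhere it vanishes. -/
lemma Setting.integral_sq_localCost_le (H : Setting μ P lam h B A δ S) (hK : 1 ≤ K) (R : ℝ) :
    ∫ ω, (localCost h K R (P ω) - δ ω) ^ 2 ∂μ ≤
      4 / K ^ 2 * ∫ ω, δ ω ^ 4 ∂μ + 4 * K ^ 2 * μ.real {ω | R < S ω} := by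
  have hm : MeasurableSet {ω | R < S ω} := measurableSet_lt measurable_const H.radius
  have hi := (H.integrable_pow_four.const_mul (4 / K ^ 2))
  have hi' : Integrable ({ω | R < S ω}.indicator fun _ => 4 * K ^ 2) μ :=
    (integrable_const _).indicator hm
  calc _ ≤ ∫ ω, (4 / K ^ 2 * δ ω ^ 4 + {ω | R < S ω}.indicator (fun _ => 4 * K ^ 2) ω) ∂μ := by
        refine integral_mono_of_nonneg (ae_of_all _ fun ω => sq_nonneg _) (hi.add hi') ?_
        filter_upwards [H.stab] with ω hω
        have hc := abs_localCost_le (h := h) (zero_le_one.trans hK) R (P ω)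
        have h0 : 0 ≤ {ω | R < S ω}.indicator (fun _ => 4 * K ^ 2) ω :=
          indicator_nonneg (fun _ _ => by positivity) _
        have h1 : 0 ≤ 4 / K ^ 2 * δ ω ^ 4 := by positivity
        have h2 : |localCost h K R (P ω) - δ ω| ≤ K + |δ ω| := (abs_sub _ _).trans (by linarith)
        rw [← sq_abs]
        rcases lt_or_ge K |δ ω| with hd | hd
        · have : 4 * |δ ω| ^ 2 ≤ 4 / K ^ 2 * δ ω ^ 4 := by
            rw [← Even.pow_abs (by decide : Even 4) (δ ω), div_mul_eq_mul_div,
              le_div_iff₀ (by positivity)]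
            have : K ^ 2 ≤ |δ ω| ^ 2 := by gcongr
            nlinarith [sq_nonneg |δ ω|]
          nlinarith [abs_nonneg (localCost h K R (P ω) - δ ω)]
        by_cases hS : ω ∈ {ω | R < S ω}
        · rw [indicator_of_mem hS]
          nlinarith [abs_nonneg (localCost h K R (P ω) - δ ω)]
        · rw [(hω R (not_lt.1 hS)).localCost_eq hd, sub_self, abs_zero]
          linarith
    _ = _ := by
        rw [integral_add hi hi', integral_const_mul, integral_indicator_const _ hm, smul_eq_mul,
          mul_comm (μ.real _)]

lemma Setting.real_lt_le (H : Setting μ P lam h B A δ S) (hK : 0 < K) :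
    μ.real {ω | K < |δ ω|} ≤ (∫ ω, δ ω ^ 4 ∂μ) / K ^ 4 := by
  rw [le_div_iff₀ (by positivity), mul_comm]
  refine le_trans ?_ (mul_meas_ge_le_integral_of_nonneg (ae_of_all _ fun ω => by positivity)
    H.integrable_pow_four (K ^ 4))
  refine mul_le_mul_of_nonneg_left (measureReal_mono fun ω hω => ?_) (by positivity)
  simp only [mem_ofPred_eq] at hω ⊢
  rw [← Even.pow_abs (by decide : Even 4) (δ ω)]
  gcongr

lemma Setting.exists_radius_le (H : Setting μ P lam h B A δ S) {ε : ℝ} (hε : 0 < ε) :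
    ∃ R, 0 < R ∧ μ.real {ω | R < S ω} ≤ ε := by
  have h1 : Tendsto (fun n : ℕ => μ {ω | (n : ℝ) < S ω}) atTop (𝓝 (μ (⋂ n : ℕ, {ω | (n : ℝ) < S ω}))) :=
    tendsto_measure_iInter_atTop
      (fun n => (measurableSet_lt measurable_const H.radius).nullMeasurableSet)
      (fun n m hnm ω (hω : (m : ℝ) < S ω) => by
        simp only [mem_ofPred_eq]; exact (Nat.cast_le.2 hnm).trans_lt hω) ⟨0, measure_ne_top _ _⟩
  have h2 : ⋂ n : ℕ, {ω | (n : ℝ) < S ω} = ∅ := by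
    refine Set.eq_empty_of_forall_notMem fun ω hω => ?_
    obtain ⟨n, hn⟩ := exists_nat_ge (S ω)
    exact absurd (Set.mem_iInter.1 hω n) (not_lt.2 hn)
  rw [h2, measure_empty] at h1
  have h3 := ((ENNReal.tendsto_toReal ENNReal.zero_ne_top).comp h1).eventually_le_const
    (by simpa using hε)
  obtain ⟨n, hn, hn0⟩ := (h3.and (eventually_gt_atTop 0)).exists
  exact ⟨n, by exact_mod_cast hn0, hn⟩

lemma Setting.measurable_cost (H : Setting μ P lam h B A δ S) (ht : 0 < t) (m : ℕ) :
    Measurable fun p : Space d × (Fin m → Space d) =>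
      cost (regular h lam B A t) p.1 (range p.2) :=
  (isExceptional_exc lam B H.fn H.riem ht).conf.jointMeasurable_cost m

lemma Setting.real_ne_le (H : Setting μ P lam h B A δ S) (hR : 0 < R) (hK : 0 < K) {p : ℝ × ℕ}
    (hp : Admissible lam B R p) :
    (rooted p.2 (unif B p.1)).real {q | cost (regular h lam B A p.1) q.1
        (range q.2) ≠ approxCost h A K R p.1 q.1 (range q.2)} ≤
      (unif B p.1).real (nearBoundary B A R p.1) + (μ.real {ω | R < S ω} +
        (∫ ω, δ ω ^ 4 ∂μ) / K ^ 4 + |countDist lam B R p.1 p.2|) := by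
  obtain ⟨t, m⟩ := p
  obtain ⟨ht, hm, hm', hvol⟩ := hp
  simp only at ht hm hm' hvol ⊢
  have ht0 : 0 < t := by linarith
  have hprob := isProbabilityMeasure_unif B ht0
  have hms : MeasurableSet {q : Space d × (Fin m → Space d) | cost (regular h lam B A t) q.1
      (range q.2) ≠ approxCost h A K R t q.1 (range q.2)} :=
    (measurableSet_eq_fun (H.measurable_cost ht0 m)
      (jointMeasurable_approxCost H.fn A K R ht0 m)).compl
  set b := μ.real {ω | R < S ω} + (∫ ω, δ ω ^ 4 ∂μ) / K ^ 4 + |countDist lam B R t m| with hb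
  have hI : 0 ≤ ∫ ω, δ ω ^ 4 ∂μ := integral_nonneg fun ω => by positivity
  have hb0 : 0 ≤ b := by positivity
  refine toReal_le_of_le_ofReal (by positivity) ?_
  rw [Measure.prod_apply hms, ofReal_add measureReal_nonneg hb0, ofReal_measureReal]
  calc _ ≤ ∫⁻ x, ((nearBoundary B A R t).indicator 1 x + ofReal b) ∂(unif B t) := by
        refine lintegral_mono_ae ?_
        filter_upwards [ae_notMem_exc lam B H.fn H.riem ht0 hm', ae_unif_mem ht0] with x hxe hxW
        by_cases hx : x ∈ nearBoundary B A R t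
        · rw [indicator_of_mem hx]
          exact prob_le_one.trans le_self_add
        · rw [indicator_of_notMem hx, zero_add]
          refine (lintegral_ne_approxCost_le (K := K) H.process H.pos H.fn H.riem
            H.stab ht0 hR hvol hxW hx hxe).trans ?_
          rw [hb, ofReal_add (by positivity) (abs_nonneg _),
            ofReal_add measureReal_nonneg (by positivity), ofReal_measureReal]
          gcongr
          · rw [← ofReal_measureReal]; exact ofReal_le_ofReal (H.real_lt_le hK)
          · exact le_abs_self _
    _ = _ := by
        rw [lintegral_add_right _ measurable_const,
          lintegral_indicator_one measurableSet_nearBoundary]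
        simp

/-- The costs differ only on an event of small probability. There `(a - g)² ≤ 2 a² + 2 K²`, and `2
a² ≤ 2 a⁴ / K + K / 2` trades the square for the bounded fourth moment. -/
lemma Setting.integral_sq_sub_approxCost_le (H : Setting μ P lam h B A δ S) (hR : 0 < R)
    (hK : 1 ≤ K) {p : ℝ × ℕ} (hp : Admissible lam B R p) {C : ℝ}
    (hC : ∫ q, cost (regular h lam B A p.1) q.1 (range q.2) ^ 4
      ∂(rooted p.2 (unif B p.1)) ≤ C) :
    ∫ q, (cost (regular h lam B A p.1) q.1 (range q.2) -
        approxCost h A K R p.1 q.1 (range q.2)) ^ 2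
        ∂(rooted p.2 (unif B p.1)) ≤
      2 / K * C + 4 * K ^ 2 * ((unif B p.1).real (nearBoundary B A R p.1) + (μ.real {ω | R < S ω} +
        (∫ ω, δ ω ^ 4 ∂μ) / K ^ 4 + |countDist lam B R p.1 p.2|)) := by
  have ht0 : 0 < p.1 := zero_lt_one.trans_le hp.one_le
  have hprob := isProbabilityMeasure_unif B ht0
  have hK0 : 0 < K := by linarith
  have hcm := H.measurable_cost ht0 p.2
  set T : Set (Space d × (Fin p.2 → Space d)) := {q | cost (regular h lam B A p.1) q.1 (range q.2) ≠
    approxCost h A K R p.1 q.1 (range q.2)}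
  have hms : MeasurableSet T :=
    (measurableSet_eq_fun hcm (jointMeasurable_approxCost H.fn A K R ht0 p.2)).compl
  obtain ⟨M, hM⟩ := regular_abs_le lam B H.fn H.riem H.pos H.poly hp.one_le
  have hi := (integrable_pow_of_abs_le (μ := rooted p.2 (unif B p.1)) hcm
    (fun q => abs_cost_le hM q.1 _) 4).const_mul (2 / K)
  have hi' := (integrable_const (μ := rooted p.2 (unif B p.1))
    (4 * K ^ 2)).indicator hms
  calc _ ≤ ∫ q, (2 / K * cost (regular h lam B A p.1) q.1 (range q.2) ^ 4 +
        T.indicator (fun _ => 4 * K ^ 2) q)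
        ∂(rooted p.2 (unif B p.1)) := by
        refine integral_mono_of_nonneg (ae_of_all _ fun q => sq_nonneg _) (hi.add hi')
          (ae_of_all _ fun q => ?_)
        simp only
        have hg := abs_approxCost_le (h := h) hK0.le A R p.1 q.1 (range q.2)
        set a := cost (regular h lam B A p.1) q.1 (range q.2)
        set g := approxCost h A K R p.1 q.1 (range q.2) with hgd
        by_cases hq : a = g
        · rw [hq, sub_self]
          have : 0 ≤ T.indicator (fun _ => 4 * K ^ 2) q :=
            indicator_nonneg (fun _ _ => by positivity) q
          have h2 : 0 ≤ 2 / K * g ^ 4 := by positivity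
          linarith
        · rw [indicator_of_mem (by exact hq)]
          have h1 : 2 * a ^ 2 ≤ 2 / K * a ^ 4 + K / 2 := by
            have : 2 / K * a ^ 4 + K / 2 - 2 * a ^ 2 = 2 / K * (a ^ 2 - K / 2) ^ 2 := by
              field_simp; ring
            linarith [show 0 ≤ 2 / K * (a ^ 2 - K / 2) ^ 2 by positivity]
          have h2 : g ^ 2 ≤ K ^ 2 := sq_le_sq' (abs_le.1 hg).1 (abs_le.1 hg).2
          nlinarith [sq_nonneg (a + g)]
    _ ≤ _ := by
        rw [integral_add hi hi', integral_const_mul, integral_indicator_const _ hms, smul_eq_mul,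
          mul_comm (Measure.real _ _)]
        gcongr
        exact H.real_ne_le hR hK0 hp

/-- Moves values in `[-K, K]` to `[0, 1]`, with either orientation. Using both signs makes the
one-sided comparison two-sided. -/
lemma affine_mem_unitInterval {σ y : ℝ} (hK : 0 < K) (hσ : |σ| = 1) (hy : |y| ≤ K) :
    0 ≤ (K + σ * y) / (2 * K) ∧ (K + σ * y) / (2 * K) ≤ 1 := by
  have : |σ * y| ≤ K := by rwa [abs_mul, hσ, one_mul]
  rw [div_le_one (by positivity)]
  exact ⟨div_nonneg (by linarith [(abs_le.1 this).1]) (by positivity),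
    by linarith [(abs_le.1 this).2]⟩

lemma lintegral_ofReal_affine {α : Type*} [MeasurableSpace α] {ρ : Measure α}
    [IsProbabilityMeasure ρ] {f : α → ℝ} {σ : ℝ} (hK : 0 < K) (hσ : |σ| = 1) (hf : Integrable f ρ)
    (hfK : ∀ a, |f a| ≤ K) : ∫⁻ a, ofReal ((K + σ * f a) / (2 * K)) ∂ρ =
      ofReal ((K + σ * ∫ a, f a ∂ρ) / (2 * K)) := by
  have h1 : Integrable (fun a => K + σ * f a) ρ := (integrable_const _).add (hf.const_mul σ)
  rw [← ofReal_integral_eq_lintegral_ofReal (h1.div_const _)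
    (ae_of_all _ fun a => (affine_mem_unitInterval hK hσ (hfK a)).1), integral_div,
    integral_add (integrable_const _) (hf.const_mul σ), integral_const_mul]
  simp

lemma Setting.abs_integral_approxCost_sub_le (H : Setting μ P lam h B A δ S) (hR : 0 < R)
    (hK : 0 < K) {p : ℝ × ℕ} (hp : Admissible lam B R p) (hx : x ∈ win B p.1)
    (hx' : x ∉ nearBoundary B A R p.1) :
    |∫ u, approxCost h A K R p.1 x (range u) ∂(iid p.2 (unif B p.1)) -
      (p.1 • interior A).indicator (fun _ => ∫ ω, localCost h K R (P ω) ∂μ) x| ≤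
      2 * K * |countDist lam B R p.1 p.2| := by
  have ht0 : 0 < p.1 := zero_lt_one.trans_le hp.one_le
  have hprob := isProbabilityMeasure_unif B ht0
  by_cases hxA : x ∈ p.1 • interior A
  swap
  · simp only [approxCost, indicator_of_notMem hxA]
    simp only [integral_zero, sub_zero, abs_zero]; positivity
  rw [indicator_of_mem hxA]
  have hgm := (jointMeasurable_approxCost H.fn A K R ht0).confMeasurable x
  have hgi : Integrable (fun u => approxCost h A K R p.1 x (range u)) (iid p.2 (unif B p.1)) :=
    integrable_of_abs_le (hgm _) fun u => abs_approxCost_le hK.le ..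
  have hli : Integrable (fun ω => localCost h K R (P ω)) μ :=
    integrable_of_abs_le (H.measurable_localCost K R) fun u => abs_localCost_le hK.le ..
  have key : ∀ σ : ℝ, |σ| = 1 → σ * (∫ u, approxCost h A K R p.1 x (range u)
      ∂(iid p.2 (unif B p.1)) - ∫ ω, localCost h K R (P ω) ∂μ) ≤
      2 * K * |countDist lam B R p.1 p.2| := fun σ hσ => by
    have hb := fun y => affine_mem_unitInterval (y := y) hK hσ
    have hmain := lintegral_unif_le (F := fun X => ofReal
      ((K + σ * approxCost h A K R p.1 x X) / (2 * K)))
      (G := fun ω => ofReal ((K + σ * localCost h K R (P ω)) / (2 * K)))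
      H.process H.pos ht0 hR hp.vol (closedBall_subset_win ht0 hR.le hx hx')
      (fun k => ((measurable_const.add ((hgm k).const_mul σ)).div_const _).ennreal_ofReal)
      (fun X => ENNReal.ofReal_le_one.2 (hb _ (abs_approxCost_le hK.le ..)).2)
      (ae_of_all _ fun ω V _ hV => by rw [approxCost_union hxA hV]) p.2
    rw [lintegral_ofReal_affine hK hσ hgi fun u => abs_approxCost_le hK.le ..,
      lintegral_ofReal_affine hK hσ hli fun u => abs_localCost_le hK.le ..] at hmain
    have h0 : 0 ≤ (K + σ * ∫ ω, localCost h K R (P ω) ∂μ) / (2 * K) := (hb _ (by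
      exact abs_integral_le_of_abs_le fun ω => abs_localCost_le hK.le ..)).1
    have := hmain.trans (add_le_add_right (ofReal_le_ofReal (le_abs_self _)) _)
    rw [← ofReal_add h0 (abs_nonneg _),
      ENNReal.ofReal_le_ofReal_iff (by positivity), div_add' _ _ _ (by positivity),
      div_le_div_iff_of_pos_right (by positivity)] at this
    linarith
  have h1 := key 1 (by simp)
  have h2 := key (-1) (by simp)
  exact abs_le.2 ⟨by linarith, by linarith⟩

lemma unif_real_smul_interior {D : Set (Space d)}
    (hD : RiemannMeasurable D) (hDB : D ⊆ B) (ht : 0 < t) :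
    (unif B t).real (t • interior D) = volume.real D / volume.real B := by
  rw [unif_real_apply ht, inter_eq_self_of_subset_right
    (show _ ⊆ win B t from smul_set_mono (interior_mono hDB)), volume_real_win ht, volume_smul_real _ ht,
    measureReal_congr (interior_ae_eq_of_null_frontier hD.2)]
  have : t ^ d ≠ 0 := by positivity
  field_simp

lemma Setting.abs_integral_approxCost_prod_sub_le (H : Setting μ P lam h B A δ S) (hR : 0 < R)
    (hK : 0 < K) {p : ℝ × ℕ} (hp : Admissible lam B R p) :
    |∫ q, approxCost h A K R p.1 q.1 (range q.2) ∂(rooted p.2 (unif B p.1)) -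
      volume.real A / volume.real B * ∫ ω, localCost h K R (P ω) ∂μ| ≤
      2 * K * (|countDist lam B R p.1 p.2| + (unif B p.1).real (nearBoundary B A R p.1)) := by
  have ht0 : 0 < p.1 := zero_lt_one.trans_le hp.one_le
  have hprob := isProbabilityMeasure_unif B ht0
  have hgi : Integrable (fun q : Space d × (Fin p.2 → Space d) =>
      approxCost h A K R p.1 q.1 (range q.2)) (rooted p.2 (unif B p.1)) :=
    integrable_of_abs_le (jointMeasurable_approxCost H.fn A K R ht0 _)
      fun u => abs_approxCost_le hK.le ..
  have hm : MeasurableSet (p.1 • interior A) := (isOpen_interior.smul₀ ht0.ne').measurableSet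
  set l := ∫ ω, localCost h K R (P ω) ∂μ
  have hl : |l| ≤ K := abs_integral_le_of_abs_le fun ω => abs_localCost_le hK.le ..
  have hAi : Integrable ((p.1 • interior A).indicator fun _ => l) (unif B p.1) :=
    (integrable_const l).indicator hm
  have hbad : Integrable ((nearBoundary B A R p.1).indicator fun _ : Space d => 2 * K)
    (unif B p.1) := (integrable_const _).indicator measurableSet_nearBoundary
  have e : volume.real A / volume.real B * l =
      ∫ x, (p.1 • interior A).indicator (fun _ => l) x ∂(unif B p.1) := by
    rw [integral_indicator_const _ hm, unif_real_smul_interior H.riem H.sub ht0, smul_eq_mul]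
  rw [e, integral_prod _ hgi, ← integral_sub hgi.integral_prod_left hAi]
  refine abs_integral_le_integral_abs.trans ((integral_mono_of_nonneg
    (ae_of_all _ fun ω => abs_nonneg _) ((integrable_const (2 * K * |countDist lam B R p.1 p.2|)).fun_add
    hbad) ?_).trans ?_)
  · filter_upwards [ae_unif_mem ht0] with x hx
    by_cases hx' : x ∈ nearBoundary B A R p.1
    · rw [indicator_of_mem hx']
      have h1 : |∫ u, approxCost h A K R p.1 x (range u) ∂(iid p.2 (unif B p.1))| ≤ K :=
        abs_integral_le_of_abs_le fun ω => abs_approxCost_le hK.le ..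
      have h2 : |(p.1 • interior A).indicator (fun _ => l) x| ≤ K := by
        classical
        rw [indicator_apply]; split_ifs
        · exact hl
        · simpa using hK.le
      have h3 : 0 ≤ 2 * K * |countDist lam B R p.1 p.2| := by positivity
      exact (abs_sub _ _).trans (by linarith)
    · rw [indicator_of_notMem hx', add_zero]
      exact H.abs_integral_approxCost_sub_le hR hK hp hx hx'
  · rw [integral_add (integrable_const _) hbad, integral_indicator_const _ measurableSet_nearBoundary]
    simp only [integral_const, probReal_univ, smul_eq_mul]
    linarith

/-- The add one costs are approximated in mean square by bounded local functionals. -/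
lemma Setting.exists_approx (H : Setting μ P lam h B A δ S) {s : ℝ} (hs : 0 < s) :
    ∃ K R, 0 < K ∧ 0 < R ∧ ∫ ω, (localCost h K R (P ω) - δ ω) ^ 2 ∂μ ≤ s ^ 2 ∧
      ∀ᶠ p in scaleFilter lam B, ∫ q, (cost (regular h lam B A p.1) q.1 (range q.2) -
          approxCost h A K R p.1 q.1 (range q.2)) ^ 2
          ∂(rooted p.2 (unif B p.1)) ≤ s ^ 2 ∧
        |∫ q, approxCost h A K R p.1 q.1 (range q.2)
          ∂(rooted p.2 (unif B p.1)) -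
          volume.real A / volume.real B * ∫ ω, δ ω ∂μ| ≤ s := by
  obtain ⟨C, hC0, hC⟩ := regular_moment_integral H.fn H.riem H.sub H.mom
  set D := ∫ ω, δ ω ^ 4 ∂μ with hD
  have hD0 : 0 ≤ D := integral_nonneg fun ω => by positivity
  have hs2 : 0 < s ^ 2 / 16 := by positivity
  -- The truncation `K` is chosen by fourth moments, then `R` depending on `K`, and the scale last,
  -- so that errors carrying the factor `K²` still vanish.
  obtain ⟨K, hK1, hK⟩ : ∃ K : ℝ, 1 ≤ K ∧ 2 / K * C + 4 / K ^ 2 * D ≤ s ^ 2 / 16 := by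
    have h1 : Tendsto (fun K : ℝ => 2 / K * C + 4 / K ^ 2 * D) atTop (𝓝 (0 * C + 0 * D)) :=
      ((tendsto_const_nhds.div_atTop tendsto_id).mul_const C).add
        ((tendsto_const_nhds.div_atTop (tendsto_pow_atTop two_ne_zero)).mul_const D)
    obtain ⟨K, a, b⟩ := ((h1.eventually_le_const (u := s ^ 2 / 16) (by simpa using pow_pos hs 2)).and
      (eventually_ge_atTop 1)).exists
    exact ⟨K, b, a⟩
  have hK0 : 0 < K := by linarith
  obtain ⟨R, hR, hRS⟩ := H.exists_radius_le (ε := s ^ 2 / 16 / (4 * K ^ 2)) (by positivity)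
  rw [le_div_iff₀' (by positivity)] at hRS
  have hloc := H.integral_sq_localCost_le hK1 R
  have h2C : 0 ≤ 2 / K * C := by positivity
  have hloc' : ∫ ω, (localCost h K R (P ω) - δ ω) ^ 2 ∂μ ≤ (s / 2) ^ 2 := by
    rw [show (s / 2) ^ 2 = s ^ 2 / 4 by ring]
    linarith
  have hlm := H.measurable_localCost K R
  have hli : MemLp (fun ω => localCost h K R (P ω)) 2 μ :=
    memLp_of_abs_le hlm fun ω => abs_localCost_le hK0.le ..
  have hmean : |∫ ω, localCost h K R (P ω) ∂μ - ∫ ω, δ ω ∂μ| ≤ s / 2 := by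
    rw [← integral_sub (hli.integrable one_le_two) (H.memLp.integrable one_le_two)]
    refine abs_le_of_sq_le_sq (le_trans ?_ hloc') (by positivity)
    have := variance_nonneg (fun ω => localCost h K R (P ω) - δ ω) μ
    rw [variance_eq_sub (show MemLp (fun ω => _ - _) 2 μ from hli.sub H.memLp)] at this
    simpa using this
  refine ⟨K, R, hK0, hR, hloc'.trans (by nlinarith), ?_⟩
  have hE : Tendsto (fun p : ℝ × ℕ => |countDist lam B R p.1 p.2| +
      (unif B p.1).real (nearBoundary B A R p.1)) (scaleFilter lam B) (𝓝 0) := by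
    simpa using (tendsto_countDist H.pos R).abs.add
      ((tendsto_unif_nearBoundary H.riem hR.le).comp tendsto_scaleFilter_fst)
  filter_upwards [eventually_admissible H.pos R,
    (hE.const_mul (4 * K ^ 2)).eventually_le_const (u := s ^ 2 / 16) (by simpa using pow_pos hs 2),
    (hE.const_mul (2 * K)).eventually_le_const (u := s / 2) (by simpa using hs)] with p hp h1 h2
  constructor
  · have := H.integral_sq_sub_approxCost_le hR hK1 hp (hC _ hp.one_le _ hp.lower hp.upper)
    have e : 4 * K ^ 2 * (D / K ^ 4) = 4 / K ^ 2 * D := by field_simp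
    rw [← hD, mul_add, mul_add, mul_add, e] at this
    rw [mul_add] at h1
    have := pow_pos hs 2
    have : 0 ≤ 4 / K ^ 2 * D := by positivity
    linarith
  · have h3 := H.abs_integral_approxCost_prod_sub_le hR hK0 hp
    have hv := volume_real_pos B
    have h4 : |volume.real A / volume.real B * ∫ ω, localCost h K R (P ω) ∂μ -
        volume.real A / volume.real B * ∫ ω, δ ω ∂μ| ≤ s / 2 := by
      rw [← mul_sub, abs_mul, abs_of_nonneg (by positivity)]
      refine (mul_le_of_le_one_left (abs_nonneg _) ?_).trans hmean
      exact (div_le_one hv).2 (measureReal_mono H.sub hB.riem.1.measure_lt_top.ne)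
    exact (abs_sub_le _ _ _).trans (by linarith)

end Approximation

/-! ### From sample sizes in a relative window to Poisson sample sizes -/

section Window

variable {E : Type*} [MeasurableSpace E]

/-- Sample sizes outside the window have exponentially small weight in `√r`, which is paired with
the uniform bound `b`. -/
lemma integral_poissonSample_le_of_window {π : Measure E} [IsProbabilityMeasure π] {r : NNReal}
    (hr : 1 ≤ r) {g : E → Set E → ℝ} (hg : JointMeasurable g) (h0 : ∀ x X, 0 ≤ g x X) {b η s : ℝ}
    (hb : ∀ x X, g x X ≤ b) (hb0 : 0 ≤ b) (hs : 0 ≤ s)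
    (h : ∀ l : ℕ, |(l : ℝ) - r| ≤ η * r → ∫ p, g p.1 (range p.2) ∂(rooted l π) ≤ s) :
    ∫ p, g p.1 (points p.2) ∂(π.prod (poissonSample r π)) ≤
      s + b * exp (-(η * √(r : ℝ))) * 6 := by
  obtain ⟨ix, ex⟩ := integrable_exp_abs_poisson r hr
  have hr0 : (0 : ℝ) < r := lt_of_lt_of_le one_pos (by exact_mod_cast hr)
  rw [integral_prod_poissonSample hg fun x X => (abs_of_nonneg (h0 x X)).trans_le (hb x X)]
  have hi := (integrable_const s).add (ix.const_mul (b * exp (-(η * √(r : ℝ)))))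
  refine (integral_mono_of_nonneg (ae_of_all _ fun l => integral_nonneg fun p => h0 _ _) hi
    (ae_of_all _ fun l => ?_)).trans ?_
  · simp only [Pi.add_apply]
    have hnn : 0 ≤ b * exp (-(η * √(r : ℝ))) * exp (|(l : ℝ) - r| / √(r : ℝ)) := by
      positivity
    by_cases hl : |(l : ℝ) - r| ≤ η * r
    · linarith [h l hl]
    · have h1 : ∫ p, g p.1 (range p.2) ∂(rooted l π) ≤ b :=
        (integral_mono_of_nonneg (ae_of_all _ fun _ => h0 _ _) (integrable_const b)
          (ae_of_all _ fun _ => hb _ _)).trans (by simp)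
      have h2 : 1 ≤ exp (-(η * √(r : ℝ))) * exp (|(l : ℝ) - r| / √(r : ℝ)) := by
        rw [← exp_add, Real.one_le_exp_iff]
        have : η * √(r : ℝ) ≤ |(l : ℝ) - r| / √(r : ℝ) := by
          rw [le_div_iff₀ (by positivity), mul_assoc, mul_self_sqrt hr0.le]
          exact (not_le.1 hl).le
        linarith
      rw [mul_assoc]
      linarith [mul_le_mul_of_nonneg_left h2 hb0]
  · simp only [Pi.add_apply]
    rw [integral_add (integrable_const s) (ix.const_mul _), integral_const_mul]
    simp only [integral_const, probReal_univ, one_smul]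
    gcongr

end Window

/-! ### Estimates along the sequence of scales -/

section Scale

variable {t : ℕ → ℝ}

/-- The mean number of points in the window at scale `t`. -/
noncomputable abbrev rate (lam : ℝ) (B : Set (Space d)) (t : ℝ) : NNReal :=
  (meanCount lam B t).toNNReal

lemma coe_rate (hlam : 0 < lam) {t : ℝ} (ht : 1 ≤ t) : (rate lam B t : ℝ) = meanCount lam B t :=
  coe_toNNReal _ (by unfold meanCount; positivity)

/-- Unfolds `scaleFilter`: what holds eventually along it holds at large scales uniformly over all
sample sizes within a fixed relative distance of the mean count. -/
lemma exists_window {Q : ℝ × ℕ → Prop} (hQ : ∀ᶠ p in scaleFilter lam B, Q p) (hlam : 0 < lam) (ht : Tendsto t atTop atTop) :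
    ∃ η : ℝ, 0 < η ∧ ∀ᶠ n in atTop, ∀ l : ℕ, |(l : ℝ) - rate lam B (t n)| ≤ η * rate lam B (t n) →
      Q (t n, l) := by
  obtain ⟨⟨T, η⟩, ⟨-, hη⟩, hsub⟩ := (((atTop_basis (α := ℝ)).comap Prod.fst).inf
    (Metric.nhds_basis_closedBall.comap fun p : ℝ × ℕ =>
      (p.2 : ℝ) / meanCount lam B p.1)).eventually_iff.1 hQ
  refine ⟨η, hη, ?_⟩
  filter_upwards [ht.eventually_ge_atTop T, ht.eventually_ge_atTop 1,
    ((tendsto_meanCount B hlam).comp ht).eventually_gt_atTop 0] with n h1 h2 h3 l hl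
  simp only [comp_apply] at h3
  rw [coe_rate hlam h2] at hl
  refine hsub ⟨h1, ?_⟩
  rw [mem_preimage, mem_closedBall, dist_eq, div_sub_one h3.ne', abs_div,
    abs_of_pos h3, div_le_iff₀ h3]
  exact hl

/-- A power of the mean count is negligible against the exponential of its square root. -/
lemma Setting.exists_bound (H : Setting μ P lam h B A δ S) (ht : ∀ n, 1 ≤ t n)
    (htt : Tendsto t atTop atTop) : ∃ M : ℕ → ℝ, (∀ n X, |regular h lam B A (t n) X| ≤ M n) ∧
    ∀ η > 0, Tendsto (fun n => M n ^ 2 * exp (-(η * √(rate lam B (t n) : ℝ)))) atTop (𝓝 0) := by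
  obtain ⟨C, q, -, -, hC⟩ := regular_bound lam B H.fn H.riem H.pos H.poly
  refine ⟨fun n => C * meanCount lam B (t n) ^ q, fun n => hC _ (ht n), fun η hη => ?_⟩
  have hm := (tendsto_meanCount B H.pos).comp htt
  have := ((tendsto_rpow_mul_exp_neg_mul_atTop_nhds_zero (4 * q) η hη).comp
    (tendsto_sqrt_atTop.comp hm)).const_mul (C ^ 2)
  rw [mul_zero] at this
  refine this.congr fun n => ?_
  have h0 : 0 ≤ meanCount lam B (t n) := by
    have := ht n; have := H.pos; unfold meanCount; positivity
  simp only [comp_apply]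
  rw [coe_rate H.pos (ht n), mul_pow, Real.sqrt_eq_rpow, ← Real.rpow_mul h0, ← Real.rpow_natCast
    (_ ^ q), ← Real.rpow_mul h0, ← mul_assoc, neg_mul]
  congr 3
  push_cast; ring

/-- The approximation of the costs for fixed sample sizes carries over to Poisson sizes; the
contribution of atypical sizes is eventually below another `s²`. -/
lemma Setting.exists_bound_cost (H : Setting μ P lam h B A δ S) (ht : ∀ n, 1 ≤ t n)
    (htt : Tendsto t atTop atTop) {K R η s : ℝ} (hK : 0 < K) (hη : 0 < η) (hs : 0 < s)
    (hw : ∀ᶠ n in atTop, ∀ l : ℕ, |(l : ℝ) - rate lam B (t n)| ≤ η * rate lam B (t n) →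
      ∫ q, (cost (regular h lam B A (t n)) q.1 (range q.2) -
          approxCost h A K R (t n) q.1 (range q.2)) ^ 2
          ∂(rooted l (unif B (t n))) ≤ s ^ 2) :
    ∀ᶠ n in atTop, ∫ q, (cost (regular h lam B A (t n)) q.1 (points q.2) -
        approxCost h A K R (t n) q.1 (points q.2)) ^ 2
        ∂((unif B (t n)).prod (poissonSample (rate lam B (t n)) (unif B (t n)))) ≤ 2 * s ^ 2 := by
  obtain ⟨M, hM, hMt⟩ := H.exists_bound ht htt
  have hm := (tendsto_meanCount B H.pos).comp htt
  have hlim : Tendsto (fun n => (8 * M n ^ 2 + 2 * K ^ 2) *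
      exp (-(η * √(rate lam B (t n) : ℝ))) * 6) atTop (𝓝 ((8 * 0 + 2 * K ^ 2 * 0) * 6)) := by
    have h1 : Tendsto (fun n => exp (-(η * √(rate lam B (t n) : ℝ)))) atTop (𝓝 0) := by
      simp_rw [fun n => coe_rate (B := B) H.pos (ht n)]
      exact Real.tendsto_exp_neg_atTop_nhds_zero.comp
        ((tendsto_sqrt_atTop.comp hm).const_mul_atTop hη)
    exact ((((hMt η hη).const_mul 8).add (h1.const_mul (2 * K ^ 2))).mul_const 6).congr
      fun n => by ring
  filter_upwards [hw, hm.eventually_ge_atTop 1, hlim.eventually_le_const (u := s ^ 2)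
    (by simpa using pow_pos hs 2)] with n h1 h2 h3
  have ht0 : 0 < t n := zero_lt_one.trans_le (ht n)
  have hprob := isProbabilityMeasure_unif B ht0
  refine (integral_poissonSample_le_of_window (g := fun x X => (cost (regular h lam B A (t n)) x X -
    approxCost h A K R (t n) x X) ^ 2) (b := 8 * M n ^ 2 + 2 * K ^ 2)
    (by rw [← NNReal.coe_le_coe, coe_rate H.pos (ht n)]; exact h2)
    (fun m => ((H.measurable_cost ht0 m).sub
      (jointMeasurable_approxCost H.fn A K R ht0 m)).pow_const 2)
    (fun x X => sq_nonneg _) (fun x X => ?_) (by positivity) (sq_nonneg s) h1).trans (by linarith)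
  have a1 := abs_le.1 (abs_cost_le (hM n) x X)
  have a2 := abs_le.1 (abs_approxCost_le (h := h) hK.le A R (t n) x X)
  have b1 := sq_le_sq' (by linarith) a1.2
  have b2 := sq_le_sq' a2.1 a2.2
  nlinarith [sq_nonneg (cost (regular h lam B A (t n)) x X + approxCost h A K R (t n) x X)]

lemma Setting.localSeq (H : Setting μ P lam h B A δ S) (ht : ∀ n, 1 ≤ t n)
    (htt : Tendsto t atTop atTop) :
    LocalSeq (fun n => unif B (t n)) (fun n => rate lam B (t n))
      (fun n => regular h lam B A (t n)) (volume.real A / volume.real B * ∫ ω, δ ω ∂μ) where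
  conf n := (isExceptional_exc lam B H.fn H.riem (zero_lt_one.trans_le (ht n))).conf
  bound := H.exists_bound ht htt
  moment := by
    obtain ⟨C, -, hC⟩ := regular_moment_integral H.fn H.riem H.sub H.mom
    refine ⟨C, ?_⟩
    filter_upwards [((tendsto_meanCount B H.pos).comp htt).eventually_ge_atTop 4]
      with n hn l hl
    rw [coe_rate H.pos (ht n), abs_le] at hl
    simp only [comp_apply] at hn
    exact hC _ (ht n) l (by linarith) (by linarith)
  approx := fun s hs => by
    obtain ⟨K, R, hK, hR, -, hev⟩ := H.exists_approx hs
    obtain ⟨η, hη, hw⟩ := exists_window hev H.pos htt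
    refine ⟨R, K, η, hη, ?_⟩
    filter_upwards [hw] with n hn
    exact ⟨approxCost h A K R (t n),
      jointMeasurable_approxCost H.fn A K R (zero_lt_one.trans_le (ht n)),
      abs_approxCost_le hK.le A R (t n), approxCost_inter A K R (t n), hn⟩

end Scale

/-! ### Conditional expectations given the half-space -/

section CondExp

variable {Ω : Type*} [mΩ : MeasurableSpace Ω] {μ : Measure Ω} [IsProbabilityMeasure μ]

/-- The decomposition of the variance into a conditional variance and the variance of the
conditional expectation. -/
lemma integral_sq_condExp_le {m : MeasurableSpace Ω} (hm : m ≤ mΩ) {X : Ω → ℝ}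
    (hX : MemLp X 2 μ) : ∫ ω, (μ[X | m]) ω ^ 2 ∂μ ≤ ∫ ω, X ω ^ 2 ∂μ := by
  have h1 := integral_condVar_add_variance_condExp hm hX
  rw [variance_eq_sub (hX.condExp one_le_two), variance_eq_sub hX, integral_condExp hm] at h1
  have h2 : 0 ≤ μ[Var[X; μ | m]] := integral_nonneg_of_ae (condExp_nonneg (ae_of_all _ fun ω =>
    sq_nonneg ((X - μ[X | m]) ω)))
  simp only [Pi.pow_apply] at h1
  linarith

/-- `a² - b² = (a - b)² + 2 (a - b) b` with a weighted Young inequality, followed by contractivity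
of conditional expectation. -/
lemma abs_integral_sq_condExp_sub_le {m : MeasurableSpace Ω} (hm : m ≤ mΩ) {X Y : Ω → ℝ}
    (hX : MemLp X 2 μ) (hY : MemLp Y 2 μ) {θ : ℝ} (hθ : 0 < θ) :
    |∫ ω, (μ[X | m]) ω ^ 2 ∂μ - ∫ ω, (μ[Y | m]) ω ^ 2 ∂μ| ≤
      (1 + θ⁻¹) * ∫ ω, (X ω - Y ω) ^ 2 ∂μ + θ * ∫ ω, Y ω ^ 2 ∂μ := by
  have hcX := hX.condExp (m := m) one_le_two
  have hcY := hY.condExp (m := m) one_le_two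
  have hcD := (hX.sub hY).condExp (m := m) one_le_two
  rw [← integral_sub hcX.integrable_sq hcY.integrable_sq]
  have hi := hcD.integrable_sq.const_mul (1 + θ⁻¹)
  have hi' := hcY.integrable_sq.const_mul θ
  calc _ ≤ ∫ ω, ((1 + θ⁻¹) * (μ[X - Y | m]) ω ^ 2 + θ * (μ[Y | m]) ω ^ 2) ∂μ := by
        refine abs_integral_le_integral_abs.trans (integral_mono_of_nonneg
          (ae_of_all _ fun ω => abs_nonneg _) (hi.add hi') ?_)
        filter_upwards [condExp_sub (hX.integrable one_le_two) (hY.integrable one_le_two) m]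
          with ω hω
        rw [hω, Pi.sub_apply]
        set a := (μ[X | m]) ω
        set b := (μ[Y | m]) ω
        have h1 : 2 * |(a - b) * b| ≤ θ⁻¹ * (a - b) ^ 2 + θ * b ^ 2 := by
          have e : θ⁻¹ * (a - b) ^ 2 + θ * b ^ 2 - 2 * |(a - b) * b| =
              θ⁻¹ * (|a - b| - θ * |b|) ^ 2 := by
            rw [abs_mul, ← sq_abs (a - b), ← sq_abs b]; field_simp; ring
          have : 0 ≤ θ⁻¹ * (|a - b| - θ * |b|) ^ 2 := by positivity
          linarith
        have h2 : a ^ 2 - b ^ 2 = (a - b) ^ 2 + 2 * ((a - b) * b) := by ring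
        rw [h2]
        refine (abs_add_le _ _).trans ?_
        rw [abs_mul, abs_two, abs_of_nonneg (sq_nonneg (a - b))]
        linarith
    _ = (1 + θ⁻¹) * ∫ ω, (μ[X - Y | m]) ω ^ 2 ∂μ + θ * ∫ ω, (μ[Y | m]) ω ^ 2 ∂μ := by
        rw [integral_add hi hi', integral_const_mul, integral_const_mul]
    _ ≤ _ := add_le_add
        (mul_le_mul_of_nonneg_left (integral_sq_condExp_le (mΩ := mΩ) hm (hX.sub hY)) (by positivity))
        (mul_le_mul_of_nonneg_left (integral_sq_condExp_le (mΩ := mΩ) hm hY) hθ.le)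

lemma integral_sq_condExp_sum {k : ℕ} (m : MeasurableSpace Ω) {δ : Fin k → Ω → ℝ}
    (hδ : ∀ i, MemLp (δ i) 2 μ) (c : Fin k → ℝ) :
    ∫ ω, (μ[fun ω => ∑ i, c i * δ i ω | m]) ω ^ 2 ∂μ =
      ∑ i, ∑ j, c i * c j * ∫ ω, (μ[δ i | m]) ω * (μ[δ j | m]) ω ∂μ := by
  have hae : μ[fun ω => ∑ i, c i * δ i ω | m] =ᵐ[μ] fun ω => ∑ i, c i * (μ[δ i | m]) ω := by
    have h1 := condExp_finsetSum (s := univ) (f := fun i => c i • δ i)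
      (fun i _ => ((hδ i).integrable one_le_two).smul (c i)) m
    have e : (fun ω => ∑ i, c i * δ i ω) = ∑ i, c i • δ i := by
      ext ω; simp
    rw [e]
    filter_upwards [h1, ae_all_iff.2 fun i => condExp_smul (μ := μ) (c i) (δ i) m] with ω h1 h2
    rw [h1, Finset.sum_apply]
    exact sum_congr rfl fun i _ => by rw [h2 i]; simp
  have hi : ∀ i j, Integrable (fun ω => c i * c j * ((μ[δ i | m]) ω * (μ[δ j | m]) ω)) μ :=
    fun i j => (((hδ i).condExp one_le_two).integrable_mul ((hδ j).condExp one_le_two)).const_mul _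
  calc _ = ∫ ω, ∑ i, ∑ j, c i * c j * ((μ[δ i | m]) ω * (μ[δ j | m]) ω) ∂μ := by
        refine integral_congr_ae ?_
        filter_upwards [hae] with ω hω
        rw [hω, sq, sum_mul_sum]
        exact sum_congr rfl fun i _ => sum_congr rfl fun j _ => by ring
    _ = _ := by
        rw [integral_finsetSum _ fun i _ => integrable_finsetSum _ fun j _ => hi i j]
        refine sum_congr rfl fun i _ => ?_
        rw [integral_finsetSum _ fun j _ => hi i j]
        exact sum_congr rfl fun j _ => integral_const_mul _ _

end CondExp

/-! ### The variance integrand as a conditional second moment -/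

section Transfer

lemma IsPoissonProcess.measurable_comp (hP : IsPoissonProcess P lam μ) (hW : MeasurableSet W)
    (hb : Bornology.IsBounded W) {F : Set (Space d) → ℝ} (hF : ConfMeasurable F) :
    Measurable fun ω => F (P ω ∩ W) :=
  hF.comp_of_counts (fun ω => hP.locallyFinite ω _ hb) (hP.measurable_ncard_inter hW hb)

lemma IsPoissonProcess.integral_eq (hP : IsPoissonProcess P lam μ) (hlam : 0 < lam)
    (hW : MeasurableSet W) (hb : Bornology.IsBounded W) (h0 : volume W ≠ 0)
    {F : Set (Space d) → ℝ} (hF : ConfMeasurable F) {M : ℝ} (hM : ∀ X, |F X| ≤ M) :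
    ∫ ω, F (P ω ∩ W) ∂μ = ∫ q, F (points q)
      ∂(poissonSample (lam * volume.real W).toNNReal volume[|W]) := by
  have hpr := isProbabilityMeasure_cond_volume hb h0
  rw [integral_eq_lintegral_pos_part_sub_lintegral_neg_part
    (integrable_of_abs_le (hP.measurable_comp hW hb hF) fun ω => hM _),
    integral_eq_lintegral_pos_part_sub_lintegral_neg_part
    (integrable_of_abs_le hF.measurable_points fun q => hM _),
    hP.lintegral_eq hlam hW hb h0 (F := fun X => ofReal (F X))
      fun m => (hF m).ennreal_ofReal,
    hP.lintegral_eq hlam hW hb h0 (F := fun X => ofReal (-F X))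
      fun m => (hF m).neg.ennreal_ofReal]

lemma exists_points_eq {E : Type*} [MeasurableSpace E] (x : E) {X : Set E} (hX : X.Finite) :
    ∃ q : Config E, points q = X := by
  obtain ⟨m, u, -, rfl⟩ := hX.fin_param
  exact ⟨_, points_extendTuple x u⟩

lemma countSigma_translate_le (P : Ω → Set (Space d)) (x : Space d) (H : Set (Space d)) :
    countSigma (fun ω => translate x (P ω)) (translate x H) ≤ countSigma P H := by
  refine iSup₂_le fun C hC => ?_
  have e : (fun ω => (translate x (P ω) ∩ C).ncard) =
      fun ω => (P ω ∩ translate (-x) C).ncard := by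
    ext ω
    rw [translate_inter_eq, translate, ncard_image_of_injective _ (add_right_injective x)]
  rw [e]
  refine le_iSup₂_of_le (translate (-x) C) ⟨measurableSet_translate _ hC.1,
    isBounded_translate _ hC.2.1, ?_⟩ le_rfl
  rw [← translate_neg_translate x H]
  exact Set.image_mono hC.2.2

lemma countSigma_translate (P : Ω → Set (Space d)) (x : Space d) :
    countSigma (fun ω => translate x (P ω)) {y | y 0 < x 0} = halfSpaceSigma P := by
  have e : {y : Space d | y 0 < x 0} = translate x {y | y 0 < 0} := by
    rw [translate_eq_preimage]; ext y; simp
  rw [e]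
  refine le_antisymm (countSigma_translate_le P x _) ?_
  have := countSigma_translate_le (fun ω => translate x (P ω)) (-x) (translate x {y | y 0 < 0})
  simpa only [translate_neg_translate] using this

/-- Ordering by the first coordinate, the mixture at `x` is the splice of two copies of the process
along the hyperplane through `x`. Averaging over the second copy is conditioning on the half-space
to the left of `x`, which a translation moves to the origin. -/
lemma integral_cost_mul_cost (hP : IsPoissonProcess P lam μ) (hlam : 0 < lam)
    (hW : MeasurableSet W) (hb : Bornology.IsBounded W) (h0 : volume W ≠ 0)
    {f : Set (Space d) → ℝ} (hf : ConfMeasurable f) {M : ℝ} (hM : ∀ X, |f X| ≤ M) (x : Space d) :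
    ∫ q, ∫ q', cost f x (points q) * cost f x (mixAt (fun y => y 0) x (points q) (points q'))
      ∂(poissonSample (lam * volume.real W).toNNReal volume[|W])
      ∂(poissonSample (lam * volume.real W).toNNReal volume[|W]) =
    ∫ ω, (μ[fun ω => cost f x (translate x (P ω) ∩ W) | halfSpaceSigma P]) ω ^ 2 ∂μ := by
  have hpr := isProbabilityMeasure_cond_volume hb h0
  have hQ := hP.translate x
  have hc : Measurable fun y : Space d => y 0 := by fun_prop
  have hcm : ConfMeasurable (cost f x) := hf.jointMeasurable_cost.confMeasurable x
  have hcb := abs_cost_le hM x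
  have hM0 : 0 ≤ 2 * M := (abs_nonneg _).trans (hcb ∅)
  have hbd : ∀ Y Y', |cost f x Y * cost f x Y'| ≤ 2 * M * (2 * M) := fun Y Y' => by
    rw [abs_mul]; exact mul_le_mul (hcb _) (hcb _) (abs_nonneg _) hM0
  have h1 := hQ.integral_eq hlam hW hb h0 (M := 2 * M * (2 * M)) (F := fun X =>
    ∫ q', cost f x X * cost f x (mixAt (fun y => y 0) x X (points q'))
      ∂(poissonSample (lam * volume.real W).toNNReal volume[|W]))
    (fun m => by
      have h2 : Measurable fun p : (Fin m → Space d) × (Config (Space d)) =>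
          cost f x (mixAt (fun y => y 0) x (range p.1) (points p.2)) := by
        simpa only [points_extendTuple] using measurable_cost_mixAt_points hf hc measurable_const
          (measurable_extendTuple (measurable_const (a := x)) measurable_fst) measurable_snd
      exact ((((hcm m).comp measurable_fst).mul h2).stronglyMeasurable.integral_prod_right').measurable)
    (fun X => abs_integral_le_of_abs_le fun _ => hbd _ _)
  have h2 : ∀ ω, ∫ q', cost f x (translate x (P ω) ∩ W) * cost f x (mixAt (fun y => y 0) x
      (translate x (P ω) ∩ W) (points q'))
      ∂(poissonSample (lam * volume.real W).toNNReal volume[|W]) =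
      ∫ ω', cost f x (translate x (P ω) ∩ W) * cost f x (splice (fun ω => translate x (P ω)) W
        {y | y 0 < x 0} (ω, ω')) ∂μ := fun ω => by
    -- The configuration at `ω` is held fixed as that of some sample `q`, so that joint
    -- measurability in two samples applies.
    obtain ⟨q, hq⟩ := exists_points_eq x (hQ.locallyFinite ω W hb)
    have := hQ.integral_eq hlam hW hb h0 (M := 2 * M * (2 * M)) (F := fun X' =>
      cost f x (translate x (P ω) ∩ W) * cost f x (mixAt (fun y => y 0) x
      (translate x (P ω) ∩ W) X')) (fun m => by
        simpa only [← hq, points_extendTuple, id] using (measurable_cost_mixAt_points hf hc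
          measurable_const measurable_const (measurable_extendTuple (measurable_const (a := x))
          measurable_id)).const_mul _) fun X => hbd _ _
    rw [← this]
    simp only [mixAt, splice, inter_assoc]
  have hm2 : MemLp (fun ω => cost f x (translate x (P ω) ∩ W)) 2 μ :=
    memLp_of_abs_le (hQ.measurable_comp hW hb hcm) fun ω => hcb _
  rw [← h1]
  simp only [h2]
  rw [hQ.integral_condExp_mul_condExp hW hb (measurableSet_lt hc measurable_const) hcm hm2 hm2,
    countSigma_translate]
  simp only [sq]

/-- Almost surely no two sample points share a first coordinate, as the exchange in spatial order
requires. -/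
lemma cond_volume_hyperplane (s : ℝ) : volume[|W] ((fun y : Space d => y 0) ⁻¹' {s}) = 0 := by
  refine ProbabilityTheory.cond_absolutelyContinuous ?_
  have h1 := (PiLp.volume_preserving_ofLp (Fin d)).measure_preimage
    (s := {f : Fin d → ℝ | f 0 = s}) (measurableSet_eq_fun (measurable_pi_apply _)
      measurable_const).nullMeasurableSet
  rw [volume_pi, Measure.pi_hyperplane] at h1
  exact h1

end Transfer

/-! ### The asymptotic variance over Poisson samples -/

section PoissonVariance

/-- The indicator function of `tA`, up to the boundary. -/
noncomputable abbrev ind (A : Set (Space d)) (t : ℝ) (x : Space d) : ℝ :=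
  (t • interior A).indicator (fun _ => 1) x

/-- The local approximation is the intermediate term. Away from the boundaries the ball around `x`
lies in the window, so restricting the process to the window is harmless; near them a crude bound is
enough, as they have vanishing mass. -/
lemma Setting.integral_sq_cost_sub_le (H : Setting μ P lam h B A δ S) {K R s t : ℝ} (hK : 0 < K)
    (hR : 0 < R) (hloc : ∫ ω, (localCost h K R (P ω) - δ ω) ^ 2 ∂μ ≤ s ^ 2) (ht : 1 ≤ t)
    (hx : x ∈ win B t) :
    MemLp (fun ω => cost (regular h lam B A t) x (translate x (P ω) ∩ win B t)) 2 μ ∧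
    ∫ ω, (cost (regular h lam B A t) x (translate x (P ω) ∩ win B t) - ind A t x * δ ω) ^ 2 ∂μ ≤
      2 * ∫ q, (cost (regular h lam B A t) x (points q) - approxCost h A K R t x (points q)) ^ 2
        ∂(poissonSample (rate lam B t) (unif B t)) + 2 * s ^ 2 +
      (nearBoundary B A R t).indicator (fun _ => 4 * (K ^ 2 + ∫ ω, δ ω ^ 2 ∂μ)) x := by
  have ht0 : 0 < t := by linarith
  have hQ := H.process.translate x
  have hW := measurableSet_win (B := B) ht0
  have hWb := isBounded_win (B := B) (t := t)
  have hcm : ConfMeasurable (cost (regular h lam B A t) x) :=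
    (isExceptional_exc lam B H.fn H.riem ht0).conf.jointMeasurable_cost.confMeasurable x
  have hgm := (jointMeasurable_approxCost H.fn A K R ht0).confMeasurable x
  obtain ⟨M, hM⟩ := regular_abs_le lam B H.fn H.riem H.pos H.poly ht
  have hF : MemLp (fun ω => cost (regular h lam B A t) x (translate x (P ω) ∩ win B t)) 2 μ :=
    memLp_of_abs_le (hQ.measurable_comp hW hWb hcm) fun ω => abs_cost_le hM x _
  have hG : MemLp (fun ω => approxCost h A K R t x (translate x (P ω) ∩ win B t)) 2 μ :=
    memLp_of_abs_le (hQ.measurable_comp hW hWb hgm) fun ω => abs_approxCost_le hK.le ..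
  have hD : MemLp (fun ω => ind A t x * δ ω) 2 μ := H.memLp.const_mul _
  refine ⟨hF, ?_⟩
  have e := hQ.integral_eq H.pos hW hWb (volume_win_ne_zero ht0)
    (F := fun X => (cost (regular h lam B A t) x X - approxCost h A K R t x X) ^ 2)
    (fun m => ((hcm m).sub (hgm m)).pow_const 2) (M := (2 * M + K) ^ 2) fun X => by
      rw [abs_pow]
      exact pow_le_pow_left₀ (abs_nonneg _) ((abs_sub _ _).trans
        (add_le_add (abs_cost_le hM x X) (abs_approxCost_le hK.le ..))) 2
  rw [rate, meanCount_eq ht0, ← e]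
  have i1 := (hF.sub hG).integrable_sq.const_mul 2
  have i2 := (hG.sub hD).integrable_sq.const_mul 2
  have h1 : ∫ ω, (cost (regular h lam B A t) x (translate x (P ω) ∩ win B t) -
      ind A t x * δ ω) ^ 2 ∂μ ≤ _ :=
    integral_mono_of_nonneg (ae_of_all _ fun ω => sq_nonneg _) (i1.fun_add i2)
      (ae_of_all _ fun ω => by
        simp only [Pi.sub_apply]
        nlinarith [sq_nonneg (cost (regular h lam B A t) x (translate x (P ω) ∩ win B t) -
          2 * approxCost h A K R t x (translate x (P ω) ∩ win B t) + ind A t x * δ ω)])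
  rw [integral_add i1 i2, integral_const_mul, integral_const_mul] at h1
  refine h1.trans ?_
  rw [add_assoc]
  refine add_le_add le_rfl ?_
  have hs2 := sq_nonneg s
  simp only [Pi.sub_apply]
  by_cases hxb : x ∈ nearBoundary B A R t
  · rw [indicator_of_mem hxb]
    have i3 : Integrable (fun ω => 2 * K ^ 2 + 2 * δ ω ^ 2) μ :=
      (integrable_const _).add (H.memLp.integrable_sq.const_mul 2)
    have h2 : ∫ ω, (approxCost h A K R t x (translate x (P ω) ∩ win B t) - ind A t x * δ ω) ^ 2 ∂μ ≤
        ∫ ω, (2 * K ^ 2 + 2 * δ ω ^ 2) ∂μ := integral_mono_of_nonneg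
      (ae_of_all _ fun ω => sq_nonneg _) i3 (ae_of_all _ fun ω => by
        have a := abs_le.1 (abs_approxCost_le (h := h) hK.le A R t x (translate x (P ω) ∩ win B t))
        have b := sq_le_sq' a.1 a.2
        have c : (ind A t x * δ ω) ^ 2 ≤ δ ω ^ 2 := by
          by_cases hxA : x ∈ t • interior A
          · rw [ind, indicator_of_mem hxA, one_mul]
          · rw [ind, indicator_of_notMem hxA, zero_mul, zero_pow two_ne_zero]
            exact sq_nonneg _
        simp only
        nlinarith [sq_nonneg (approxCost h A K R t x (translate x (P ω) ∩ win B t) +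
          ind A t x * δ ω)])
    rw [integral_add (integrable_const _) (H.memLp.integrable_sq.const_mul 2)] at h2
    simp only [integral_const, probReal_univ, one_smul, integral_const_mul] at h2
    linarith
  · rw [indicator_of_notMem hxb, add_zero]
    refine mul_le_mul_of_nonneg_left ?_ zero_le_two
    by_cases hxA : x ∈ t • interior A
    · refine le_trans (le_of_eq (integral_congr_ae (ae_of_all _ fun ω => ?_))) hloc
      simp only
      have := approxCost_union (h := h) (K := K) (V := ∅) (X := P ω) hxA (Set.empty_subset
        (closedBall x R)ᶜ)
      rw [approxCost_inter, inter_assoc, inter_eq_self_of_subset_right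
        (closedBall_subset_win ht0 hR.le hx hxb), ← union_empty (_ ∩ _), this, ind,
        indicator_of_mem hxA, one_mul]
    · simp only [approxCost, ind, indicator_of_notMem hxA]
      simpa using hs2

lemma RiemannMeasurable.inter {A A' : Set (Space d)} (hA : RiemannMeasurable A)
    (hA' : RiemannMeasurable A') : RiemannMeasurable (A ∩ A') := by
  refine ⟨hA.1.subset inter_subset_left, measure_mono_null (frontier_inter_subset _ _) ?_⟩
  exact measure_union_null (measure_mono_null inter_subset_left hA.2)
    (measure_mono_null inter_subset_right hA'.2)

variable {h : Fin k → Set (Space d) → Set (Space d) → ℝ} {A : Fin k → Set (Space d)}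
  {δ S : Fin k → Ω → ℝ} {t : ℕ → ℝ}

/-- Averaging products of indicators over the window produces the fractions `|A_i ∩ A_j| / |B|`. -/
lemma integral_sum_ind (hA : ∀ i, RiemannMeasurable (A i)) (hAB : ∀ i, A i ⊆ B) (c : Fin k → ℝ)
    (σ : Matrix (Fin k) (Fin k) ℝ) {t : ℝ} (ht : 0 < t) :
    Integrable (fun x => ∑ i, ∑ j, c i * ind (A i) t x * (c j * ind (A j) t x) * σ i j) (unif B t) ∧
    ∫ x, ∑ i, ∑ j, c i * ind (A i) t x * (c j * ind (A j) t x) * σ i j ∂(unif B t) =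
      ∑ i, ∑ j, c i * c j * (σ i j * volume.real (A i ∩ A j) / volume.real B) := by
  have hprob := isProbabilityMeasure_unif B ht
  have hm : ∀ i j, MeasurableSet (t • interior (A i ∩ A j)) := fun i j =>
    (isOpen_interior.smul₀ ht.ne').measurableSet
  have e : ∀ i j x, c i * ind (A i) t x * (c j * ind (A j) t x) * σ i j =
      (t • interior (A i ∩ A j)).indicator (fun _ => c i * c j * σ i j) x := fun i j x => by
    rw [interior_inter, Set.smul_set_inter₀ ht.ne']
    by_cases h1 : x ∈ t • interior (A i) <;> by_cases h2 : x ∈ t • interior (A j) <;>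
      simp [ind, h1, h2]
  have hi : ∀ i j, Integrable ((t • interior (A i ∩ A j)).indicator fun _ => c i * c j * σ i j)
    (unif B t) := fun i j => (integrable_const _).indicator (hm i j)
  simp only [e]
  refine ⟨integrable_finsetSum _ fun i _ => integrable_finsetSum _ fun j _ => hi i j, ?_⟩
  rw [integral_finsetSum _ fun i _ => integrable_finsetSum _ fun j _ => hi i j]
  refine sum_congr rfl fun i _ => ?_
  rw [integral_finsetSum _ fun j _ => hi i j]
  refine sum_congr rfl fun j _ => ?_
  rw [integral_indicator_const _ (hm i j), unif_real_smul_interior ((hA i).inter (hA j))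
    (inter_subset_left.trans (hAB i)) ht, smul_eq_mul]
  ring

lemma integral_sq_sum_mul_le {z : Fin k → Ω → ℝ} (hz : ∀ i, Integrable (fun ω => z i ω ^ 2) μ)
    (c : Fin k → ℝ) : ∫ ω, (∑ i, c i * z i ω) ^ 2 ∂μ ≤ (∑ i, c i ^ 2) * ∑ i, ∫ ω, z i ω ^ 2 ∂μ := by
  rw [← integral_finsetSum _ fun i _ => hz i, ← integral_const_mul]
  exact integral_mono_of_nonneg (ae_of_all _ fun ω => sq_nonneg _)
    ((integrable_finsetSum _ fun i _ => hz i).const_mul _)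
    (ae_of_all _ fun ω => Finset.sum_mul_sq_le_sq_mul_sq _ _ _)

/-- The asymptotic variance of linear combinations over Poisson samples. -/
lemma tendsto_variance_poissonSample (hP : IsPoissonProcess P lam μ) (hlam : 0 < lam)
    (H : ∀ i, Setting μ P lam (h i) B (A i) (δ i) (S i)) (ht : ∀ n, 1 ≤ t n)
    (htt : Tendsto t atTop atTop) (c : Fin k → ℝ) :
    Tendsto (fun n => (rate lam B (t n) : ℝ)⁻¹ * Var[fun q => ∑ i, c i *
      regular (h i) lam B (A i) (t n) (points q); poissonSample (rate lam B (t n)) (unif B (t n))])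
      atTop (𝓝 (∑ i, ∑ j, c i * c j *
        (sigmaMatrix P μ δ i j * volume.real (A i ∩ A j) / volume.real B))) := by
  set c₂ := ∑ i, c i ^ 2
  have hc₂ : 0 ≤ c₂ := sum_nonneg fun i _ => sq_nonneg _
  set D := c₂ * ∑ i, ∫ ω, δ i ω ^ 2 ∂μ
  have hD : 0 ≤ D := mul_nonneg hc₂ (sum_nonneg fun i _ => integral_nonneg fun ω => sq_nonneg _)
  have hm := (tendsto_meanCount B hlam).comp htt
  rw [Metric.tendsto_nhds]
  intro ε hε
  obtain ⟨s, hs, hs1, hsε⟩ : ∃ s : ℝ, 0 < s ∧ s ≤ 1 ∧ s * (14 * (c₂ * k) + D) < ε := by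
    have hpos : 0 < 14 * (c₂ * k) + D + 1 := by positivity
    refine ⟨min 1 (ε / (14 * (c₂ * k) + D + 1)), by positivity, min_le_left _ _, ?_⟩
    have := (le_div_iff₀ hpos).1 (min_le_right 1 (ε / (14 * (c₂ * k) + D + 1)))
    have h0 : 0 < min 1 (ε / (14 * (c₂ * k) + D + 1)) := by positivity
    linarith
  choose K R hK hR hloc hev using fun i => (H i).exists_approx hs
  choose η hη hw using fun i => exists_window (hev i) hlam htt
  have hcost := fun i => (H i).exists_bound_cost ht htt (hK i) (hη i) hs
    ((hw i).mono fun n hn l hl => (hn l hl).1)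
  have hnb := fun i => (((tendsto_unif_nearBoundary (B := B) (H i).riem (hR i).le).comp
    htt).mul_const (4 * (K i ^ 2 + ∫ ω, δ i ω ^ 2 ∂μ))).eventually_le_const (u := s ^ 2)
    (by simpa using pow_pos hs 2)
  filter_upwards [eventually_all.2 hcost, eventually_all.2 hnb, hm.eventually_ge_atTop 1]
    with n hcost hnb hr
  have ht0 : 0 < t n := zero_lt_one.trans_le (ht n)
  have hprob := isProbabilityMeasure_unif B ht0
  have hr1 : 1 ≤ rate lam B (t n) := by
    rw [← NNReal.coe_le_coe, coe_rate hlam (ht n)]; exact hr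
  have hr0 : (rate lam B (t n) : ℝ) ≠ 0 := (zero_lt_one.trans_le (NNReal.coe_le_coe.2 hr1)).ne'
  set F : Set (Space d) → ℝ := fun X => ∑ i, c i * regular (h i) lam B (A i) (t n) X with hF
  set ρ := poissonSample (rate lam B (t n)) (unif B (t n)) with hρ
  have hFm : ConfMeasurable F := fun m => Finset.measurable_fun_sum _ fun i _ =>
    ((isExceptional_exc lam B (H i).fn (H i).riem ht0).conf m).const_mul (c i)
  choose M hM using fun i => regular_abs_le lam B (H i).fn (H i).riem hlam
    (H i).poly (ht n)
  have hFb : ∀ X, |F X| ≤ ∑ i, |c i| * M i := fun X =>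
    (abs_sum_le_sum_abs _ _).trans (sum_le_sum fun i _ => by
      rw [abs_mul]; exact mul_le_mul_of_nonneg_left (hM i X) (abs_nonneg _))
  have hFc : ∀ x X, cost F x X = ∑ i, c i * cost (regular (h i) lam B (A i) (t n)) x X :=
    fun x X => by simp only [hF, cost, mul_sub, sum_sub_distrib]
  have hcm : Measurable fun y : Space d => y 0 := by fun_prop
  set V : Space d → ℝ := fun x => ∫ q, ∫ q', cost F x (points q) *
    cost F x (mixAt (fun y => y 0) x (points q) (points q')) ∂ρ ∂ρ with hV
  obtain ⟨hVi, hvar⟩ := variance_poissonSample (π := unif B (t n)) hr1 hFm hFb hcm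
    cond_volume_hyperplane
  obtain ⟨hTi, hT⟩ := integral_sum_ind (fun i => (H i).riem) (fun i => (H i).sub) c
    (sigmaMatrix P μ δ) ht0
  rw [hvar, inv_mul_cancel_left₀ hr0, dist_eq, ← hT, ← integral_sub hVi hTi]
  set e : Fin k → Space d → ℝ := fun i x => ∫ q, (cost (regular (h i) lam B (A i) (t n)) x (points q) -
    approxCost (h i) (A i) (K i) (R i) (t n) x (points q)) ^ 2 ∂ρ with he
  have hei : ∀ i, Integrable (e i) (unif B (t n)) ∧ ∫ x, e i x ∂(unif B (t n)) ≤ 2 * s ^ 2 := fun i => by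
    have hm : JointMeasurable fun x X => cost (regular (h i) lam B (A i) (t n)) x X -
      approxCost (h i) (A i) (K i) (R i) (t n) x X := fun m => ((H i).measurable_cost ht0 m).sub
      (jointMeasurable_approxCost (H i).fn (A i) (K i) (R i) ht0 m)
    have hi := integrable_pow_of_abs_le (μ := (unif B (t n)).prod ρ) hm.measurable_points
      (b := 2 * M i + K i) (fun p => (abs_sub _ _).trans
        (add_le_add (abs_cost_le (hM i) _ _) (abs_approxCost_le (hK i).le ..))) 2
    exact ⟨hi.integral_prod_left, (integral_prod _ hi).symm.trans_le (hcost i)⟩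
  have hbi : ∀ i, Integrable ((nearBoundary B (A i) (R i) (t n)).indicator
      fun _ => 4 * (K i ^ 2 + ∫ ω, δ i ω ^ 2 ∂μ)) (unif B (t n)) := fun i =>
    (integrable_const _).indicator measurableSet_nearBoundary
  have hji : ∀ i, Integrable (fun x => 2 * e i x + 2 * s ^ 2 + (nearBoundary B (A i) (R i)
      (t n)).indicator (fun _ => 4 * (K i ^ 2 + ∫ ω, δ i ω ^ 2 ∂μ)) x) (unif B (t n)) := fun i =>
    (((hei i).1.const_mul 2).add (integrable_const _)).add (hbi i)
  have hsum := integrable_finsetSum univ fun i _ => hji i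
  calc _ ≤ ∫ x, ((1 + s⁻¹) * (c₂ * ∑ i, (2 * e i x + 2 * s ^ 2 + (nearBoundary B (A i) (R i)
        (t n)).indicator (fun _ => 4 * (K i ^ 2 + ∫ ω, δ i ω ^ 2 ∂μ)) x)) + s * D)
        ∂(unif B (t n)) := by
        refine abs_integral_le_integral_abs.trans (integral_mono_of_nonneg
          (ae_of_all _ fun _ => abs_nonneg _) (((hsum.const_mul _).const_mul _).add
          (integrable_const _)) ?_)
        filter_upwards [ae_unif_mem ht0] with x hx
        have hJ := fun i => (H i).integral_sq_cost_sub_le (hK i) (hR i) (hloc i) (ht n) hx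
        have hδi := fun i => (H i).memLp.const_mul (ind (A i) (t n) x)
        have hY : MemLp (fun ω => ∑ i, c i * ind (A i) (t n) x * δ i ω) 2 μ :=
          memLp_finsetSum _ fun i _ => (H i).memLp.const_mul _
        have hX : MemLp (fun ω => cost F x (translate x (P ω) ∩ win B (t n))) 2 μ := by
          simp only [hFc]
          exact memLp_finsetSum _ fun i _ => (hJ i).1.const_mul _
        have e1 : V x = ∫ ω, (μ[fun ω => cost F x (translate x (P ω) ∩ win B (t n)) |
            halfSpaceSigma P]) ω ^ 2 ∂μ := by
          rw [hV, hρ, rate, meanCount_eq ht0]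
          exact integral_cost_mul_cost hP hlam (measurableSet_win ht0) isBounded_win
            (volume_win_ne_zero ht0) hFm hFb x
        have e2 := integral_sq_condExp_sum (halfSpaceSigma P) (fun i => (H i).memLp)
          fun i => c i * ind (A i) (t n) x
        change |V x - _| ≤ _
        rw [e1]
        -- Both sides are second moments of conditional expectations, compared with weight `s`.
        refine (le_of_eq (congrArg _ (congrArg _ e2.symm))).trans
          ((abs_integral_sq_condExp_sub_le (hP.countSigma_le _) hX hY hs).trans ?_)
        refine add_le_add (mul_le_mul_of_nonneg_left ?_ (by positivity))
          (mul_le_mul_of_nonneg_left ?_ hs.le)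
        · simp only [hFc, mul_assoc, ← sum_sub_distrib, ← mul_sub]
          refine (integral_sq_sum_mul_le (fun i => ((hJ i).1.sub (hδi i)).integrable_sq) c).trans
            (mul_le_mul_of_nonneg_left (sum_le_sum fun i _ => (hJ i).2) hc₂)
        · simp only [mul_assoc]
          refine (integral_sq_sum_mul_le (fun i => (hδi i).integrable_sq) c).trans
            (mul_le_mul_of_nonneg_left (sum_le_sum fun i _ => integral_mono_of_nonneg
              (ae_of_all _ fun _ => sq_nonneg _) (H i).memLp.integrable_sq
              (ae_of_all _ fun ω => ?_)) hc₂)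
          by_cases hxA : x ∈ t n • interior (A i)
          · simp [ind, hxA]
          · simp [ind, hxA, sq_nonneg]
    -- The constant collects `2 * 2 s²` from the costs, `2 s²` from the limit and `s²` from the
    -- boundary.
    _ ≤ (1 + s⁻¹) * (c₂ * ∑ _i : Fin k, 7 * s ^ 2) + s * D := by
        rw [integral_add ((hsum.const_mul _).const_mul _) (integrable_const _), integral_const_mul,
          integral_const_mul, integral_finsetSum _ fun i _ => hji i]
        simp only [integral_const, probReal_univ, one_smul]
        gcongr with i
        rw [integral_add (((hei i).1.const_mul 2).fun_add (integrable_const _)) (hbi i),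
          integral_add ((hei i).1.const_mul 2) (integrable_const _), integral_const_mul,
          integral_indicator_const _ measurableSet_nearBoundary]
        simp only [integral_const, probReal_univ, smul_eq_mul]
        have := hnb i
        simp only [comp_apply] at this
        linarith [(hei i).2]
    _ ≤ s * (14 * (c₂ * k) + D) := by
        rw [sum_const, card_univ, Fintype.card_fin, nsmul_eq_mul]
        have : (1 + s⁻¹) * (c₂ * (k * (7 * s ^ 2))) = 7 * (c₂ * k) * (s * s + s) := by
          field_simp
        have h2 : s * s + s ≤ 2 * s := by nlinarith
        have := mul_le_mul_of_nonneg_left h2 (by positivity : 0 ≤ 7 * (c₂ * k))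
        linarith
    _ < ε := hsε

end PoissonVariance

/-! ### Binomial samples -/

section Binomial

variable {t : ℕ → ℝ}

lemma exists_abs_rate_sub_le (hlam : 0 < lam) (ht : ∀ n, 1 ≤ t n)
    (htn : (fun n : ℕ => lam * t n ^ d * volume.real B - n) =O[atTop] fun n : ℕ => √(n : ℝ)) :
    ∃ b, ∀ᶠ n : ℕ in atTop, |(rate lam B (t n) : ℝ) - n| ≤ b * √(n : ℝ) := by
  obtain ⟨b, hb⟩ := htn.bound
  refine ⟨b, hb.mono fun n hn => ?_⟩
  rw [coe_rate hlam (ht n), meanCount]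
  simpa [norm_eq_abs, abs_of_nonneg (Real.sqrt_nonneg _)] using hn

lemma tendsto_scale (hlam : 0 < lam) (ht : ∀ n, 1 ≤ t n)
    (hr : Tendsto (fun n => (rate lam B (t n) : ℝ)) atTop atTop) : Tendsto t atTop atTop := by
  refine tendsto_atTop.2 fun a => ?_
  filter_upwards [hr.eventually_gt_atTop (lam * a ^ d * volume.real B)] with n hn
  rw [coe_rate hlam (ht n), meanCount] at hn
  by_contra hlt
  have := ht n
  have : t n ^ d ≤ a ^ d := pow_le_pow_left₀ (by linarith) (not_le.1 hlt).le d
  exact absurd hn (not_lt.2 (by gcongr))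

lemma ae_eq_regular (hh : IsPointProcessSetFunction h)
    (hA : RiemannMeasurable A) {t : ℝ} (ht : 0 < t) {n : ℕ}
    (hn : (n : ℝ) ≤ 3 * meanCount lam B t / 2) :
    (fun u : Fin n → Space d => h (range u) (t • A)) =ᵐ[iid n (unif B t)]
      fun u => regular h lam B A t (range u) := by
  filter_upwards [(isExceptional_exc lam B hh hA ht).ae_notMem n hn] with u hu
  rw [regular, indicator_of_mem (Set.mem_compl hu)]

/-- The regularization may be formed with any intensity. One with mean count `n + 1` admits samples
of size `n`, so square integrability holds for every `n` and not only for large `n`. -/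
lemma memLp_range
    (hh : IsPointProcessSetFunction h) (hpoly : PolynomialBound h) (hA : RiemannMeasurable A) {t : ℝ} (ht : 1 ≤ t) (n : ℕ) :
    MemLp (fun u : Fin n → Space d => h (range u) (t • A)) 2 (iid n (unif B t)) := by
  have hv := volume_real_pos B
  have ht0 : 0 < t := by linarith
  have hprob := isProbabilityMeasure_unif B ht0
  obtain ⟨M, hM⟩ := regular_abs_le ((n + 1) / (t ^ d * volume.real B)) B hh hA
    (by positivity) hpoly ht
  refine (memLp_congr_ae (ae_eq_regular hh hA ht0 ?_)).2 (memLp_of_abs_le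
    ((isExceptional_exc _ B hh hA ht0).conf n) fun u => hM _)
  rw [meanCount, mul_assoc, div_mul_cancel₀ _ (by positivity)]
  linarith

lemma measurePreserving_sample {t : ℝ}
    (ht : 0 < t) {Ω' : Type*} [MeasurableSpace Ω'] {ν : Measure Ω'} [IsProbabilityMeasure ν] {n : ℕ}
    {U : Fin n → Ω' → Space d} (hU : iIndepFun U ν) (hU' : ∀ l, pdf.IsUniform (U l) (t • B) ν) :
    AEMeasurable (fun ω l => U l ω) ν ∧ ν.map (fun ω l => U l ω) = iid n (unif B t) := by
  have hb := hB.riem.1.smul₀ t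
  have h0 : volume (t • B) ≠ 0 := by
    rw [measure_congr (smul_ae_eq_win B ht)]; exact volume_win_ne_zero ht
  have hm := fun l => (hU' l).aemeasurable h0 hb.measure_lt_top.ne
  refine ⟨aemeasurable_pi_lambda _ hm, ?_⟩
  rw [(iIndepFun_iff_map_fun_eq_pi_map hm).1 hU, ← uniformSampleLaw_eq ht,
    uniformSampleLaw]
  exact congrArg _ (funext hU')

variable {h : Fin k → Set (Space d) → Set (Space d) → ℝ} {A : Fin k → Set (Space d)}
  {δ S : Fin k → Ω → ℝ}

lemma tauMatrix_symm (i j : Fin k) : tauMatrix P μ δ B A j i = tauMatrix P μ δ B A i j := by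
  simp only [tauMatrix, sigmaMatrix, Matrix.of_apply, Set.inter_comm (A j)]
  rw [mul_comm (volume.real (A j)), mul_comm (∫ ω, δ j ω ∂μ)]
  simp only [mul_comm ((μ[δ j | halfSpaceSigma P]) _)]

/-- Variances and characteristic functions of linear combinations over binomial samples. -/
lemma tendsto_binomial (hP : IsPoissonProcess P lam μ) (hlam : 0 < lam)
    (H : ∀ i, Setting μ P lam (h i) B (A i) (δ i) (S i)) (ht : ∀ n, 1 ≤ t n) {b : ℝ}
    (hr : ∀ᶠ n : ℕ in atTop, |(rate lam B (t n) : ℝ) - n| ≤ b * √(n : ℝ)) (c : Fin k → ℝ) :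
    Tendsto (fun n : ℕ => (n : ℝ)⁻¹ * Var[fun u => ∑ i, c i * regular (h i) lam B (A i) (t n)
      (range u); iid n (unif B (t n))]) atTop
      (𝓝 (∑ i, ∑ j, c i * c j * tauMatrix P μ δ B A i j)) ∧
    Tendsto (fun n : ℕ => ∫ u, Complex.exp (((√(n : ℝ))⁻¹ * (∑ i, c i * regular (h i) lam B (A i)
        (t n) (range u) - ∫ u', ∑ i, c i * regular (h i) lam B (A i) (t n) (range u')
          ∂(iid n (unif B (t n)))) : ℝ) * I) ∂(iid n (unif B (t n)))) atTop
      (𝓝 (exp (-(∑ i, ∑ j, c i * c j * tauMatrix P μ δ B A i j) / 2) : ℂ)) := by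
  have htt := tendsto_scale hlam ht (tendsto_atTop_of_sub_le hr)
  have hprob := fun n => isProbabilityMeasure_unif B (zero_lt_one.trans_le (ht n))
  have hπ : ∀ R, ∃ c, ∀ᶠ n in atTop, ∀ y, (unif B (t n)).real (closedBall y R) *
      rate lam B (t n) ≤ c := fun R => ⟨_, Eventually.of_forall fun n y => by
    rw [coe_rate hlam (ht n)]
    exact unif_real_closedBall_mul_le hlam (zero_lt_one.trans_le (ht n)) y R⟩
  have hL := LocalSeq.sum (fun i => (H i).localSeq ht htt) c
  have h1 := hL.tendsto_variance hr hπ (tendsto_variance_poissonSample hP hlam H ht htt c)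
  -- The square of the mean add one cost of the linear combination supplies the product term of `τ`.
  have e : ∑ i, ∑ j, c i * c j * (sigmaMatrix P μ δ i j * volume.real (A i ∩ A j) /
      volume.real B) - (∑ i, c i * (volume.real (A i) / volume.real B * ∫ ω, δ i ω ∂μ)) ^ 2 =
      ∑ i, ∑ j, c i * c j * tauMatrix P μ δ B A i j := by
    rw [sq, sum_mul_sum, ← sum_sub_distrib]
    refine sum_congr rfl fun i _ => ?_
    rw [← sum_sub_distrib]
    refine sum_congr rfl fun j _ => ?_
    simp only [tauMatrix, Matrix.of_apply]
    have := (volume_real_pos B).ne'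
    field_simp
  rw [e] at h1
  exact ⟨h1, hL.tendsto_charFun hr hπ h1⟩

end Binomial

end StabCLT

theorem mainTheorem3 {d k : ℕ} [NeZero d]
    {Ω : Type*} [MeasurableSpace Ω] (μ : Measure Ω) [IsProbabilityMeasure μ]
    (lam : ℝ) (hlam : 0 < lam)
    (P : Ω → Set (StabCLT.Space d)) (hP : StabCLT.IsPoissonProcess P lam μ)
    (B₀ : Set (StabCLT.Space d)) (hB₀ : StabCLT.RiemannMeasurable B₀) (hB₀pos : 0 < volume B₀)
    (h : Fin k → Set (StabCLT.Space d) → Set (StabCLT.Space d) → ℝ)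
    (hh : ∀ i, StabCLT.IsPointProcessSetFunction (h i))
    (δ : Fin k → Ω → ℝ)
    (hstab : ∀ i, StabCLT.StronglyStabilizing (h i) P μ (δ i))
    (hmom : ∀ i, StabCLT.MomentsCondition (h i) lam B₀)
    (hpoly : ∀ i, StabCLT.PolynomialBound (h i))
    (A : Fin k → Set (StabCLT.Space d))
    (hA : ∀ i, StabCLT.RiemannMeasurable (A i)) (hAB : ∀ i, A i ⊆ B₀)
    (t : ℕ → ℝ) (ht : ∀ n, 1 ≤ t n)
    (htn : (fun n : ℕ => lam * t n ^ d * volume.real B₀ - n) =O[atTop] fun n : ℕ => √(n : ℝ))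
    {Ω' : ℕ → Type*} [∀ n, MeasurableSpace (Ω' n)] (ν : ∀ n, Measure (Ω' n))
    [∀ n, IsProbabilityMeasure (ν n)]
    (U : ∀ n, Fin n → Ω' n → StabCLT.Space d)
    (hUindep : ∀ n, iIndepFun (U n) (ν n))
    (hUunif : ∀ n l, pdf.IsUniform (U n l) (t n • B₀) (ν n)) :
    -- the moments that occur below exist
    (∀ i, MemLp (δ i) 2 μ) ∧
    (∀ n i, MemLp (fun ω => h i (StabCLT.sample (U n) ω) (t n • A i)) 2 (ν n)) ∧
    -- convergence of the covariances
    (∀ i j, Tendsto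
      (fun n : ℕ => (n : ℝ)⁻¹ *
        cov[fun ω => h i (StabCLT.sample (U n) ω) (t n • A i),
          fun ω => h j (StabCLT.sample (U n) ω) (t n • A j); ν n])
      atTop (𝓝 (StabCLT.tauMatrix P μ δ B₀ A i j))) ∧
    -- the limit is a covariance matrix, and the central limit theorem holds
    (StabCLT.tauMatrix P μ δ B₀ A).PosSemidef ∧
    TendstoInDistribution
      (fun (n : ℕ) (ω : Ω' n) => (WithLp.toLp 2 fun i : Fin k =>
        (√(n : ℝ))⁻¹ * (h i (StabCLT.sample (U n) ω) (t n • A i)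
          - ∫ ω', h i (StabCLT.sample (U n) ω') (t n • A i) ∂(ν n)) : EuclideanSpace ℝ (Fin k)))
      atTop (id : EuclideanSpace ℝ (Fin k) → EuclideanSpace ℝ (Fin k)) ν
      (multivariateGaussian 0 (StabCLT.tauMatrix P μ δ B₀ A)) := by
  have : StabCLT.IsWindow B₀ := ⟨hB₀, hB₀pos⟩
  choose S hS hSt using fun i => (hstab i).exists_radius hP
  have H : ∀ i, StabCLT.Setting μ P lam (h i) B₀ (A i) (δ i) (S i) := fun i =>
    ⟨hP, hlam, hh i, hA i, hAB i, hpoly i, hmom i, (hstab i).1, hS i, hSt i⟩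
  have ht0 := fun n => zero_lt_one.trans_le (ht n)
  choose hUm hUlaw using fun n =>
    StabCLT.measurePreserving_sample (ht0 n) (hUindep n) (hUunif n)
  obtain ⟨b, hr⟩ := StabCLT.exists_abs_rate_sub_le hlam ht htn
  set X : ∀ n, Fin k → Ω' n → ℝ := fun n i ω => h i (StabCLT.sample (U n) ω) (t n • A i) with hX
  have hXm : ∀ n i, MemLp (X n i) 2 (ν n) := fun n i => by
    have := StabCLT.memLp_range (B := B₀) (hh i) (hpoly i) (hA i) (ht n) n
    rw [← hUlaw n] at this
    exact this.comp_of_map (hUm n)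
  set f : ∀ n, Fin k → Set (StabCLT.Space d) → ℝ :=
    fun n i => StabCLT.regular (h i) lam B₀ (A i) (t n) with hf
  have hfm : ∀ n i, StabCLT.ConfMeasurable (f n i) := fun n i =>
    (StabCLT.isExceptional_exc _ _ (hh i) (hA i) (ht0 n)).conf
  -- Regularization is invisible once `n` is at most `3/2` times the mean count, which holds for
  -- large `n`.
  have hXf : ∀ᶠ n in atTop, ∀ i, X n i =ᵐ[ν n] fun ω => f n i (Set.range fun l => U n l ω) := by
    filter_upwards [(StabCLT.tendsto_div_natCast hr).eventually_const_le
      (by norm_num : (2 / 3 : ℝ) < 1), eventually_gt_atTop 0] with n hn hn0 i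
    rw [le_div_iff₀ (by positivity), StabCLT.coe_rate hlam (ht n)] at hn
    have := StabCLT.ae_eq_regular (lam := lam) (B := B₀) (hh i) (hA i) (ht0 n) (n := n)
      (by linarith)
    rw [← hUlaw n] at this
    exact ae_of_ae_map (hUm n) this
  have hsum : ∀ c : Fin k → ℝ, ∀ᶠ n in atTop, (fun ω => ∑ i, c i * X n i ω) =ᵐ[ν n]
      (fun u => ∑ i, c i * f n i (Set.range u)) ∘ fun ω l => U n l ω := fun c => by
    filter_upwards [hXf] with n hn
    filter_upwards [ae_all_iff.2 hn] with ω hω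
    exact Finset.sum_congr rfl fun i _ => by rw [hω i]
  have hFm : ∀ c : Fin k → ℝ, ∀ n, Measurable fun u : Fin n → StabCLT.Space d =>
      ∑ i, c i * f n i (Set.range u) := fun c n =>
    Finset.measurable_fun_sum _ fun i _ => (hfm n i n).const_mul (c i)
  have hlim := fun c => StabCLT.tendsto_binomial hP hlam H ht hr c
  have hvar : ∀ c : Fin k → ℝ, Tendsto (fun n : ℕ => (n : ℝ)⁻¹ *
      Var[fun ω => ∑ i, c i * X n i ω; ν n]) atTop
      (𝓝 (∑ i, ∑ j, c i * c j * StabCLT.tauMatrix P μ δ B₀ A i j)) := fun c => by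
    refine (hlim c).1.congr' ?_
    filter_upwards [hsum c] with n hn
    rw [variance_congr hn, ← variance_map (hFm c n).aemeasurable (hUm n), hUlaw n]
  -- The quadratic form is a limit of variances.
  have hpos : (StabCLT.tauMatrix P μ δ B₀ A).PosSemidef := by
    refine Matrix.PosSemidef.of_dotProduct_mulVec_nonneg
      (Matrix.IsHermitian.ext fun i j => by simpa using StabCLT.tauMatrix_symm i j) fun c => ?_
    refine (ge_of_tendsto' (hvar c) fun n =>
      mul_nonneg (by positivity) (variance_nonneg _ _)).trans_eq ?_
    simp only [dotProduct, Matrix.mulVec, Pi.star_apply, star_trivial, Finset.mul_sum]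
    exact Finset.sum_congr rfl fun i _ => Finset.sum_congr rfl fun j _ => by ring
  refine ⟨fun i => (H i).memLp, hXm, fun i j => ?_, hpos, ?_⟩
  -- Polarization: the covariance from the variances of the sum and of the summands.
  · have h1 := ((hvar (Pi.single i 1 + Pi.single j 1)).sub (hvar (Pi.single i 1))).sub
      (hvar (Pi.single j 1))
    simp only [Pi.add_apply, add_mul, mul_add, Finset.sum_add_distrib, Pi.single_apply, ite_mul,
      mul_ite, one_mul, zero_mul, mul_one, mul_zero, Finset.sum_ite_eq', Finset.mem_univ, if_true]
      at h1
    rw [StabCLT.tauMatrix_symm i j] at h1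
    refine ((h1.const_mul (1 / 2)).congr fun n => ?_).trans (le_of_eq (congrArg 𝓝 (by ring)))
    rw [variance_fun_add (hXm n i) (hXm n j)]
    ring
  have hZm : ∀ n, AEMeasurable (fun ω : Ω' n => (WithLp.toLp 2 fun i : Fin k =>
      (√(n : ℝ))⁻¹ * (X n i ω - ∫ ω', X n i ω' ∂(ν n)) : EuclideanSpace ℝ (Fin k))) (ν n) :=
    fun n => (WithLp.measurable_toLp 2 _).comp_aemeasurable (aemeasurable_pi_lambda _ fun i =>
      ((hXm n i).1.aemeasurable.sub_const _).const_mul _)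
  refine ⟨hZm, aemeasurable_id, ?_⟩
  -- Lévy's continuity theorem; the characteristic function at `x` is that of the linear combination
  -- with coefficients `x`.
  refine (ProbabilityMeasure.tendsto_iff_tendsto_charFun (E := EuclideanSpace ℝ (Fin k))).2
    fun x => ?_
  simp only [ProbabilityMeasure.coe_mk, Measure.map_id]
  rw [charFun_multivariateGaussian hpos]
  have e : Complex.exp (inner ℝ x 0 * Complex.I -
      (x.ofLp ⬝ᵥ (StabCLT.tauMatrix P μ δ B₀ A).mulVec x.ofLp : ℝ) / 2) =
      (Real.exp (-(∑ i, ∑ j, x i * x j * StabCLT.tauMatrix P μ δ B₀ A i j) / 2) : ℂ) := by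
    rw [inner_zero_right, Complex.ofReal_exp]
    simp only [dotProduct, Matrix.mulVec, Finset.mul_sum]
    push_cast
    rw [zero_mul, zero_sub, neg_div]
    congr 3
    exact Finset.sum_congr rfl fun i _ => Finset.sum_congr rfl fun j _ => by ring
  rw [e]
  refine (hlim x).2.congr' ?_
  filter_upwards [hsum x] with n hn
  have hi : ∫ u, ∑ i, x i * f n i (Set.range u) ∂(StabCLT.iid n (StabCLT.unif B₀ (t n))) =
      ∑ i, x i * ∫ ω, X n i ω ∂(ν n) := by
    rw [← hUlaw n, integral_map (hUm n) (hFm x n).aestronglyMeasurable]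
    refine (integral_congr_ae hn).symm.trans ?_
    rw [integral_finsetSum _ fun i _ => ((hXm n i).integrable one_le_two).const_mul _]
    exact Finset.sum_congr rfl fun i _ => integral_const_mul _ _
  rw [hi, charFun_apply, integral_map (hZm n) (by fun_prop), ← hUlaw n,
    integral_map (hUm n) (by exact (Complex.measurable_exp.comp ((Complex.measurable_ofReal.comp
      (((hFm x n).sub_const _).const_mul _)).mul_const _)).aestronglyMeasurable)]
  refine integral_congr_ae ?_
  filter_upwards [hn] with ω hω
  simp only [Function.comp_apply] at hω
  rw [← hω]
  congr 3
  simp only [PiLp.inner_apply, RCLike.inner_apply, conj_trivial]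
  rw [← Finset.sum_sub_distrib, Finset.mul_sum]
  exact Finset.sum_congr rfl fun i _ => by ring
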